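/- Let $a,b,c:\mathbb R\to\mathbb R$ be smooth, put $\phi(\xi,\eta)=-a(\xi+\eta)+b(\xi)+c(\eta)$ and $\Gamma=\{\phi=0\}\subset\mathbb R^2$. For $f,g\in L^2(\mathbb R)$ and a symbol $m$ let $(u,v,w)$, with $u,v,w\in C([0,\infty);L^2(\mathbb R))$, solve $$ i\partial_t u+a(D)u=T_m(v,w),\quad i\partial_t v+b(D)v=0,\quad i\partial_t w+c(D)w=0,\qquad u(0)=0,\ v(0)=f,\ w(0)=g, $$ where, with $\widehat f(\xi)=(2\pi)^{-1/2}\int e^{-ix\xi}f(x)\,dx$, $\widehat{a(D)u}=a\,\widehat u$ and $\widehat{T_m(v,w)}(\xi)=\int m(\xi-\eta,\eta)\widehat v(\xi-\eta)\widehat w(\eta)\,d\eta$; the equations are understood in the sense of distributions in the frequency variable. There is an absolute integer $N$ such that the following holds for all such $a,b,c$ and every set $U\subset\mathbb R^2$ (for instance $U=\mathbb R^2$). For $R>0$ let $\mathcal M_R$ be the set of smooth $m:\mathbb R^2\to\mathbb C$ supported in $B(0,R)\cap U$ whose derivatives of order $0,\dots,N$ are bounded by $1$. **(A)** For each $q\in[2,\infty]$,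 in each of the situations below there is a constant $C$, depending only on $a,b,c,U,q$, such that for all $R>0$, $m\in\mathcal M_R$, $f,g\in L^2(\mathbb R)$ and $t>0$ $$\|u(t)\|_{L^q}\le C\,R\,\alpha(t)\,\|f\|_{L^2}\|g\|_{L^2}.$$ 1. Without further hypothesis: $\alpha(t)=t$. 2. $|\phi|$ is bounded below on $U$ by a positive constant (no time resonances): $\alpha(t)=1$. 3. $\phi$ and $\nabla\phi$ vanish at a point $p_0$ at which the Hessian of $\phi$ is positive definite or negative definite, and $|\phi|$ is bounded below by a positive constant on $\{p\in U: |p-p_0|\ge r\}$ for every $r>0$: $\alpha(t)=t^{\frac12+\frac1{2q}}$. 4. $\phi$ vanishes at order one on $\Gamma$, and $\Gamma$ is a nowhere characteristic curve: $\alpha(t)=t^{1/q}$ if $q<\infty$, and $\alpha(t)=\langle\log t\rangle=\sqrt{1+\log^2 t}$ if $q=\infty$. 5. $\phi$ vanishes at order one on $\Gamma$, and $\Gamma$ is a curve with non-vanishing curvature: $\alpha(t)=t^{\frac14+\frac1{2q}}$. 6. $\phi$ vanishes at order one on $\Gamma$, and $\Gamma$ is a curve: $\alpha(t)=t^{1/2}$.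 In 4–6 the hypotheses are uniform over $U$, in the following sense. *$\phi$ vanishes at order one on $\Gamma$*: there is $\kappa>0$ such that for every $p\in U$ either $|\phi(p)|\ge\kappa$ or $|\phi(p)|\ge\kappa|p-z|$ for some $z\in\Gamma$. *$\Gamma$ is a curve*: there are $r>0$, $K$ and $n$ such that for every $p\in U$ the set $\Gamma\cap B(p,r)$ is covered by at most $n$ arcs contained in $\Gamma$, each of class $C^2$, parametrised by arc length, of length and curvature at most $K$. *Nowhere characteristic*, respectively *with non-vanishing curvature*: the arcs can be chosen such that, for some $\kappa>0$ independent of $p$, their unit tangents $T=(T_1,T_2)$ satisfy $|T_1|,|T_2|,|T_1+T_2|\ge\kappa$, respectively their curvature is at least $\kappa$. **(B)** Assume (H): $|a''|,|b''|,|c''|$ are bounded below on $\mathbb R$ by a positive constant. Then for each $q\in[2,\infty]$ the estimate of (A) holds with $\alpha(t)=t^{\frac12+\frac1{2q}}$. If moreover $|\phi|$ is bounded below on $U$ by a positive constant, then for all $p,q\in[2,\infty)$ with $\frac1p+\frac1q<\frac12$ there is a constant $C$, depending only on $a,b,c,U,p,q$, such that for all $R>0$, $m\in\mathcal M_R$ and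 $f,g\in L^2(\mathbb R)$ $$\|u\|_{L^p_tL^q_x((0,\infty)\times\mathbb R)}\le C\,R\,\|f\|_{L^2}\|g\|_{L^2}.$$ -/

import Mathlib

open MeasureTheory Set
open scoped ENNReal ContDiff FourierTransform

/-- The frequency plane `ℝ²`, with the Euclidean norm; its points are the pairs `(ξ, η)`. -/
abbrev FreqPlane : Type := EuclideanSpace ℝ (Fin 2)

/-- Complex-valued `L²(ℝ)`. -/
abbrev L2Line : Type := Lp ℂ 2 (volume : Measure ℝ)

/-! ### The equation -/

/-- The Fourier (Plancherel) transform on `L²(ℝ)`, normalised as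
`f̂(ξ) = (2π)^(-1/2) ∫ e^(-ixξ) f(x) dx`. -/
noncomputable def hatL2 (f : L2Line) : ℝ → ℂ := fun ξ =>
  (((Real.sqrt (2 * Real.pi))⁻¹ : ℝ) : ℂ) * (𝓕 f : L2Line) (ξ / (2 * Real.pi))

/-- The Fourier transform of the pseudo-product `T_m(f, g)`, in terms of `F = f̂` and `G = ĝ`:
`ξ ↦ ∫ m(ξ - η, η) F(ξ - η) G(η) dη`. -/
noncomputable def pseudoProductHat (m : FreqPlane → ℂ) (F G : ℝ → ℂ) : ℝ → ℂ := fun ξ =>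
  ∫ η : ℝ, m !₂[ξ - η, η] * F (ξ - η) * G η

/-- `u ∈ C([0,∞); L²(ℝ))` solves `i ∂ₜ u + a(D) u = S`, `u(0) = u₀`, where `S` is given through
its spatial Fourier transform `Shat t ξ`. As `a` may grow arbitrarily fast, the equation
`i ∂ₜ û + a(ξ) û = Ŝ` is read in the sense of distributions in the frequency variable `ξ`. -/
structure SolvesDispersive (a : ℝ → ℝ) (u₀ : L2Line) (Shat : ℝ → ℝ → ℂ) (u : ℝ → L2Line) :
    Prop where
  continuousOn : ContinuousOn u (Ici 0)
  initial : u 0 = u₀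
  equation : ∀ χ : ℝ → ℂ, ContDiff ℝ ∞ χ → HasCompactSupport χ → ∀ t : ℝ, 0 ≤ t →
    HasDerivWithinAt (fun s : ℝ => Complex.I * ∫ ξ : ℝ, χ ξ * hatL2 (u s) ξ)
      (∫ ξ : ℝ, χ ξ * (Shat t ξ - (a ξ : ℂ) * hatL2 (u t) ξ)) (Ici 0) t

/-- `(u, v, w)` solves the system
`i ∂ₜ u + a(D) u = T_m(v, w)`, `i ∂ₜ v + b(D) v = 0`, `i ∂ₜ w + c(D) w = 0` with data
`u(0) = 0`, `v(0) = f`, `w(0) = g`. -/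
structure SolvesSystem (a b c : ℝ → ℝ) (m : FreqPlane → ℂ) (f g : L2Line)
    (u v w : ℝ → L2Line) : Prop where
  eq_v : SolvesDispersive b f (fun _ _ => 0) v
  eq_w : SolvesDispersive c g (fun _ _ => 0) w
  eq_u : SolvesDispersive a 0
    (fun t => pseudoProductHat m (hatL2 (v t)) (hatL2 (w t))) u

/-- `m` is smooth, bounded by `1` together with its derivatives up to order `N`, and supported in
`B(0, R)` and in `U`. -/
structure IsSymbol (N : ℕ) (R : ℝ) (U : Set FreqPlane) (m : FreqPlane → ℂ) : Prop where
  smooth : ContDiff ℝ ∞ m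
  bounded : ∀ k : ℕ, k ≤ N → ∀ p : FreqPlane, ‖iteratedFDeriv ℝ k m p‖ ≤ 1
  support_ball : Function.support m ⊆ Metric.closedBall 0 R
  support_region : Function.support m ⊆ U

/-! ### The resonant set and its geometry

Each geometric hypothesis is imposed uniformly over a region `U` of the frequency plane. -/

/-- `φ(ξ, η) = -a(ξ + η) + b(ξ) + c(η)`. -/
def phase (a b c : ℝ → ℝ) (p : FreqPlane) : ℝ := -a (p 0 + p 1) + b (p 0) + c (p 1)

/-- The time resonant set `Γ = {φ = 0}`. -/
def resonantSet (a b c : ℝ → ℝ) : Set FreqPlane := {p | phase a b c p = 0}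

/-- Condition (H) for one dispersion relation: the second derivative is bounded away from zero. -/
def SecondDerivBddAway (a : ℝ → ℝ) : Prop := ∃ κ : ℝ, 0 < κ ∧ ∀ x : ℝ, κ ≤ |iteratedDeriv 2 a x|

/-- No time resonances over `U`: `φ` is bounded away from zero there. -/
def NonResonant (φ : FreqPlane → ℝ) (U : Set FreqPlane) : Prop :=
  ∃ κ : ℝ, 0 < κ ∧ ∀ p ∈ U, κ ≤ |φ p|

/-- The resonant set is a single point `p₀`, at which `φ` vanishes at order two: `φ` and `∇φ`
vanish at `p₀`, the Hessian of `φ` at `p₀` is definite, and over `U` the function `φ` is bounded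
away from zero outside each neighbourhood of `p₀`. -/
def ResonantPoint (φ : FreqPlane → ℝ) (U : Set FreqPlane) : Prop :=
  ∃ p₀ : FreqPlane, φ p₀ = 0 ∧ fderiv ℝ φ p₀ = 0 ∧
    ((∀ v : FreqPlane, v ≠ 0 → 0 < iteratedFDeriv ℝ 2 φ p₀ ![v, v]) ∨
      (∀ v : FreqPlane, v ≠ 0 → iteratedFDeriv ℝ 2 φ p₀ ![v, v] < 0)) ∧
    ∀ r : ℝ, 0 < r → ∃ κ : ℝ, 0 < κ ∧ ∀ p ∈ U, r ≤ dist p p₀ → κ ≤ |φ p|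

/-- `φ` vanishes at order one on its zero set, uniformly over `U`:
`|φ(p)| ≥ κ min(1, dist(p, {φ = 0}))`. -/
def VanishesAtOrderOne (φ : FreqPlane → ℝ) (U : Set FreqPlane) : Prop :=
  ∃ κ : ℝ, 0 < κ ∧ ∀ p ∈ U, κ ≤ |φ p| ∨ ∃ z : FreqPlane, φ z = 0 ∧ κ * dist p z ≤ |φ p|

/-- `γ` restricted to `[0, ℓ]` is an arc of class `C²`, contained in `Γ`, parametrised by arc
length, with length and curvature at most `K`, and its unit tangent `T` and its curvature vector
`A` satisfy `P T A` at each point. -/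
structure IsArcIn (Γ : Set FreqPlane) (K : ℝ) (P : FreqPlane → FreqPlane → Prop)
    (γ : ℝ → FreqPlane) (ℓ : ℝ) : Prop where
  length_pos : 0 < ℓ
  length_le : ℓ ≤ K
  contDiff : ContDiff ℝ 2 γ
  mem : ∀ s ∈ Icc 0 ℓ, γ s ∈ Γ
  unit_speed : ∀ s ∈ Icc 0 ℓ, ‖deriv γ s‖ = 1
  curvature_le : ∀ s ∈ Icc 0 ℓ, ‖iteratedDeriv 2 γ s‖ ≤ K
  prop : ∀ s ∈ Icc 0 ℓ, P (deriv γ s) (iteratedDeriv 2 γ s)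

/-- `Γ` is a curve, uniformly near `U`: in the ball of some fixed radius `r` around any point of
`U`, `Γ` is covered by a bounded number of arcs of `Γ` as above. -/
def IsUniformCurve (Γ U : Set FreqPlane) (P : FreqPlane → FreqPlane → Prop) : Prop :=
  ∃ r : ℝ, 0 < r ∧ ∃ K : ℝ, ∃ n : ℕ, ∀ p ∈ U, ∃ k : ℕ, k ≤ n ∧
    ∃ (γ : Fin k → ℝ → FreqPlane) (ℓ : Fin k → ℝ), (∀ i, IsArcIn Γ K P (γ i) (ℓ i)) ∧
      Γ ∩ Metric.ball p r ⊆ ⋃ i, γ i '' Icc 0 (ℓ i)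

/-- `Γ` is a curve, without further condition. -/
def GeneralCurve (Γ U : Set FreqPlane) : Prop := IsUniformCurve Γ U fun _ _ => True

/-- `Γ` is a nowhere characteristic curve: its tangent stays away from the directions of the
two axes and of `(-1, 1)`, i.e. none of `ξ`, `η`, `ξ + η` is stationary along `Γ`. -/
def NonCharacteristicCurve (Γ U : Set FreqPlane) : Prop :=
  ∃ κ : ℝ, 0 < κ ∧ IsUniformCurve Γ U fun T _ => κ ≤ |T 0| ∧ κ ≤ |T 1| ∧ κ ≤ |T 0 + T 1|

/-- `Γ` is a curve with non-vanishing curvature. -/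
def CurvedCurve (Γ U : Set FreqPlane) : Prop :=
  ∃ κ : ℝ, 0 < κ ∧ IsUniformCurve Γ U fun _ A => κ ≤ ‖A‖

/-! ### The estimates -/

/-- `‖u(t)‖_{L^q} ≤ C R α(t) ‖f‖ ‖g‖` for all `t > 0`, with one constant `C` for all radii `R`,
all admissible symbols `m` and all data `f`, `g`. -/
def PointwiseBound (N : ℕ) (a b c : ℝ → ℝ) (U : Set FreqPlane) (q : ℝ≥0∞) (α : ℝ → ℝ) : Prop :=
  ∃ C : ℝ, ∀ (R : ℝ) (m : FreqPlane → ℂ), 0 < R → IsSymbol N R U m →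
    ∀ (f g : L2Line) (u v w : ℝ → L2Line), SolvesSystem a b c m f g u v w →
      ∀ t : ℝ, 0 < t →
        eLpNorm (u t) q volume ≤ ENNReal.ofReal (C * R * α t * ‖f‖ * ‖g‖)

/-- `‖u‖_{L^p_t L^q_x} ≤ C R ‖f‖ ‖g‖`, the time variable running over `(0, ∞)`, with one constant
`C` for all radii `R`, all admissible symbols `m` and all data `f`, `g`. -/
def MixedNormBound (N : ℕ) (a b c : ℝ → ℝ) (U : Set FreqPlane) (p q : ℝ) : Prop :=
  ∃ C : ℝ, ∀ (R : ℝ) (m : FreqPlane → ℂ), 0 < R → IsSymbol N R U m →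
    ∀ (f g : L2Line) (u v w : ℝ → L2Line), SolvesSystem a b c m f g u v w →
      (∫⁻ t in Ioi (0 : ℝ), eLpNorm (u t) (ENNReal.ofReal q) volume ^ p) ^ (1 / p)
        ≤ ENNReal.ofReal (C * R * ‖f‖ * ‖g‖)

/-- `1 / q`, with `1 / ∞ = 0`. -/
noncomputable def invExp (q : ℝ≥0∞) : ℝ := (q⁻¹).toReal

/-! Conjugating away the free flows turns the system into an explicit formula: up to a unimodular
factor, `û(t)` is the pseudo-product of `f̂` and `ĝ` with symbol `m · osc t φ`, where `osc t x = ∫₀ᵗ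
e^{isx} ds` (`SolvesSystem.hatL2_eq`). All estimates exploit `|osc t x| ≤ min(t, 2/|x|)`, the
oscillation of the flows, or both.

Part (A) uses only the size of the symbol. It is cut into dyadic shells `|φ| ~ 2^{-n}`, down to
`2^{-n} ~ 1/t`; on such a shell it is `O(2^n)`. A bilinear operator with bounded symbol supported in
a planar set `E` is controlled by Cauchy–Schwarz through the lengths of the slices of `E`: with
slices in both axis directions it maps `L² × L²` into functions with integrable Fourier transform,
hence into `L^∞`, and with slices in a single direction it maps into `L²`. `LevelBound φ U θ₁ θ₂`
records gains `s^θ₁` (into `L^∞`) and `s^θ₂` (into `L²`) for the set `|φ| ≤ s`. Interpolating on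
each shell and summing a geometric series gives growth `t^{1-θ}`, with `θ` the interpolated
exponent, a logarithm if `θ = 1`, and a bounded quantity if `θ > 1` (`dyadic_estimate`).

The gains come from plane geometry. Near a nondegenerate critical zero, `|φ| ≤ s` is contained in a
disc of radius `O(√s)`, so the gains are `(1/2, 1/4)`. If `φ` vanishes at order one on a curve, the
set lies in a neighbourhood of the curve of width `δ ~ s`. One family of axis-parallel slices has
length `O(δ)`; the other has length `O(δ^σ)`, with `σ = 1` for curves transversal to both axes, `σ =
1/2` for curved ones and `σ = 0` in general. This yields gains `((1+σ)/2, 1/2)`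
(`VanishesAtOrderOne.levelBound`).

Under (H) the endpoint `q = ∞` is a dispersive estimate. Van der Corput's lemma gives the decay
`|t-s|^{-1/2}` of the group of `a`; writing `m` as a superposition of tensor products by the
fundamental theorem of calculus transfers it to the bilinear form at the cost of one derivative of
`m` and a factor `R`; integration over `s ∈ (0,t)` gives `t^{1/2}`. At `q = 2`, along one of three
families of lines two of the three second derivatives add up, so `φ` is uniformly convex or concave
there; its sublevel sets have slices `O(√s)`, which gives `t^{3/4}`. The rest is interpolation.

Without time resonances, integration in time replaces `m · osc t φ` by `(m/φ)(e^{itφ} - 1)`. The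
constant term is a fixed profile moved by the group of `a`, and its `L^∞` norm decays like
`t^{-1/2}` (`enorm_integral_quotient_form_le`). The other term is a product of free waves of `b` and
`c`; decomposing frequency pairs by the size of the velocity difference `b'(ξ) - c'(η)` (a Whitney
decomposition) and applying Plancherel in time to each piece puts it in `L^s_t` of the Fourier
algebra for every `s > 2` (`exists_evolvedMass_bound`). Interpolation with the uniform `L²` bound
yields the mixed-norm estimate. -/

/-! ### Fourier inversion and Plancherel: the integral transform versus the `L²` transform. -/

theorem integral_fourier_mul_eq_flip {f g : ℝ → ℂ} (hf : Integrable f) (hg : Integrable g) :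
    ∫ ξ, 𝓕 f ξ * g ξ = ∫ x, f x * 𝓕 g x := by
  have := VectorFourier.integral_fourierIntegral_smul_eq_flip (μ := volume) (ν := volume)
    (L := innerₗ ℝ) Real.continuous_fourierChar continuous_inner hf hg
  simp only [smul_eq_mul, flip_innerₗ] at this
  exact this

theorem integral_fourierInv_mul_eq_flip {f g : ℝ → ℂ} (hf : Integrable f) (hg : Integrable g) :
    ∫ ξ, 𝓕⁻ f ξ * g ξ = ∫ x, f x * 𝓕⁻ g x := by
  have h := integral_fourier_mul_eq_flip hf hg.comp_neg
  have h1 : ∀ x, 𝓕 (fun y => g (-y)) x = 𝓕⁻ g x := by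
    intro x
    rw [Real.fourierInv_eq_fourier_comp_neg]
  have h2 : ∫ ξ, 𝓕⁻ f ξ * g ξ = ∫ ξ, 𝓕 f ξ * g (-ξ) := by
    rw [← integral_neg_eq_self]
    simp [Real.fourierInv_eq_fourier_neg]
  rw [h2, h]
  simp_rw [h1]

theorem integral_schwartz_mul_fourier_Lp (h : L2Line) (ψ : SchwartzMap ℝ ℂ) :
    ∫ x, ψ x * (𝓕 h : L2Line) x = ∫ x, 𝓕 (ψ : ℝ → ℂ) x * h x := by
  have h1 := congrArg (fun T => T ψ) (Lp.fourier_toTemperedDistribution_eq h)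
  simp only [TemperedDistribution.fourier_apply, Lp.toTemperedDistribution_apply] at h1
  simpa [SchwartzMap.fourier_coe] using h1.symm

/-- Inversion for an `L²` function whose transform is integrable. A test function is written as the
Fourier transform of a Schwartz function; duality then moves the transform onto `h`, where it may be
replaced by `H`, and a second flip moves it back. -/
theorem Lp_ae_eq_fourierInv {h : L2Line} {H : ℝ → ℂ} (hH : Integrable H)
    (hh : (𝓕 h : L2Line) =ᵐ[volume] H) : h =ᵐ[volume] 𝓕⁻ H := by
  have hc : Continuous (𝓕⁻ H) := by
    have : 𝓕⁻ H = fun x => 𝓕 H (-x) := by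
      ext x; rw [Real.fourierInv_eq_fourier_neg]
    rw [this]
    exact (VectorFourier.fourierIntegral_continuous Real.continuous_fourierChar
      continuous_inner hH).comp continuous_neg
  refine ae_eq_of_integral_contDiff_smul_eq ((Lp.memLp h).locallyIntegrable (by norm_num))
    hc.locallyIntegrable fun g hg hgs => ?_
  have hg' : ContDiff ℝ ∞ (fun x => (g x : ℂ)) := Complex.ofRealCLM.contDiff.comp hg
  have hgs' : HasCompactSupport (fun x => (g x : ℂ)) :=
    hgs.comp_left (g := fun y : ℝ => (y : ℂ)) (by simp)
  set χ : SchwartzMap ℝ ℂ := hgs'.toSchwartzMap hg' with hχ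
  have hχx : ∀ x, χ x = (g x : ℂ) := fun x => rfl
  have e1 := integral_schwartz_mul_fourier_Lp h (𝓕⁻ χ)
  have e2 : 𝓕 ((𝓕⁻ χ : SchwartzMap ℝ ℂ) : ℝ → ℂ) = χ := by
    rw [← SchwartzMap.fourier_coe, FourierTransform.fourier_fourierInv_eq]
  rw [e2, SchwartzMap.fourierInv_coe] at e1
  simp_rw [Complex.real_smul, ← hχx]
  rw [← e1, ← integral_fourierInv_mul_eq_flip χ.integrable hH]
  refine integral_congr_ae ?_
  filter_upwards [hh] with x hx
  rw [hx]

/-- Plancherel for the transform defined by an integral: for integrable `H` it represents the `L²`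
transform, for which the isometry is known. -/
theorem eLpNorm_fourierInv_eq {H : ℝ → ℂ} (h1 : Integrable H) (h2 : MemLp H 2) :
    eLpNorm (𝓕⁻ H) 2 volume = eLpNorm H 2 volume := by
  set h : L2Line := 𝓕⁻ (h2.toLp H)
  have e1 : (𝓕 h : L2Line) = h2.toLp H := FourierTransform.fourier_fourierInv_eq _
  have e2 : (𝓕 h : L2Line) =ᵐ[volume] H := by rw [e1]; exact h2.coeFn_toLp
  have e3 := Lp_ae_eq_fourierInv h1 e2
  rw [← eLpNorm_congr_ae e3, ← eLpNorm_congr_ae e2]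
  have := Lp.norm_fourier_eq h
  rw [Lp.norm_def, Lp.norm_def, ENNReal.toReal_eq_toReal_iff' (Lp.memLp _).2.ne (Lp.memLp _).2.ne]
    at this
  exact this.symm

theorem eLpNorm_fourier_eq {H : ℝ → ℂ} (h1 : Integrable H) (h2 : MemLp H 2) :
    eLpNorm (𝓕 H) 2 volume = eLpNorm H 2 volume := by
  have e : 𝓕 H = 𝓕⁻ (fun x => H (-x)) := by
    ext x; rw [Real.fourierInv_eq_fourier_comp_neg]; simp
  have hm := Measure.measurePreserving_neg (volume : Measure ℝ)
  rw [e, eLpNorm_fourierInv_eq h1.comp_neg (h2.comp_measurePreserving hm)]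
  exact eLpNorm_comp_measurePreserving h2.1 hm

theorem continuous_fourier_of_integrable {H : ℝ → ℂ} (h1 : Integrable H) : Continuous (𝓕 H) :=
  VectorFourier.fourierIntegral_continuous Real.continuous_fourierChar continuous_inner h1

theorem memLp_fourier {H : ℝ → ℂ} (h1 : Integrable H) (h2 : MemLp H 2) : MemLp (𝓕 H) 2 :=
  ⟨(continuous_fourier_of_integrable h1).aestronglyMeasurable, by
    rw [eLpNorm_fourier_eq h1 h2]; exact h2.2⟩

/-- Pairing with a fixed `L²` function is continuous on `L²`. -/
theorem continuous_integral_mul_Lp {k : ℝ → ℂ} (hk : MemLp k 2) :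
    Continuous fun h : L2Line => ∫ x, k x * h x := by
  have hs : MemLp (fun x => (starRingEnd ℂ) (k x)) 2 := hk.star
  have : (fun h : L2Line => ∫ x, k x * h x) = fun h : L2Line => inner ℂ (hs.toLp _) h := by
    ext h
    rw [L2.inner_def]
    refine integral_congr_ae ?_
    filter_upwards [hs.coeFn_toLp] with x hx
    rw [hx]; simp [mul_comm]
  rw [this]
  fun_prop

/-- Both sides are continuous in `h ∈ L²`, and for Schwartz `h` this is the flip formula for
integrable functions; Schwartz functions are dense. -/
theorem integral_mul_fourier_Lp {k : ℝ → ℂ} (h1 : Integrable k) (h2 : MemLp k 2) (h : L2Line) :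
    ∫ x, k x * (𝓕 h : L2Line) x = ∫ x, 𝓕 k x * h x := by
  refine DenseRange.induction_on (p := fun h : L2Line =>
      ∫ x, k x * (𝓕 h : L2Line) x = ∫ x, 𝓕 k x * h x)
    (SchwartzMap.denseRange_toLpCLM (F := ℂ) (μ := (volume : Measure ℝ)) (p := 2)
      ENNReal.ofNat_ne_top) h ?_ ?_
  · refine isClosed_eq ?_ (continuous_integral_mul_Lp (memLp_fourier h1 h2))
    exact (continuous_integral_mul_Lp h2).comp (Lp.fourierTransformₗᵢ ℝ ℂ).continuous
  · intro ψ
    have e1 : (𝓕 (SchwartzMap.toLpCLM ℝ (E := ℝ) ℂ 2 volume ψ) : L2Line)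
        = (𝓕 ψ : SchwartzMap ℝ ℂ).toLp 2 := SchwartzMap.toLp_fourier_eq ψ
    rw [e1]
    have e2 := integral_fourier_mul_eq_flip h1 ψ.integrable
    calc _ = ∫ x, k x * 𝓕 (ψ : ℝ → ℂ) x := by
            refine integral_congr_ae ?_
            filter_upwards [(𝓕 ψ : SchwartzMap ℝ ℂ).coeFn_toLp 2 volume] with x hx
            rw [hx, SchwartzMap.fourier_coe]
      _ = _ := e2.symm
      _ = _ := by
            refine integral_congr_ae ?_
            filter_upwards [ψ.coeFn_toLp 2 volume] with x hx
            simp only [SchwartzMap.toLpCLM_apply, hx]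

/-! ### The normalised transform `hatL2`: isometry, inversion, surjectivity, linearity. -/

/-- The `L²` norm of a nonnegative function. -/
noncomputable def l2n (F : ℝ → ℝ≥0∞) : ℝ≥0∞ := (∫⁻ x, F x ^ (2 : ℝ)) ^ (1 / 2 : ℝ)

/-- The modulus of the Fourier transform. -/
noncomputable def hatE (f : L2Line) : ℝ → ℝ≥0∞ := fun ξ => ‖hatL2 f ξ‖ₑ

theorem eLpNorm_two_eq_l2n (f : ℝ → ℂ) : eLpNorm f 2 volume = l2n fun x => ‖f x‖ₑ := by
  rw [eLpNorm_eq_lintegral_rpow_enorm_toReal (by norm_num) (by norm_num)]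
  simp [l2n]

theorem quasiMeasurePreserving_mul_left {a : ℝ} (ha : a ≠ 0) :
    Measure.QuasiMeasurePreserving (fun x : ℝ => a * x) volume volume := by
  refine ⟨by fun_prop, ?_⟩
  rw [Real.map_volume_mul_left ha]
  exact Measure.smul_absolutelyContinuous

theorem quasiMeasurePreserving_div {a : ℝ} (ha : a ≠ 0) :
    Measure.QuasiMeasurePreserving (fun x : ℝ => x / a) volume volume := by
  have := quasiMeasurePreserving_mul_left (inv_ne_zero ha)
  simpa [div_eq_inv_mul] using this

theorem lintegral_comp_div_pos {a : ℝ} (ha : 0 < a) {g : ℝ → ℝ≥0∞} (hg : Measurable g) :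
    ∫⁻ x, g (x / a) = ENNReal.ofReal a * ∫⁻ x, g x := by
  have h := Real.smul_map_volume_mul_left ha.ne'
  calc ∫⁻ x, g (x / a) = ∫⁻ x, g (x / a) ∂(ENNReal.ofReal |a| • Measure.map (a * ·) volume) := by
        rw [h]
    _ = ENNReal.ofReal a * ∫⁻ x, g x := by
        rw [lintegral_smul_measure, abs_of_pos ha,
          lintegral_map (f := fun x => g (x / a)) (hg.comp (by fun_prop)) (by fun_prop)]
        simp [ha.ne']

theorem measurable_hatL2 (f : L2Line) : Measurable (hatL2 f) := by
  unfold hatL2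
  exact measurable_const.mul ((Lp.stronglyMeasurable _).measurable.comp (by fun_prop))

theorem measurable_hatE (f : L2Line) : Measurable (hatE f) := (measurable_hatL2 f).enorm

theorem eLpNorm_Lp (f : L2Line) : eLpNorm f 2 volume = ENNReal.ofReal ‖f‖ := by
  rw [Lp.norm_def, ENNReal.ofReal_toReal (Lp.memLp f).2.ne]

/-- The square of the prefactor `(2π)^{-1/2}` cancels the Jacobian `2π` of the dilation, so the
normalisation is unitary. -/
theorem l2n_hatE (f : L2Line) : l2n (hatE f) = ENNReal.ofReal ‖f‖ := by
  have h2 : (0 : ℝ) < 2 * Real.pi := by positivity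
  have h1 : ∫⁻ x, hatE f x ^ (2 : ℝ) = ∫⁻ x, ‖(𝓕 f : L2Line) x‖ₑ ^ (2 : ℝ) := by
    have e : ∀ x, hatE f x ^ (2 : ℝ)
        = ENNReal.ofReal (2 * Real.pi)⁻¹ * ‖(𝓕 f : L2Line) (x / (2 * Real.pi))‖ₑ ^ (2 : ℝ) := by
      intro x
      simp only [hatE, hatL2, enorm_mul]
      rw [ENNReal.mul_rpow_of_nonneg _ _ (by norm_num)]
      congr 1
      rw [← ofReal_norm, ENNReal.ofReal_rpow_of_nonneg (norm_nonneg _) (by norm_num)]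
      congr 1
      rw [Complex.norm_real, Real.norm_of_nonneg (by positivity)]
      norm_cast
      rw [inv_pow, Real.sq_sqrt h2.le]
    simp_rw [e]
    rw [lintegral_const_mul _ (by
      exact (((Lp.stronglyMeasurable _).measurable.comp (by fun_prop)).enorm.pow_const _)),
      lintegral_comp_div_pos h2 (g := fun x => ‖(𝓕 f : L2Line) x‖ₑ ^ (2 : ℝ))
        ((Lp.stronglyMeasurable _).measurable.enorm.pow_const _),
      ← mul_assoc, ← ENNReal.ofReal_mul (by positivity), inv_mul_cancel₀ h2.ne']
    simp
  rw [l2n, h1, ← Lp.norm_fourier_eq f, ← eLpNorm_Lp, eLpNorm_two_eq_l2n, l2n]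

theorem memLp_hatL2 (f : L2Line) : MemLp (hatL2 f) 2 := by
  refine ⟨(measurable_hatL2 f).aestronglyMeasurable, ?_⟩
  rw [eLpNorm_two_eq_l2n]
  have := l2n_hatE f
  unfold hatE at this
  rw [this]; exact ENNReal.ofReal_lt_top

theorem hatL2_eq_iff {f : L2Line} {H : ℝ → ℂ} : hatL2 f =ᵐ[volume] H ↔
    (𝓕 f : L2Line) =ᵐ[volume] fun x => (Real.sqrt (2 * Real.pi) : ℂ) * H (2 * Real.pi * x) := by
  have h2 : (2 * Real.pi : ℝ) ≠ 0 := by positivity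
  have h3 : ((Real.sqrt (2 * Real.pi) : ℝ) : ℂ) ≠ 0 := by
    exact_mod_cast (Real.sqrt_pos.2 (by positivity)).ne'
  constructor
  · intro h
    filter_upwards [(quasiMeasurePreserving_mul_left h2).ae h] with x hx
    rw [← hx, hatL2, mul_div_cancel_left₀ _ h2]
    push_cast
    field_simp
  · intro h
    filter_upwards [(quasiMeasurePreserving_div h2).ae h] with x hx
    rw [hatL2, hx, mul_div_cancel₀ _ h2]
    push_cast
    field_simp

/-- The inversion formula for an integrable transform. It is the source of all `L^∞` bounds: one
either bounds the `L¹` norm of `H`, or estimates the oscillatory integral for each `x`. -/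
theorem ae_eq_integral_of_hatL2 {u : L2Line} {H : ℝ → ℂ} (hH : Integrable H)
    (hu : hatL2 u =ᵐ[volume] H) :
    u =ᵐ[volume] fun x => ((Real.sqrt (2 * Real.pi))⁻¹ : ℂ) *
      ∫ ξ, Complex.exp (Complex.I * (x * ξ : ℝ)) * H ξ := by
  have h2 : (0 : ℝ) < 2 * Real.pi := by positivity
  have h3 : ((Real.sqrt (2 * Real.pi) : ℝ) : ℂ) ≠ 0 := by
    exact_mod_cast (Real.sqrt_pos.2 h2).ne'
  have h := hatL2_eq_iff.1 hu
  have hi : Integrable fun x => (Real.sqrt (2 * Real.pi) : ℂ) * H (2 * Real.pi * x) :=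
    (hH.comp_mul_left' h2.ne').const_mul _
  filter_upwards [Lp_ae_eq_fourierInv hi h] with x hx
  rw [hx, Real.fourierInv_eq']
  have e : ∀ v : ℝ, Complex.exp (↑(2 * Real.pi * inner ℝ v x) * Complex.I) •
      ((Real.sqrt (2 * Real.pi) : ℂ) * H (2 * Real.pi * v)) =
      (Real.sqrt (2 * Real.pi) : ℂ) * (fun ξ : ℝ => Complex.exp (Complex.I * (x * ξ : ℝ)) * H ξ)
        (2 * Real.pi * v) := by
    intro v
    simp only [smul_eq_mul, RCLike.inner_apply, conj_trivial]
    rw [mul_left_comm]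
    congr 3
    push_cast; ring
  simp_rw [e]
  rw [integral_const_mul, Measure.integral_comp_mul_left
    (fun ξ : ℝ => Complex.exp (Complex.I * (x * ξ : ℝ)) * H ξ) (2 * Real.pi), abs_of_pos (by positivity)]
  rw [Complex.real_smul, ← mul_assoc]
  congr 1
  have : (Real.sqrt (2 * Real.pi) : ℂ) * (Real.sqrt (2 * Real.pi) : ℂ) = ((2 * Real.pi : ℝ) : ℂ) := by
    rw [← Complex.ofReal_mul, Real.mul_self_sqrt h2.le]
  rw [Complex.ofReal_inv, ← this]
  field_simp

/-- Surjectivity allows a solution to be split into pieces prescribed on the Fourier side. -/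
theorem exists_hatL2_eq {H : ℝ → ℂ} (hH : MemLp H 2) : ∃ h : L2Line, hatL2 h =ᵐ[volume] H := by
  have h2 : (2 * Real.pi : ℝ) ≠ 0 := by positivity
  have hm : MemLp (fun x => (Real.sqrt (2 * Real.pi) : ℂ) * H (2 * Real.pi * x)) 2 := by
    refine MemLp.const_mul ⟨hH.1.comp_quasiMeasurePreserving (quasiMeasurePreserving_mul_left h2), ?_⟩ _
    have : eLpNorm (H ∘ fun x => 2 * Real.pi * x) 2 volume
        = eLpNorm H 2 (Measure.map (fun x => 2 * Real.pi * x) volume) := by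
      rw [eLpNorm_map_measure _ (by fun_prop)]
      rw [Real.map_volume_mul_left h2]
      exact hH.1.smul_measure _
    change eLpNorm (H ∘ fun x => 2 * Real.pi * x) 2 volume < ⊤
    rw [this, Real.map_volume_mul_left h2, eLpNorm_smul_measure_of_ne_top (by norm_num)]
    exact ENNReal.mul_lt_top (ENNReal.rpow_lt_top_of_nonneg (by simp) ENNReal.ofReal_ne_top) hH.2
  refine ⟨𝓕⁻ (hm.toLp _), hatL2_eq_iff.2 ?_⟩
  rw [FourierTransform.fourier_fourierInv_eq]
  exact hm.coeFn_toLp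

theorem hatL2_add (f g : L2Line) : hatL2 (f + g) =ᵐ[volume] fun ξ => hatL2 f ξ + hatL2 g ξ := by
  have h2 : (2 * Real.pi : ℝ) ≠ 0 := by positivity
  have : (𝓕 (f + g) : L2Line) =ᵐ[volume] (𝓕 f : L2Line) + (𝓕 g : L2Line) := by
    rw [FourierTransform.fourier_add]; exact Lp.coeFn_add _ _
  filter_upwards [(quasiMeasurePreserving_div h2).ae this] with x hx
  simp only [hatL2, hx, Pi.add_apply]; ring

theorem hatL2_sub (f g : L2Line) : hatL2 (f - g) =ᵐ[volume] fun ξ => hatL2 f ξ - hatL2 g ξ := by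
  filter_upwards [hatL2_add (f - g) g] with x hx
  rw [sub_add_cancel] at hx
  rw [hx]; ring

theorem hatL2_zero : hatL2 0 =ᵐ[volume] 0 := by
  filter_upwards [hatL2_sub 0 0] with x hx
  simpa using hx

theorem hatL2_sum {ι : Type*} (s : Finset ι) (f : ι → L2Line) :
    hatL2 (∑ i ∈ s, f i) =ᵐ[volume] fun ξ => ∑ i ∈ s, hatL2 (f i) ξ := by
  classical
  induction s using Finset.induction with
  | empty => simp only [Finset.sum_empty]; exact hatL2_zero
  | insert i s hi ih =>
    filter_upwards [hatL2_add (f i) (∑ i ∈ s, f i), ih] with x h1 h2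
    rw [Finset.sum_insert hi, Finset.sum_insert hi, h1, h2]

theorem eq_of_hatL2_ae_eq {f g : L2Line} (h : hatL2 f =ᵐ[volume] hatL2 g) : f = g := by
  rw [← sub_eq_zero, ← norm_eq_zero]
  have h0 : l2n (hatE (f - g)) = 0 := by
    unfold l2n
    have : ∫⁻ x, hatE (f - g) x ^ (2 : ℝ) = 0 := by
      rw [lintegral_eq_zero_iff ((measurable_hatE _).pow_const _)]
      filter_upwards [hatL2_sub f g, h] with x h1 h2
      simp [hatE, h1, h2]
    rw [this]; simp
  rw [l2n_hatE, ENNReal.ofReal_eq_zero] at h0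
  exact le_antisymm h0 (norm_nonneg _)

/-! ### Interpolation between `L²` and `L^∞`. -/

theorem invExp_top : invExp ⊤ = 0 := by simp [invExp]

theorem invExp_two : invExp 2 = 1 / 2 := by simp [invExp]

theorem invExp_nonneg (q : ℝ≥0∞) : 0 ≤ invExp q := ENNReal.toReal_nonneg

theorem invExp_le_half {q : ℝ≥0∞} (hq : 2 ≤ q) : invExp q ≤ 1 / 2 := by
  rw [← invExp_two]
  exact ENNReal.toReal_mono (by simp) (ENNReal.inv_le_inv.2 hq)

theorem invExp_pos {q : ℝ≥0∞} (hq : 2 ≤ q) (hq' : q ≠ ⊤) : 0 < invExp q :=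
  ENNReal.toReal_pos (by simpa using hq') (by simpa using (lt_of_lt_of_le (by norm_num) hq).ne')

/-- Pointwise almost everywhere, `|u|^q ≤ ‖u‖_∞^{q-2} |u|²`. -/
theorem eLpNorm_interpolate {u : ℝ → ℂ} (hu : AEStronglyMeasurable u) {q : ℝ≥0∞} (hq : 2 ≤ q) :
    eLpNorm u q volume ≤
      eLpNorm u 2 volume ^ (2 * invExp q) * eLpNorm u ⊤ volume ^ (1 - 2 * invExp q) := by
  rcases eq_or_ne q ⊤ with rfl | hq'
  · simp [invExp_top]
  have hr : 2 ≤ q.toReal := by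
    have := ENNReal.toReal_mono hq' hq; simpa using this
  have hq0 : q ≠ 0 := (lt_of_lt_of_le (by norm_num) hq).ne'
  have hi : invExp q = 1 / q.toReal := by simp [invExp, ENNReal.toReal_inv]
  rw [eLpNorm_eq_lintegral_rpow_enorm_toReal hq0 hq',
    eLpNorm_eq_lintegral_rpow_enorm_toReal (by norm_num) (by norm_num), eLpNorm_exponent_top, hi]
  set r := q.toReal
  have hr0 : 0 < r := by linarith
  have h1 : ∫⁻ x, ‖u x‖ₑ ^ r ≤ eLpNormEssSup u volume ^ (r - 2) * ∫⁻ x, ‖u x‖ₑ ^ (2 : ℝ) := by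
    calc ∫⁻ x, ‖u x‖ₑ ^ r ≤ ∫⁻ x, eLpNormEssSup u volume ^ (r - 2) * ‖u x‖ₑ ^ (2 : ℝ) := by
          refine lintegral_mono_ae ?_
          filter_upwards [enorm_ae_le_eLpNormEssSup u volume] with x hx
          have : ‖u x‖ₑ ^ r = ‖u x‖ₑ ^ (r - 2) * ‖u x‖ₑ ^ (2 : ℝ) := by
            rw [← ENNReal.rpow_add_of_nonneg _ _ (by linarith) (by norm_num)]; simp
          rw [this]
          gcongr
      _ ≤ _ := by
          rw [lintegral_const_mul'' _ (hu.enorm.pow_const _)]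
  calc (∫⁻ x, ‖u x‖ₑ ^ r) ^ (1 / r)
      ≤ (eLpNormEssSup u volume ^ (r - 2) * ∫⁻ x, ‖u x‖ₑ ^ (2 : ℝ)) ^ (1 / r) := by gcongr
    _ = _ := by
        rw [ENNReal.mul_rpow_of_nonneg _ _ (by positivity), ← ENNReal.rpow_mul, mul_comm]
        congr 1
        · rw [← ENNReal.rpow_mul]; congr 1; simp
        · congr 1
          field_simp

/-! ### Unimodular exponentials and their time integrals. -/

/-- The unimodular number `e^{iθ}`. -/
noncomputable def cis (θ : ℝ) : ℂ := Complex.exp (Complex.I * (θ : ℂ))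

theorem norm_cis (θ : ℝ) : ‖cis θ‖ = 1 := by
  rw [cis, mul_comm, Complex.norm_exp_ofReal_mul_I]

theorem enorm_cis (θ : ℝ) : ‖cis θ‖ₑ = 1 := by
  rw [← ofReal_norm, norm_cis, ENNReal.ofReal_one]

theorem cis_zero : cis 0 = 1 := by simp [cis]

theorem cis_add (x y : ℝ) : cis (x + y) = cis x * cis y := by
  simp [cis, mul_add, Complex.exp_add]

theorem contDiff_cis : ContDiff ℝ ∞ cis := by
  unfold cis
  exact (contDiff_const.mul Complex.ofRealCLM.contDiff).cexp

theorem continuous_cis : Continuous cis := contDiff_cis.continuous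

theorem hasDerivAt_cis (x : ℝ) : HasDerivAt cis (Complex.I * cis x) x := by
  have h : HasDerivAt (fun x : ℝ => Complex.I * (x : ℂ)) (Complex.I * 1) x :=
    (Complex.ofRealCLM.hasDerivAt (x := x)).const_mul Complex.I
  have := h.cexp
  unfold cis
  convert this using 1
  ring

theorem hasDerivAt_cis_mul (x t : ℝ) :
    HasDerivAt (fun s : ℝ => cis (s * x)) (Complex.I * x * cis (t * x)) t := by
  have := (hasDerivAt_cis (t * x)).scomp t ((hasDerivAt_id t).mul_const x)
  refine HasDerivAt.congr_deriv (f := fun s : ℝ => cis (s * x)) this ?_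
  rw [one_mul, Complex.real_smul]; ring

theorem norm_cis_sub_le (x y : ℝ) : ‖cis x - cis y‖ ≤ |x - y| := by
  have := Convex.norm_image_sub_le_of_norm_hasDerivWithin_le (f := cis)
    (f' := fun x => Complex.I * cis x) (s := univ) (C := 1) (x := y) (y := x)
    (fun z _ => (hasDerivAt_cis z).hasDerivWithinAt)
    (fun z _ => by simp [norm_cis]) convex_univ (mem_univ _) (mem_univ _)
  simpa using this

/-- The oscillatory time integral `∫₀ᵗ e^{isx} ds`. -/
noncomputable def osc (t x : ℝ) : ℂ := ∫ s in (0 : ℝ)..t, cis (s * x)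

theorem continuous_osc (t : ℝ) : Continuous (osc t) := by
  unfold osc
  exact intervalIntegral.continuous_parametric_intervalIntegral_of_continuous'
    (f := fun x s => cis (s * x)) (continuous_cis.comp (by fun_prop)) 0 t

theorem norm_osc_le (t x : ℝ) : ‖osc t x‖ ≤ |t| := by
  have := intervalIntegral.norm_integral_le_of_norm_le_const (a := 0) (b := t) (C := 1)
    (f := fun s => cis (s * x)) (fun s _ => (norm_cis _).le)
  simpa [osc] using this

theorem osc_eq {x : ℝ} (hx : x ≠ 0) (t : ℝ) : osc t x = (cis (t * x) - 1) / (Complex.I * x) := by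
  have hx' : (Complex.I * x : ℂ) ≠ 0 := by simp [hx]
  have h : ∀ s ∈ uIcc 0 t,
      HasDerivAt (fun s : ℝ => cis (s * x) / (Complex.I * x)) (cis (s * x)) s := by
    intro s _
    have := (hasDerivAt_cis_mul x s).div_const (Complex.I * x)
    rwa [mul_div_cancel_left₀ _ hx'] at this
  have hint : IntervalIntegrable (fun s => cis (s * x)) volume 0 t :=
    (continuous_cis.comp (by fun_prop)).intervalIntegrable _ _
  rw [osc, intervalIntegral.integral_eq_sub_of_hasDerivAt h hint]
  simp [cis_zero, sub_div]

/-- Together with `norm_osc_le` this is the bound `min(t, 2/|x|)` that converts smallness of the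
resonant region into slow growth in time. -/
theorem norm_osc_le_div {x : ℝ} (hx : x ≠ 0) (t : ℝ) : ‖osc t x‖ ≤ 2 / |x| := by
  rw [osc_eq hx, norm_div]
  simp only [norm_mul, Complex.norm_I, one_mul, Complex.norm_real, Real.norm_eq_abs]
  gcongr
  calc _ ≤ ‖cis (t * x)‖ + ‖(1 : ℂ)‖ := norm_sub_le _ _
    _ = 2 := by rw [norm_cis]; norm_num

theorem hasDerivAt_osc (t x : ℝ) : HasDerivAt (fun s => osc s x) (cis (t * x)) t := by
  have hc : Continuous fun s => cis (s * x) := continuous_cis.comp (by fun_prop)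
  exact hc.integral_hasStrictDerivAt 0 t |>.hasDerivAt

theorem osc_zero (x : ℝ) : osc 0 x = 0 := by simp [osc]

/-! ### Duhamel's formula on the Fourier side. -/

theorem lintegral_mul_le_l2n {F G : ℝ → ℝ≥0∞} (hF : AEMeasurable F) (hG : AEMeasurable G) :
    ∫⁻ x, F x * G x ≤ l2n F * l2n G :=
  ENNReal.lintegral_mul_le_Lp_mul_Lq volume (p := 2) (q := 2)
    (Real.HolderConjugate.two_two) hF hG

theorem enorm_integral_mul_hatL2_le {k : ℝ → ℂ} (hk : AEMeasurable k) (f : L2Line) :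
    ‖∫ x, k x * hatL2 f x‖ₑ ≤ l2n (fun x => ‖k x‖ₑ) * ENNReal.ofReal ‖f‖ := by
  rw [← l2n_hatE]
  refine (enorm_integral_le_lintegral_enorm _).trans ?_
  simp_rw [enorm_mul]
  exact lintegral_mul_le_l2n hk.enorm (measurable_hatE f).aemeasurable

theorem integrable_mul_hatL2 {k : ℝ → ℂ} (hk : Continuous k) (hs : HasCompactSupport k)
    (f : L2Line) : Integrable fun x => k x * hatL2 f x :=
  (hk.memLp_of_hasCompactSupport (p := 2) hs).integrable_mul (memLp_hatL2 f)

/-- Removing the free evolution from a solution of a dispersive equation. -/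
theorem SolvesDispersive.hasDerivWithinAt {a : ℝ → ℝ} {u₀ : L2Line} {S : ℝ → ℝ → ℂ}
    {u : ℝ → L2Line} (h : SolvesDispersive a u₀ S u) (ha : ContDiff ℝ ∞ a) {χ : ℝ → ℂ}
    (hχ : ContDiff ℝ ∞ χ) (hχs : HasCompactSupport χ) {t : ℝ} (ht : 0 ≤ t)
    (hS : Integrable fun ξ => χ ξ * cis (-t * a ξ) * S t ξ) :
    HasDerivWithinAt (fun s => ∫ ξ, χ ξ * cis (-s * a ξ) * hatL2 (u s) ξ)
      (-Complex.I * ∫ ξ, χ ξ * cis (-t * a ξ) * S t ξ) (Ici 0) t := by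
  have hac := ha.continuous
  have hχc := hχ.continuous
  have hcc : ∀ s : ℝ, Continuous fun ξ => χ ξ * cis (-s * a ξ) := fun s =>
    hχc.mul (continuous_cis.comp (by fun_prop))
  -- The twisted function `χ e^{-ita}` is again an admissible test function, since `a` is smooth and
  -- `χ` has compact support; the equation at time `t` is tested against it.
  have hcd : ContDiff ℝ ∞ fun ξ => χ ξ * cis (-t * a ξ) :=
    hχ.mul (contDiff_cis.comp (contDiff_const.mul ha))
  have hcs : ∀ s : ℝ, HasCompactSupport fun ξ => χ ξ * cis (-s * a ξ) := fun s => hχs.mul_right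
  have hχac : Continuous fun ξ => χ ξ * (a ξ : ℂ) := hχc.mul (Complex.continuous_ofReal.comp hac)
  have hχas : HasCompactSupport fun ξ => χ ξ * (a ξ : ℂ) := hχs.mul_right
  have hI2 : Integrable fun ξ => χ ξ * cis (-t * a ξ) * ((a ξ : ℂ) * hatL2 (u t) ξ) := by
    have := integrable_mul_hatL2 ((hcc t).mul (Complex.continuous_ofReal.comp hac))
      (hcs t).mul_right (u t)
    simpa [mul_assoc] using this
  -- the three increments
  have d1 : HasDerivWithinAt (fun s => ∫ ξ, χ ξ * cis (-t * a ξ) * hatL2 (u s) ξ)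
      (-Complex.I * ∫ ξ, χ ξ * cis (-t * a ξ) * (S t ξ - (a ξ : ℂ) * hatL2 (u t) ξ)) (Ici 0) t := by
    have := (h.equation _ hcd (hcs t) t ht).const_mul (-Complex.I)
    simpa [← mul_assoc] using this
  -- Only the multiplier moves here. Because `χ` has compact support, `χ a` is in `L²` however fast
  -- `a` grows, and it provides the dominating function.
  have d2 : HasDerivAt (fun s => ∫ ξ, χ ξ * cis (-s * a ξ) * hatL2 (u t) ξ)
      (∫ ξ, χ ξ * (-Complex.I * a ξ * cis (-t * a ξ)) * hatL2 (u t) ξ) t := by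
    refine (hasDerivAt_integral_of_dominated_loc_of_deriv_le (𝕜 := ℝ) (μ := volume)
      (F := fun s ξ => χ ξ * cis (-s * a ξ) * hatL2 (u t) ξ)
      (F' := fun s ξ => χ ξ * (-Complex.I * a ξ * cis (-s * a ξ)) * hatL2 (u t) ξ)
      (bound := fun ξ => ‖χ ξ * (a ξ : ℂ) * hatL2 (u t) ξ‖) (s := univ) Filter.univ_mem
      ?_ ?_ ?_ ?_ ?_ ?_).2
    · exact Filter.Eventually.of_forall fun s => (integrable_mul_hatL2 (hcc s) (hcs s) _).1
    · exact integrable_mul_hatL2 (hcc t) (hcs t) _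
    · refine (Continuous.aestronglyMeasurable ?_).mul (measurable_hatL2 _).aestronglyMeasurable
      exact hχc.mul ((continuous_const.mul (Complex.continuous_ofReal.comp hac)).mul
        (continuous_cis.comp (by fun_prop)))
    · refine Filter.Eventually.of_forall fun ξ s _ => le_of_eq ?_
      simp [norm_cis]
    · exact (integrable_mul_hatL2 hχac hχas _).norm
    · refine Filter.Eventually.of_forall fun ξ s _ => ?_
      have := ((hasDerivAt_cis_mul (-a ξ) s).const_mul (χ ξ)).mul_const (hatL2 (u t) ξ)
      simp only [mul_neg, ← neg_mul, Complex.ofReal_neg] at this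
      simp only [neg_mul] at this ⊢
      convert this using 2
  -- The cross term of the product rule: the multipliers differ by `O(|s - t|)` in `L²`, and `u s -
  -- u t` tends to `0` in `L²`, so the product is `o(|s - t|)`.
  have d3 : HasDerivWithinAt (fun s => ∫ ξ, (χ ξ * cis (-s * a ξ) - χ ξ * cis (-t * a ξ)) *
      hatL2 (u s - u t) ξ) 0 (Ici 0) t := by
    rw [hasDerivWithinAt_iff_isLittleO]
    simp only [sub_self, zero_mul, integral_zero, sub_zero, smul_zero]
    set C : ℝ≥0∞ := l2n fun ξ => ‖χ ξ * (a ξ : ℂ)‖ₑ with hC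
    have hCt : C ≠ ⊤ := by
      rw [hC, ← eLpNorm_two_eq_l2n]
      exact (hχac.memLp_of_hasCompactSupport hχas).2.ne
    have hb : ∀ s, ‖∫ ξ, (χ ξ * cis (-s * a ξ) - χ ξ * cis (-t * a ξ)) * hatL2 (u s - u t) ξ‖
        ≤ |s - t| * (C.toReal * ‖u s - u t‖) := by
      intro s
      have h1 := enorm_integral_mul_hatL2_le ((hcc s).sub (hcc t)).aemeasurable (u s - u t)
      have h2 : l2n (fun ξ => ‖χ ξ * cis (-s * a ξ) - χ ξ * cis (-t * a ξ)‖ₑ)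
          ≤ ENNReal.ofReal |s - t| * C := by
        rw [← eLpNorm_two_eq_l2n, hC, ← eLpNorm_two_eq_l2n]
        have := eLpNorm_le_mul_eLpNorm_of_ae_le_mul (μ := volume) (c := |s - t|)
          (f := fun ξ => χ ξ * cis (-s * a ξ) - χ ξ * cis (-t * a ξ))
          (g := fun ξ => χ ξ * (a ξ : ℂ)) (Filter.Eventually.of_forall fun ξ => by
            rw [← mul_sub, norm_mul, norm_mul]
            have := norm_cis_sub_le (-s * a ξ) (-t * a ξ)
            rw [show -s * a ξ - -t * a ξ = -((s - t) * a ξ) by ring, abs_neg, abs_mul] at this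
            calc _ ≤ ‖χ ξ‖ * (|s - t| * |a ξ|) := by gcongr
              _ = _ := by simp; ring) 2
        simpa using this
      have h3 := h1.trans (mul_le_mul_left h2 _)
      rw [← ENNReal.ofReal_toReal hCt, ← ENNReal.ofReal_mul (by positivity),
        ← ENNReal.ofReal_mul (by positivity), ← ofReal_norm,
        ENNReal.ofReal_le_ofReal_iff (by positivity)] at h3
      rw [← mul_assoc]; exact h3
    have hcont : Filter.Tendsto (fun s => C.toReal * ‖u s - u t‖) (nhdsWithin t (Ici 0)) (nhds 0) := by
      have h1 : Filter.Tendsto u (nhdsWithin t (Ici 0)) (nhds (u t)) := h.continuousOn t ht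
      have := ((h1.sub_const (u t)).norm).const_mul C.toReal
      simpa using this
    rw [Asymptotics.isLittleO_iff]
    intro ε hε
    filter_upwards [hcont.eventually (ge_mem_nhds hε)] with s hs
    calc _ ≤ _ := hb s
      _ ≤ |s - t| * ε := by gcongr
      _ = ε * ‖s - t‖ := by rw [Real.norm_eq_abs]; ring
  have hsum := (d1.add (d2.hasDerivWithinAt.add d3)).sub
    (hasDerivWithinAt_const t (Ici 0) (∫ ξ, χ ξ * cis (-t * a ξ) * hatL2 (u t) ξ))
  refine (hsum.congr_deriv ?_).congr_of_mem (fun s _ => ?_) ht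
  · rw [sub_zero, add_zero]
    have e1 : ∫ ξ, χ ξ * cis (-t * a ξ) * (S t ξ - (a ξ : ℂ) * hatL2 (u t) ξ)
        = ∫ ξ, χ ξ * cis (-t * a ξ) * S t ξ - χ ξ * cis (-t * a ξ) * ((a ξ : ℂ) * hatL2 (u t) ξ) := by
      congr 1; ext ξ; ring
    have e2 : ∫ ξ, χ ξ * (-Complex.I * a ξ * cis (-t * a ξ)) * hatL2 (u t) ξ
        = -Complex.I * ∫ ξ, χ ξ * cis (-t * a ξ) * ((a ξ : ℂ) * hatL2 (u t) ξ) := by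
      rw [← integral_const_mul]; congr 1; ext ξ; ring
    rw [e1, integral_sub hS hI2, e2]; ring
  · have e1 : ∫ ξ, (χ ξ * cis (-s * a ξ) - χ ξ * cis (-t * a ξ)) * hatL2 (u s - u t) ξ
        = (∫ ξ, χ ξ * cis (-s * a ξ) * hatL2 (u s) ξ) - (∫ ξ, χ ξ * cis (-s * a ξ) * hatL2 (u t) ξ)
          - ((∫ ξ, χ ξ * cis (-t * a ξ) * hatL2 (u s) ξ)
            - (∫ ξ, χ ξ * cis (-t * a ξ) * hatL2 (u t) ξ)) := by
      have i1 := fun s' s'' => integrable_mul_hatL2 (hcc s') (hcs s') (u s'')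
      rw [← integral_sub (i1 _ _) (i1 _ _), ← integral_sub (i1 _ _) (i1 _ _),
        ← integral_sub (by exact (i1 _ _).sub (i1 _ _)) (by exact (i1 _ _).sub (i1 _ _))]
      refine integral_congr_ae ?_
      filter_upwards [hatL2_sub (u s) (u t)] with ξ hξ
      rw [hξ]; ring
    simp only [Pi.add_apply, Pi.sub_apply]
    rw [e1]; ring

theorem eq_of_hasDerivWithinAt_Ici {E₁ E₂ D : ℝ → ℂ}
    (h₁ : ∀ t, 0 ≤ t → HasDerivWithinAt E₁ (D t) (Ici 0) t)
    (h₂ : ∀ t, 0 ≤ t → HasDerivWithinAt E₂ (D t) (Ici 0) t) (h0 : E₁ 0 = E₂ 0) {t : ℝ}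
    (ht : 0 ≤ t) : E₁ t = E₂ t := by
  have h : ∀ s, 0 ≤ s → HasDerivWithinAt (fun s => E₁ s - E₂ s) 0 (Ici 0) s := fun s hs => by
    have := (h₁ s hs).sub (h₂ s hs)
    rw [sub_self] at this
    exact this
  have := constant_of_has_deriv_right_zero (f := fun s => E₁ s - E₂ s) (a := 0) (b := t)
    (fun s hs => ((h s hs.1).continuousWithinAt).mono (fun x hx => hx.1))
    (fun s hs => (h s hs.1).mono (fun x (hx : s ≤ x) => hs.1.trans hx)) t ⟨ht, le_rfl⟩
  simp only [h0, sub_self] at this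
  exact sub_eq_zero.1 this

theorem ae_eq_of_forall_test {f g : ℝ → ℂ} (hf : LocallyIntegrable f) (hg : LocallyIntegrable g)
    (h : ∀ χ : ℝ → ℂ, ContDiff ℝ ∞ χ → HasCompactSupport χ →
      ∫ x, χ x * f x = ∫ x, χ x * g x) : f =ᵐ[volume] g := by
  refine ae_eq_of_integral_contDiff_smul_eq hf hg fun χ hχ hχs => ?_
  simp_rw [Complex.real_smul]
  exact h _ (Complex.ofRealCLM.contDiff.comp hχ)
    (hχs.comp_left (g := fun y : ℝ => (y : ℂ)) (by simp))

theorem MeasureTheory.LocallyIntegrable.cis_mul {f : ℝ → ℂ} (hf : LocallyIntegrable f) {θ : ℝ → ℝ}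
    (hθ : Continuous θ) : LocallyIntegrable fun x => cis (θ x) * f x := by
  have hm : AEStronglyMeasurable (fun x => cis (θ x)) volume :=
    (continuous_cis.comp hθ).aestronglyMeasurable
  refine hf.mono (hm.mul hf.aestronglyMeasurable) (Filter.Eventually.of_forall fun x => ?_)
  simp [norm_cis]

theorem locallyIntegrable_hatL2 (f : L2Line) : LocallyIntegrable (hatL2 f) :=
  (memLp_hatL2 f).locallyIntegrable (by norm_num)

theorem SolvesDispersive.hatL2_free {b : ℝ → ℝ} {f : L2Line} {v : ℝ → L2Line}
    (h : SolvesDispersive b f (fun _ _ => 0) v) (hb : ContDiff ℝ ∞ b) {t : ℝ} (ht : 0 ≤ t) :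
    hatL2 (v t) =ᵐ[volume] fun ξ => cis (t * b ξ) * hatL2 f ξ := by
  have hbc := hb.continuous
  refine ae_eq_of_forall_test (locallyIntegrable_hatL2 _)
    ((locallyIntegrable_hatL2 f).cis_mul (by fun_prop)) fun χ hχ hχs => ?_
  -- The twist is frozen at the final time `t`, so that at `s = t` it cancels the factor `e^{-isb}`.
  set χ' : ℝ → ℂ := fun ξ => χ ξ * cis (t * b ξ) with hχ'
  have hd : ContDiff ℝ ∞ χ' := hχ.mul (contDiff_cis.comp (contDiff_const.mul hb))
  have hs : HasCompactSupport χ' := hχs.mul_right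
  have key := eq_of_hasDerivWithinAt_Ici
    (E₁ := fun s => ∫ ξ, χ' ξ * cis (-s * b ξ) * hatL2 (v s) ξ)
    (E₂ := fun _ => ∫ ξ, χ' ξ * hatL2 f ξ) (D := fun _ => 0)
    (fun s hs0 => by simpa using h.hasDerivWithinAt hb hd hs hs0 (by simp))
    (fun s _ => hasDerivWithinAt_const s _ _) (by simp [cis_zero, h.initial]) ht
  simp only [hχ'] at key
  calc _ = ∫ ξ, χ ξ * cis (t * b ξ) * cis (-t * b ξ) * hatL2 (v t) ξ := by
        congr 1; ext ξ
        rw [mul_assoc (χ ξ), ← cis_add, neg_mul, add_neg_cancel, cis_zero, mul_one]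
    _ = _ := key
    _ = _ := by congr 1; ext ξ; ring

theorem continuous_pt : Continuous fun p : ℝ × ℝ => (!₂[p.1, p.2] : FreqPlane) := by
  refine (PiLp.continuous_toLp 2 _).comp ?_
  refine continuous_pi fun i => ?_
  fin_cases i
  · exact continuous_fst
  · exact continuous_snd

theorem continuous_sheared_pt : Continuous fun p : ℝ × ℝ => (!₂[p.1 - p.2, p.2] : FreqPlane) :=
  continuous_pt.comp (f := fun p : ℝ × ℝ => (p.1 - p.2, p.2)) (by fun_prop)

theorem continuous_phase {a b c : ℝ → ℝ} (ha : Continuous a) (hb : Continuous b)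
    (hc : Continuous c) : Continuous (phase a b c) := by
  unfold phase; fun_prop

theorem phase_pt (a b c : ℝ → ℝ) (x y : ℝ) :
    phase a b c !₂[x, y] = -a (x + y) + b x + c y := by simp [phase]

theorem l2n_comp_sub_left (F : ℝ → ℝ≥0∞) (ξ : ℝ) : l2n (fun η => F (ξ - η)) = l2n F := by
  unfold l2n
  rw [lintegral_sub_left_eq_self (fun η => F η ^ (2 : ℝ)) ξ]

theorem lintegral_convolution_le {F G : ℝ → ℝ≥0∞} (hF : Measurable F) (hG : Measurable G) (ξ : ℝ) :
    ∫⁻ η, F (ξ - η) * G η ≤ l2n F * l2n G := by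
  rw [← l2n_comp_sub_left F ξ]
  exact lintegral_mul_le_l2n (hF.comp (by fun_prop)).aemeasurable hG.aemeasurable

theorem l2n_hatE_ne_top (f : L2Line) : l2n (hatE f) ≠ ⊤ := by
  rw [l2n_hatE]; exact ENNReal.ofReal_ne_top

theorem enorm_pseudoProductHat_le {σ : FreqPlane → ℂ} {M : ℝ≥0∞} (hσ : ∀ p, ‖σ p‖ₑ ≤ M)
    (f g : L2Line) (ξ : ℝ) :
    ‖pseudoProductHat σ (hatL2 f) (hatL2 g) ξ‖ₑ ≤ M * (l2n (hatE f) * l2n (hatE g)) := by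
  refine (enorm_integral_le_lintegral_enorm _).trans ?_
  calc ∫⁻ η, ‖σ !₂[ξ - η, η] * hatL2 f (ξ - η) * hatL2 g η‖ₑ
      ≤ ∫⁻ η, M * (hatE f (ξ - η) * hatE g η) := by
        refine lintegral_mono fun η => ?_
        rw [enorm_mul, enorm_mul, mul_assoc]
        exact mul_le_mul_left (hσ _) _
    _ = M * ∫⁻ η, hatE f (ξ - η) * hatE g η := by
        rw [lintegral_const_mul]
        exact ((measurable_hatE f).comp (by fun_prop)).mul (measurable_hatE g)
    _ ≤ _ := mul_le_mul_right (lintegral_convolution_le (measurable_hatE f) (measurable_hatE g) ξ) _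

theorem measurable_pseudoProduct_integrand {σ : FreqPlane → ℂ} (hσ : Measurable σ) (f g : L2Line) :
    Measurable fun p : ℝ × ℝ => σ !₂[p.1 - p.2, p.2] * hatL2 f (p.1 - p.2) * hatL2 g p.2 :=
  ((hσ.comp continuous_sheared_pt.measurable).mul
    ((measurable_hatL2 f).comp (by fun_prop))).mul ((measurable_hatL2 g).comp (by fun_prop))

theorem stronglyMeasurable_pseudoProductHat {σ : FreqPlane → ℂ} (hσ : Measurable σ)
    (f g : L2Line) : StronglyMeasurable (pseudoProductHat σ (hatL2 f) (hatL2 g)) :=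
  (measurable_pseudoProduct_integrand hσ f g).stronglyMeasurable.integral_prod_right

theorem locallyIntegrable_pseudoProductHat {σ : FreqPlane → ℂ} (hσ : Measurable σ) {M : ℝ≥0∞}
    (hM : M ≠ ⊤) (hb : ∀ p, ‖σ p‖ₑ ≤ M) (f g : L2Line) :
    LocallyIntegrable (pseudoProductHat σ (hatL2 f) (hatL2 g)) := by
  have : MemLp (pseudoProductHat σ (hatL2 f) (hatL2 g)) ⊤ := by
    refine ⟨(stronglyMeasurable_pseudoProductHat hσ f g).aestronglyMeasurable, ?_⟩
    rw [eLpNorm_exponent_top]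
    refine lt_of_le_of_lt (essSup_le_of_ae_le _ (Filter.Eventually.of_forall
      (enorm_pseudoProductHat_le hb f g))) ?_
    exact ENNReal.mul_lt_top hM.lt_top (ENNReal.mul_lt_top (l2n_hatE_ne_top f).lt_top
      (l2n_hatE_ne_top g).lt_top)
  exact this.locallyIntegrable le_top

theorem integrable_test_mul_pseudoProduct {σ : FreqPlane → ℂ} (hσ : Measurable σ) {M : ℝ≥0∞}
    (hM : M ≠ ⊤) (hb : ∀ p, ‖σ p‖ₑ ≤ M) {χ : ℝ → ℂ} (hχ : Continuous χ)
    (hχs : HasCompactSupport χ) (f g : L2Line) :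
    Integrable fun p : ℝ × ℝ =>
      χ p.1 * (σ !₂[p.1 - p.2, p.2] * hatL2 f (p.1 - p.2) * hatL2 g p.2) := by
  have hm : Measurable fun p : ℝ × ℝ =>
      χ p.1 * (σ !₂[p.1 - p.2, p.2] * hatL2 f (p.1 - p.2) * hatL2 g p.2) :=
    (hχ.measurable.comp measurable_fst).mul (measurable_pseudoProduct_integrand hσ f g)
  refine ⟨hm.aestronglyMeasurable, ?_⟩
  rw [HasFiniteIntegral, Measure.volume_eq_prod, lintegral_prod _ hm.enorm.aemeasurable]
  have hχi := (hχ.integrable_of_hasCompactSupport (μ := volume) hχs).2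
  rw [HasFiniteIntegral] at hχi
  calc ∫⁻ ξ, ∫⁻ η, ‖χ ξ * (σ !₂[ξ - η, η] * hatL2 f (ξ - η) * hatL2 g η)‖ₑ
      ≤ ∫⁻ ξ, ‖χ ξ‖ₑ * (M * (l2n (hatE f) * l2n (hatE g))) := by
        refine lintegral_mono fun ξ => ?_
        calc _ ≤ ∫⁻ η, (‖χ ξ‖ₑ * M) * (hatE f (ξ - η) * hatE g η) := by
              refine lintegral_mono fun η => ?_
              simp only [enorm_mul]
              rw [mul_assoc ‖σ _‖ₑ, ← mul_assoc]
              exact mul_le_mul_left (mul_le_mul_right (hb _) _) _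
          _ = (‖χ ξ‖ₑ * M) * ∫⁻ η, hatE f (ξ - η) * hatE g η := by
              rw [lintegral_const_mul]
              exact ((measurable_hatE f).comp (by fun_prop)).mul (measurable_hatE g)
          _ ≤ _ := by
              rw [← mul_assoc]
              exact mul_le_mul_right
                (lintegral_convolution_le (measurable_hatE f) (measurable_hatE g) ξ) _
    _ = (∫⁻ ξ, ‖χ ξ‖ₑ) * (M * (l2n (hatE f) * l2n (hatE g))) := by
        rw [lintegral_mul_const _ hχ.measurable.enorm]
    _ < ⊤ := ENNReal.mul_lt_top hχi (ENNReal.mul_lt_top hM.lt_top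
        (ENNReal.mul_lt_top (l2n_hatE_ne_top f).lt_top (l2n_hatE_ne_top g).lt_top))

theorem integral_test_mul_pseudoProductHat {σ : FreqPlane → ℂ} (hσ : Measurable σ) {M : ℝ≥0∞}
    (hM : M ≠ ⊤) (hb : ∀ p, ‖σ p‖ₑ ≤ M) {χ : ℝ → ℂ} (hχ : Continuous χ)
    (hχs : HasCompactSupport χ) (f g : L2Line) :
    ∫ ξ, χ ξ * pseudoProductHat σ (hatL2 f) (hatL2 g) ξ =
      ∫ p : ℝ × ℝ, χ p.1 * (σ !₂[p.1 - p.2, p.2] * hatL2 f (p.1 - p.2) * hatL2 g p.2) := by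
  have := integral_prod _ (by
    simpa only [Measure.volume_eq_prod] using
      integrable_test_mul_pseudoProduct hσ hM hb hχ hχs f g)
  rw [Measure.volume_eq_prod, this]
  simp only [pseudoProductHat, integral_const_mul]

/-- The symbol of `u(t)` as a bilinear expression in the data. -/
noncomputable def duhamelSymbol (a b c : ℝ → ℝ) (m : FreqPlane → ℂ) (t : ℝ) : FreqPlane → ℂ :=
  fun p => m p * osc t (phase a b c p)

/-- Once `v` and `w` are replaced by free waves and `û` is multiplied by `e^{-isa}`, the source
becomes the pseudo-product with symbol `m e^{isφ}`, whose primitive in `s` is `m · osc s φ`. Tested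
against any `χ`, the two sides have the same time derivative and vanish at time `0`. -/
theorem SolvesSystem.hatL2_eq {a b c : ℝ → ℝ} (ha : ContDiff ℝ ∞ a) (hb : ContDiff ℝ ∞ b)
    (hc : ContDiff ℝ ∞ c) {m : FreqPlane → ℂ} (hm : Continuous m) (hm1 : ∀ p, ‖m p‖ ≤ 1)
    {f g : L2Line} {u v w : ℝ → L2Line} (h : SolvesSystem a b c m f g u v w) {t : ℝ}
    (ht : 0 ≤ t) :
    hatL2 (u t) =ᵐ[volume] fun ξ => cis (t * a ξ) *
      (-Complex.I * pseudoProductHat (duhamelSymbol a b c m t) (hatL2 f) (hatL2 g) ξ) := by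
  have hφ : Continuous (phase a b c) := continuous_phase ha.continuous hb.continuous hc.continuous
  have hac := ha.continuous
  have hσm : ∀ s, Measurable (duhamelSymbol a b c m s) := fun s =>
    (hm.mul ((continuous_osc s).comp hφ)).measurable
  have hm1' : ∀ p, ‖m p‖ₑ ≤ 1 := fun p => by
    rw [← ofReal_norm, ← ENNReal.ofReal_one]; exact ENNReal.ofReal_le_ofReal (hm1 p)
  have hσb : ∀ s p, ‖duhamelSymbol a b c m s p‖ₑ ≤ ENNReal.ofReal |s| := fun s p => by
    rw [duhamelSymbol, enorm_mul, ← one_mul (ENNReal.ofReal _)]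
    refine mul_le_mul' (hm1' p) ?_
    rw [← ofReal_norm]; exact ENNReal.ofReal_le_ofReal (norm_osc_le _ _)
  set τ : ℝ → FreqPlane → ℂ := fun s p => m p * cis (s * phase a b c p) with hτ
  have hτm : ∀ s, Measurable (τ s) := fun s =>
    (hm.mul (continuous_cis.comp (by fun_prop))).measurable
  have hτb : ∀ s p, ‖τ s p‖ₑ ≤ 1 := fun s p => by
    rw [hτ]; simp only [enorm_mul, enorm_cis, mul_one]; exact hm1' p
  -- the source term
  have hsrc : ∀ s, 0 ≤ s → ∀ ξ, cis (-s * a ξ) *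
      pseudoProductHat m (hatL2 (v s)) (hatL2 (w s)) ξ
      = pseudoProductHat (τ s) (hatL2 f) (hatL2 g) ξ := by
    intro s hs ξ
    have hv := h.eq_v.hatL2_free hb hs
    have hw := h.eq_w.hatL2_free hc hs
    have hv' := (quasiMeasurePreserving_sub_left (volume : Measure ℝ) ξ).ae hv
    rw [pseudoProductHat, pseudoProductHat, ← integral_const_mul]
    refine integral_congr_ae ?_
    filter_upwards [hv', hw] with η h1 h2
    simp only [hτ]
    rw [h1, h2, phase_pt, sub_add_cancel]
    rw [show s * (-a ξ + b (ξ - η) + c η) = -s * a ξ + s * b (ξ - η) + s * c η by ring, cis_add,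
      cis_add]
    ring
  have key : (fun ξ => cis (-t * a ξ) * hatL2 (u t) ξ) =ᵐ[volume]
      fun ξ => -Complex.I * pseudoProductHat (duhamelSymbol a b c m t) (hatL2 f) (hatL2 g) ξ := by
    refine ae_eq_of_forall_test ((locallyIntegrable_hatL2 _).cis_mul (by fun_prop))
      ((locallyIntegrable_pseudoProductHat (hσm t) ENNReal.ofReal_ne_top (hσb t) f g).smul
        (-Complex.I)) fun χ hχ hχs => ?_
    have hχc := hχ.continuous
    have e := eq_of_hasDerivWithinAt_Ici
      (E₁ := fun s => ∫ ξ, χ ξ * cis (-s * a ξ) * hatL2 (u s) ξ)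
      (E₂ := fun s => -Complex.I * ∫ ξ, χ ξ * pseudoProductHat (duhamelSymbol a b c m s)
        (hatL2 f) (hatL2 g) ξ)
      (D := fun s => -Complex.I * ∫ ξ, χ ξ * pseudoProductHat (τ s) (hatL2 f) (hatL2 g) ξ)
      ?_ ?_ ?_ ht
    · calc _ = ∫ ξ, χ ξ * cis (-t * a ξ) * hatL2 (u t) ξ := by congr 1; ext ξ; ring
        _ = _ := e
        _ = _ := by rw [← integral_const_mul]; congr 1; ext ξ; ring
    · intro s hs
      have heq : ∀ ξ, χ ξ * cis (-s * a ξ) * pseudoProductHat m (hatL2 (v s)) (hatL2 (w s)) ξ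
          = χ ξ * pseudoProductHat (τ s) (hatL2 f) (hatL2 g) ξ := fun ξ => by
        rw [mul_assoc, hsrc s hs]
      have := h.eq_u.hasDerivWithinAt ha hχ hχs hs (by
        simp_rw [heq]
        have := integrable_test_mul_pseudoProduct (hτm s) ENNReal.one_ne_top (hτb s) hχc hχs f g
        rw [Measure.volume_eq_prod] at this
        have := this.integral_prod_left
        simp only [integral_const_mul] at this
        exact this)
      simp_rw [heq] at this
      exact this
    · intro s hs
      simp_rw [integral_test_mul_pseudoProductHat (hσm _) ENNReal.ofReal_ne_top (hσb _) hχc hχs,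
        integral_test_mul_pseudoProductHat (hτm _) ENNReal.one_ne_top (hτb _) hχc hχs]
      refine (HasDerivAt.const_mul _ ?_).hasDerivWithinAt
      -- The time derivative of `osc s x` is `cis (s * x)`, of modulus one, so the integrand with
      -- `m` alone dominates.
      have hmb := integrable_test_mul_pseudoProduct hm.measurable ENNReal.one_ne_top hm1' hχc hχs f g
      refine (hasDerivAt_integral_of_dominated_loc_of_deriv_le (𝕜 := ℝ) (μ := volume)
        (F := fun s (p : ℝ × ℝ) => χ p.1 * (duhamelSymbol a b c m s !₂[p.1 - p.2, p.2] *
          hatL2 f (p.1 - p.2) * hatL2 g p.2))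
        (F' := fun s (p : ℝ × ℝ) => χ p.1 * (τ s !₂[p.1 - p.2, p.2] *
          hatL2 f (p.1 - p.2) * hatL2 g p.2))
        (bound := fun p => ‖χ p.1 * (m !₂[p.1 - p.2, p.2] *
          hatL2 f (p.1 - p.2) * hatL2 g p.2)‖) (s := univ) Filter.univ_mem
        ?_ ?_ ?_ ?_ ?_ ?_).2
      · exact Filter.Eventually.of_forall fun s => (integrable_test_mul_pseudoProduct (hσm s)
          ENNReal.ofReal_ne_top (hσb s) hχc hχs f g).1
      · exact integrable_test_mul_pseudoProduct (hσm s) ENNReal.ofReal_ne_top (hσb s) hχc hχs f g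
      · exact (integrable_test_mul_pseudoProduct (hτm s) ENNReal.one_ne_top (hτb s) hχc hχs f g).1
      · refine Filter.Eventually.of_forall fun p s _ => le_of_eq ?_
        simp [hτ, norm_cis]
      · exact hmb.norm
      · refine Filter.Eventually.of_forall fun p s _ => ?_
        exact ((((hasDerivAt_osc s _).const_mul _).mul_const _).mul_const _).const_mul _
    · have hz : duhamelSymbol a b c m 0 = 0 := by ext p; simp [duhamelSymbol, osc_zero]
      have h0 := hatL2_zero
      have e1 : ∫ ξ, χ ξ * cis (-0 * a ξ) * hatL2 (u 0) ξ = 0 := by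
        rw [h.eq_u.initial]
        rw [integral_eq_zero_of_ae]
        filter_upwards [h0] with ξ hξ
        rw [hξ]; simp
      rw [e1, hz]
      simp [pseudoProductHat]
  filter_upwards [key] with ξ hξ
  rw [← hξ, ← mul_assoc, ← cis_add]
  rw [show t * a ξ + -t * a ξ = 0 by ring, cis_zero, one_mul]

/-! ### Bilinear forms supported on planar sets, controlled by slices. -/

theorem l2n_rpow_two (F : ℝ → ℝ≥0∞) : l2n F ^ (2 : ℝ) = ∫⁻ x, F x ^ (2 : ℝ) := by
  rw [l2n, ← ENNReal.rpow_mul]; norm_num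

theorem l2n_mono {F G : ℝ → ℝ≥0∞} (h : ∀ x, F x ≤ G x) : l2n F ≤ l2n G := by
  unfold l2n; gcongr with x; exact h x

/-- `A` bounds the bilinear form with kernel `1_E(ζ, η) H(ζ + η)` on `L² × L²`. -/
def FormBound (H : ℝ → ℝ≥0∞) (E : Set (ℝ × ℝ)) (A : ℝ≥0∞) : Prop :=
  ∀ F G : ℝ → ℝ≥0∞, Measurable F → Measurable G →
    ∫⁻ p in E, F p.1 * G p.2 * H (p.1 + p.2) ≤ A * (l2n F * l2n G)

theorem FormBound.mono {H : ℝ → ℝ≥0∞} {E E' : Set (ℝ × ℝ)} {A A' : ℝ≥0∞} (h : FormBound H E A)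
    (hE : E' ⊆ E) (hA : A ≤ A') : FormBound H E' A' := fun F G hF hG =>
  (lintegral_mono_set hE).trans ((h F G hF hG).trans (by gcongr))

theorem FormBound.empty (H : ℝ → ℝ≥0∞) : FormBound H ∅ 0 := fun F G _ _ => by simp

theorem FormBound.union {H : ℝ → ℝ≥0∞} {E E' : Set (ℝ × ℝ)} {A A' : ℝ≥0∞} (h : FormBound H E A)
    (h' : FormBound H E' A') : FormBound H (E ∪ E') (A + A') := fun F G hF hG => by
  rw [add_mul]
  exact (lintegral_union_le _ _ _).trans (add_le_add (h F G hF hG) (h' F G hF hG))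

theorem FormBound.biUnion {H : ℝ → ℝ≥0∞} {ι : Type*} (s : Finset ι) {E : ι → Set (ℝ × ℝ)}
    {A : ι → ℝ≥0∞} (h : ∀ i ∈ s, FormBound H (E i) (A i)) :
    FormBound H (⋃ i ∈ s, E i) (∑ i ∈ s, A i) := by
  classical
  induction s using Finset.induction with
  | empty => simpa using FormBound.empty H
  | insert i s hi ih =>
    rw [Finset.sum_insert hi, Finset.set_biUnion_insert]
    exact (h i (by simp)).union (ih fun j hj => h j (by simp [hj]))

theorem setLIntegral_mul_le {E : Set (ℝ × ℝ)} {X Y : ℝ × ℝ → ℝ≥0∞} (hX : Measurable X)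
    (hY : Measurable Y) : ∫⁻ p in E, X p * Y p ≤
      (∫⁻ p in E, X p ^ (2 : ℝ)) ^ (1 / 2 : ℝ) * (∫⁻ p in E, Y p ^ (2 : ℝ)) ^ (1 / 2 : ℝ) :=
  ENNReal.lintegral_mul_le_Lp_mul_Lq _ (p := 2) (q := 2)
    (Real.HolderConjugate.two_two) hX.aemeasurable hY.aemeasurable

theorem setLIntegral_fst_le {E : Set (ℝ × ℝ)} (hE : MeasurableSet E) {S : ℝ≥0∞}
    (hS : ∀ x, volume {y | (x, y) ∈ E} ≤ S) {F : ℝ → ℝ≥0∞} (hF : Measurable F) :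
    ∫⁻ p in E, F p.1 ^ (2 : ℝ) ≤ S * l2n F ^ (2 : ℝ) := by
  rw [l2n_rpow_two, ← lintegral_indicator hE, Measure.volume_eq_prod, lintegral_prod _
    (by exact (((hF.comp measurable_fst).pow_const _).indicator hE).aemeasurable),
    ← lintegral_const_mul _ (hF.pow_const _)]
  refine lintegral_mono fun x => ?_
  have : ∀ y, E.indicator (fun p : ℝ × ℝ => F p.1 ^ (2 : ℝ)) (x, y)
      = {y | (x, y) ∈ E}.indicator (fun _ => F x ^ (2 : ℝ)) y := fun y => rfl
  simp_rw [this]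
  rw [lintegral_indicator_const (by exact hE.preimage measurable_prodMk_left), mul_comm]
  gcongr
  exact hS x

theorem setLIntegral_snd_le {E : Set (ℝ × ℝ)} (hE : MeasurableSet E) {S : ℝ≥0∞}
    (hS : ∀ y, volume {x | (x, y) ∈ E} ≤ S) {G : ℝ → ℝ≥0∞} (hG : Measurable G) :
    ∫⁻ p in E, G p.2 ^ (2 : ℝ) ≤ S * l2n G ^ (2 : ℝ) := by
  rw [l2n_rpow_two, ← lintegral_indicator hE, Measure.volume_eq_prod, lintegral_prod_symm _
    (by exact (((hG.comp measurable_snd).pow_const _).indicator hE).aemeasurable),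
    ← lintegral_const_mul _ (hG.pow_const _)]
  refine lintegral_mono fun y => ?_
  have : ∀ x, E.indicator (fun p : ℝ × ℝ => G p.2 ^ (2 : ℝ)) (x, y)
      = {x | (x, y) ∈ E}.indicator (fun _ => G y ^ (2 : ℝ)) x := fun x => rfl
  simp_rw [this]
  rw [lintegral_indicator_const (by exact hE.preimage measurable_prodMk_right), mul_comm]
  gcongr
  exact hS y

/-- The shear `(ξ, η) ↦ (ξ - η, η)` preserves the Lebesgue measure. -/
theorem lintegral_shear {k : ℝ × ℝ → ℝ≥0∞} (hk : Measurable k) :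
    ∫⁻ ξ, ∫⁻ η, k (ξ - η, η) = ∫⁻ p, k p := by
  rw [Measure.volume_eq_prod, lintegral_prod_symm _ hk.aemeasurable,
    lintegral_lintegral_swap]
  · refine lintegral_congr fun η => ?_
    exact lintegral_sub_right_eq_self (fun ζ => k (ζ, η)) η
  · exact (hk.comp (by fun_prop : Measurable fun p : ℝ × ℝ => (p.1 - p.2, p.2))).aemeasurable

theorem setLIntegral_sum_le {E : Set (ℝ × ℝ)} (hE : MeasurableSet E) {S : ℝ≥0∞}
    (hS : ∀ ξ, volume {y | (ξ - y, y) ∈ E} ≤ S) {H : ℝ → ℝ≥0∞} (hH : Measurable H) :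
    ∫⁻ p in E, H (p.1 + p.2) ^ (2 : ℝ) ≤ S * l2n H ^ (2 : ℝ) := by
  have hm : Measurable fun p : ℝ × ℝ => H (p.1 + p.2) ^ (2 : ℝ) :=
    (hH.comp (by fun_prop)).pow_const _
  rw [l2n_rpow_two, ← lintegral_indicator hE, ← lintegral_shear (hm.indicator hE),
    ← lintegral_const_mul _ (hH.pow_const _)]
  refine lintegral_mono fun ξ => ?_
  have : ∀ y, E.indicator (fun p : ℝ × ℝ => H (p.1 + p.2) ^ (2 : ℝ)) (ξ - y, y)
      = {y | (ξ - y, y) ∈ E}.indicator (fun _ => H ξ ^ (2 : ℝ)) y := fun y => by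
    simp [indicator]
  simp_rw [this]
  rw [lintegral_indicator_const (by exact hE.preimage (by fun_prop : Measurable fun y : ℝ => (ξ - y, y))),
    mul_comm]
  gcongr
  exact hS ξ

theorem rpow_half_mul_sq (S x : ℝ≥0∞) :
    (S * x ^ (2 : ℝ)) ^ (1 / 2 : ℝ) = S ^ (1 / 2 : ℝ) * x := by
  rw [ENNReal.mul_rpow_of_nonneg _ _ (by norm_num), ← ENNReal.rpow_mul]; norm_num

theorem lintegral_fst_mul_snd {F G : ℝ → ℝ≥0∞} (hF : Measurable F) (hG : Measurable G) :
    ∫⁻ p : ℝ × ℝ, (F p.1 * G p.2) ^ (2 : ℝ) = (l2n F * l2n G) ^ (2 : ℝ) := by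
  simp_rw [ENNReal.mul_rpow_of_nonneg _ _ (zero_le_two : (0 : ℝ) ≤ 2)]
  rw [Measure.volume_eq_prod, lintegral_prod_mul (hF.pow_const _).aemeasurable
    (hG.pow_const _).aemeasurable, l2n_rpow_two, l2n_rpow_two]

theorem lintegral_snd_mul_sum {G H : ℝ → ℝ≥0∞} (hG : Measurable G) (hH : Measurable H) :
    ∫⁻ p : ℝ × ℝ, (G p.2 * H (p.1 + p.2)) ^ (2 : ℝ) = (l2n G * l2n H) ^ (2 : ℝ) := by
  simp_rw [ENNReal.mul_rpow_of_nonneg _ _ (zero_le_two : (0 : ℝ) ≤ 2)]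
  rw [Measure.volume_eq_prod, lintegral_prod_symm _ (by
    exact (((hG.comp measurable_snd).pow_const _).mul
      ((hH.comp (by fun_prop)).pow_const _)).aemeasurable), l2n_rpow_two, l2n_rpow_two,
    ← lintegral_mul_const _ (hG.pow_const _)]
  refine lintegral_congr fun y => ?_
  dsimp only
  rw [lintegral_const_mul _ (by exact (hH.comp (by fun_prop)).pow_const _),
    lintegral_add_right_eq_self (fun x => H x ^ (2 : ℝ)) y]

theorem lintegral_fst_mul_sum {F H : ℝ → ℝ≥0∞} (hF : Measurable F) (hH : Measurable H) :
    ∫⁻ p : ℝ × ℝ, (F p.1 * H (p.1 + p.2)) ^ (2 : ℝ) = (l2n F * l2n H) ^ (2 : ℝ) := by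
  simp_rw [ENNReal.mul_rpow_of_nonneg _ _ (zero_le_two : (0 : ℝ) ≤ 2)]
  rw [Measure.volume_eq_prod, lintegral_prod _ (by
    exact (((hF.comp measurable_fst).pow_const _).mul
      ((hH.comp (by fun_prop)).pow_const _)).aemeasurable), l2n_rpow_two, l2n_rpow_two,
    ← lintegral_mul_const _ (hF.pow_const _)]
  refine lintegral_congr fun y => ?_
  dsimp only
  rw [lintegral_const_mul _ (by exact (hH.comp (by fun_prop)).pow_const _),
    lintegral_add_left_eq_self (fun x => H x ^ (2 : ℝ)) y]

theorem sq_rpow_half (x : ℝ≥0∞) : (x ^ (2 : ℝ)) ^ (1 / 2 : ℝ) = x := by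
  rw [← ENNReal.rpow_mul]; norm_num

/-- Schur's test. -/
theorem formBound_one_of_slices {E : Set (ℝ × ℝ)} (hE : MeasurableSet E) {S₁ S₂ : ℝ≥0∞}
    (h₁ : ∀ x, volume {y | (x, y) ∈ E} ≤ S₁) (h₂ : ∀ y, volume {x | (x, y) ∈ E} ≤ S₂) :
    FormBound (fun _ => 1) E (S₁ ^ (1 / 2 : ℝ) * S₂ ^ (1 / 2 : ℝ)) := fun F G hF hG => by
  simp only [mul_one]
  refine (setLIntegral_mul_le (hF.comp measurable_fst) (hG.comp measurable_snd)).trans ?_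
  calc _ ≤ (S₁ * l2n F ^ (2 : ℝ)) ^ (1 / 2 : ℝ) * (S₂ * l2n G ^ (2 : ℝ)) ^ (1 / 2 : ℝ) := by
        gcongr
        · exact setLIntegral_fst_le hE h₁ hF
        · exact setLIntegral_snd_le hE h₂ hG
    _ = _ := by rw [rpow_half_mul_sq, rpow_half_mul_sq]; ring

/-- Cauchy–Schwarz with `F` against `G H`: the square of the first factor integrates to slice
lengths, while that of the second, taken over the whole plane, splits by translation invariance. As
`H` ranges over `L²`, this is by duality a bound into `L²`, and one family of slices suffices. -/
theorem formBound_of_slices_fst {E : Set (ℝ × ℝ)} (hE : MeasurableSet E) {S : ℝ≥0∞}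
    (hS : ∀ x, volume {y | (x, y) ∈ E} ≤ S) {H : ℝ → ℝ≥0∞} (hH : Measurable H) :
    FormBound H E (S ^ (1 / 2 : ℝ) * l2n H) := fun F G hF hG => by
  calc ∫⁻ p in E, F p.1 * G p.2 * H (p.1 + p.2)
      = ∫⁻ p in E, F p.1 * (G p.2 * H (p.1 + p.2)) := by simp_rw [mul_assoc]
    _ ≤ _ := setLIntegral_mul_le (hF.comp measurable_fst)
        ((hG.comp measurable_snd).mul (hH.comp (by fun_prop)))
    _ ≤ (S * l2n F ^ (2 : ℝ)) ^ (1 / 2 : ℝ) * ((l2n G * l2n H) ^ (2 : ℝ)) ^ (1 / 2 : ℝ) := by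
        gcongr
        · exact setLIntegral_fst_le hE hS hF
        · rw [← lintegral_snd_mul_sum hG hH]; exact setLIntegral_le_lintegral _ _
    _ = _ := by rw [rpow_half_mul_sq, sq_rpow_half]; ring

theorem formBound_of_slices_snd {E : Set (ℝ × ℝ)} (hE : MeasurableSet E) {S : ℝ≥0∞}
    (hS : ∀ y, volume {x | (x, y) ∈ E} ≤ S) {H : ℝ → ℝ≥0∞} (hH : Measurable H) :
    FormBound H E (S ^ (1 / 2 : ℝ) * l2n H) := fun F G hF hG => by
  calc ∫⁻ p in E, F p.1 * G p.2 * H (p.1 + p.2)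
      = ∫⁻ p in E, G p.2 * (F p.1 * H (p.1 + p.2)) := by
        refine lintegral_congr fun p => ?_; ring
    _ ≤ _ := setLIntegral_mul_le (hG.comp measurable_snd)
        ((hF.comp measurable_fst).mul (hH.comp (by fun_prop)))
    _ ≤ (S * l2n G ^ (2 : ℝ)) ^ (1 / 2 : ℝ) * ((l2n F * l2n H) ^ (2 : ℝ)) ^ (1 / 2 : ℝ) := by
        gcongr
        · exact setLIntegral_snd_le hE hS hG
        · rw [← lintegral_fst_mul_sum hF hH]; exact setLIntegral_le_lintegral _ _
    _ = _ := by rw [rpow_half_mul_sq, sq_rpow_half]; ring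

/-- The same with `H` isolated; the relevant slices are then the lines on which the output frequency
is constant. -/
theorem formBound_of_slices_sum {E : Set (ℝ × ℝ)} (hE : MeasurableSet E) {S : ℝ≥0∞}
    (hS : ∀ ξ, volume {y | (ξ - y, y) ∈ E} ≤ S) {H : ℝ → ℝ≥0∞} (hH : Measurable H) :
    FormBound H E (S ^ (1 / 2 : ℝ) * l2n H) := fun F G hF hG => by
  calc ∫⁻ p in E, F p.1 * G p.2 * H (p.1 + p.2)
      = ∫⁻ p in E, H (p.1 + p.2) * (F p.1 * G p.2) := by
        refine lintegral_congr fun p => ?_; ring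
    _ ≤ _ := setLIntegral_mul_le (hH.comp (by fun_prop))
        ((hF.comp measurable_fst).mul (hG.comp measurable_snd))
    _ ≤ (S * l2n H ^ (2 : ℝ)) ^ (1 / 2 : ℝ) * ((l2n F * l2n G) ^ (2 : ℝ)) ^ (1 / 2 : ℝ) := by
        gcongr
        · exact setLIntegral_sum_le hE hS hH
        · rw [← lintegral_fst_mul_snd hF hG]; exact setLIntegral_le_lintegral _ _
    _ = _ := by rw [rpow_half_mul_sq, sq_rpow_half]

/-- The bilinear operator with symbol supported in `E`, tested against `H`. -/
theorem lintegral_pseudoProductHat_mul_le {σ : FreqPlane → ℂ} (hσ : Measurable σ) {M : ℝ≥0∞}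
    (hM : ∀ p, ‖σ p‖ₑ ≤ M) {E : Set (ℝ × ℝ)} (hE : MeasurableSet E)
    (hσE : ∀ x y, (x, y) ∉ E → σ !₂[x, y] = 0) (f g : L2Line) {H : ℝ → ℝ≥0∞} (hH : Measurable H)
    {A : ℝ≥0∞} (hA : FormBound H E A) :
    ∫⁻ ξ, ‖pseudoProductHat σ (hatL2 f) (hatL2 g) ξ‖ₑ * H ξ
      ≤ M * A * (l2n (hatE f) * l2n (hatE g)) := by
  have hf := measurable_hatE f
  have hg := measurable_hatE g
  set k : ℝ × ℝ → ℝ≥0∞ := E.indicator fun p => hatE f p.1 * hatE g p.2 * H (p.1 + p.2) with hk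
  have hkm : Measurable k := (((hf.comp measurable_fst).mul (hg.comp measurable_snd)).mul
    (hH.comp (by fun_prop))).indicator hE
  calc _ ≤ ∫⁻ ξ, M * ∫⁻ η, k (ξ - η, η) := by
        refine lintegral_mono fun ξ => ?_
        rw [← lintegral_const_mul _ (by exact hkm.comp (by fun_prop))]
        calc _ ≤ (∫⁻ η, ‖σ !₂[ξ - η, η] * hatL2 f (ξ - η) * hatL2 g η‖ₑ) * H ξ :=
              mul_le_mul_left (enorm_integral_le_lintegral_enorm _) _
          _ = ∫⁻ η, ‖σ !₂[ξ - η, η] * hatL2 f (ξ - η) * hatL2 g η‖ₑ * H ξ := by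
              rw [lintegral_mul_const]
              exact ((measurable_pseudoProduct_integrand hσ f g).comp
                (by fun_prop : Measurable fun η : ℝ => (ξ, η))).enorm
          _ ≤ _ := by
              refine lintegral_mono fun η => ?_
              by_cases h : (ξ - η, η) ∈ E
              · simp only [hk, indicator_of_mem h, enorm_mul, sub_add_cancel]
                rw [mul_assoc, mul_assoc, mul_assoc]
                exact mul_le_mul_left (hM _) _
              · simp [hσE _ _ h]
    _ = M * ∫⁻ ξ, ∫⁻ η, k (ξ - η, η) := by
        rw [lintegral_const_mul]
        exact (hkm.comp (by fun_prop : Measurable fun p : ℝ × ℝ => (p.1 - p.2, p.2))).lintegral_prod_right'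
    _ = M * ∫⁻ p in E, hatE f p.1 * hatE g p.2 * H (p.1 + p.2) := by
        rw [lintegral_shear hkm, hk, lintegral_indicator hE]
    _ ≤ _ := by
        rw [mul_assoc]; gcongr; exact hA _ _ hf hg

/-- Duality: test with `X` itself. Truncation to `[-n, n]`, with `X` bounded, makes the norm of the
test function finite, so that one factor of it can be cancelled; monotone convergence removes the
truncation. -/
theorem l2n_le_of_forall_mul {X : ℝ → ℝ≥0∞} (hX : Measurable X) {C : ℝ≥0∞} (hC : C ≠ ⊤)
    (hXC : ∀ x, X x ≤ C) {A : ℝ≥0∞}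
    (h : ∀ H : ℝ → ℝ≥0∞, Measurable H → ∫⁻ x, X x * H x ≤ A * l2n H) : l2n X ≤ A := by
  have key : ∀ n : ℕ, ∫⁻ x in Icc (-(n : ℝ)) n, X x ^ (2 : ℝ) ≤ A ^ (2 : ℝ) := by
    intro n
    set H : ℝ → ℝ≥0∞ := (Icc (-(n : ℝ)) n).indicator X with hH
    have hHm : Measurable H := hX.indicator measurableSet_Icc
    have e1 : ∫⁻ x, X x * H x = l2n H ^ (2 : ℝ) := by
      rw [l2n_rpow_two]
      refine lintegral_congr fun x => ?_
      by_cases hx : x ∈ Icc (-(n : ℝ)) n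
      · simp [hH, indicator_of_mem hx, sq]
      · simp [hH, indicator_of_notMem hx]
    have e2 : ∫⁻ x in Icc (-(n : ℝ)) n, X x ^ (2 : ℝ) = l2n H ^ (2 : ℝ) := by
      rw [l2n_rpow_two, ← lintegral_indicator measurableSet_Icc]
      refine lintegral_congr fun x => ?_
      by_cases hx : x ∈ Icc (-(n : ℝ)) n
      · simp [hH, indicator_of_mem hx]
      · simp [hH, indicator_of_notMem hx]
    have hfin : l2n H ^ (2 : ℝ) ≠ ⊤ := by
      rw [← e2]
      refine ne_top_of_le_ne_top ?_ (lintegral_mono fun x =>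
        ENNReal.rpow_le_rpow (hXC x) (zero_le_two : (0 : ℝ) ≤ 2))
      rw [setLIntegral_const]
      exact ENNReal.mul_ne_top (ENNReal.rpow_ne_top_of_nonneg zero_le_two hC) (by simp)
    have hfin' : l2n H ≠ ⊤ := fun h => hfin (by rw [h]; simp)
    rw [e2]
    refine ENNReal.rpow_le_rpow ?_ zero_le_two
    rcases eq_or_ne (l2n H) 0 with h0 | h0
    · rw [h0]; exact zero_le
    have := h H hHm
    rw [e1, show (2 : ℝ) = ((2 : ℕ) : ℝ) by norm_num, ENNReal.rpow_natCast, sq] at this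
    exact (ENNReal.mul_le_mul_iff_left h0 hfin').1 this
  have hU : (⋃ n : ℕ, Icc (-(n : ℝ)) n) = univ := by
    refine eq_univ_of_forall fun x => mem_iUnion.2 ?_
    obtain ⟨n, hn⟩ := exists_nat_ge |x|
    exact ⟨n, abs_le.1 hn⟩
  have hm : Monotone fun n : ℕ => Icc (-(n : ℝ)) n := fun n k hnk =>
    Icc_subset_Icc (by simpa using hnk) (by simpa using hnk)
  have hlim : ∫⁻ x, X x ^ (2 : ℝ) ≤ A ^ (2 : ℝ) := by
    rw [← setLIntegral_univ, ← hU, setLIntegral_iUnion_of_directed _ hm.directed_le]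
    exact iSup_le key
  unfold l2n
  calc _ ≤ (A ^ (2 : ℝ)) ^ (1 / 2 : ℝ) := by gcongr
    _ = A := sq_rpow_half A

theorem l2n_pseudoProductHat_le {σ : FreqPlane → ℂ} (hσ : Measurable σ) {M : ℝ≥0∞} (hMt : M ≠ ⊤)
    (hM : ∀ p, ‖σ p‖ₑ ≤ M) {E : Set (ℝ × ℝ)} (hE : MeasurableSet E)
    (hσE : ∀ x y, (x, y) ∉ E → σ !₂[x, y] = 0) (f g : L2Line)
    {A : ℝ≥0∞} (hA : ∀ H, Measurable H → FormBound H E (A * l2n H)) :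
    l2n (fun ξ => ‖pseudoProductHat σ (hatL2 f) (hatL2 g) ξ‖ₑ)
      ≤ M * A * (l2n (hatE f) * l2n (hatE g)) := by
  refine l2n_le_of_forall_mul (stronglyMeasurable_pseudoProductHat hσ f g).measurable.enorm
    (C := M * (l2n (hatE f) * l2n (hatE g)))
    (ENNReal.mul_ne_top hMt (ENNReal.mul_ne_top (l2n_hatE_ne_top f) (l2n_hatE_ne_top g)))
    (enorm_pseudoProductHat_le hM f g) fun H hH => ?_
  refine (lintegral_pseudoProductHat_mul_le hσ hM hE hσE f g hH (hA H hH)).trans (le_of_eq ?_)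
  ring

/-! ### Size of symbols, and the factor `R`. -/

theorem IsSymbol.norm_le_one {N : ℕ} {R : ℝ} {U : Set FreqPlane} {m : FreqPlane → ℂ}
    (h : IsSymbol N R U m) (p : FreqPlane) : ‖m p‖ ≤ 1 := by
  simpa using h.bounded 0 (Nat.zero_le _) p

theorem IsSymbol.norm_fderiv_le_one {N : ℕ} (hN : 1 ≤ N) {R : ℝ} {U : Set FreqPlane}
    {m : FreqPlane → ℂ} (h : IsSymbol N R U m) (p : FreqPlane) : ‖fderiv ℝ m p‖ ≤ 1 := by
  rw [← norm_iteratedFDeriv_one]; exact h.bounded 1 hN p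

/-- The symbol vanishes at a point of norm `2R`, which is at distance at most `3R` from its support,
and its gradient is at most `1`. -/
theorem IsSymbol.norm_le_radius {N : ℕ} (hN : 1 ≤ N) {R : ℝ} (hR : 0 < R) {U : Set FreqPlane}
    {m : FreqPlane → ℂ} (h : IsSymbol N R U m) (p : FreqPlane) : ‖m p‖ ≤ 3 * R := by
  by_cases hp : m p = 0
  · rw [hp, norm_zero]; positivity
  have hpR : ‖p‖ ≤ R := by simpa using h.support_ball hp
  set q : FreqPlane := !₂[2 * R, 0]
  have hq : ‖q‖ = 2 * R := by
    rw [EuclideanSpace.norm_eq]; simp [q]; exact Real.sqrt_sq (by positivity)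
  have hmq : m q = 0 := by
    by_contra hne
    have : ‖q‖ ≤ R := by simpa using h.support_ball hne
    linarith
  have := Convex.norm_image_sub_le_of_norm_fderiv_le (𝕜 := ℝ) (f := m) (s := univ) (C := 1)
    (x := q) (y := p) (fun x _ => (h.smooth.differentiable (by norm_num)) x)
    (fun x _ => h.norm_fderiv_le_one hN x) convex_univ (mem_univ _) (mem_univ _)
  rw [hmq, sub_zero, one_mul] at this
  calc ‖m p‖ ≤ ‖p - q‖ := this
    _ ≤ ‖p‖ + ‖q‖ := norm_sub_le _ _
    _ ≤ 3 * R := by linarith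

/-- The bound for symbols of radius `R`. -/
noncomputable def symbolSize (R : ℝ) : ℝ := min 1 (3 * R)

theorem symbolSize_nonneg {R : ℝ} (hR : 0 < R) : 0 ≤ symbolSize R :=
  le_min zero_le_one (by positivity)

/-- Estimates by slices and by covering lose `1 + R`. For small `R` the smallness `3R` of the symbol
compensates, so every final bound is linear in `R`. -/
theorem symbolSize_mul_le {R : ℝ} (hR : 0 < R) : symbolSize R * (1 + R) ≤ 6 * R := by
  rcases le_total R 1 with h | h
  · calc _ ≤ (3 * R) * (1 + R) := by gcongr; exact min_le_right _ _
      _ ≤ 6 * R := by nlinarith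
  · calc _ ≤ 1 * (1 + R) := by gcongr; exact min_le_left _ _
      _ ≤ 6 * R := by linarith

theorem IsSymbol.norm_le_symbolSize {N : ℕ} (hN : 1 ≤ N) {R : ℝ} (hR : 0 < R) {U : Set FreqPlane}
    {m : FreqPlane → ℂ} (h : IsSymbol N R U m) (p : FreqPlane) : ‖m p‖ ≤ symbolSize R :=
  le_min (h.norm_le_one p) (h.norm_le_radius hN hR p)

theorem abs_le_of_mem_closedBall {R x y : ℝ} (h : (!₂[x, y] : FreqPlane) ∈ Metric.closedBall 0 R) :
    |x| ≤ R ∧ |y| ≤ R := by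
  have h' : ‖(!₂[x, y] : FreqPlane)‖ ≤ R := by simpa using h
  exact ⟨(PiLp.norm_apply_le (!₂[x, y] : FreqPlane) 0).trans h',
    (PiLp.norm_apply_le (!₂[x, y] : FreqPlane) 1).trans h'⟩

theorem volume_le_of_abs_le {S : Set ℝ} {R : ℝ} (h : ∀ x ∈ S, |x| ≤ R) :
    volume S ≤ ENNReal.ofReal (2 * R) := by
  calc volume S ≤ volume (Icc (-R) R) := measure_mono fun x hx => abs_le.1 (h x hx)
    _ = _ := by rw [Real.volume_Icc]; congr 1; ring

theorem formBound_one_ball {R : ℝ} {E : Set (ℝ × ℝ)} (hE : MeasurableSet E)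
    (hER : ∀ p ∈ E, |p.1| ≤ R ∧ |p.2| ≤ R) :
    FormBound (fun _ => 1) E (ENNReal.ofReal (2 * R)) := by
  have := formBound_one_of_slices hE (S₁ := ENNReal.ofReal (2 * R))
    (S₂ := ENNReal.ofReal (2 * R)) (fun x => volume_le_of_abs_le fun y hy => (hER _ hy).2)
    (fun y => volume_le_of_abs_le fun x hx => (hER _ hx).1)
  refine this.mono Subset.rfl (le_of_eq ?_)
  rw [← ENNReal.rpow_add_of_nonneg _ _ (by norm_num) (by norm_num)]; norm_num

theorem formBound_ball {R : ℝ} (hR : 0 < R) {E : Set (ℝ × ℝ)} (hE : MeasurableSet E)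
    (hER : ∀ p ∈ E, |p.1| ≤ R ∧ |p.2| ≤ R) {H : ℝ → ℝ≥0∞} (hH : Measurable H) :
    FormBound H E (ENNReal.ofReal (1 + R) * l2n H) := by
  refine (formBound_of_slices_fst hE (S := ENNReal.ofReal (2 * R))
    (fun x => volume_le_of_abs_le fun y hy => (hER _ hy).2) hH).mono Subset.rfl ?_
  gcongr
  rw [ENNReal.ofReal_rpow_of_nonneg (by positivity) (by norm_num)]
  refine ENNReal.ofReal_le_ofReal ?_
  rw [← Real.sqrt_eq_rpow]
  refine Real.sqrt_le_iff.2 ⟨by positivity, by nlinarith⟩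

/-! ### From gains on level sets to growth in time. -/

/-- The frequency interactions over `U` in the ball of radius `R` at which `|φ| ≤ s`. -/
def levelRegion (φ : FreqPlane → ℝ) (U : Set FreqPlane) (R s : ℝ) : Set (ℝ × ℝ) :=
  {p | !₂[p.1, p.2] ∈ U ∧ !₂[p.1, p.2] ∈ Metric.closedBall (0 : FreqPlane) R ∧ |φ !₂[p.1, p.2]| ≤ s}

/-- The bilinear operators with symbols concentrated where `|φ| ≤ s` gain `s^θ₁` as maps into
`L^∞`, and `s^θ₂` as maps into `L²`. -/
def LevelBound (φ : FreqPlane → ℝ) (U : Set FreqPlane) (θ₁ θ₂ : ℝ) : Prop :=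
  ∃ C : ℝ, 0 ≤ C ∧ ∀ R s : ℝ, 0 < R → 0 < s → s ≤ 1 → ∀ E : Set (ℝ × ℝ), MeasurableSet E →
    E ⊆ levelRegion φ U R s →
      FormBound (fun _ => 1) E (ENNReal.ofReal (C * (1 + R) * s ^ θ₁)) ∧
      ∀ H, Measurable H → FormBound H E (ENNReal.ofReal (C * (1 + R) * s ^ θ₂) * l2n H)

theorem eLpNorm_top_le_of_hatL2 {u : L2Line} {H : ℝ → ℂ} (hH : Measurable H)
    (hu : hatL2 u =ᵐ[volume] H) {A : ℝ≥0∞} (hA : A ≠ ⊤) (h : ∫⁻ ξ, ‖H ξ‖ₑ ≤ A) :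
    eLpNorm u ⊤ volume ≤ A := by
  have hi : Integrable H := ⟨hH.aestronglyMeasurable, lt_of_le_of_lt h hA.lt_top⟩
  rw [eLpNorm_exponent_top]
  refine essSup_le_of_ae_le _ ?_
  filter_upwards [ae_eq_integral_of_hatL2 hi hu] with x hx
  rw [hx, enorm_mul]
  have h1 : ‖((Real.sqrt (2 * Real.pi) : ℂ))⁻¹‖ₑ ≤ 1 := by
    rw [← ofReal_norm, ← ENNReal.ofReal_one]
    refine ENNReal.ofReal_le_ofReal ?_
    rw [norm_inv, Complex.norm_real, Real.norm_of_nonneg (Real.sqrt_nonneg _)]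
    refine inv_le_one_of_one_le₀ (Real.one_le_sqrt.2 ?_)
    linarith [Real.pi_gt_three]
  calc _ ≤ 1 * ∫⁻ ξ, ‖cis (x * ξ) * H ξ‖ₑ := by
        gcongr
        exact enorm_integral_le_lintegral_enorm _
    _ ≤ A := by simpa [enorm_cis] using h

theorem eLpNorm_two_of_hatL2 {u : L2Line} {H : ℝ → ℂ} (hu : hatL2 u =ᵐ[volume] H) :
    eLpNorm u 2 volume = l2n fun ξ => ‖H ξ‖ₑ := by
  rw [eLpNorm_Lp, ← l2n_hatE]
  unfold l2n
  congr 1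
  refine lintegral_congr_ae ?_
  filter_upwards [hu] with ξ hξ
  rw [hatE, hξ]

theorem eLpNorm_le_of_hatL2 {u : L2Line} {H : ℝ → ℂ} (hH : Measurable H)
    (hu : hatL2 u =ᵐ[volume] H) {A B : ℝ≥0∞} (hA : A ≠ ⊤) (h₁ : ∫⁻ ξ, ‖H ξ‖ₑ ≤ A)
    (h₂ : l2n (fun ξ => ‖H ξ‖ₑ) ≤ B) {q : ℝ≥0∞} (hq : 2 ≤ q) :
    eLpNorm u q volume ≤ B ^ (2 * invExp q) * A ^ (1 - 2 * invExp q) := by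
  refine (eLpNorm_interpolate (Lp.aestronglyMeasurable u) hq).trans ?_
  have := invExp_le_half hq
  have := invExp_nonneg q
  gcongr
  · rw [eLpNorm_two_of_hatL2 hu]; exact h₂
  · linarith
  · exact eLpNorm_top_le_of_hatL2 hH hu hA h₁

/-- Each piece is realised as an `L²` function and interpolated before the summation. Interpolating
the summed endpoint bounds instead would spread the logarithm of the non-characteristic case at `q =
∞` to all finite `q > 2`. -/
theorem eLpNorm_le_sum_of_hatL2 {ι : Type*} {s : Finset ι} {u : L2Line} {H : ι → ℝ → ℂ}
    (hH : ∀ i, Measurable (H i)) (hu : hatL2 u =ᵐ[volume] fun ξ => ∑ i ∈ s, H i ξ)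
    {A B : ι → ℝ≥0∞} (hA : ∀ i, A i ≠ ⊤) (hB : ∀ i, B i ≠ ⊤)
    (h₁ : ∀ i, ∫⁻ ξ, ‖H i ξ‖ₑ ≤ A i) (h₂ : ∀ i, l2n (fun ξ => ‖H i ξ‖ₑ) ≤ B i)
    {q : ℝ≥0∞} (hq : 2 ≤ q) :
    eLpNorm u q volume ≤ ∑ i ∈ s, B i ^ (2 * invExp q) * A i ^ (1 - 2 * invExp q) := by
  have hmem : ∀ i, MemLp (H i) 2 := fun i => ⟨(hH i).aestronglyMeasurable, by
    rw [eLpNorm_two_eq_l2n]; exact lt_of_le_of_lt (h₂ i) (hB i).lt_top⟩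
  choose h hh using fun i => exists_hatL2_eq (hmem i)
  have hsum : u = ∑ i ∈ s, h i := by
    refine eq_of_hatL2_ae_eq ?_
    have : ∀ᵐ ξ, ∀ i ∈ s, hatL2 (h i) ξ = H i ξ :=
      (Finset.eventually_all s).2 fun i _ => hh i
    filter_upwards [hu, hatL2_sum s h, this] with ξ h1 h2 h3
    rw [h1, h2]
    exact Finset.sum_congr rfl fun i hi => (h3 i hi).symm
  have hcoe : (u : ℝ → ℂ) =ᵐ[volume] ∑ i ∈ s, (h i : ℝ → ℂ) := by
    rw [hsum]; exact Lp.coeFn_finsetSum s h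
  rw [eLpNorm_congr_ae hcoe]
  refine (eLpNorm_sum_le (fun i _ => Lp.aestronglyMeasurable (h i))
    (le_trans (by norm_num) hq)).trans ?_
  exact Finset.sum_le_sum fun i _ => eLpNorm_le_of_hatL2 (hH i) (hh i) (hA i) (h₁ i) (h₂ i) hq

theorem integrable_pseudoProduct_integrand {σ : FreqPlane → ℂ} (hσ : Measurable σ) {M : ℝ≥0∞}
    (hM : M ≠ ⊤) (hb : ∀ p, ‖σ p‖ₑ ≤ M) (f g : L2Line) (ξ : ℝ) :
    Integrable fun η => σ !₂[ξ - η, η] * hatL2 f (ξ - η) * hatL2 g η := by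
  refine ⟨((measurable_pseudoProduct_integrand hσ f g).comp
    (by fun_prop : Measurable fun η : ℝ => (ξ, η))).aestronglyMeasurable, ?_⟩
  rw [HasFiniteIntegral]
  calc _ ≤ ∫⁻ η, M * (hatE f (ξ - η) * hatE g η) := by
        refine lintegral_mono fun η => ?_
        rw [enorm_mul, enorm_mul, mul_assoc]
        exact mul_le_mul_left (hb _) _
    _ = M * ∫⁻ η, hatE f (ξ - η) * hatE g η := by
        rw [lintegral_const_mul]
        exact ((measurable_hatE f).comp (by fun_prop)).mul (measurable_hatE g)
    _ ≤ M * (l2n (hatE f) * l2n (hatE g)) := by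
        gcongr
        exact lintegral_convolution_le (measurable_hatE f) (measurable_hatE g) ξ
    _ < ⊤ := ENNReal.mul_lt_top hM.lt_top (ENNReal.mul_lt_top (l2n_hatE_ne_top f).lt_top
        (l2n_hatE_ne_top g).lt_top)

theorem pseudoProductHat_sum {ι : Type*} {s : Finset ι} {σ : ι → FreqPlane → ℂ}
    (hσ : ∀ i, Measurable (σ i)) {M : ℝ≥0∞} (hM : M ≠ ⊤) (hb : ∀ i p, ‖σ i p‖ₑ ≤ M)
    (f g : L2Line) (ξ : ℝ) :
    pseudoProductHat (fun p => ∑ i ∈ s, σ i p) (hatL2 f) (hatL2 g) ξ =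
      ∑ i ∈ s, pseudoProductHat (σ i) (hatL2 f) (hatL2 g) ξ := by
  simp only [pseudoProductHat]
  rw [← integral_finsetSum _ fun i _ =>
    integrable_pseudoProduct_integrand (hσ i) hM (hb i) f g ξ]
  congr 1; ext η
  rw [Finset.sum_mul, Finset.sum_mul]

theorem rpow_interpolate {K s θ₁ θ₂ x : ℝ} (hK : 0 ≤ K) (hs : 0 < s) (hx0 : 0 ≤ x) (hx1 : x ≤ 1) :
    ENNReal.ofReal (K * s ^ θ₂) ^ x * ENNReal.ofReal (K * s ^ θ₁) ^ (1 - x)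
      = ENNReal.ofReal (K * s ^ (x * θ₂ + (1 - x) * θ₁)) := by
  rw [ENNReal.ofReal_rpow_of_nonneg (by positivity) hx0,
    ENNReal.ofReal_rpow_of_nonneg (by positivity) (by linarith), ← ENNReal.ofReal_mul (by positivity)]
  congr 1
  rw [Real.mul_rpow hK (by positivity), Real.mul_rpow hK (by positivity), ← Real.rpow_mul hs.le,
    ← Real.rpow_mul hs.le]
  calc _ = (K ^ x * K ^ (1 - x)) * (s ^ (θ₂ * x) * s ^ (θ₁ * (1 - x))) := by ring
    _ = _ := by
        rw [← Real.rpow_add' hK (by simp), ← Real.rpow_add hs]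
        simp; left; congr 1; ring

/-- Bounds for one piece of the bilinear symbol. -/
theorem piece_bounds {σ : FreqPlane → ℂ} (hσ : Measurable σ) {M A₁ A₂ : ℝ} (hM0 : 0 ≤ M)
    (hA₁ : 0 ≤ A₁) (hA₂ : 0 ≤ A₂)
    (hM : ∀ p, ‖σ p‖ ≤ M) {E : Set (ℝ × ℝ)} (hE : MeasurableSet E)
    (hσE : ∀ x y, (x, y) ∉ E → σ !₂[x, y] = 0) (f g : L2Line)
    (h₁ : FormBound (fun _ => 1) E (ENNReal.ofReal A₁))
    (h₂ : ∀ H, Measurable H → FormBound H E (ENNReal.ofReal A₂ * l2n H)) :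
    (∫⁻ ξ, ‖pseudoProductHat σ (hatL2 f) (hatL2 g) ξ‖ₑ ≤ ENNReal.ofReal (M * A₁ * (‖f‖ * ‖g‖))) ∧
    l2n (fun ξ => ‖pseudoProductHat σ (hatL2 f) (hatL2 g) ξ‖ₑ)
      ≤ ENNReal.ofReal (M * A₂ * (‖f‖ * ‖g‖)) := by
  have hM' : ∀ p, ‖σ p‖ₑ ≤ ENNReal.ofReal M := fun p => by
    rw [← ofReal_norm]; exact ENNReal.ofReal_le_ofReal (hM p)
  constructor
  · have := lintegral_pseudoProductHat_mul_le hσ hM' hE hσE f g measurable_const h₁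
    simp only [mul_one, l2n_hatE] at this
    rwa [ENNReal.ofReal_mul (by positivity), ENNReal.ofReal_mul hM0,
      ENNReal.ofReal_mul (norm_nonneg _)]
  · have := l2n_pseudoProductHat_le hσ ENNReal.ofReal_ne_top hM' hE hσE f g h₂
    simp only [l2n_hatE] at this
    rwa [ENNReal.ofReal_mul (by positivity), ENNReal.ofReal_mul hM0,
      ENNReal.ofReal_mul (norm_nonneg _)]

/-- The decreasing family of sets `{|φ| ≤ 2^(1-n)}`, `1 ≤ n ≤ J + 1`, completed by the whole plane
and the empty set. -/
def levelCut (φ : FreqPlane → ℝ) (J n : ℕ) : Set FreqPlane :=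
  {p | n = 0 ∨ (n ≤ J + 1 ∧ |φ p| ≤ ((2 : ℝ) ^ (n - 1))⁻¹)}

/-- The dyadic shells of `φ`. -/
def levelShell (φ : FreqPlane → ℝ) (J n : ℕ) : Set FreqPlane :=
  levelCut φ J n \ levelCut φ J (n + 1)

theorem measurableSet_levelCut {φ : FreqPlane → ℝ} (hφ : Continuous φ) (J n : ℕ) :
    MeasurableSet (levelCut φ J n) := by
  have : MeasurableSet {p | |φ p| ≤ ((2 : ℝ) ^ (n - 1))⁻¹} :=
    measurableSet_le hφ.abs.measurable measurable_const
  unfold levelCut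
  exact (MeasurableSet.const _).union ((MeasurableSet.const _).inter this)

theorem measurableSet_levelShell {φ : FreqPlane → ℝ} (hφ : Continuous φ) (J n : ℕ) :
    MeasurableSet (levelShell φ J n) :=
  (measurableSet_levelCut hφ J n).diff (measurableSet_levelCut hφ J (n + 1))

theorem levelCut_succ_subset (φ : FreqPlane → ℝ) (J n : ℕ) :
    levelCut φ J (n + 1) ⊆ levelCut φ J n := by
  rintro p (h | ⟨h1, h2⟩)
  · simp at h
  rcases Nat.eq_zero_or_pos n with rfl | hn
  · exact Or.inl rfl
  refine Or.inr ⟨by omega, h2.trans ?_⟩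
  gcongr
  · norm_num
  · omega

theorem sum_indicator_levelShell (φ : FreqPlane → ℝ) (J : ℕ) (F : FreqPlane → ℂ) (p : FreqPlane) :
    ∑ n ∈ Finset.range (J + 2), (levelShell φ J n).indicator F p = F p := by
  have h : ∀ n, (levelShell φ J n).indicator F p
      = (levelCut φ J n).indicator F p - (levelCut φ J (n + 1)).indicator F p := fun n => by
    have h1 := levelCut_succ_subset φ J n
    by_cases h2 : p ∈ levelCut φ J n <;> by_cases h3 : p ∈ levelCut φ J (n + 1)
    · simp [levelShell, h2, h3]
    · simp [levelShell, h2, h3]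
    · exact absurd (h1 h3) h2
    · simp [levelShell, h2, h3]
  simp_rw [h]
  -- The sum telescopes: the cut of index `0` is the whole plane and that of index `J + 2` is empty.
  rw [Finset.sum_range_sub']
  simp [levelCut]

theorem abs_le_of_mem_levelShell {φ : FreqPlane → ℝ} {J n : ℕ} {p : FreqPlane}
    (hp : p ∈ levelShell φ J (n + 1)) : |φ p| ≤ ((2 : ℝ) ^ n)⁻¹ := by
  rcases hp.1 with h | h
  · simp at h
  · simpa using h.2

/-- Outside the last shell `|φ| > 2^{-n}`, and the bound `2/|φ|` applies. The last shell, of index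
`J + 1`, contains the resonant set; there only `t ≤ 2^J` is available, and it has the same order. -/
theorem norm_osc_le_of_mem_levelShell {φ : FreqPlane → ℝ} {J n : ℕ} {p : FreqPlane}
    (hp : p ∈ levelShell φ J n) (hn : n < J + 2) {t : ℝ} (ht0 : 0 < t) (ht : t ≤ 2 ^ J) :
    ‖osc t (φ p)‖ ≤ 4 * 2 ^ (n - 1) := by
  by_cases hnJ : n = J + 1
  · calc _ ≤ |t| := norm_osc_le _ _
      _ = t := abs_of_pos ht0
      _ ≤ 2 ^ J := ht
      _ ≤ 4 * 2 ^ (n - 1) := by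
        rw [hnJ, Nat.add_sub_cancel]
        have : (0 : ℝ) < 2 ^ J := by positivity
        linarith
  · have h2 := hp.2
    simp only [levelCut, mem_ofPred_eq, not_or, not_and, not_le, Nat.add_sub_cancel] at h2
    have h3 := h2.2 (by omega)
    have hpos : 0 < ((2 : ℝ) ^ n)⁻¹ := by positivity
    have hne : φ p ≠ 0 := abs_pos.1 (hpos.trans h3)
    calc _ ≤ 2 / |φ p| := norm_osc_le_div hne t
      _ ≤ 2 / ((2 : ℝ) ^ n)⁻¹ := by gcongr
      _ = 2 * 2 ^ n := by rw [div_inv_eq_mul]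
      _ ≤ 2 * 2 ^ ((n - 1) + 1) := by
        gcongr
        · norm_num
        · omega
      _ = 4 * 2 ^ (n - 1) := by rw [pow_succ]; ring

/-- Interpolated gain. -/
noncomputable def interpExp (θ₁ θ₂ : ℝ) (q : ℝ≥0∞) : ℝ :=
  2 * invExp q * θ₂ + (1 - 2 * invExp q) * θ₁

/-- With `e = 2^{n-1}`, the piece of index `n` has a symbol `O(e)` and an operator gain `e^{-θ}`,
`θ` being the interpolated exponent; hence the terms `e^{1-θ}`. The isolated `1` is the shell `|φ| >
1`, on which nothing is gained. The constant depends neither on `J` nor on `q`. -/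
theorem dyadic_estimate {a b c : ℝ → ℝ} (ha : ContDiff ℝ ∞ a) (hb : ContDiff ℝ ∞ b)
    (hc : ContDiff ℝ ∞ c) {U : Set FreqPlane} {θ₁ θ₂ : ℝ}
    (hLB : LevelBound (phase a b c) U θ₁ θ₂) :
    ∃ C : ℝ, 0 ≤ C ∧ ∀ (R : ℝ) (m : FreqPlane → ℂ), 0 < R → IsSymbol 1 R U m →
      ∀ (f g : L2Line) (u v w : ℝ → L2Line), SolvesSystem a b c m f g u v w →
      ∀ t : ℝ, 0 < t → ∀ J : ℕ, t ≤ 2 ^ J → ∀ q : ℝ≥0∞, 2 ≤ q →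
        eLpNorm (u t) q volume ≤ ENNReal.ofReal (C * R *
          (1 + ∑ n ∈ Finset.range (J + 1), ((2 : ℝ) ^ n) ^ (1 - interpExp θ₁ θ₂ q)) *
            (‖f‖ * ‖g‖)) := by
  obtain ⟨C₀, hC₀, hLB⟩ := hLB
  -- The value `2` serves the shell of index `0`, which is only bounded by the ball: `2R ≤ 2(1 +
  -- R)`.
  set C := max C₀ 2
  have hC2 : 2 ≤ C := le_max_right _ _
  refine ⟨24 * C, by positivity, fun R m hR hm f g u v w hs t ht J hJ q hq => ?_⟩
  set φ := phase a b c with hφd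
  have hφ : Continuous φ := continuous_phase ha.continuous hb.continuous hc.continuous
  have hmc : Continuous m := hm.smooth.continuous
  set e : ℕ → ℝ := fun n => 2 ^ (n - 1) with he
  have he0 : ∀ n, 0 < e n := fun n => by simp only [he]; positivity
  -- Pieces beyond the last shell are set to `0`, so that the bounds below hold for every `n`.
  set σ : ℕ → FreqPlane → ℂ := fun n =>
    if n < J + 2 then (levelShell φ J n).indicator (duhamelSymbol a b c m t) else 0 with hσ
  have hdm : Measurable (duhamelSymbol a b c m t) :=
    (hmc.mul ((continuous_osc t).comp hφ)).measurable
  have hσm : ∀ n, Measurable (σ n) := fun n => by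
    simp only [hσ]; split_ifs
    · exact hdm.indicator (measurableSet_levelShell hφ J n)
    · exact measurable_zero
  have hμ := symbolSize_nonneg hR
  have hσb : ∀ n p, ‖σ n p‖ ≤ 4 * e n * symbolSize R := fun n p => by
    have h0 : 0 ≤ 4 * e n * symbolSize R := mul_nonneg (by have := he0 n; positivity) hμ
    simp only [hσ]; split_ifs with hn
    · by_cases hp : p ∈ levelShell φ J n
      · rw [indicator_of_mem hp, duhamelSymbol, norm_mul, mul_comm]
        have h1 := norm_osc_le_of_mem_levelShell hp hn ht hJ
        have h2 := hm.norm_le_symbolSize le_rfl hR p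
        have := he0 n
        gcongr
      · rw [indicator_of_notMem hp, norm_zero]; exact h0
    · simpa using h0
  -- Requiring `m ≠ 0` puts `E n` inside both `U` and the ball of radius `R`.
  set E : ℕ → Set (ℝ × ℝ) := fun n =>
    {p | !₂[p.1, p.2] ∈ levelShell φ J n ∧ m !₂[p.1, p.2] ≠ 0} with hE
  have hEm : ∀ n, MeasurableSet (E n) := fun n => by
    refine MeasurableSet.inter (continuous_pt.measurable (measurableSet_levelShell hφ J n)) ?_
    exact (hmc.comp continuous_pt).measurable (measurableSet_singleton 0).compl
  have hσE : ∀ n x y, (x, y) ∉ E n → σ n !₂[x, y] = 0 := fun n x y h => by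
    simp only [hσ]; split_ifs
    · by_cases hp : !₂[x, y] ∈ levelShell φ J n
      · have : m !₂[x, y] = 0 := by
          by_contra hne
          exact h ⟨hp, hne⟩
        rw [indicator_of_mem hp, duhamelSymbol, this, zero_mul]
      · rw [indicator_of_notMem hp]
    · rfl
  have hball : ∀ n, ∀ p ∈ E n, |p.1| ≤ R ∧ |p.2| ≤ R := fun n p hp =>
    abs_le_of_mem_closedBall (hm.support_ball hp.2)
  have hFB : ∀ n, FormBound (fun _ => 1) (E n) (ENNReal.ofReal (C * (1 + R) * (e n)⁻¹ ^ θ₁)) ∧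
      ∀ H, Measurable H →
        FormBound H (E n) (ENNReal.ofReal (C * (1 + R) * (e n)⁻¹ ^ θ₂) * l2n H) := by
    intro n
    rcases n with _ | n
    · simp only [he, Nat.zero_sub, pow_zero, inv_one, Real.one_rpow, mul_one]
      refine ⟨(formBound_one_ball (hEm 0) (hball 0)).mono Subset.rfl
        (ENNReal.ofReal_le_ofReal (by nlinarith)), fun H hH =>
        (formBound_ball hR (hEm 0) (hball 0) hH).mono Subset.rfl ?_⟩
      gcongr
      nlinarith
    · have h1 : 0 < (e (n + 1))⁻¹ := inv_pos.2 (he0 _)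
      have h2 : (e (n + 1))⁻¹ ≤ 1 := inv_le_one_of_one_le₀ (one_le_pow₀ (by norm_num))
      have h3 : E (n + 1) ⊆ levelRegion φ U R (e (n + 1))⁻¹ := fun p hp =>
        ⟨hm.support_region hp.2, hm.support_ball hp.2, by
          simpa [he] using abs_le_of_mem_levelShell hp.1⟩
      obtain ⟨h4, h5⟩ := hLB R _ hR h1 h2 _ (hEm (n + 1)) h3
      refine ⟨h4.mono Subset.rfl ?_, fun H hH => (h5 H hH).mono Subset.rfl ?_⟩
      · gcongr; exact le_max_left _ _
      · gcongr; exact le_max_left _ _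
  have hsol := hs.hatL2_eq ha hb hc hmc hm.norm_le_one ht.le
  set P : ℕ → ℝ → ℂ := fun n ξ =>
    cis (t * a ξ) * (-Complex.I * pseudoProductHat (σ n) (hatL2 f) (hatL2 g) ξ) with hP
  have hPm : ∀ n, Measurable (P n) := fun n =>
    ((continuous_cis.comp (by have := ha.continuous; fun_prop)).measurable).mul
      (measurable_const.mul (stronglyMeasurable_pseudoProductHat (hσm n) f g).measurable)
  have hPe : ∀ n ξ, ‖P n ξ‖ₑ = ‖pseudoProductHat (σ n) (hatL2 f) (hatL2 g) ξ‖ₑ := fun n ξ => by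
    have h1 : ‖-Complex.I‖ₑ = 1 := by rw [← ofReal_norm]; simp
    simp only [hP, enorm_mul, enorm_cis, one_mul, h1]
  have hsum : hatL2 (u t) =ᵐ[volume] fun ξ => ∑ n ∈ Finset.range (J + 2), P n ξ := by
    filter_upwards [hsol] with ξ hξ
    rw [hξ, ← Finset.mul_sum, ← Finset.mul_sum]
    congr 2
    have hbE : ∀ n p, ‖σ n p‖ₑ ≤ ENNReal.ofReal |t| := fun n p => by
      have h1 : ‖duhamelSymbol a b c m t p‖ₑ ≤ ENNReal.ofReal |t| := by
        rw [← ofReal_norm]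
        refine ENNReal.ofReal_le_ofReal ?_
        rw [duhamelSymbol, norm_mul]
        calc _ ≤ 1 * |t| := mul_le_mul (hm.norm_le_one p) (norm_osc_le _ _) (norm_nonneg _) zero_le_one
          _ = |t| := one_mul _
      simp only [hσ]; split_ifs
      · exact (enorm_indicator_le_enorm_self _ _).trans h1
      · simp
    rw [← pseudoProductHat_sum hσm ENNReal.ofReal_ne_top hbE]
    congr 1
    ext p
    rw [← sum_indicator_levelShell φ J (duhamelSymbol a b c m t) p]
    refine Finset.sum_congr rfl fun n hn => ?_
    simp only [hσ, if_pos (Finset.mem_range.1 hn)]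
  set NN := ‖f‖ * ‖g‖ with hNN
  have hNN0 : 0 ≤ NN := by positivity
  set K : ℕ → ℝ := fun n => 4 * e n * symbolSize R * (C * (1 + R)) * NN with hK
  have hK0 : ∀ n, 0 ≤ K n := fun n => by
    have := he0 n
    simp only [hK]
    positivity
  have hpb : ∀ n, (∫⁻ ξ, ‖P n ξ‖ₑ ≤ ENNReal.ofReal (K n * (e n)⁻¹ ^ θ₁)) ∧
      l2n (fun ξ => ‖P n ξ‖ₑ) ≤ ENNReal.ofReal (K n * (e n)⁻¹ ^ θ₂) := fun n => by
    have h1 : 0 ≤ (e n)⁻¹ := inv_nonneg.2 (he0 n).le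
    have := piece_bounds (hσm n) (mul_nonneg (mul_nonneg (by norm_num) (he0 n).le) hμ)
      (mul_nonneg (by positivity : 0 ≤ C * (1 + R)) (Real.rpow_nonneg h1 θ₁))
      (mul_nonneg (by positivity : 0 ≤ C * (1 + R)) (Real.rpow_nonneg h1 θ₂))
      (hσb n) (hEm n) (hσE n) f g (hFB n).1 (hFB n).2
    simp_rw [hPe]
    refine ⟨this.1.trans (le_of_eq ?_), this.2.trans (le_of_eq ?_)⟩ <;>
    · congr 1; simp only [hK]; ring
  refine (eLpNorm_le_sum_of_hatL2 hPm hsum (fun n => ENNReal.ofReal_ne_top)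
    (fun n => ENNReal.ofReal_ne_top) (fun n => (hpb n).1) (fun n => (hpb n).2) hq).trans ?_
  have hi0 := invExp_nonneg q
  have hi1 := invExp_le_half hq
  have hterm : ∀ n, ENNReal.ofReal (K n * (e n)⁻¹ ^ θ₂) ^ (2 * invExp q) *
      ENNReal.ofReal (K n * (e n)⁻¹ ^ θ₁) ^ (1 - 2 * invExp q)
      ≤ ENNReal.ofReal (24 * C * R * NN * e n ^ (1 - interpExp θ₁ θ₂ q)) := fun n => by
    rw [rpow_interpolate (hK0 n) (inv_pos.2 (he0 n)) (by linarith) (by linarith)]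
    refine ENNReal.ofReal_le_ofReal ?_
    have h1 : (e n)⁻¹ ^ (2 * invExp q * θ₂ + (1 - 2 * invExp q) * θ₁) * e n
        = e n ^ (1 - interpExp θ₁ θ₂ q) := by
      rw [Real.inv_rpow (he0 n).le, ← Real.rpow_neg (he0 n).le, interpExp]
      nth_rewrite 2 [← Real.rpow_one (e n)]
      rw [← Real.rpow_add (he0 n)]
      congr 1; ring
    rw [← h1]
    -- The constant `24` is `4`, from the oscillatory factor, times `6`, from trading `1 + R` for
    -- `R`.
    have h2 := symbolSize_mul_le hR
    have h3 : 0 ≤ (e n)⁻¹ ^ (2 * invExp q * θ₂ + (1 - 2 * invExp q) * θ₁) * e n :=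
      mul_nonneg (Real.rpow_nonneg (inv_nonneg.2 (he0 n).le) _) (he0 n).le
    calc _ = (symbolSize R * (1 + R)) * (4 * C * NN) *
          ((e n)⁻¹ ^ (2 * invExp q * θ₂ + (1 - 2 * invExp q) * θ₁) * e n) := by
          simp only [hK]; ring
      _ ≤ (6 * R) * (4 * C * NN) *
          ((e n)⁻¹ ^ (2 * invExp q * θ₂ + (1 - 2 * invExp q) * θ₁) * e n) := by
          gcongr
      _ = _ := by ring
  refine (Finset.sum_le_sum fun n _ => hterm n).trans ?_
  rw [← ENNReal.ofReal_sum_of_nonneg fun n _ =>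
    mul_nonneg (by positivity) (Real.rpow_nonneg (he0 n).le _)]
  refine ENNReal.ofReal_le_ofReal (le_of_eq ?_)
  rw [← Finset.mul_sum, Finset.sum_range_succ']
  simp only [he, Nat.add_sub_cancel, Nat.zero_sub, pow_zero, Real.one_rpow]
  ring

/-- The trivial bound, which integrates the forcing in time. -/
theorem eLpNorm_le_linear {a b c : ℝ → ℝ} (ha : ContDiff ℝ ∞ a) (hb : ContDiff ℝ ∞ b)
    (hc : ContDiff ℝ ∞ c) {U : Set FreqPlane} {R : ℝ} {m : FreqPlane → ℂ} (hR : 0 < R)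
    (hm : IsSymbol 1 R U m) {f g : L2Line} {u v w : ℝ → L2Line}
    (hs : SolvesSystem a b c m f g u v w) {t : ℝ} (ht : 0 < t) {q : ℝ≥0∞} (hq : 2 ≤ q) :
    eLpNorm (u t) q volume ≤ ENNReal.ofReal (12 * R * t * (‖f‖ * ‖g‖)) := by
  have hφ : Continuous (phase a b c) := continuous_phase ha.continuous hb.continuous hc.continuous
  have hmc : Continuous m := hm.smooth.continuous
  have hdm : Measurable (duhamelSymbol a b c m t) :=
    (hmc.mul ((continuous_osc t).comp hφ)).measurable
  have hμ := symbolSize_nonneg hR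
  have hσb : ∀ p, ‖duhamelSymbol a b c m t p‖ ≤ symbolSize R * t := fun p => by
    rw [duhamelSymbol, norm_mul]
    have h1 := norm_osc_le t (phase a b c p)
    rw [abs_of_pos ht] at h1
    exact mul_le_mul (hm.norm_le_symbolSize le_rfl hR p) h1 (norm_nonneg _) hμ
  set E : Set (ℝ × ℝ) := {p | m !₂[p.1, p.2] ≠ 0} with hE
  have hEm : MeasurableSet E :=
    (hmc.comp continuous_pt).measurable (measurableSet_singleton 0).compl
  have hσE : ∀ x y, (x, y) ∉ E → duhamelSymbol a b c m t !₂[x, y] = 0 := fun x y h => by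
    have : m !₂[x, y] = 0 := by
      by_contra hne
      exact h hne
    rw [duhamelSymbol, this, zero_mul]
  have hball : ∀ p ∈ E, |p.1| ≤ R ∧ |p.2| ≤ R := fun p hp =>
    abs_le_of_mem_closedBall (hm.support_ball hp)
  have hp := piece_bounds hdm (mul_nonneg hμ ht.le) (by positivity : 0 ≤ 2 * (1 + R))
    (by positivity : 0 ≤ 2 * (1 + R)) hσb hEm hσE f g
    ((formBound_one_ball hEm hball).mono Subset.rfl (ENNReal.ofReal_le_ofReal (by linarith)))
    (fun H hH => (formBound_ball hR hEm hball hH).mono Subset.rfl (by gcongr; linarith))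
  have hle : symbolSize R * t * (2 * (1 + R)) * (‖f‖ * ‖g‖) ≤ 12 * R * t * (‖f‖ * ‖g‖) := by
    gcongr ?_ * (‖f‖ * ‖g‖)
    have := symbolSize_mul_le hR
    nlinarith
  have hn : ∀ ξ, ‖cis (t * a ξ) *
      (-Complex.I * pseudoProductHat (duhamelSymbol a b c m t) (hatL2 f) (hatL2 g) ξ)‖ₑ
      = ‖pseudoProductHat (duhamelSymbol a b c m t) (hatL2 f) (hatL2 g) ξ‖ₑ := fun ξ => by
    have h1 : ‖-Complex.I‖ₑ = 1 := by rw [← ofReal_norm]; simp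
    simp only [enorm_mul, enorm_cis, one_mul, h1]
  have hi0 := invExp_nonneg q
  have hi1 := invExp_le_half hq
  refine (eLpNorm_le_of_hatL2 (A := ENNReal.ofReal (12 * R * t * (‖f‖ * ‖g‖)))
    (B := ENNReal.ofReal (12 * R * t * (‖f‖ * ‖g‖)))
    (((continuous_cis.comp (by have := ha.continuous; fun_prop)).measurable).mul
      (measurable_const.mul (stronglyMeasurable_pseudoProductHat hdm f g).measurable))
    (hs.hatL2_eq ha hb hc hmc hm.norm_le_one ht.le) ENNReal.ofReal_ne_top ?_ ?_ hq).trans ?_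
  · exact (lintegral_congr hn).trans_le (hp.1.trans (ENNReal.ofReal_le_ofReal hle))
  · exact (congrArg l2n (funext hn)).trans_le (hp.2.trans (ENNReal.ofReal_le_ofReal hle))
  · rw [← ENNReal.rpow_add_of_nonneg _ _ (by linarith) (by linarith)]
    simp

theorem pointwiseBound_linear {a b c : ℝ → ℝ} (ha : ContDiff ℝ ∞ a) (hb : ContDiff ℝ ∞ b)
    (hc : ContDiff ℝ ∞ c) (U : Set FreqPlane) {q : ℝ≥0∞} (hq : 2 ≤ q) :
    PointwiseBound 1 a b c U q fun t => t :=
  ⟨12, fun R m hR hm f g u v w hs t ht => by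
    simpa only [mul_assoc] using eLpNorm_le_linear ha hb hc hR hm hs ht hq⟩

/-- It suffices to prove an estimate for large times. -/
theorem pointwiseBound_of_large_time {a b c : ℝ → ℝ} (ha : ContDiff ℝ ∞ a) (hb : ContDiff ℝ ∞ b)
    (hc : ContDiff ℝ ∞ c) {U : Set FreqPlane} {q : ℝ≥0∞} (hq : 2 ≤ q) {α : ℝ → ℝ}
    (hα0 : ∀ t, 0 < t → 0 ≤ α t) (hα1 : ∀ t, 0 < t → t ≤ 1 → t ≤ α t)
    (h : ∃ C : ℝ, ∀ (R : ℝ) (m : FreqPlane → ℂ), 0 < R → IsSymbol 1 R U m →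
      ∀ (f g : L2Line) (u v w : ℝ → L2Line), SolvesSystem a b c m f g u v w →
      ∀ t : ℝ, 1 ≤ t → eLpNorm (u t) q volume ≤ ENNReal.ofReal (C * R * α t * (‖f‖ * ‖g‖))) :
    PointwiseBound 1 a b c U q α := by
  obtain ⟨C, h⟩ := h
  refine ⟨max C 12, fun R m hR hm f g u v w hs t ht => ?_⟩
  have hα := hα0 t ht
  rw [mul_assoc (_ * α t)]
  rcases le_total t 1 with h1 | h1
  · refine (eLpNorm_le_linear ha hb hc hR hm hs ht hq).trans (ENNReal.ofReal_le_ofReal ?_)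
    gcongr
    · exact le_max_right _ _
    · exact hα1 t ht h1
  · refine (h R m hR hm f g u v w hs t h1).trans (ENNReal.ofReal_le_ofReal ?_)
    gcongr
    exact le_max_left _ _

theorem pointwiseBound_of_levelBound {a b c : ℝ → ℝ} (ha : ContDiff ℝ ∞ a) (hb : ContDiff ℝ ∞ b)
    (hc : ContDiff ℝ ∞ c) {U : Set FreqPlane} {θ₁ θ₂ : ℝ}
    (hLB : LevelBound (phase a b c) U θ₁ θ₂) {q : ℝ≥0∞} (hq : 2 ≤ q) {α : ℝ → ℝ}
    (hα0 : ∀ t, 0 < t → 0 ≤ α t) (hα1 : ∀ t, 0 < t → t ≤ 1 → t ≤ α t)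
    (h : ∃ D : ℝ, ∀ (J : ℕ) (t : ℝ), 1 ≤ t → 2 ^ J ≤ 2 * t →
      1 + ∑ n ∈ Finset.range (J + 1), ((2 : ℝ) ^ n) ^ (1 - interpExp θ₁ θ₂ q) ≤ D * α t) :
    PointwiseBound 1 a b c U q α := by
  obtain ⟨C, hC, hest⟩ := dyadic_estimate ha hb hc hLB
  obtain ⟨D, hD⟩ := h
  refine pointwiseBound_of_large_time ha hb hc hq hα0 hα1
    ⟨C * D, fun R m hR hm f g u v w hs t ht => ?_⟩
  -- Since `2^J ≤ t < 2^{J+1} ≤ 2t`, the level `J + 1` is deep enough for the decomposition and too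
  -- deep by at most a factor `2`.
  obtain ⟨J, hJ1, hJ2⟩ := exists_nat_pow_near ht one_lt_two
  refine (hest R m hR hm f g u v w hs t (by linarith) (J + 1) hJ2.le q hq).trans
    (ENNReal.ofReal_le_ofReal ?_)
  have h1 := hD (J + 1) t ht (by rw [pow_succ]; linarith)
  calc _ ≤ C * R * (D * α t) * (‖f‖ * ‖g‖) := by gcongr
    _ = _ := by ring

theorem sum_two_pow_rpow (γ : ℝ) (J : ℕ) :
    ∑ n ∈ Finset.range (J + 1), ((2 : ℝ) ^ n) ^ γ
      = ∑ n ∈ Finset.range (J + 1), ((2 : ℝ) ^ γ) ^ n := by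
  refine Finset.sum_congr rfl fun n _ => ?_
  rw [← Real.rpow_natCast, ← Real.rpow_natCast, ← Real.rpow_mul (by norm_num),
    ← Real.rpow_mul (by norm_num), mul_comm]

/-- For a positive exponent the geometric sum is comparable to its last term, which is `O(t^γ)`. The
condition `γ ≤ 1` makes the linear bound sufficient for `t ≤ 1`. -/
theorem pointwiseBound_rpow {a b c : ℝ → ℝ} (ha : ContDiff ℝ ∞ a) (hb : ContDiff ℝ ∞ b)
    (hc : ContDiff ℝ ∞ c) {U : Set FreqPlane} {θ₁ θ₂ : ℝ}
    (hLB : LevelBound (phase a b c) U θ₁ θ₂) {q : ℝ≥0∞} (hq : 2 ≤ q) {γ : ℝ}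
    (hγ : 1 - interpExp θ₁ θ₂ q = γ) (hγ0 : 0 < γ) (hγ1 : γ ≤ 1) :
    PointwiseBound 1 a b c U q fun t => t ^ γ := by
  refine pointwiseBound_of_levelBound ha hb hc hLB hq (fun t ht => Real.rpow_nonneg ht.le _)
    (fun t ht ht1 => ?_) ?_
  · simpa using Real.rpow_le_rpow_of_exponent_ge ht ht1 hγ1
  rw [hγ]
  set r : ℝ := 2 ^ γ with hr
  have hr1 : 1 < r := Real.one_lt_rpow one_lt_two hγ0
  refine ⟨1 + r * r / (r - 1), fun J t ht hJ => ?_⟩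
  have h1 : 1 ≤ t ^ γ := Real.one_le_rpow ht hγ0.le
  have h2 : r ^ J ≤ r * t ^ γ := by
    rw [hr, ← Real.mul_rpow (by norm_num) (by linarith), ← Real.rpow_natCast,
      ← Real.rpow_mul (by norm_num), mul_comm γ, Real.rpow_mul (by norm_num), Real.rpow_natCast]
    exact Real.rpow_le_rpow (by positivity) hJ hγ0.le
  rw [sum_two_pow_rpow, geom_sum_eq hr1.ne', add_mul, one_mul]
  have h3 : (r ^ (J + 1) - 1) / (r - 1) ≤ r * r / (r - 1) * t ^ γ := by
    rw [div_mul_eq_mul_div, div_le_div_iff_of_pos_right (by linarith), pow_succ]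
    nlinarith
  linarith

theorem pointwiseBound_log {a b c : ℝ → ℝ} (ha : ContDiff ℝ ∞ a) (hb : ContDiff ℝ ∞ b)
    (hc : ContDiff ℝ ∞ c) {U : Set FreqPlane} {θ₁ θ₂ : ℝ}
    (hLB : LevelBound (phase a b c) U θ₁ θ₂) {q : ℝ≥0∞} (hq : 2 ≤ q)
    (hγ : interpExp θ₁ θ₂ q = 1) :
    PointwiseBound 1 a b c U q fun t => Real.sqrt (1 + Real.log t ^ 2) := by
  refine pointwiseBound_of_levelBound ha hb hc hLB hq (fun t ht => Real.sqrt_nonneg _)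
    (fun t ht ht1 => ht1.trans (Real.one_le_sqrt.2 (by nlinarith [sq_nonneg (Real.log t)]))) ?_
  rw [hγ, sub_self]
  -- All terms equal `1`, so the left side is `2 + J`. From `2^J ≤ 2t` and `1 / log 2 < 2` it is at
  -- most `3 + 2 log t`, and both `1` and `log t` are bounded by the square root.
  refine ⟨5, fun J t ht hJ => ?_⟩
  have h1 : 1 ≤ Real.sqrt (1 + Real.log t ^ 2) :=
    Real.one_le_sqrt.2 (by nlinarith [sq_nonneg (Real.log t)])
  have h2 : Real.log t ≤ Real.sqrt (1 + Real.log t ^ 2) := Real.le_sqrt_of_sq_le (by linarith)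
  have h3 : (J : ℝ) * Real.log 2 ≤ Real.log 2 + Real.log t := by
    rw [← Real.log_pow, ← Real.log_mul (by norm_num) (by linarith)]
    exact Real.log_le_log (by positivity) hJ
  have h4 := Real.log_two_gt_d9
  have h5 := Real.log_nonneg ht
  simp only [Real.rpow_zero, Finset.sum_const, Finset.card_range, nsmul_eq_mul, mul_one]
  push_cast
  nlinarith

theorem pointwiseBound_const {a b c : ℝ → ℝ} (ha : ContDiff ℝ ∞ a) (hb : ContDiff ℝ ∞ b)
    (hc : ContDiff ℝ ∞ c) {U : Set FreqPlane} {θ₁ θ₂ : ℝ}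
    (hLB : LevelBound (phase a b c) U θ₁ θ₂) {q : ℝ≥0∞} (hq : 2 ≤ q)
    (hγ : 1 < interpExp θ₁ θ₂ q) :
    PointwiseBound 1 a b c U q fun _ => 1 := by
  refine pointwiseBound_of_levelBound ha hb hc hLB hq (fun t ht => zero_le_one)
    (fun t ht ht1 => ht1) ?_
  set r : ℝ := 2 ^ (1 - interpExp θ₁ θ₂ q) with hr
  have hr0 : 0 < r := by positivity
  have hr1 : r < 1 := Real.rpow_lt_one_of_one_lt_of_neg one_lt_two (by linarith)
  refine ⟨1 + (1 - r)⁻¹, fun J t ht hJ => ?_⟩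
  rw [sum_two_pow_rpow, mul_one]
  gcongr
  rw [← tsum_geometric_of_lt_one hr0.le hr1]
  exact (summable_geometric_of_lt_one hr0.le hr1).sum_le_tsum _ fun n _ => by positivity

/-- Only the level sets of small values matter. -/
theorem levelBound_of_small {φ : FreqPlane → ℝ} {U : Set FreqPlane} {θ₁ θ₂ : ℝ} (h₁ : 0 ≤ θ₁)
    (h₂ : 0 ≤ θ₂) {s₀ C : ℝ} (hs₀ : 0 < s₀) (hC : 0 ≤ C)
    (h : ∀ R s : ℝ, 0 < R → 0 < s → s ≤ s₀ → ∀ E : Set (ℝ × ℝ), MeasurableSet E →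
      E ⊆ levelRegion φ U R s →
      FormBound (fun _ => 1) E (ENNReal.ofReal (C * (1 + R) * s ^ θ₁)) ∧
      ∀ H, Measurable H → FormBound H E (ENNReal.ofReal (C * (1 + R) * s ^ θ₂) * l2n H)) :
    LevelBound φ U θ₁ θ₂ := by
  refine ⟨C + 2 * (s₀ ^ θ₁)⁻¹ + (s₀ ^ θ₂)⁻¹, by positivity, fun R s hR hs _ E hE hES => ?_⟩
  have hs1 := Real.rpow_nonneg hs.le θ₁
  have hs2 := Real.rpow_nonneg hs.le θ₂
  have hq1 := inv_nonneg.2 (Real.rpow_nonneg hs₀.le θ₁)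
  have hq2 := inv_nonneg.2 (Real.rpow_nonneg hs₀.le θ₂)
  rcases le_total s s₀ with hss | hss
  · obtain ⟨h3, h4⟩ := h R s hR hs hss E hE hES
    refine ⟨h3.mono Subset.rfl ?_, fun H hH => (h4 H hH).mono Subset.rfl ?_⟩ <;>
    · gcongr; linarith
  · have hball : ∀ p ∈ E, |p.1| ≤ R ∧ |p.2| ≤ R := fun p hp =>
      abs_le_of_mem_closedBall (hES hp).2.1
    have key : ∀ θ : ℝ, 0 ≤ θ → 1 ≤ (s₀ ^ θ)⁻¹ * s ^ θ := fun θ hθ => by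
      rw [inv_mul_eq_div, one_le_div (by positivity)]
      exact Real.rpow_le_rpow hs₀.le hss hθ
    refine ⟨(formBound_one_ball hE hball).mono Subset.rfl (ENNReal.ofReal_le_ofReal ?_),
      fun H hH => (formBound_ball hR hE hball hH).mono Subset.rfl ?_⟩
    · calc 2 * R ≤ 2 * (1 + R) * 1 := by linarith
        _ ≤ 2 * (1 + R) * ((s₀ ^ θ₁)⁻¹ * s ^ θ₁) := by gcongr; exact key θ₁ h₁
        _ = (2 * (s₀ ^ θ₁)⁻¹) * (1 + R) * s ^ θ₁ := by ring
        _ ≤ _ := by gcongr; linarith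
    · refine mul_le_mul_left (ENNReal.ofReal_le_ofReal ?_) _
      calc 1 + R = (1 + R) * 1 := by ring
        _ ≤ (1 + R) * ((s₀ ^ θ₂)⁻¹ * s ^ θ₂) := by gcongr; exact key θ₂ h₂
        _ = ((s₀ ^ θ₂)⁻¹) * (1 + R) * s ^ θ₂ := by ring
        _ ≤ _ := by gcongr; linarith

/-! ### Gains without resonances and near a resonant point. -/

/-- Below the threshold the level regions are empty, so any gain may be claimed. -/
theorem NonResonant.levelBound {φ : FreqPlane → ℝ} {U : Set FreqPlane} (h : NonResonant φ U)
    {θ₁ θ₂ : ℝ} (h₁ : 0 ≤ θ₁) (h₂ : 0 ≤ θ₂) : LevelBound φ U θ₁ θ₂ := by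
  obtain ⟨κ, hκ, h⟩ := h
  refine levelBound_of_small h₁ h₂ (half_pos hκ) le_rfl fun R s hR hs hsκ E hE hES => ?_
  have : E = ∅ := eq_empty_of_forall_notMem fun p hp => by
    have h3 := h _ (hES hp).1
    have h4 := (hES hp).2.2
    linarith
  subst this
  exact ⟨(FormBound.empty _).mono Subset.rfl zero_le, fun H _ =>
    (FormBound.empty _).mono Subset.rfl zero_le⟩

theorem NonResonant.pointwiseBound {a b c : ℝ → ℝ} (ha : ContDiff ℝ ∞ a) (hb : ContDiff ℝ ∞ b)
    (hc : ContDiff ℝ ∞ c) {U : Set FreqPlane} (h : NonResonant (phase a b c) U) {q : ℝ≥0∞}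
    (hq : 2 ≤ q) : PointwiseBound 1 a b c U q fun _ => 1 :=
  -- The exponents `2` are chosen only to exceed `1`, so that the dyadic sum converges.
  pointwiseBound_const ha hb hc (h.levelBound zero_le_two zero_le_two) hq (by
    rw [interpExp]; linarith)

theorem volume_le_of_pairwise {S : Set ℝ} {D : ℝ} (h : ∀ x ∈ S, ∀ y ∈ S, |x - y| ≤ D) :
    volume S ≤ ENNReal.ofReal D := by
  refine (Real.volume_le_diam S).trans (Metric.ediam_le fun x hx y hy => ?_)
  rw [edist_dist, Real.dist_eq]
  exact ENNReal.ofReal_le_ofReal (h x hx y hy)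

/-- By compactness of the unit sphere the Hessian `B` satisfies `B v v ≥ c ‖v‖²`. Differentiability
of the gradient at `p₀` keeps half of this near `p₀`: the derivative along `w` at `p₀ + τ w` is at
least `(c/2) τ ‖w‖²`, and integration over the segment gives `c/4`. -/
theorem exists_quadratic_lower {E : Type*} [NormedAddCommGroup E] [NormedSpace ℝ E]
    [FiniteDimensional ℝ E] {ψ : E → ℝ} (hψ : ContDiff ℝ 2 ψ) {p₀ : E} (h0 : ψ p₀ = 0)
    (h1 : fderiv ℝ ψ p₀ = 0) (h2 : ∀ v, v ≠ 0 → 0 < iteratedFDeriv ℝ 2 ψ p₀ ![v, v]) :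
    ∃ r : ℝ, 0 < r ∧ ∃ c : ℝ, 0 < c ∧ ∀ p, dist p p₀ < r → c * dist p p₀ ^ 2 ≤ ψ p := by
  set B := fderiv ℝ (fderiv ℝ ψ) p₀ with hB
  have hpos : ∀ v, v ≠ 0 → 0 < B v v := fun v hv => by
    have := h2 v hv
    rwa [iteratedFDeriv_two_apply] at this
  obtain ⟨c, hc, hcB⟩ : ∃ c : ℝ, 0 < c ∧ ∀ v, c * ‖v‖ ^ 2 ≤ B v v := by
    rcases (Metric.sphere (0 : E) 1).eq_empty_or_nonempty with he | hne
    · refine ⟨1, one_pos, fun v => ?_⟩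
      have : v = 0 := by
        by_contra hv
        have : (‖v‖⁻¹ • v) ∈ Metric.sphere (0 : E) 1 := by
          simp [norm_smul, hv]
        rw [he] at this
        exact this
      simp [this]
    · have hcont : Continuous fun v => B v v := by fun_prop
      obtain ⟨v₀, hv₀, hmin⟩ := (isCompact_sphere (0 : E) 1).exists_isMinOn hne hcont.continuousOn
      have hv₀0 : v₀ ≠ 0 := by
        rintro rfl
        simp at hv₀
      refine ⟨B v₀ v₀, hpos v₀ hv₀0, fun v => ?_⟩
      by_cases hv : v = 0
      · simp [hv]
      have hn : ‖v‖ ≠ 0 := by simpa using hv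
      have := hmin (show (‖v‖⁻¹ • v) ∈ Metric.sphere (0 : E) 1 by simp [norm_smul, hv])
      simp only [mem_ofPred_eq, map_smul, smul_apply, smul_eq_mul] at this
      calc _ ≤ (‖v‖⁻¹ * (‖v‖⁻¹ * B v v)) * ‖v‖ ^ 2 := by gcongr
        _ = _ := by field_simp
  have hd : HasFDerivAt (fderiv ℝ ψ) B p₀ :=
    ((hψ.fderiv_right (m := 1) (by norm_num)).differentiable (by norm_num) p₀).hasFDerivAt
  have hlo := hd.isLittleO.bound (half_pos hc)
  obtain ⟨r, hr, hball⟩ := Metric.eventually_nhds_iff.1 hlo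
  refine ⟨r, hr, c / 4, by positivity, fun p hp => ?_⟩
  set w := p - p₀ with hw
  have hwn : dist p p₀ = ‖w‖ := dist_eq_norm _ _
  rw [hwn] at hp ⊢
  have hderiv : ∀ τ : ℝ, HasDerivAt (fun τ : ℝ => ψ (p₀ + τ • w) - c / 4 * ‖w‖ ^ 2 * τ ^ 2)
      (fderiv ℝ ψ (p₀ + τ • w) w - c / 4 * ‖w‖ ^ 2 * (2 * τ)) τ := fun τ => by
    have h3 : HasDerivAt (fun τ : ℝ => p₀ + τ • w) w τ := by
      simpa using ((hasDerivAt_id τ).smul_const w).const_add p₀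
    have h4 := ((hψ.differentiable (by norm_num) (p₀ + τ • w)).hasFDerivAt).comp_hasDerivAt τ h3
    refine h4.sub (HasDerivAt.const_mul _ ?_)
    simpa using hasDerivAt_pow 2 τ
  have hmono : MonotoneOn (fun τ : ℝ => ψ (p₀ + τ • w) - c / 4 * ‖w‖ ^ 2 * τ ^ 2) (Icc 0 1) := by
    refine monotoneOn_of_deriv_nonneg (convex_Icc 0 1)
      (fun τ _ => (hderiv τ).continuousAt.continuousWithinAt)
      (fun τ _ => (hderiv τ).differentiableAt.differentiableWithinAt) fun τ hτ => ?_
    rw [interior_Icc] at hτ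
    rw [(hderiv τ).deriv]
    have h5 : dist (p₀ + τ • w) p₀ < r := by
      rw [dist_eq_norm, add_sub_cancel_left, norm_smul, Real.norm_of_nonneg hτ.1.le]
      nlinarith [hτ.2, norm_nonneg w, hτ.1]
    have h6 := hball h5
    rw [h1, sub_zero, add_sub_cancel_left, norm_smul, Real.norm_of_nonneg hτ.1.le, map_smul] at h6
    have h7 := (ContinuousLinearMap.le_opNorm (fderiv ℝ ψ (p₀ + τ • w) - τ • B w) w).trans
      (mul_le_mul_of_nonneg_right h6 (norm_nonneg w))
    have h8 := (abs_le.1 h7).1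
    simp only [sub_apply, smul_apply, smul_eq_mul] at h8
    have h9 := mul_le_mul_of_nonneg_left (hcB w) hτ.1.le
    nlinarith
  have := hmono (left_mem_Icc.2 zero_le_one) (right_mem_Icc.2 zero_le_one) zero_le_one
  simp only [zero_smul, add_zero, h0, one_smul] at this
  have h10 : p₀ + w = p := by rw [hw]; abel
  rw [h10] at this
  linarith

theorem ResonantPoint.exists_quadratic_lower {φ : FreqPlane → ℝ} (hφ : ContDiff ℝ 2 φ)
    {U : Set FreqPlane} (h : ResonantPoint φ U) :
    ∃ p₀ : FreqPlane, ∃ s₀ : ℝ, 0 < s₀ ∧ ∃ c : ℝ, 0 < c ∧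
      ∀ p ∈ U, |φ p| ≤ s₀ → c * dist p p₀ ^ 2 ≤ |φ p| := by
  obtain ⟨p₀, h0, h1, h2, h3⟩ := h
  have key : ∃ r : ℝ, 0 < r ∧ ∃ c : ℝ, 0 < c ∧ ∀ p, dist p p₀ < r → c * dist p p₀ ^ 2 ≤ |φ p| := by
    rcases h2 with h2 | h2
    · obtain ⟨r, hr, c, hc, h⟩ := _root_.exists_quadratic_lower hφ h0 h1 h2
      exact ⟨r, hr, c, hc, fun p hp => (h p hp).trans (le_abs_self _)⟩
    · obtain ⟨r, hr, c, hc, h⟩ := _root_.exists_quadratic_lower (ψ := -φ) hφ.neg (p₀ := p₀)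
        (by simp [h0]) (by rw [fderiv_neg, h1, neg_zero]) fun v hv => by
          rw [iteratedFDeriv_neg]
          simpa using h2 v hv
      exact ⟨r, hr, c, hc, fun p hp => (h p hp).trans (neg_le_abs _)⟩
  obtain ⟨r, hr, c, hc, h⟩ := key
  obtain ⟨κ, hκ, h4⟩ := h3 r hr
  refine ⟨p₀, κ / 2, half_pos hκ, c, hc, fun p hp hps => h p ?_⟩
  by_contra hne
  have := h4 p hp (not_lt.1 hne)
  linarith

/-- The set `|φ| ≤ s` lies in a disc of radius `O(√s)`, so all its axis-parallel slices have length
`O(√s)`. Schur's test gives the full power `s^{1/2}`; the bound into `L²` gives its square root. -/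
theorem ResonantPoint.levelBound {φ : FreqPlane → ℝ} (hφ : ContDiff ℝ 2 φ)
    {U : Set FreqPlane} (h : ResonantPoint φ U) : LevelBound φ U (1 / 2) (1 / 4) := by
  obtain ⟨p₀, s₀, hs₀, c, hc, h⟩ := h.exists_quadratic_lower hφ
  refine levelBound_of_small (C := 2 * (c⁻¹ ^ (1 / 2 : ℝ)) + (2 * (c⁻¹ ^ (1 / 2 : ℝ))) ^ (1 / 2 : ℝ))
    (by norm_num) (by norm_num) hs₀ (by positivity) fun R s hR hs hss E hE hES => ?_
  set D : ℝ := (c⁻¹ ^ (1 / 2 : ℝ)) * s ^ (1 / 2 : ℝ) with hD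
  have hD0 : 0 ≤ D := by positivity
  have hdist : ∀ p ∈ E, dist (!₂[p.1, p.2] : FreqPlane) p₀ ≤ D := fun p hp => by
    obtain ⟨h1, _, h2⟩ := hES hp
    have h3 := (h _ h1 (h2.trans hss)).trans h2
    rw [hD, ← Real.mul_rpow (by positivity) hs.le, ← Real.sqrt_eq_rpow]
    refine Real.le_sqrt_of_sq_le ?_
    rw [inv_mul_eq_div, le_div_iff₀ hc]
    linarith
  have h1 : ∀ p ∈ E, |p.1 - p₀ 0| ≤ D := fun p hp =>
    (PiLp.norm_apply_le ((!₂[p.1, p.2] : FreqPlane) - p₀) 0).trans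
      (by simpa [dist_eq_norm] using hdist p hp)
  have h2 : ∀ p ∈ E, |p.2 - p₀ 1| ≤ D := fun p hp =>
    (PiLp.norm_apply_le ((!₂[p.1, p.2] : FreqPlane) - p₀) 1).trans
      (by simpa [dist_eq_norm] using hdist p hp)
  have hS₁ : ∀ x, volume {y | (x, y) ∈ E} ≤ ENNReal.ofReal (2 * D) := fun x =>
    volume_le_of_pairwise fun y hy z hz => by
      have := abs_le.1 (h2 _ hy); have := abs_le.1 (h2 _ hz)
      exact abs_le.2 ⟨by simp only at *; linarith, by simp only at *; linarith⟩
  have hS₂ : ∀ y, volume {x | (x, y) ∈ E} ≤ ENNReal.ofReal (2 * D) := fun x =>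
    volume_le_of_pairwise fun y hy z hz => by
      have := abs_le.1 (h1 _ hy); have := abs_le.1 (h1 _ hz)
      exact abs_le.2 ⟨by simp only at *; linarith, by simp only at *; linarith⟩
  have hsr := Real.rpow_nonneg hs.le (1 / 2)
  have hsr' := Real.rpow_nonneg hs.le (1 / 4)
  have hcr : 0 ≤ c⁻¹ ^ (1 / 2 : ℝ) := by positivity
  have hcr' : 0 ≤ (2 * c⁻¹ ^ (1 / 2 : ℝ)) ^ (1 / 2 : ℝ) := by positivity
  refine ⟨(formBound_one_of_slices hE hS₁ hS₂).mono Subset.rfl ?_, fun H hH =>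
    (formBound_of_slices_fst hE hS₁ hH).mono Subset.rfl (mul_le_mul_left ?_ _)⟩
  · rw [← ENNReal.rpow_add_of_nonneg _ _ (by norm_num) (by norm_num), add_halves, ENNReal.rpow_one]
    refine ENNReal.ofReal_le_ofReal ?_
    calc 2 * D = 2 * c⁻¹ ^ (1 / 2 : ℝ) * 1 * s ^ (1 / 2 : ℝ) := by rw [hD]; ring
      _ ≤ _ := by gcongr <;> linarith
  · rw [ENNReal.ofReal_rpow_of_nonneg (by positivity) (by norm_num)]
    refine ENNReal.ofReal_le_ofReal ?_
    calc (2 * D) ^ (1 / 2 : ℝ) = (2 * c⁻¹ ^ (1 / 2 : ℝ)) ^ (1 / 2 : ℝ) * 1 * s ^ (1 / 4 : ℝ) := by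
          rw [hD, ← mul_assoc, Real.mul_rpow (by positivity) hsr, ← Real.rpow_mul hs.le]
          norm_num
      _ ≤ _ := by gcongr <;> linarith

/-! ### Localisation to grid cells. -/

/-- The part of `F` on which `κ` takes the value `j`. -/
noncomputable def fiberPart {ι : Type*} (κ : ℝ → ι) (j : ι) (F : ℝ → ℝ≥0∞) : ℝ → ℝ≥0∞ :=
  (κ ⁻¹' {j}).indicator F

theorem measurable_fiberPart {ι : Type*} [MeasurableSpace ι] [MeasurableSingletonClass ι]
    {κ : ℝ → ι} (hκ : Measurable κ) (j : ι) {F : ℝ → ℝ≥0∞} (hF : Measurable F) :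
    Measurable (fiberPart κ j F) :=
  hF.indicator (hκ (measurableSet_singleton j))

theorem sum_l2n_fiberPart_sq_le {ι : Type*} [MeasurableSpace ι] [MeasurableSingletonClass ι]
    {κ : ℝ → ι} (hκ : Measurable κ) {F : ℝ → ℝ≥0∞} (hF : Measurable F) (s : Finset ι) :
    ∑ j ∈ s, l2n (fiberPart κ j F) ^ (2 : ℝ) ≤ l2n F ^ (2 : ℝ) := by
  classical
  simp_rw [l2n_rpow_two]
  rw [← lintegral_finsetSum s fun j _ => (measurable_fiberPart hκ j hF).pow_const _]
  refine lintegral_mono fun x => ?_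
  have h : ∀ j, fiberPart κ j F x ^ (2 : ℝ) = if κ x = j then F x ^ (2 : ℝ) else 0 := fun j => by
    by_cases hj : κ x = j <;> simp [fiberPart, hj]
  simp only [h]
  rw [Finset.sum_ite_eq]
  split_ifs <;> simp

theorem sum_l2n_fiberPart_le {ι : Type*} [MeasurableSpace ι] [MeasurableSingletonClass ι]
    {κ : ℝ → ι} (hκ : Measurable κ) {F : ℝ → ℝ≥0∞} (hF : Measurable F) (s : Finset ι) :
    ∑ j ∈ s, l2n (fiberPart κ j F) ≤ (s.card : ℝ≥0∞) ^ (1 / 2 : ℝ) * l2n F := by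
  have := ENNReal.inner_le_Lp_mul_Lq s (fun _ => 1) (fun j => l2n (fiberPart κ j F))
    Real.HolderConjugate.two_two
  simp only [one_mul, ENNReal.one_rpow, Finset.sum_const, nsmul_eq_mul, mul_one] at this
  refine this.trans (mul_le_mul_right ?_ _)
  calc _ ≤ (l2n F ^ (2 : ℝ)) ^ (1 / 2 : ℝ) := by
        gcongr; exact sum_l2n_fiberPart_sq_le hκ hF s
    _ = l2n F := by rw [← ENNReal.rpow_mul]; norm_num

/-- The square cells of a grid of mesh `h`. -/
def gridCell (h : ℝ) (j k : ℤ) : Set (ℝ × ℝ) := {p | ⌊p.1 / h⌋ = j ∧ ⌊p.2 / h⌋ = k}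

theorem measurable_floor_div (h : ℝ) : Measurable fun x : ℝ => ⌊x / h⌋ :=
  Int.measurable_floor.comp (by fun_prop)

theorem measurableSet_gridCell (h : ℝ) (j k : ℤ) : MeasurableSet (gridCell h j k) :=
  (((measurable_floor_div h).comp measurable_fst) (measurableSet_singleton j)).inter
    (((measurable_floor_div h).comp measurable_snd) (measurableSet_singleton k))

theorem abs_sub_le_of_floor_div_eq {h x y : ℝ} (hh : 0 < h) (hxy : ⌊x / h⌋ = ⌊y / h⌋) :
    |x - y| ≤ h := by
  have := Int.abs_sub_lt_one_of_floor_eq_floor hxy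
  rw [← sub_div, abs_div, abs_of_pos hh, div_lt_one hh] at this
  exact this.le

/-- There are about `(R/h)²` cells, but the loss is linear in `R/h`. Only the restrictions of `F`
and `G` to the sides of a cell enter, and the sum of products of their norms factors as `(∑ⱼ
‖Fⱼ‖)(∑ₖ ‖Gₖ‖)`; by Cauchy–Schwarz and disjointness each factor costs the square root of the number
of intervals. -/
theorem FormBound.of_grid {H : ℝ → ℝ≥0∞} (hH : Measurable H) {E : Set (ℝ × ℝ)} (hE : MeasurableSet E) {h R : ℝ}
    (hh : 0 < h) (hR : 0 < R) (hER : ∀ p ∈ E, |p.1| ≤ R ∧ |p.2| ≤ R) {A : ℝ≥0∞}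
    (hA : ∀ j k, FormBound H (E ∩ gridCell h j k) A) :
    FormBound H E (ENNReal.ofReal (2 * R / h + 2) * A) := fun F G hF hG => by
  set κ : ℝ → ℤ := fun x => ⌊x / h⌋ with hκ
  have hκm : Measurable κ := measurable_floor_div h
  set J : Finset ℤ := Finset.Icc ⌊-R / h⌋ ⌊R / h⌋ with hJ
  have hcard : (J.card : ℝ≥0∞) ≤ ENNReal.ofReal (2 * R / h + 2) := by
    rw [← ENNReal.ofReal_natCast]
    refine ENNReal.ofReal_le_ofReal ?_
    have h1 : ⌊-R / h⌋ ≤ ⌊R / h⌋ := Int.floor_mono (by gcongr; linarith)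
    have h2 : ((J.card : ℤ) : ℝ) = ⌊R / h⌋ + 1 - ⌊-R / h⌋ := by
      rw [hJ, Int.card_Icc, Int.toNat_of_nonneg (by linarith)]; push_cast; ring
    have h3 := Int.floor_le (R / h)
    have h4 := Int.lt_floor_add_one (-R / h)
    have h5 : ((J.card : ℤ) : ℝ) = (J.card : ℝ) := by push_cast; rfl
    rw [← h5, h2]
    have h6 : -R / h = -(R / h) := by ring
    have h7 : 2 * R / h = 2 * (R / h) := by ring
    rw [h6] at h4 ⊢
    rw [h7]
    linarith
  have hmem : ∀ x, |x| ≤ R → κ x ∈ J := fun x hx => by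
    have := abs_le.1 hx
    exact Finset.mem_Icc.2 ⟨Int.floor_mono (by gcongr; linarith), Int.floor_mono (by gcongr; linarith)⟩
  have hcov : ∀ p ∈ E, F p.1 * G p.2 * H (p.1 + p.2) = ∑ q ∈ J ×ˢ J, (gridCell h q.1 q.2).indicator
      (fun p => fiberPart κ q.1 F p.1 * fiberPart κ q.2 G p.2 * H (p.1 + p.2)) p := fun p hp => by
    rw [Finset.sum_eq_single (κ p.1, κ p.2)]
    · rw [indicator_of_mem (show p ∈ gridCell h (κ p.1) (κ p.2) from ⟨rfl, rfl⟩)]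
      simp [fiberPart]
    · rintro ⟨j, k⟩ - hne
      refine indicator_of_notMem (fun hm => hne ?_) _
      rw [Prod.ext_iff]
      exact ⟨hm.1.symm, hm.2.symm⟩
    · intro hn
      exact absurd (Finset.mk_mem_product (hmem _ (hER p hp).1) (hmem _ (hER p hp).2)) hn
  have hone : ∀ q : ℤ × ℤ, ∫⁻ p in E, (gridCell h q.1 q.2).indicator
      (fun p => fiberPart κ q.1 F p.1 * fiberPart κ q.2 G p.2 * H (p.1 + p.2)) p
      ≤ A * (l2n (fiberPart κ q.1 F) * l2n (fiberPart κ q.2 G)) := fun q => by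
    rw [lintegral_indicator (measurableSet_gridCell h q.1 q.2),
      Measure.restrict_restrict (measurableSet_gridCell h q.1 q.2), inter_comm]
    exact hA q.1 q.2 _ _ (measurable_fiberPart hκm _ hF) (measurable_fiberPart hκm _ hG)
  rw [setLIntegral_congr_fun hE hcov]
  calc ∫⁻ p in E, ∑ q ∈ J ×ˢ J, (gridCell h q.1 q.2).indicator
        (fun p => fiberPart κ q.1 F p.1 * fiberPart κ q.2 G p.2 * H (p.1 + p.2)) p
      ≤ ∑ q ∈ J ×ˢ J, A * (l2n (fiberPart κ q.1 F) * l2n (fiberPart κ q.2 G)) := by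
        rw [lintegral_finsetSum]
        · exact Finset.sum_le_sum fun q _ => hone q
        · intro q _
          refine Measurable.indicator ?_ (measurableSet_gridCell h q.1 q.2)
          exact (((measurable_fiberPart hκm _ hF).comp measurable_fst).mul
            ((measurable_fiberPart hκm _ hG).comp measurable_snd)).mul (hH.comp (by fun_prop))
    _ = A * ((∑ j ∈ J, l2n (fiberPart κ j F)) * ∑ k ∈ J, l2n (fiberPart κ k G)) := by
        rw [← Finset.mul_sum, Finset.sum_product, Finset.sum_mul_sum]
    _ ≤ A * (((J.card : ℝ≥0∞) ^ (1 / 2 : ℝ) * l2n F) * ((J.card : ℝ≥0∞) ^ (1 / 2 : ℝ) * l2n G)) := by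
        gcongr
        · exact sum_l2n_fiberPart_le hκm hF J
        · exact sum_l2n_fiberPart_le hκm hG J
    _ = ((J.card : ℝ≥0∞) ^ (1 / 2 : ℝ) * (J.card : ℝ≥0∞) ^ (1 / 2 : ℝ)) * A * (l2n F * l2n G) := by
        ring
    _ = (J.card : ℝ≥0∞) * A * (l2n F * l2n G) := by
        rw [← ENNReal.rpow_add_of_nonneg _ _ (by norm_num) (by norm_num)]; norm_num
    _ ≤ _ := by gcongr

/-! ### Slices of neighbourhoods of arcs. -/

/-- The points at distance at most `δ` from the arc `γ([α, β])`. -/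
def arcNbhd (γ : ℝ → FreqPlane) (α β δ : ℝ) : Set (ℝ × ℝ) :=
  {p | ∃ τ ∈ Icc α β, dist (!₂[p.1, p.2] : FreqPlane) (γ τ) ≤ δ}

theorem measurableSet_arcNbhd {γ : ℝ → FreqPlane} (hγ : Continuous γ) (α β : ℝ) {δ : ℝ}
    (hδ : 0 ≤ δ) : MeasurableSet (arcNbhd γ α β δ) := by
  have h := (isCompact_Icc.image hγ : IsCompact (γ '' Icc α β)).cthickening_eq_biUnion_closedBall hδ
  have h2 : arcNbhd γ α β δ
      = (fun p : ℝ × ℝ => (!₂[p.1, p.2] : FreqPlane)) ⁻¹' Metric.cthickening δ (γ '' Icc α β) := by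
    ext p
    rw [h]
    simp [arcNbhd]
  rw [h2]
  exact (Metric.isClosed_cthickening.preimage continuous_pt).measurableSet

theorem hasDerivAt_coord {γ : ℝ → FreqPlane} {γ' : FreqPlane} {τ : ℝ} (h : HasDerivAt γ γ' τ)
    (i : Fin 2) : HasDerivAt (fun τ => γ τ i) (γ' i) τ :=
  ((EuclideanSpace.proj i : FreqPlane →L[ℝ] ℝ).hasFDerivAt.comp_hasDerivAt τ h)

theorem hasDerivAt_deriv_of_contDiff {F : Type*} [NormedAddCommGroup F] [NormedSpace ℝ F]
    {γ : ℝ → F} (hγ : ContDiff ℝ 2 γ) (τ : ℝ) :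
    HasDerivAt γ (deriv γ τ) τ ∧ HasDerivAt (deriv γ) (iteratedDeriv 2 γ τ) τ := by
  refine ⟨(hγ.differentiable (by norm_num) τ).hasDerivAt, ?_⟩
  have h1 : Differentiable ℝ (iteratedDeriv 1 γ) :=
    hγ.differentiable_iteratedDeriv 1 (by norm_num)
  rw [iteratedDeriv_one] at h1
  have := (h1 τ).hasDerivAt
  rwa [show iteratedDeriv 2 γ τ = deriv (deriv γ) τ by
    rw [iteratedDeriv_succ, iteratedDeriv_one]]

/-- Slices of neighbourhoods of arcs, in a line on which the `i`-th coordinate is constant. -/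
structure IsSliceLine (i : Fin 2) (P : ℝ → FreqPlane) : Prop where
  le_dist : ∀ y y', |y - y'| ≤ dist (P y) (P y')
  const : ∀ y y', P y i = P y' i

theorem isSliceLine_fst (x : ℝ) : IsSliceLine 0 fun y => !₂[x, y] :=
  ⟨fun y y' => (PiLp.norm_apply_le ((!₂[x, y] : FreqPlane) - !₂[x, y']) 1).trans_eq'
    (by simp) |>.trans_eq (dist_eq_norm _ _).symm, fun y y' => by simp⟩

theorem isSliceLine_snd (y : ℝ) : IsSliceLine 1 fun x => !₂[x, y] :=
  ⟨fun x x' => (PiLp.norm_apply_le ((!₂[x, y] : FreqPlane) - !₂[x', y]) 0).trans_eq'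
    (by simp) |>.trans_eq (dist_eq_norm _ _).symm, fun y y' => by simp⟩

section

variable {i : Fin 2} {P γ : ℝ → FreqPlane} {α β δ κ : ℝ}

/-- Length along the slice is controlled by the parameter of the arc, which has unit speed.
Conversely, as the `i`-th coordinate is frozen on the line, that coordinate of the arc can vary by
at most `2δ`; this is what confines the parameter below. -/
theorem IsSliceLine.abs_sub_le (hP : IsSliceLine i P) (hγ : Differentiable ℝ γ)
    (hu : ∀ τ ∈ Icc α β, ‖deriv γ τ‖ = 1) {y y' τ τ' : ℝ} (hτ : τ ∈ Icc α β) (hτ' : τ' ∈ Icc α β)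
    (h : dist (P y) (γ τ) ≤ δ) (h' : dist (P y') (γ τ') ≤ δ) :
    |y - y'| ≤ 2 * δ + |τ - τ'| ∧ |γ τ i - γ τ' i| ≤ 2 * δ := by
  have h1 : dist (γ τ) (γ τ') ≤ |τ - τ'| := by
    have := Convex.norm_image_sub_le_of_norm_deriv_le (f := γ) (C := 1) (s := Icc α β)
      (fun x _ => hγ x) (fun x hx => (hu x hx).le) (convex_Icc α β) hτ' hτ
    rwa [one_mul, Real.norm_eq_abs, ← dist_eq_norm] at this
  have h2 : ∀ p q : FreqPlane, |p i - q i| ≤ dist p q := fun p q => by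
    rw [dist_eq_norm]; exact PiLp.norm_apply_le (p - q) i
  refine ⟨?_, ?_⟩
  · have := hP.le_dist y y'
    have h3 := dist_triangle (P y) (γ τ) (P y')
    have h4 := dist_triangle (γ τ) (γ τ') (P y')
    rw [dist_comm (γ τ') (P y')] at h4
    linarith
  · have h3 := abs_le.1 ((h2 (P y) (γ τ)).trans h)
    have h4 := abs_le.1 ((h2 (P y') (γ τ')).trans h')
    have h5 := hP.const y y'
    exact abs_le.2 ⟨by linarith, by linarith⟩

theorem IsSliceLine.volume_le (hP : IsSliceLine i P) (hγ : Differentiable ℝ γ)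
    (hu : ∀ τ ∈ Icc α β, ‖deriv γ τ‖ = 1) :
    volume {y | ∃ τ ∈ Icc α β, dist (P y) (γ τ) ≤ δ} ≤ ENNReal.ofReal (2 * δ + (β - α)) := by
  refine volume_le_of_pairwise ?_
  rintro y ⟨τ, hτ, h⟩ y' ⟨τ', hτ', h'⟩
  refine (hP.abs_sub_le hγ hu hτ hτ' h h').1.trans ?_
  have : |τ - τ'| ≤ β - α := abs_le.2 ⟨by linarith [hτ.1, hτ'.2], by linarith [hτ.2, hτ'.1]⟩
  linarith

/-- By the mean value theorem a variation of at most `2δ` in the `i`-th coordinate confines the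
parameter to an interval of length `2δ/κ`. -/
theorem IsSliceLine.volume_le_of_transversal (hP : IsSliceLine i P) (hγ : Differentiable ℝ γ)
    (hu : ∀ τ ∈ Icc α β, ‖deriv γ τ‖ = 1) (hκ : 0 < κ) (hT : ∀ τ ∈ Icc α β, κ ≤ |deriv γ τ i|) :
    volume {y | ∃ τ ∈ Icc α β, dist (P y) (γ τ) ≤ δ} ≤ ENNReal.ofReal ((2 + 2 / κ) * δ) := by
  have hlow : ∀ τ ∈ Icc α β, ∀ τ' ∈ Icc α β, τ < τ' → κ * |τ - τ'| ≤ |γ τ i - γ τ' i| := by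
    intro τ hτ τ' hτ' hlt
    obtain ⟨σ, hσ, he⟩ := exists_hasDerivAt_eq_slope (fun τ => γ τ i) (fun τ => deriv γ τ i) hlt
      (fun x _ => (hasDerivAt_coord (hγ x).hasDerivAt i).continuousAt.continuousWithinAt)
      (fun x _ => hasDerivAt_coord (hγ x).hasDerivAt i)
    have h1 := hT σ ⟨hτ.1.trans hσ.1.le, hσ.2.le.trans hτ'.2⟩
    rw [he, abs_div, le_div_iff₀ (abs_pos.2 (by linarith))] at h1
    rwa [abs_sub_comm τ, abs_sub_comm (γ τ i)]
  refine volume_le_of_pairwise ?_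
  rintro y ⟨τ, hτ, h⟩ y' ⟨τ', hτ', h'⟩
  obtain ⟨h1, h2⟩ := hP.abs_sub_le hγ hu hτ hτ' h h'
  have h3 : κ * |τ - τ'| ≤ |γ τ i - γ τ' i| := by
    rcases lt_trichotomy τ τ' with hlt | rfl | hlt
    · exact hlow τ hτ τ' hτ' hlt
    · simp
    · rw [abs_sub_comm τ, abs_sub_comm (γ τ i)]; exact hlow τ' hτ' τ hτ hlt
  have h4 : |τ - τ'| ≤ 2 / κ * δ := by
    rw [div_mul_eq_mul_div, le_div_iff₀ hκ]; linarith
  linarith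

/-- Growth of a convex function away from a point at which it is nondecreasing. -/
theorem quadratic_growth {h h' h'' : ℝ → ℝ} (hd : ∀ τ ∈ Icc α β, HasDerivAt h (h' τ) τ)
    (hd' : ∀ τ ∈ Icc α β, HasDerivAt h' (h'' τ) τ) (hc : ∀ τ ∈ Icc α β, κ ≤ h'' τ)
    (hαβ : α ≤ β) (h0 : 0 ≤ h' α) : κ / 2 * (β - α) ^ 2 ≤ h β - h α := by
  have hm : MonotoneOn (fun τ => h' τ - κ * (τ - α)) (Icc α β) := by
    have hD : ∀ τ ∈ Icc α β, HasDerivAt (fun τ => h' τ - κ * (τ - α)) (h'' τ - κ) τ :=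
      fun τ hτ => (hd' τ hτ).sub
        (by simpa using ((hasDerivAt_id τ).sub_const α).const_mul κ)
    refine monotoneOn_of_deriv_nonneg (convex_Icc α β)
      (fun τ hτ => (hD τ hτ).continuousAt.continuousWithinAt)
      (fun τ hτ => (hD τ (interior_subset hτ)).differentiableAt.differentiableWithinAt)
      fun τ hτ => ?_
    rw [(hD τ (interior_subset hτ)).deriv]
    linarith [hc τ (interior_subset hτ)]
  have hm2 : MonotoneOn (fun τ => h τ - κ / 2 * (τ - α) ^ 2) (Icc α β) := by
    have hD : ∀ τ ∈ Icc α β, HasDerivAt (fun τ => h τ - κ / 2 * (τ - α) ^ 2)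
        (h' τ - κ * (τ - α)) τ := fun τ hτ => by
      refine ((hd τ hτ).sub ((((hasDerivAt_id τ).sub_const α).pow 2).const_mul (κ / 2))).congr_deriv ?_
      simp; ring
    refine monotoneOn_of_deriv_nonneg (convex_Icc α β)
      (fun τ hτ => (hD τ hτ).continuousAt.continuousWithinAt)
      (fun τ hτ => (hD τ (interior_subset hτ)).differentiableAt.differentiableWithinAt)
      fun τ hτ => ?_
    rw [(hD τ (interior_subset hτ)).deriv]
    have := hm (left_mem_Icc.2 hαβ) (interior_subset hτ) (interior_subset hτ).1
    simp only [sub_self, mul_zero, sub_zero] at this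
    linarith
  have := hm2 (left_mem_Icc.2 hαβ) (right_mem_Icc.2 hαβ) hαβ
  simp only [sub_self] at this
  linarith

/-- When `h'` has the same sign at both ends there is no turning back in between, and strong
convexity forces quadratic growth from the end where `|h'|` is smaller. The nonpositive case follows
by reflection. -/
theorem sq_le_abs_sub_of_convex {h h' h'' : ℝ → ℝ} (hd : ∀ τ, HasDerivAt h (h' τ) τ)
    (hd' : ∀ τ, HasDerivAt h' (h'' τ) τ) {τ τ' : ℝ} (hc : ∀ σ ∈ uIcc τ τ', κ ≤ h'' σ)
    (hs : 0 ≤ h' τ ∧ 0 ≤ h' τ' ∨ h' τ ≤ 0 ∧ h' τ' ≤ 0) :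
    κ / 2 * (τ - τ') ^ 2 ≤ |h τ - h τ'| := by
  wlog hle : τ ≤ τ' generalizing τ τ'
  · have := this (by rwa [uIcc_comm]) (hs.imp And.symm And.symm) (le_of_not_ge hle)
    rw [abs_sub_comm]
    linarith [sq_nonneg (τ - τ')]
  rw [uIcc_of_le hle] at hc
  rw [abs_sub_comm]
  rcases hs with ⟨h0, -⟩ | ⟨-, h0⟩
  · have := quadratic_growth (fun σ _ => hd σ) (fun σ _ => hd' σ) hc hle h0
    exact (by linarith [le_abs_self (h τ' - h τ)])
  · have := quadratic_growth (h := fun σ => h (-σ)) (h' := fun σ => -h' (-σ))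
      (h'' := fun σ => h'' (-σ)) (α := -τ') (β := -τ) (κ := κ)
      (fun σ _ => ((hd (-σ)).scomp σ (hasDerivAt_neg σ)).congr_deriv (by simp))
      (fun σ _ => (((hd' (-σ)).scomp σ (hasDerivAt_neg σ)).neg).congr_deriv (by simp))
      (fun σ hσ => hc _ ⟨by linarith [hσ.2], by linarith [hσ.1]⟩) (by linarith) (by simpa using h0)
    simp only [neg_neg] at this
    have h1 := neg_le_abs (h τ' - h τ)
    linarith

/-- The arc may be tangent to the slicing line. Splitting the parameters by the sign of the
derivative of the `i`-th coordinate, quadratic growth confines each half to a length `√(4δ/κ)`; the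
slice is then covered by two sets of small diameter. -/
theorem IsSliceLine.volume_le_of_curved (hP : IsSliceLine i P) (hγ : ContDiff ℝ 2 γ)
    (hu : ∀ τ ∈ Icc α β, ‖deriv γ τ‖ = 1) (hκ : 0 < κ) (hδ : 0 ≤ δ)
    (hA : (∀ τ ∈ Icc α β, κ ≤ iteratedDeriv 2 γ τ i) ∨
      ∀ τ ∈ Icc α β, iteratedDeriv 2 γ τ i ≤ -κ) :
    volume {y | ∃ τ ∈ Icc α β, dist (P y) (γ τ) ≤ δ}
      ≤ ENNReal.ofReal (2 * (2 * δ + Real.sqrt (4 * δ / κ))) := by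
  obtain ⟨ε, hε, hA⟩ : ∃ ε : ℝ, |ε| = 1 ∧ ∀ τ ∈ Icc α β, κ ≤ ε * iteratedDeriv 2 γ τ i := by
    rcases hA with hA | hA
    · exact ⟨1, by simp, fun τ hτ => by simpa using hA τ hτ⟩
    · exact ⟨-1, by simp, fun τ hτ => by linarith [hA τ hτ]⟩
  set h : ℝ → ℝ := fun τ => ε * γ τ i
  set h' : ℝ → ℝ := fun τ => ε * deriv γ τ i with hh'
  have hd : ∀ τ, HasDerivAt h (h' τ) τ := fun τ =>
    (hasDerivAt_coord (hasDerivAt_deriv_of_contDiff hγ τ).1 i).const_mul ε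
  have hd' : ∀ τ, HasDerivAt h' (ε * iteratedDeriv 2 γ τ i) τ := fun τ =>
    (hasDerivAt_coord (hasDerivAt_deriv_of_contDiff hγ τ).2 i).const_mul ε
  have habs : ∀ τ τ', |h τ - h τ'| = |γ τ i - γ τ' i| := fun τ τ' => by
    rw [← mul_sub, abs_mul, hε, one_mul]
  have hroot : ∀ τ τ' : ℝ, κ / 2 * (τ - τ') ^ 2 ≤ 2 * δ → |τ - τ'| ≤ Real.sqrt (4 * δ / κ) :=
    fun τ τ' hle => by
      refine Real.abs_le_sqrt ?_
      rw [le_div_iff₀ hκ]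
      nlinarith
  have hsplit : {y | ∃ τ ∈ Icc α β, dist (P y) (γ τ) ≤ δ} ⊆
      {y | ∃ τ ∈ Icc α β, 0 ≤ h' τ ∧ dist (P y) (γ τ) ≤ δ} ∪
      {y | ∃ τ ∈ Icc α β, h' τ ≤ 0 ∧ dist (P y) (γ τ) ≤ δ} := by
    rintro y ⟨τ, hτ, hy⟩
    rcases le_total 0 (h' τ) with h0 | h0
    · exact Or.inl ⟨τ, hτ, h0, hy⟩
    · exact Or.inr ⟨τ, hτ, h0, hy⟩
  have hγd : Differentiable ℝ γ := hγ.differentiable (by norm_num)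
  have hsq := Real.sqrt_nonneg (4 * δ / κ)
  refine (measure_mono hsplit).trans ((measure_union_le _ _).trans ?_)
  rw [two_mul, ENNReal.ofReal_add (by positivity) (by positivity)]
  refine add_le_add (volume_le_of_pairwise ?_) (volume_le_of_pairwise ?_)
  · rintro y ⟨τ, hτ, h0, hy⟩ y' ⟨τ', hτ', h0', hy'⟩
    obtain ⟨h1, h2⟩ := hP.abs_sub_le hγd hu hτ hτ' hy hy'
    refine h1.trans (add_le_add le_rfl ?_)
    rw [← habs] at h2
    exact hroot τ τ' ((sq_le_abs_sub_of_convex hd hd' (fun σ hσ => hA σ (uIcc_subset_Icc hτ hτ' hσ))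
      (Or.inl ⟨h0, h0'⟩)).trans h2)
  · rintro y ⟨τ, hτ, h0, hy⟩ y' ⟨τ', hτ', h0', hy'⟩
    obtain ⟨h1, h2⟩ := hP.abs_sub_le hγd hu hτ hτ' hy hy'
    refine h1.trans (add_le_add le_rfl ?_)
    rw [← habs] at h2
    exact hroot τ τ' ((sq_le_abs_sub_of_convex hd hd' (fun σ hσ => hA σ (uIcc_subset_Icc hτ hτ' hσ))
      (Or.inr ⟨h0, h0'⟩)).trans h2)

end

/-! ### Thin arcs and the gains of a resonant curve. -/

/-- The slices of `E` along one axis have length at most `B δ`, along the other `B δ^σ`. -/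
def HasThinSlices (B δ σ : ℝ) (E : Set (ℝ × ℝ)) : Prop :=
  ((∀ x, volume {y | (x, y) ∈ E} ≤ ENNReal.ofReal (B * δ)) ∧
    ∀ y, volume {x | (x, y) ∈ E} ≤ ENNReal.ofReal (B * δ ^ σ)) ∨
  ((∀ x, volume {y | (x, y) ∈ E} ≤ ENNReal.ofReal (B * δ ^ σ)) ∧
    ∀ y, volume {x | (x, y) ∈ E} ≤ ENNReal.ofReal (B * δ))

theorem HasThinSlices.formBound_one {B δ σ : ℝ} {E : Set (ℝ × ℝ)} (h : HasThinSlices B δ σ E)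
    (hE : MeasurableSet E) (hB : 0 ≤ B) (hδ : 0 < δ) :
    FormBound (fun _ => 1) E (ENNReal.ofReal (B * δ ^ ((1 + σ) / 2))) := by
  have key : (B * δ) ^ (1 / 2 : ℝ) * (B * δ ^ σ) ^ (1 / 2 : ℝ) = B * δ ^ ((1 + σ) / 2) := by
    rw [Real.mul_rpow hB hδ.le, Real.mul_rpow hB (by positivity), ← Real.rpow_mul hδ.le]
    calc _ = (B ^ (1 / 2 : ℝ) * B ^ (1 / 2 : ℝ)) * (δ ^ (1 / 2 : ℝ) * δ ^ (σ * (1 / 2))) := by ring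
      _ = _ := by
        rw [← Real.rpow_add_of_nonneg hB (by norm_num) (by norm_num), ← Real.rpow_add hδ,
          add_halves, Real.rpow_one]
        congr 2; ring
  have h1 : 0 ≤ B * δ := by positivity
  have h2 : 0 ≤ B * δ ^ σ := by positivity
  rcases h with ⟨hx, hy⟩ | ⟨hx, hy⟩
  · refine (formBound_one_of_slices hE hx hy).mono Subset.rfl (le_of_eq ?_)
    rw [ENNReal.ofReal_rpow_of_nonneg h1 (by norm_num),
      ENNReal.ofReal_rpow_of_nonneg h2 (by norm_num), ← ENNReal.ofReal_mul (by positivity), key]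
  · refine (formBound_one_of_slices hE hx hy).mono Subset.rfl (le_of_eq ?_)
    rw [ENNReal.ofReal_rpow_of_nonneg h1 (by norm_num),
      ENNReal.ofReal_rpow_of_nonneg h2 (by norm_num), ← ENNReal.ofReal_mul (by positivity),
      mul_comm, key]

/-- The bound into `L²` needs only the thin family of slices, so the gain `δ^{1/2}` does not depend
on `σ`. The condition `1 ≤ B` merely replaces `√B` by `B`. -/
theorem HasThinSlices.formBound {B δ σ : ℝ} {E : Set (ℝ × ℝ)} (h : HasThinSlices B δ σ E)
    (hE : MeasurableSet E) (hB : 1 ≤ B) (hδ : 0 < δ) {H : ℝ → ℝ≥0∞} (hH : Measurable H) :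
    FormBound H E (ENNReal.ofReal (B * δ ^ (1 / 2 : ℝ)) * l2n H) := by
  have key : ENNReal.ofReal (B * δ) ^ (1 / 2 : ℝ) ≤ ENNReal.ofReal (B * δ ^ (1 / 2 : ℝ)) := by
    rw [ENNReal.ofReal_rpow_of_nonneg (by positivity) (by norm_num),
      Real.mul_rpow (by linarith) hδ.le]
    gcongr
    simpa using Real.rpow_le_rpow_of_exponent_le hB (by norm_num : (1 / 2 : ℝ) ≤ 1)
  rcases h with ⟨hx, -⟩ | ⟨-, hy⟩
  · exact (formBound_of_slices_fst hE hx hH).mono Subset.rfl (mul_le_mul_left key _)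
  · exact (formBound_of_slices_snd hE hy hH).mono Subset.rfl (mul_le_mul_left key _)

theorem hasThinSlices_arcNbhd {i : Fin 2} {γ : ℝ → FreqPlane} {α β δ B σ : ℝ}
    (h₁ : ∀ P, IsSliceLine i P →
      volume {y | ∃ τ ∈ Icc α β, dist (P y) (γ τ) ≤ δ} ≤ ENNReal.ofReal (B * δ))
    (h₂ : ∀ j ≠ i, ∀ P, IsSliceLine j P →
      volume {y | ∃ τ ∈ Icc α β, dist (P y) (γ τ) ≤ δ} ≤ ENNReal.ofReal (B * δ ^ σ)) :
    HasThinSlices B δ σ (arcNbhd γ α β δ) := by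
  fin_cases i
  · exact Or.inl ⟨fun x => h₁ _ (isSliceLine_fst x), fun y => h₂ 1 (by decide) _ (isSliceLine_snd y)⟩
  · exact Or.inr ⟨fun x => h₂ 0 (by decide) _ (isSliceLine_fst x), fun y => h₁ _ (isSliceLine_snd y)⟩

/-- Short pieces of the arcs considered have thin neighbourhoods. -/
def ThinArcs (K : ℝ) (P : FreqPlane → FreqPlane → Prop) (σ : ℝ) : Prop :=
  ∃ B : ℝ, 1 ≤ B ∧ ∃ ε : ℝ, 0 < ε ∧ ∀ (Γ : Set FreqPlane) (γ : ℝ → FreqPlane) (ℓ : ℝ),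
    IsArcIn Γ K P γ ℓ → ∀ α β : ℝ, 0 ≤ α → α ≤ β → β ≤ ℓ → β - α ≤ ε →
      ∀ δ : ℝ, 0 < δ → δ ≤ 1 → HasThinSlices B δ σ (arcNbhd γ α β δ)

/-- Both coordinates move with speed at least `κ`, so the arc is transversal to slices in both
directions. -/
theorem thinArcs_of_nonCharacteristic (K : ℝ) {κ : ℝ} (hκ : 0 < κ) :
    ThinArcs K (fun T _ => κ ≤ |T 0| ∧ κ ≤ |T 1| ∧ κ ≤ |T 0 + T 1|) 1 := by
  have h2 : 0 ≤ 2 / κ := by positivity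
  refine ⟨2 + 2 / κ, by linarith, 1, one_pos, fun Γ γ ℓ h α β hα hαβ hβ _ δ hδ _ => ?_⟩
  have hsub : Icc α β ⊆ Icc 0 ℓ := Icc_subset_Icc hα hβ
  have hT : ∀ i : Fin 2, ∀ τ ∈ Icc α β, κ ≤ |deriv γ τ i| := fun i τ hτ => by
    have := h.prop τ (hsub hτ)
    fin_cases i
    · exact this.1
    · exact this.2.1
  have hl : ∀ i : Fin 2, ∀ P, IsSliceLine i P →
      volume {y | ∃ τ ∈ Icc α β, dist (P y) (γ τ) ≤ δ} ≤ ENNReal.ofReal ((2 + 2 / κ) * δ) :=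
    fun i P hP => hP.volume_le_of_transversal (h.contDiff.differentiable (by norm_num))
      (fun τ hτ => h.unit_speed τ (hsub hτ)) hκ (hT i)
  exact hasThinSlices_arcNbhd (i := 0) (hl 0) fun j _ => by simpa using hl j

theorem sq_add_sq_eq_norm_sq (v : FreqPlane) {i j : Fin 2} (hij : j ≠ i) :
    v i ^ 2 + v j ^ 2 = ‖v‖ ^ 2 := by
  rw [EuclideanSpace.norm_sq_eq, Fin.sum_univ_two]
  simp only [Real.norm_eq_abs, sq_abs]
  fin_cases i <;> fin_cases j <;> simp at hij ⊢
  ring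

/-- On a short arc one component of the tangent stays large. -/
theorem IsArcIn.exists_abs_deriv_ge {Γ : Set FreqPlane} {K : ℝ} {P : FreqPlane → FreqPlane → Prop}
    {γ : ℝ → FreqPlane} {ℓ : ℝ} (h : IsArcIn Γ K P γ ℓ) {α β : ℝ} (hα : 0 ≤ α) (hαβ : α ≤ β)
    (hβ : β ≤ ℓ) (hε : β - α ≤ 1 / (5 * (|K| + 1))) :
    ∃ i : Fin 2, ∀ τ ∈ Icc α β, 1 / 2 ≤ |deriv γ τ i| := by
  have hsub : Icc α β ⊆ Icc 0 ℓ := Icc_subset_Icc hα hβ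
  -- One component of a unit vector is at least `7/10`, as `2 · 0.49 < 1`. Over a length
  -- `1/(5(|K|+1))` the tangent turns by at most `1/5`, and `7/10 - 1/5 = 1/2`.
  have h1 : ∃ i : Fin 2, 7 / 10 ≤ |deriv γ α i| := by
    by_contra! hc
    have h2 := sq_add_sq_eq_norm_sq (deriv γ α) (show (1 : Fin 2) ≠ 0 by decide)
    rw [h.unit_speed α (hsub (left_mem_Icc.2 hαβ))] at h2
    have h3 := abs_lt.1 (hc 0)
    have h4 := abs_lt.1 (hc 1)
    nlinarith
  obtain ⟨i, hi⟩ := h1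
  refine ⟨i, fun τ hτ => ?_⟩
  have hd := hasDerivAt_deriv_of_contDiff h.contDiff
  have h2 := Convex.norm_image_sub_le_of_norm_deriv_le (f := deriv γ) (C := |K|) (s := Icc α β)
      (fun x _ => (hd x).2.differentiableAt)
      (fun x hx => by
        rw [(hd x).2.deriv]
        exact (h.curvature_le x (hsub hx)).trans (le_abs_self K))
      (convex_Icc α β) (left_mem_Icc.2 hαβ) hτ
  have h3 : ‖τ - α‖ ≤ 1 / (5 * (|K| + 1)) := by
    rw [Real.norm_of_nonneg (by linarith [hτ.1])]; linarith [hτ.2]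
  have h4 : |K| * ‖τ - α‖ ≤ 1 / 5 := by
    have hK := abs_nonneg K
    calc _ ≤ (|K| + 1) * (1 / (5 * (|K| + 1))) := by gcongr; linarith
      _ = _ := by field_simp
  have h5 := (PiLp.norm_apply_le (deriv γ τ - deriv γ α) i).trans (h2.trans h4)
  rw [PiLp.sub_apply, Real.norm_eq_abs] at h5
  have h6 := abs_sub_abs_le_abs_sub (deriv γ α i) (deriv γ τ i)
  rw [abs_sub_comm] at h5
  linarith

theorem one_div_five_mul_le_one (K : ℝ) : 1 / (5 * (|K| + 1)) ≤ 1 := by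
  rw [div_le_one (by positivity)]
  linarith [abs_nonneg K]

/-- A short arc is transversal to one of the two families of lines, with constant `2 + 2/(1/2) = 6`.
In the other direction it may be straight along the slice, and nothing better than its length is
available. -/
theorem thinArcs_general (K : ℝ) : ThinArcs K (fun _ _ => True) 0 := by
  refine ⟨6, by norm_num, 1 / (5 * (|K| + 1)), by positivity,
    fun Γ γ ℓ h α β hα hαβ hβ hε δ hδ hδ1 => ?_⟩
  have hsub : Icc α β ⊆ Icc 0 ℓ := Icc_subset_Icc hα hβ
  have hd : Differentiable ℝ γ := h.contDiff.differentiable (by norm_num)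
  obtain ⟨i, hi⟩ := h.exists_abs_deriv_ge hα hαβ hβ hε
  have h1 := one_div_five_mul_le_one K
  refine hasThinSlices_arcNbhd (i := i) (fun P hP => ?_) fun j _ P hP => ?_
  · refine (hP.volume_le_of_transversal hd (fun τ hτ => h.unit_speed τ (hsub hτ))
      (by norm_num) hi).trans (le_of_eq ?_)
    norm_num
  · refine (hP.volume_le hd (fun τ hτ => h.unit_speed τ (hsub hτ))).trans
      (ENNReal.ofReal_le_ofReal ?_)
    rw [Real.rpow_zero]
    linarith

theorem le_or_le_neg_of_le_abs {X : Type*} [TopologicalSpace X] {s : Set X} (hs : IsPreconnected s)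
    {f : X → ℝ} (hf : ContinuousOn f s) {κ : ℝ} (hκ : 0 < κ) (h : ∀ x ∈ s, κ ≤ |f x|) :
    (∀ x ∈ s, κ ≤ f x) ∨ ∀ x ∈ s, f x ≤ -κ := by
  by_contra! hc
  obtain ⟨⟨x, hx, hx1⟩, y, hy, hy1⟩ := hc
  have h1 : f x ≤ -κ := by
    rcases le_abs.1 (h x hx) with h2 | h2 <;> linarith
  have h2 : κ ≤ f y := by
    rcases le_abs.1 (h y hy) with h2 | h2 <;> linarith
  obtain ⟨z, hz, hz0⟩ := hs.intermediate_value hx hy hf (show (0 : ℝ) ∈ Icc (f x) (f y) from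
    ⟨by linarith, by linarith⟩)
  have := h z hz
  rw [hz0, abs_zero] at this
  linarith

/-- Unit speed makes the curvature vector orthogonal to the tangent, so in the plane `|A j| = ‖A‖ |T
i|`: where one component of the tangent is large, the curvature is visible in the other coordinate.
-/
theorem IsArcIn.abs_curvature_ge {Γ : Set FreqPlane} {K κ : ℝ} (hκ : 0 < κ)
    {γ : ℝ → FreqPlane} {ℓ : ℝ} (h : IsArcIn Γ K (fun _ A => κ ≤ ‖A‖) γ ℓ) {τ : ℝ}
    (hτ : τ ∈ Icc 0 ℓ) {i j : Fin 2} (hij : j ≠ i) (hi : 1 / 2 ≤ |deriv γ τ i|) :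
    κ / 2 ≤ |iteratedDeriv 2 γ τ j| := by
  set T := deriv γ τ with hT
  set A := iteratedDeriv 2 γ τ with hA
  have hd := fun k => hasDerivAt_coord (hasDerivAt_deriv_of_contDiff h.contDiff τ).2 k
  have h1 : HasDerivWithinAt (fun σ => deriv γ σ i ^ 2 + deriv γ σ j ^ 2)
      (2 * T i * A i + 2 * T j * A j) (Icc 0 ℓ) τ := by
    exact (((hd i).pow 2).add ((hd j).pow 2)).hasDerivWithinAt.congr_deriv (by simp [hT, hA])
  -- Unit speed is known on `[0, ℓ]` only, so at the end points the derivatives are compared within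
  -- the interval.
  have h2 : HasDerivWithinAt (fun σ => deriv γ σ i ^ 2 + deriv γ σ j ^ 2) 0 (Icc 0 ℓ) τ := by
    refine (hasDerivWithinAt_const τ (Icc 0 ℓ) (1 : ℝ)).congr (fun σ hσ => ?_) ?_
    · rw [sq_add_sq_eq_norm_sq _ hij, h.unit_speed σ hσ, one_pow]
    · rw [sq_add_sq_eq_norm_sq _ hij, h.unit_speed τ hτ, one_pow]
  have h3 := (uniqueDiffOn_Icc h.length_pos τ hτ).eq_deriv _ h1 h2
  have h4 := sq_add_sq_eq_norm_sq T hij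
  rw [hT, h.unit_speed τ hτ, ← hT] at h4
  have h5 := sq_add_sq_eq_norm_sq A hij
  have h6 : κ ≤ ‖A‖ := h.prop τ hτ
  have h7 : A j ^ 2 = ‖A‖ ^ 2 * T i ^ 2 := by
    have h8 : T i * A i = -(T j * A j) := by linarith
    have h9 : (T i * A i) ^ 2 = (T j * A j) ^ 2 := by rw [h8]; ring
    calc A j ^ 2 = A j ^ 2 * (T i ^ 2 + T j ^ 2) := by rw [h4]; ring
      _ = A j ^ 2 * T i ^ 2 + (T j * A j) ^ 2 := by ring
      _ = (A i ^ 2 + A j ^ 2) * T i ^ 2 := by rw [← h9]; ring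
      _ = _ := by rw [h5]
  have h8 : |A j| = ‖A‖ * |T i| := by
    rw [← abs_norm A, ← abs_mul, ← sq_eq_sq_iff_abs_eq_abs, h7]; ring
  rw [h8]
  nlinarith

/-- Slices freezing the coordinate `i` in which the tangent is large are transversal. Along the
other slices the frozen coordinate has second derivative at least `κ/2` in modulus, and of constant
sign by connectedness, which gives `O(√δ)`. -/
theorem thinArcs_of_curved (K : ℝ) {κ : ℝ} (hκ : 0 < κ) :
    ThinArcs K (fun _ A => κ ≤ ‖A‖) (1 / 2) := by
  have hs := Real.sqrt_nonneg (8 / κ)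
  refine ⟨6 + 2 * Real.sqrt (8 / κ), by linarith, 1 / (5 * (|K| + 1)), by positivity,
    fun Γ γ ℓ h α β hα hαβ hβ hε δ hδ hδ1 => ?_⟩
  have hsub : Icc α β ⊆ Icc 0 ℓ := Icc_subset_Icc hα hβ
  have hd : Differentiable ℝ γ := h.contDiff.differentiable (by norm_num)
  obtain ⟨i, hi⟩ := h.exists_abs_deriv_ge hα hαβ hβ hε
  refine hasThinSlices_arcNbhd (i := i) (fun P hP => ?_) fun j hj P hP => ?_
  · refine (hP.volume_le_of_transversal hd (fun τ hτ => h.unit_speed τ (hsub hτ))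
      (by norm_num) hi).trans (ENNReal.ofReal_le_ofReal ?_)
    refine mul_le_mul_of_nonneg_right ?_ hδ.le
    rw [show (2 : ℝ) / (1 / 2) = 4 by norm_num]
    linarith
  · have hA := le_or_le_neg_of_le_abs (isPreconnected_Icc (a := α) (b := β))
      (f := fun τ => iteratedDeriv 2 γ τ j)
      (((EuclideanSpace.proj j : FreqPlane →L[ℝ] ℝ).continuous.comp
        (h.contDiff.continuous_iteratedDeriv 2 le_rfl)).continuousOn) (half_pos hκ)
      fun τ hτ => h.abs_curvature_ge hκ (hsub hτ) hj (hi τ hτ)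
    refine (hP.volume_le_of_curved h.contDiff (fun τ hτ => h.unit_speed τ (hsub hτ))
      (half_pos hκ) hδ.le hA).trans (ENNReal.ofReal_le_ofReal ?_)
    rw [← Real.sqrt_eq_rpow, show 4 * δ / (κ / 2) = 8 / κ * δ by field_simp; ring,
      Real.sqrt_mul (by positivity)]
    have h1 : δ ≤ Real.sqrt δ := Real.le_sqrt_of_sq_le (by nlinarith)
    nlinarith [Real.sqrt_nonneg δ]

theorem arcNbhd_subset_biUnion {γ : ℝ → FreqPlane} {ℓ ε : ℝ} (hε : 0 < ε) {n : ℕ}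
    (hn : ℓ < n * ε) (δ : ℝ) :
    arcNbhd γ 0 ℓ δ ⊆ ⋃ j ∈ (Finset.range n).filter (fun j : ℕ => (j : ℝ) * ε ≤ ℓ),
      arcNbhd γ (j * ε) (min ((j + 1) * ε) ℓ) δ := by
  rintro p ⟨τ, hτ, hp⟩
  have h0 : 0 ≤ τ / ε := by have := hτ.1; positivity
  have h1 := Nat.floor_le h0
  have h2 := Nat.lt_floor_add_one (τ / ε)
  rw [le_div_iff₀ hε] at h1
  rw [div_lt_iff₀ hε] at h2
  have h3 : ⌊τ / ε⌋₊ < n := by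
    rw [Nat.floor_lt h0, div_lt_iff₀ hε]
    exact hτ.2.trans_lt hn
  simp only [mem_iUnion, Finset.mem_filter, Finset.mem_range]
  exact ⟨⌊τ / ε⌋₊, ⟨h3, h1.trans hτ.2⟩, τ, ⟨h1, le_min h2.le hτ.2⟩, hp⟩

theorem formBound_of_subset_biUnion {H : ℝ → ℝ≥0∞} {ι : Type*} {s : Finset ι} {n : ℕ}
    (hs : s.card ≤ n) {E : Set (ℝ × ℝ)} {E' : ι → Set (ℝ × ℝ)} (hE : E ⊆ ⋃ i ∈ s, E' i) {A : ℝ≥0∞}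
    (h : ∀ i ∈ s, FormBound H (E' i) A) : FormBound H E (n * A) := by
  refine (FormBound.biUnion s h).mono hE ?_
  rw [Finset.sum_const, nsmul_eq_mul]
  gcongr

/-- Neighbourhoods of whole arcs. -/
theorem ThinArcs.formBound {K : ℝ} {P : FreqPlane → FreqPlane → Prop} {σ : ℝ}
    (h : ThinArcs K P σ) : ∃ B : ℝ, 0 ≤ B ∧ ∀ (Γ : Set FreqPlane) (γ : ℝ → FreqPlane) (ℓ : ℝ),
      IsArcIn Γ K P γ ℓ → ∀ δ : ℝ, 0 < δ → δ ≤ 1 →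
        FormBound (fun _ => 1) (arcNbhd γ 0 ℓ δ) (ENNReal.ofReal (B * δ ^ ((1 + σ) / 2))) ∧
        ∀ H, Measurable H → FormBound H (arcNbhd γ 0 ℓ δ)
          (ENNReal.ofReal (B * δ ^ (1 / 2 : ℝ)) * l2n H) := by
  obtain ⟨B, hB, ε, hε, h⟩ := h
  -- The arcs have length at most `K`, so the number of pieces of length `ε` is bounded
  -- independently of the arc.
  obtain ⟨n, hn⟩ := exists_nat_gt (|K| / ε)
  rw [div_lt_iff₀ hε] at hn
  refine ⟨n * B, by positivity, fun Γ γ ℓ hγ δ hδ hδ1 => ?_⟩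
  have hcov := arcNbhd_subset_biUnion (γ := γ) hε
    ((hγ.length_le.trans (le_abs_self K)).trans_lt hn) δ
  have hcard : ((Finset.range n).filter (fun j : ℕ => (j : ℝ) * ε ≤ ℓ)).card ≤ n :=
    (Finset.card_filter_le _ _).trans (Finset.card_range n).le
  have hthin : ∀ j ∈ (Finset.range n).filter (fun j : ℕ => (j : ℝ) * ε ≤ ℓ),
      HasThinSlices B δ σ (arcNbhd γ (j * ε) (min ((j + 1) * ε) ℓ) δ) := fun j hj => by
    refine h Γ γ ℓ hγ _ _ (by positivity) (le_min (by gcongr; linarith) (Finset.mem_filter.1 hj).2)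
      (min_le_right _ _) ?_ δ hδ hδ1
    have := min_le_left (((j : ℝ) + 1) * ε) ℓ
    linarith
  have hm : ∀ j : ℕ, MeasurableSet (arcNbhd γ (j * ε) (min ((j + 1) * ε) ℓ) δ) := fun j =>
    measurableSet_arcNbhd hγ.contDiff.continuous _ _ hδ.le
  have hcast : ∀ x : ℝ, 0 ≤ x → (n : ℝ≥0∞) * ENNReal.ofReal (B * x) = ENNReal.ofReal (n * B * x) :=
    fun x hx => by
      rw [mul_assoc, ENNReal.ofReal_mul (Nat.cast_nonneg n), ENNReal.ofReal_natCast]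
  refine ⟨?_, fun H hH => ?_⟩
  · rw [← hcast _ (by positivity)]
    exact formBound_of_subset_biUnion hcard hcov fun j hj =>
      (hthin j hj).formBound_one (hm j) (by linarith) hδ
  · rw [← hcast _ (by positivity), mul_assoc]
    exact formBound_of_subset_biUnion hcard hcov fun j hj =>
      (hthin j hj).formBound (hm j) hB hδ hH

theorem dist_pt_le_of_mem_gridCell {h : ℝ} (hh : 0 < h) {j k : ℤ} {p q : ℝ × ℝ}
    (hp : p ∈ gridCell h j k) (hq : q ∈ gridCell h j k) :
    dist (!₂[p.1, p.2] : FreqPlane) !₂[q.1, q.2] ≤ 2 * h := by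
  have h1 := abs_sub_le_of_floor_div_eq hh (hp.1.trans hq.1.symm)
  have h2 := abs_sub_le_of_floor_div_eq hh (hp.2.trans hq.2.symm)
  rw [EuclideanSpace.dist_eq, Fin.sum_univ_two]
  refine Real.sqrt_le_iff.2 ⟨by positivity, ?_⟩
  simp only [Matrix.cons_val_zero, Matrix.cons_val_one, Real.dist_eq]
  have := abs_nonneg (p.1 - q.1)
  have := abs_nonneg (p.2 - q.2)
  nlinarith

/-- Order-one vanishing places the points with `|φ| ≤ s` within `δ = s/κ` of the zero set. In a grid
cell of side `r/4` only the zero set within `r` of one point of `U` matters, hence a bounded number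
of arcs; the cells are then recombined at a cost linear in `R`. -/
theorem VanishesAtOrderOne.levelBound {φ : FreqPlane → ℝ} {U : Set FreqPlane}
    (hφ : VanishesAtOrderOne φ U) {P : FreqPlane → FreqPlane → Prop}
    (hcurve : IsUniformCurve {p | φ p = 0} U P) {σ : ℝ} (hσ : 0 ≤ σ)
    (hthin : ∀ K, ThinArcs K P σ) : LevelBound φ U ((1 + σ) / 2) (1 / 2) := by
  obtain ⟨κ, hκ, hφ⟩ := hφ
  obtain ⟨r, hr, K, n, hcurve⟩ := hcurve
  obtain ⟨B, hB, harc⟩ := (hthin K).formBound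
  -- The three bounds exclude the alternative `|φ| ≥ κ`, ensure `δ ≤ 1`, and ensure `δ ≤ r/4`. With
  -- cells of diameter at most `r/2`, the last one keeps the nearby zeros inside the ball of radius
  -- `r`.
  set s₀ : ℝ := min (κ / 2) (min κ (κ * (r / 4))) with hs₀
  have hs₀0 : 0 < s₀ := by positivity
  set C : ℝ → ℝ := fun θ => (8 / r + 2) * (n * B * κ⁻¹ ^ θ) with hC
  have hC0 : ∀ θ, 0 ≤ C θ := fun θ => by simp only [hC]; positivity
  refine levelBound_of_small (C := C ((1 + σ) / 2) + C (1 / 2)) (by positivity) (by norm_num) hs₀0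
    (add_nonneg (hC0 _) (hC0 _)) fun R s hR hs hss E hE hES => ?_
  have hs1 : s ≤ κ / 2 := hss.trans (min_le_left _ _)
  have hs2 : s ≤ κ := hss.trans ((min_le_right _ _).trans (min_le_left _ _))
  have hs3 : s ≤ κ * (r / 4) := hss.trans ((min_le_right _ _).trans (min_le_right _ _))
  set δ := κ⁻¹ * s with hδ
  have hδ0 : 0 < δ := by positivity
  have hδ1 : δ ≤ 1 := by rw [hδ, inv_mul_le_iff₀ hκ]; linarith
  have hδr : δ ≤ r / 4 := by rw [hδ, inv_mul_le_iff₀ hκ]; linarith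
  have hball : ∀ p ∈ E, |p.1| ≤ R ∧ |p.2| ≤ R := fun p hp => abs_le_of_mem_closedBall (hES hp).2.1
  have hnear : ∀ p ∈ E, ∃ z, φ z = 0 ∧ dist (!₂[p.1, p.2] : FreqPlane) z ≤ δ := fun p hp => by
    obtain ⟨h1, -, h2⟩ := hES hp
    rcases hφ _ h1 with h3 | ⟨z, hz, h3⟩
    · linarith
    · refine ⟨z, hz, ?_⟩
      rw [hδ, inv_mul_eq_div, le_div_iff₀ hκ]
      linarith
  have hcell : ∀ j k : ℤ, ∃ N : ℕ, N ≤ n ∧ ∃ (γ : Fin N → ℝ → FreqPlane) (ℓ : Fin N → ℝ),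
      (∀ i, IsArcIn {p | φ p = 0} K P (γ i) (ℓ i)) ∧
      E ∩ gridCell (r / 4) j k ⊆ ⋃ i ∈ (Finset.univ : Finset (Fin N)), arcNbhd (γ i) 0 (ℓ i) δ := by
    intro j k
    rcases (E ∩ gridCell (r / 4) j k).eq_empty_or_nonempty with he | ⟨p₀, hp₀⟩
    · exact ⟨0, Nat.zero_le _, Fin.elim0, Fin.elim0, fun i => i.elim0, by simp [he]⟩
    obtain ⟨N, hN, γ, ℓ, harcs, hcov⟩ := hcurve _ (hES hp₀.1).1
    refine ⟨N, hN, γ, ℓ, harcs, fun p hp => ?_⟩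
    obtain ⟨z, hz, hpz⟩ := hnear p hp.1
    have h1 := dist_pt_le_of_mem_gridCell (by positivity) hp.2 hp₀.2
    have h2 : z ∈ Metric.ball (!₂[p₀.1, p₀.2] : FreqPlane) r := by
      rw [Metric.mem_ball, dist_comm]
      have := dist_triangle (!₂[p₀.1, p₀.2] : FreqPlane) !₂[p.1, p.2] z
      rw [dist_comm (!₂[p₀.1, p₀.2] : FreqPlane) !₂[p.1, p.2]] at this
      linarith
    obtain ⟨i, hi⟩ := mem_iUnion.1 (hcov ⟨hz, h2⟩)
    obtain ⟨τ, hτ, rfl⟩ := hi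
    simp only [mem_iUnion]
    exact ⟨i, Finset.mem_univ i, τ, hτ, hpz⟩
  have hnum : ∀ θ X, 0 ≤ X → C θ ≤ X →
      ENNReal.ofReal (2 * R / (r / 4) + 2) * (n * ENNReal.ofReal (B * δ ^ θ))
        ≤ ENNReal.ofReal (X * (1 + R) * s ^ θ) := fun θ X hX0 hX => by
    rw [← ENNReal.ofReal_natCast, ← ENNReal.ofReal_mul (by positivity),
      ← ENNReal.ofReal_mul (by positivity)]
    refine ENNReal.ofReal_le_ofReal ?_
    rw [hδ, Real.mul_rpow (by positivity) hs.le]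
    have h1 : 2 * R / (r / 4) + 2 ≤ (8 / r + 2) * (1 + R) := by
      have h2 : 2 * R / (r / 4) = 8 / r * R := by field_simp; ring
      have h3 : 0 < 8 / r := by positivity
      rw [h2]; nlinarith
    calc _ ≤ (8 / r + 2) * (1 + R) * (n * (B * (κ⁻¹ ^ θ * s ^ θ))) := by gcongr
      _ = C θ * (1 + R) * s ^ θ := by simp only [hC]; ring
      _ ≤ _ := by gcongr
  refine ⟨(FormBound.of_grid measurable_const hE (h := r / 4) (by positivity) hR hball
      (A := n * ENNReal.ofReal (B * δ ^ ((1 + σ) / 2))) fun j k => ?_).mono Subset.rfl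
      (hnum _ _ (add_nonneg (hC0 _) (hC0 _)) (by linarith [hC0 (1 / 2)])), fun H hH =>
    (FormBound.of_grid hH hE (h := r / 4) (by positivity) hR hball
      (A := n * (ENNReal.ofReal (B * δ ^ (1 / 2 : ℝ)) * l2n H)) fun j k => ?_).mono Subset.rfl ?_⟩
  · obtain ⟨N, hN, γ, ℓ, harcs, hcov⟩ := hcell j k
    exact formBound_of_subset_biUnion (by simpa using hN) hcov fun i _ =>
      (harc _ _ _ (harcs i) δ hδ0 hδ1).1
  · obtain ⟨N, hN, γ, ℓ, harcs, hcov⟩ := hcell j k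
    exact formBound_of_subset_biUnion (by simpa using hN) hcov fun i _ =>
      (harc _ _ _ (harcs i) δ hδ0 hδ1).2 H hH
  · rw [← mul_assoc, ← mul_assoc]
    refine mul_le_mul_left ?_ _
    rw [mul_assoc]
    exact hnum _ _ (add_nonneg (hC0 _) (hC0 _)) (by linarith [hC0 ((1 + σ) / 2)])

/-! ### The estimates of part (A) for resonant points and curves. -/

section

variable {a b c : ℝ → ℝ} {U : Set FreqPlane} {q : ℝ≥0∞}

theorem ResonantPoint.pointwiseBound (ha : ContDiff ℝ ∞ a) (hb : ContDiff ℝ ∞ b)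
    (hc : ContDiff ℝ ∞ c) (h : ResonantPoint (phase a b c) U) (hq : 2 ≤ q) :
    PointwiseBound 1 a b c U q fun t => t ^ (1 / 2 + invExp q / 2) := by
  have hφ : ContDiff ℝ 2 (phase a b c) := by
    have h0 : ∀ i : Fin 2, ContDiff ℝ 2 fun p : FreqPlane => p i := fun i =>
      (EuclideanSpace.proj i : FreqPlane →L[ℝ] ℝ).contDiff
    exact (((contDiff_infty.1 ha 2).comp ((h0 0).add (h0 1))).neg.add
      ((contDiff_infty.1 hb 2).comp (h0 0))).add
      ((contDiff_infty.1 hc 2).comp (h0 1))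
  have h1 := invExp_nonneg q
  have h2 := invExp_le_half hq
  exact pointwiseBound_rpow ha hb hc (h.levelBound hφ) hq (by rw [interpExp]; ring)
    (by linarith) (by linarith)

theorem VanishesAtOrderOne.pointwiseBound_of_nonCharacteristic (ha : ContDiff ℝ ∞ a)
    (hb : ContDiff ℝ ∞ b) (hc : ContDiff ℝ ∞ c) (h : VanishesAtOrderOne (phase a b c) U)
    (hΓ : NonCharacteristicCurve (resonantSet a b c) U) (hq : 2 ≤ q) :
    (q ≠ ⊤ → PointwiseBound 1 a b c U q fun t => t ^ invExp q) ∧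
    (q = ⊤ → PointwiseBound 1 a b c U q fun t => Real.sqrt (1 + Real.log t ^ 2)) := by
  obtain ⟨κ, hκ, hΓ⟩ := hΓ
  have hLB := h.levelBound hΓ zero_le_one fun K => thinArcs_of_nonCharacteristic K hκ
  have h2 := invExp_le_half hq
  refine ⟨fun hqt => pointwiseBound_rpow ha hb hc hLB hq (by rw [interpExp]; ring)
    (invExp_pos hq hqt) (by linarith), fun hqt => pointwiseBound_log ha hb hc hLB hq ?_⟩
  rw [interpExp, hqt, invExp_top]; norm_num

theorem VanishesAtOrderOne.pointwiseBound_of_curved (ha : ContDiff ℝ ∞ a)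
    (hb : ContDiff ℝ ∞ b) (hc : ContDiff ℝ ∞ c) (h : VanishesAtOrderOne (phase a b c) U)
    (hΓ : CurvedCurve (resonantSet a b c) U) (hq : 2 ≤ q) :
    PointwiseBound 1 a b c U q fun t => t ^ (1 / 4 + invExp q / 2) := by
  obtain ⟨κ, hκ, hΓ⟩ := hΓ
  have h1 := invExp_nonneg q
  have h2 := invExp_le_half hq
  exact pointwiseBound_rpow ha hb hc
    (h.levelBound hΓ (by norm_num : (0 : ℝ) ≤ 1 / 2) fun K => thinArcs_of_curved K hκ) hq
    (by rw [interpExp]; ring) (by linarith) (by linarith)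

theorem VanishesAtOrderOne.pointwiseBound_of_generalCurve (ha : ContDiff ℝ ∞ a)
    (hb : ContDiff ℝ ∞ b) (hc : ContDiff ℝ ∞ c) (h : VanishesAtOrderOne (phase a b c) U)
    (hΓ : GeneralCurve (resonantSet a b c) U) (hq : 2 ≤ q) :
    PointwiseBound 1 a b c U q fun t => t ^ (1 / 2 : ℝ) :=
  pointwiseBound_rpow ha hb hc (h.levelBound hΓ le_rfl thinArcs_general) hq
    (by rw [interpExp]; ring) (by norm_num) (by norm_num)

end

/-! ### Condition (H) at the endpoint `q = 2`. -/

/-- Sublevel sets of functions with large second derivative. -/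
theorem volume_abs_le_of_convex {h h' h'' : ℝ → ℝ} (hd : ∀ τ, HasDerivAt h (h' τ) τ)
    (hd' : ∀ τ, HasDerivAt h' (h'' τ) τ) {κ : ℝ} (hκ : 0 < κ) (hc : ∀ σ, κ ≤ h'' σ) (s : ℝ) :
    volume {y | |h y| ≤ s} ≤ ENNReal.ofReal (2 * Real.sqrt (4 * s / κ)) := by
  have hpair : ∀ y y', |h y| ≤ s → |h y'| ≤ s → (0 ≤ h' y ∧ 0 ≤ h' y' ∨ h' y ≤ 0 ∧ h' y' ≤ 0) →
      |y - y'| ≤ Real.sqrt (4 * s / κ) := fun y y' hy hy' h0 => by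
    have h1 := sq_le_abs_sub_of_convex hd hd' (fun σ _ => hc σ) h0
    have h2 : |h y - h y'| ≤ 2 * s := by
      have := abs_le.1 hy; have := abs_le.1 hy'
      exact abs_le.2 ⟨by linarith, by linarith⟩
    refine Real.abs_le_sqrt ?_
    rw [le_div_iff₀ hκ]
    linarith
  have hsplit : {y | |h y| ≤ s} ⊆ {y | |h y| ≤ s ∧ 0 ≤ h' y} ∪ {y | |h y| ≤ s ∧ h' y ≤ 0} :=
    fun y hy => (le_total 0 (h' y)).imp (fun h0 => ⟨hy, h0⟩) fun h0 => ⟨hy, h0⟩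
  refine (measure_mono hsplit).trans ((measure_union_le _ _).trans ?_)
  rw [two_mul, ENNReal.ofReal_add (Real.sqrt_nonneg _) (Real.sqrt_nonneg _)]
  exact add_le_add
    (volume_le_of_pairwise fun y hy y' hy' => hpair y y' hy.1 hy'.1 (Or.inl ⟨hy.2, hy'.2⟩))
    (volume_le_of_pairwise fun y hy y' hy' => hpair y y' hy.1 hy'.1 (Or.inr ⟨hy.2, hy'.2⟩))

theorem SecondDerivBddAway.sign {a : ℝ → ℝ} (h : SecondDerivBddAway a) (ha : ContDiff ℝ ∞ a) :
    ∃ κ : ℝ, 0 < κ ∧ ∃ ε : ℝ, (ε = 1 ∨ ε = -1) ∧ ∀ x, κ ≤ ε * iteratedDeriv 2 a x := by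
  obtain ⟨κ, hκ, h⟩ := h
  refine ⟨κ, hκ, ?_⟩
  rcases le_or_le_neg_of_le_abs isPreconnected_univ
    ((contDiff_infty.1 ha 2).continuous_iteratedDeriv 2 le_rfl).continuousOn hκ
    (fun x _ => h x) with h1 | h1
  · exact ⟨1, Or.inl rfl, fun x => by simpa using h1 x (mem_univ x)⟩
  · exact ⟨-1, Or.inr rfl, fun x => by linarith [h1 x (mem_univ x)]⟩

theorem ContDiff.hasDerivAt_two {a : ℝ → ℝ} (ha : ContDiff ℝ ∞ a) :
    (∀ τ, HasDerivAt a (deriv a τ) τ) ∧ ∀ τ, HasDerivAt (deriv a) (iteratedDeriv 2 a τ) τ :=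
  ⟨fun τ => (hasDerivAt_deriv_of_contDiff (contDiff_infty.1 ha 2) τ).1,
    fun τ => (hasDerivAt_deriv_of_contDiff (contDiff_infty.1 ha 2) τ).2⟩

/-- One family of slices of length `O(√s)` already gives `s^{1/4}` into `L²`. No gain into `L^∞` is
claimed: under (H) that endpoint comes from dispersion, not from the size of the symbol. -/
theorem levelBound_of_slices {φ : FreqPlane → ℝ} {U : Set FreqPlane} {B : ℝ} (hB : 0 ≤ B)
    (h : (∀ s, 0 < s → ∀ x, volume {y | |φ !₂[x, y]| ≤ s} ≤ ENNReal.ofReal (B * Real.sqrt s)) ∨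
      (∀ s, 0 < s → ∀ y, volume {x | |φ !₂[x, y]| ≤ s} ≤ ENNReal.ofReal (B * Real.sqrt s)) ∨
      ∀ s, 0 < s → ∀ ξ, volume {y | |φ !₂[ξ - y, y]| ≤ s} ≤ ENNReal.ofReal (B * Real.sqrt s)) :
    LevelBound φ U 0 (1 / 4) := by
  refine ⟨2 + B ^ (1 / 2 : ℝ), by positivity, fun R s hR hs hs1 E hE hES => ⟨?_, fun H hH => ?_⟩⟩
  · refine (formBound_one_ball hE fun p hp => abs_le_of_mem_closedBall (hES hp).2.1).mono
      Subset.rfl (ENNReal.ofReal_le_ofReal ?_)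
    rw [Real.rpow_zero]
    have := Real.rpow_nonneg hB (1 / 2)
    nlinarith
  · have key : ENNReal.ofReal (B * Real.sqrt s) ^ (1 / 2 : ℝ)
        ≤ ENNReal.ofReal ((2 + B ^ (1 / 2 : ℝ)) * (1 + R) * s ^ (1 / 4 : ℝ)) := by
      rw [ENNReal.ofReal_rpow_of_nonneg (by positivity) (by norm_num),
        Real.mul_rpow hB (Real.sqrt_nonneg s), Real.sqrt_eq_rpow, ← Real.rpow_mul hs.le,
        show (1 / 2 : ℝ) * (1 / 2) = 1 / 4 by norm_num]
      have := Real.rpow_nonneg hB (1 / 2)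
      gcongr
      nlinarith
    have hmem : ∀ p ∈ E, |φ !₂[p.1, p.2]| ≤ s := fun p hp => (hES hp).2.2
    rcases h with h | h | h
    · exact (formBound_of_slices_fst hE (fun x =>
        le_trans (measure_mono fun y hy => by exact hmem _ hy) (h s hs x)) hH).mono Subset.rfl (mul_le_mul_left key _)
    · exact (formBound_of_slices_snd hE (fun x =>
        le_trans (measure_mono fun y hy => by exact hmem _ hy) (h s hs x)) hH).mono Subset.rfl (mul_le_mul_left key _)
    · exact (formBound_of_slices_sum hE (fun x =>
        le_trans (measure_mono fun y hy => by exact hmem _ hy) (h s hs x)) hH).mono Subset.rfl (mul_le_mul_left key _)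

/-- Along lines with the first coordinate, the second coordinate, or their sum held fixed, the
second derivative of `φ` is `c'' - a''`, `b'' - a''` and `b'' + c''` respectively. Each of `a''`,
`b''`, `c''` has a constant sign. If `a''` is opposite to `c''` or to `b''`, one of the first two
families works; otherwise `b''` and `c''` share a sign and the third does. -/
theorem levelBound_of_secondDeriv {a b c : ℝ → ℝ} (ha : ContDiff ℝ ∞ a) (hb : ContDiff ℝ ∞ b)
    (hc : ContDiff ℝ ∞ c) (hHa : SecondDerivBddAway a) (hHb : SecondDerivBddAway b)
    (hHc : SecondDerivBddAway c) (U : Set FreqPlane) : LevelBound (phase a b c) U 0 (1 / 4) := by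
  obtain ⟨κa, hκa, εa, hεa, hsa⟩ := hHa.sign ha
  obtain ⟨κb, hκb, εb, hεb, hsb⟩ := hHb.sign hb
  obtain ⟨κc, hκc, εc, hεc, hsc⟩ := hHc.sign hc
  set κ := min κa (min κb κc) with hκd
  have hκ : 0 < κ := by positivity
  have h1 : κ ≤ κa := min_le_left _ _
  have h2 : κ ≤ κb := (min_le_right _ _).trans (min_le_left _ _)
  have h3 : κ ≤ κc := (min_le_right _ _).trans (min_le_right _ _)
  have hvol : ∀ {ψ ψ' ψ'' : ℝ → ℝ} {ε : ℝ}, (ε = 1 ∨ ε = -1) → (∀ τ, HasDerivAt ψ (ψ' τ) τ) →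
      (∀ τ, HasDerivAt ψ' (ψ'' τ) τ) → (∀ τ, κ ≤ ε * ψ'' τ) → ∀ s, 0 < s →
      volume {y | |ψ y| ≤ s} ≤ ENNReal.ofReal (2 * Real.sqrt (4 / κ) * Real.sqrt s) := by
    intro ψ ψ' ψ'' ε hε hd hd' hc s hs
    have habs : ∀ y, |ψ y| = |ε * ψ y| := fun y => by
      rcases hε with rfl | rfl <;> simp
    simp_rw [habs]
    refine (volume_abs_le_of_convex (fun τ => (hd τ).const_mul ε) (fun τ => (hd' τ).const_mul ε) hκ
      hc s).trans (le_of_eq ?_)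
    rw [mul_assoc, ← Real.sqrt_mul (by positivity), div_mul_eq_mul_div]
  obtain ⟨da, da'⟩ := ha.hasDerivAt_two
  obtain ⟨db, db'⟩ := hb.hasDerivAt_two
  obtain ⟨dc, dc'⟩ := hc.hasDerivAt_two
  refine levelBound_of_slices (B := 2 * Real.sqrt (4 / κ)) (by positivity) ?_
  simp_rw [phase_pt]
  have hadd : ∀ {f : ℝ → ℝ} {f' : ℝ} {x τ : ℝ}, HasDerivAt f f' (x + τ) →
      HasDerivAt (fun τ => f (x + τ)) f' τ := fun h => h.comp_const_add _ _
  have hadd' : ∀ {f : ℝ → ℝ} {f' : ℝ} {x τ : ℝ}, HasDerivAt f f' (τ + x) →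
      HasDerivAt (fun τ => f (τ + x)) f' τ := fun h => h.comp_add_const _ _
  have hsub : ∀ {f : ℝ → ℝ} {f' : ℝ} {x τ : ℝ}, HasDerivAt f f' (x - τ) →
      HasDerivAt (fun τ => f (x - τ)) (-f') τ := fun h => h.comp_const_sub _ _
  by_cases hac : εa = -εc
  · left
    intro s hs x
    exact hvol hεc (ψ := fun y => -a (x + y) + b x + c y)
      (fun τ => ((hadd (da (x + τ))).neg.add_const (b x)).add (dc τ))
      (fun τ => (hadd (da' (x + τ))).neg.add (dc' τ))
      (fun τ => by
        have h4 := hsa (x + τ); have h5 := hsc τ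
        rw [hac] at h4
        simp only [neg_mul] at *
        linarith) s hs
  by_cases hab : εa = -εb
  · right; left
    intro s hs y
    exact hvol hεb (ψ := fun x => -a (x + y) + b x + c y)
      (fun τ => ((hadd' (da (τ + y))).neg.add (db τ)).add_const (c y))
      (fun τ => (hadd' (da' (τ + y))).neg.add (db' τ))
      (fun τ => by
        have h4 := hsa (τ + y); have h5 := hsb τ
        rw [hab] at h4
        simp only [neg_mul] at *
        linarith) s hs
  · right; right
    intro s hs ξ
    have hbc : εb = εc := by
      rcases hεa with rfl | rfl <;> rcases hεb with rfl | rfl <;> rcases hεc with rfl | rfl <;>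
        norm_num at *
    have := hvol hεc (ψ := fun y => -a (ξ - y + y) + b (ξ - y) + c y)
      (ψ' := fun y => -deriv b (ξ - y) + deriv c y)
      (ψ'' := fun y => iteratedDeriv 2 b (ξ - y) + iteratedDeriv 2 c y)
      (fun τ => by
        simp only [sub_add_cancel]
        exact ((hsub (db (ξ - τ))).const_add (-a ξ)).add (dc τ))
      (fun τ => ((hsub (db' (ξ - τ))).neg.add (dc' τ)).congr_deriv (by simp))
      (fun τ => by
        have h4 := hsb (ξ - τ); have h5 := hsc τ
        rw [hbc] at h4
        linarith) s hs
    exact this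

/-! ### Van der Corput's lemma. -/

section

variable {ψ ψ' ψ'' : ℝ → ℝ} {α β : ℝ}

theorem norm_integral_cis_le (hαβ : α ≤ β) : ‖∫ s in α..β, cis (ψ s)‖ ≤ β - α := by
  have := intervalIntegral.norm_integral_le_of_norm_le_const (a := α) (b := β) (C := 1)
    (f := fun s => cis (ψ s)) (fun s _ => (norm_cis _).le)
  rwa [one_mul, abs_of_nonneg (by linarith)] at this

theorem hasDerivAt_cis_comp {s : ℝ} (hd : HasDerivAt ψ (ψ' s) s) :
    HasDerivAt (fun s => cis (ψ s)) (ψ' s * (Complex.I * cis (ψ s))) s :=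
  ((hasDerivAt_cis (ψ s)).scomp s hd).congr_deriv (Complex.real_smul ..)

/-- Non-stationary phase with a monotone derivative. -/
theorem norm_integral_cis_le_of_deriv (hd : ∀ s, HasDerivAt ψ (ψ' s) s)
    (hd' : ∀ s, HasDerivAt ψ' (ψ'' s) s) (hc : Continuous ψ'') (hαβ : α ≤ β) {μ : ℝ} (hμ : 0 < μ)
    (h1 : ∀ s ∈ Icc α β, μ ≤ ψ' s) (h2 : ∀ s ∈ Icc α β, 0 ≤ ψ'' s) :
    ‖∫ s in α..β, cis (ψ s)‖ ≤ 3 / μ := by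
  have hψ : Continuous ψ := continuous_iff_continuousAt.2 fun s => (hd s).continuousAt
  have hψ' : Continuous ψ' := continuous_iff_continuousAt.2 fun s => (hd' s).continuousAt
  have hpos : ∀ s ∈ uIcc α β, 0 < ψ' s := fun s hs => by
    rw [uIcc_of_le hαβ] at hs
    exact hμ.trans_le (h1 s hs)
  have hne : ∀ s ∈ uIcc α β, ψ' s ≠ 0 := fun s hs => (hpos s hs).ne'
  have hinv : ∀ s ∈ uIcc α β, HasDerivAt (fun s => (ψ' s)⁻¹) (-ψ'' s / ψ' s ^ 2) s :=
    fun s hs => (hd' s).inv (hne s hs)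
  have hint : IntervalIntegrable (fun s => -ψ'' s / ψ' s ^ 2) volume α β :=
    ContinuousOn.intervalIntegrable (ContinuousOn.div (by fun_prop) (by fun_prop)
      fun s hs => pow_ne_zero 2 (hne s hs))
  have hcu : ∀ s ∈ uIcc α β, HasDerivAt (fun s => (((ψ' s)⁻¹ : ℝ) : ℂ))
      (((-ψ'' s / ψ' s ^ 2 : ℝ)) : ℂ) s := fun s hs => (hinv s hs).ofReal_comp
  have hcv : ∀ s ∈ uIcc α β, HasDerivAt (fun s => -Complex.I * cis (ψ s))
      ((ψ' s : ℂ) * cis (ψ s)) s := fun s _ => by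
    refine ((hasDerivAt_cis_comp (hd s)).const_mul (-Complex.I)).congr_deriv ?_
    calc _ = -(Complex.I * Complex.I) * ((ψ' s : ℂ) * cis (ψ s)) := by ring
      _ = _ := by rw [Complex.I_mul_I]; ring
  have hcc : Continuous fun s => cis (ψ s) := continuous_cis.comp hψ
  -- Integration by parts against `e^{iψ} = (1/ψ') · ψ' e^{iψ}`. Since `1/ψ'` is monotone, the
  -- integral of `|(1/ψ')'|` telescopes to at most `1/μ`; each boundary term contributes another
  -- `1/μ`.
  have hparts := intervalIntegral.integral_mul_deriv_eq_deriv_mul hcu hcv (⟨hint.1.ofReal, hint.2.ofReal⟩)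
    (Continuous.intervalIntegrable (by fun_prop) _ _)
  have hlhs : ∫ s in α..β, (((ψ' s)⁻¹ : ℝ) : ℂ) * ((ψ' s : ℂ) * cis (ψ s))
      = ∫ s in α..β, cis (ψ s) := by
    refine intervalIntegral.integral_congr fun s hs => ?_
    have : (ψ' s : ℂ) ≠ 0 := by exact_mod_cast hne s hs
    simp only [Complex.ofReal_inv]
    rw [inv_mul_cancel_left₀ this]
  rw [hlhs] at hparts
  rw [hparts]
  have hbd : ∀ s ∈ Icc α β, ‖(((ψ' s)⁻¹ : ℝ) : ℂ) * (-Complex.I * cis (ψ s))‖ = (ψ' s)⁻¹ :=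
    fun s hs => by
      rw [← uIcc_of_le hαβ] at hs
      rw [norm_mul, norm_mul, norm_cis, norm_neg, Complex.norm_I, Complex.norm_real,
        Real.norm_of_nonneg (inv_nonneg.2 (hpos s hs).le)]
      ring
  have hle : ∀ s ∈ Icc α β, (ψ' s)⁻¹ ≤ 1 / μ := fun s hs => by
    rw [one_div]
    exact inv_anti₀ hμ (h1 s hs)
  have hI : ‖∫ s in α..β, (((-ψ'' s / ψ' s ^ 2 : ℝ)) : ℂ) * (-Complex.I * cis (ψ s))‖ ≤ 1 / μ := by
    calc _ ≤ ∫ s in α..β, ψ'' s / ψ' s ^ 2 := by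
          refine intervalIntegral.norm_integral_le_of_norm_le hαβ (ae_of_all _ fun s hs => ?_) ?_
          · have hs' : s ∈ Icc α β := Ioc_subset_Icc_self hs
            rw [norm_mul, norm_mul, norm_cis, norm_neg, Complex.norm_I, Complex.norm_real,
              neg_div, norm_neg, Real.norm_of_nonneg (div_nonneg (h2 s hs') (sq_nonneg _))]
            linarith
          · simpa [neg_div, Pi.neg_def] using hint.neg
      _ = -∫ s in α..β, -ψ'' s / ψ' s ^ 2 := by
          rw [← intervalIntegral.integral_neg]
          simp [neg_div]
      _ = (ψ' α)⁻¹ - (ψ' β)⁻¹ := by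
          rw [intervalIntegral.integral_eq_sub_of_hasDerivAt hinv hint]; ring
      _ ≤ 1 / μ := by
          have h3 := hle α (left_mem_Icc.2 hαβ)
          have h4 := hpos β right_mem_uIcc
          have h5 := inv_pos.2 h4
          linarith
  have e1 := hbd β (right_mem_Icc.2 hαβ)
  have e2 := hbd α (left_mem_Icc.2 hαβ)
  have e3 := hle β (right_mem_Icc.2 hαβ)
  have e4 := hle α (left_mem_Icc.2 hαβ)
  refine (norm_sub_le _ _).trans ?_
  have e5 := norm_sub_le ((((ψ' β)⁻¹ : ℝ) : ℂ) * (-Complex.I * cis (ψ β)))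
    ((((ψ' α)⁻¹ : ℝ) : ℂ) * (-Complex.I * cis (ψ α)))
  have e6 : 3 / μ = 1 / μ + 1 / μ + 1 / μ := by ring
  rw [e6]
  linarith

/-- On an initial interval of length `1/μ` the trivial bound is used; past it, the second derivative
`≥ μ²` has raised `ψ'` to at least `μ`, and the non-stationary bound `3/μ` applies. -/
theorem norm_integral_cis_le_of_convex_of_nonneg (hd : ∀ s, HasDerivAt ψ (ψ' s) s)
    (hd' : ∀ s, HasDerivAt ψ' (ψ'' s) s) (hc : Continuous ψ'') (hαβ : α ≤ β) {μ : ℝ} (hμ : 0 < μ)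
    (h2 : ∀ s, μ ^ 2 ≤ ψ'' s) (h0 : 0 ≤ ψ' α) : ‖∫ s in α..β, cis (ψ s)‖ ≤ 4 / μ := by
  have hψ : Continuous ψ := continuous_iff_continuousAt.2 fun s => (hd s).continuousAt
  have hint : ∀ x y, IntervalIntegrable (fun s => cis (ψ s)) volume x y := fun x y =>
    (continuous_cis.comp hψ).intervalIntegrable x y
  have e6 : 4 / μ = 1 / μ + 3 / μ := by ring
  have hμ' : 0 < 1 / μ := by positivity
  rcases le_total β (α + 1 / μ) with h | h
  · refine (norm_integral_cis_le hαβ).trans ?_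
    have : 0 < 3 / μ := by positivity
    rw [e6]; linarith
  · rw [← intervalIntegral.integral_add_adjacent_intervals (hint α (α + 1 / μ))
      (hint (α + 1 / μ) β), e6]
    refine (norm_add_le _ _).trans (add_le_add ?_ ?_)
    · refine (norm_integral_cis_le (by linarith)).trans (by linarith)
    · refine norm_integral_cis_le_of_deriv hd hd' hc h hμ (fun s hs => ?_)
        fun s _ => (sq_nonneg μ).trans (h2 s)
      have hm : MonotoneOn (fun s => ψ' s - μ ^ 2 * s) univ := by
        have hD : ∀ s, HasDerivAt (fun s => ψ' s - μ ^ 2 * s) (ψ'' s - μ ^ 2) s := fun s =>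
          ((hd' s).sub ((hasDerivAt_id s).const_mul (μ ^ 2))).congr_deriv (by simp)
        exact (monotone_of_deriv_nonneg (fun s => (hD s).differentiableAt) fun s => by
          rw [(hD s).deriv]; linarith [h2 s]).monotoneOn _
      have h3 := hm (mem_univ α) (mem_univ s) (by linarith [hs.1])
      simp only at h3
      have h4 : μ ^ 2 * (1 / μ) = μ := by field_simp
      have h5 : μ ^ 2 * (1 / μ) ≤ μ ^ 2 * (s - α) := by
        gcongr; linarith [hs.1]
      linarith

theorem norm_integral_cis_le_of_convex_of_nonpos (hd : ∀ s, HasDerivAt ψ (ψ' s) s)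
    (hd' : ∀ s, HasDerivAt ψ' (ψ'' s) s) (hc : Continuous ψ'') (hαβ : α ≤ β) {μ : ℝ} (hμ : 0 < μ)
    (h2 : ∀ s, μ ^ 2 ≤ ψ'' s) (h0 : ψ' β ≤ 0) : ‖∫ s in α..β, cis (ψ s)‖ ≤ 4 / μ := by
  have := norm_integral_cis_le_of_convex_of_nonneg (ψ := fun s => ψ (-s)) (ψ' := fun s => -ψ' (-s))
    (ψ'' := fun s => ψ'' (-s)) (α := -β) (β := -α)
    (fun σ => ((hd (-σ)).scomp σ (hasDerivAt_neg σ)).congr_deriv (by simp))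
    (fun σ => (((hd' (-σ)).scomp σ (hasDerivAt_neg σ)).neg).congr_deriv (by simp))
    (by fun_prop) (by linarith) hμ (fun s => h2 _) (by simpa using h0)
  rwa [intervalIntegral.integral_comp_neg (fun s => cis (ψ s)), neg_neg, neg_neg] at this

/-- Van der Corput's lemma. -/
theorem norm_integral_cis_le_of_convex (hd : ∀ s, HasDerivAt ψ (ψ' s) s)
    (hd' : ∀ s, HasDerivAt ψ' (ψ'' s) s) (hc : Continuous ψ'') (hαβ : α ≤ β) {μ : ℝ} (hμ : 0 < μ)
    (h2 : ∀ s, μ ^ 2 ≤ ψ'' s) : ‖∫ s in α..β, cis (ψ s)‖ ≤ 8 / μ := by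
  have hψ : Continuous ψ := continuous_iff_continuousAt.2 fun s => (hd s).continuousAt
  have hψ' : Continuous ψ' := continuous_iff_continuousAt.2 fun s => (hd' s).continuousAt
  have hint : ∀ x y, IntervalIntegrable (fun s => cis (ψ s)) volume x y := fun x y =>
    (continuous_cis.comp hψ).intervalIntegrable x y
  have h48 : 4 / μ ≤ 8 / μ := by gcongr; norm_num
  rcases le_total 0 (ψ' α) with h0 | h0
  · exact (norm_integral_cis_le_of_convex_of_nonneg hd hd' hc hαβ hμ h2 h0).trans h48
  rcases le_total (ψ' β) 0 with h1 | h1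
  · exact (norm_integral_cis_le_of_convex_of_nonpos hd hd' hc hαβ hμ h2 h1).trans h48
  obtain ⟨c, hcm, hc0⟩ := intermediate_value_Icc hαβ hψ'.continuousOn (show (0 : ℝ) ∈ _ from ⟨h0, h1⟩)
  rw [← intervalIntegral.integral_add_adjacent_intervals (hint α c) (hint c β),
    show 8 / μ = 4 / μ + 4 / μ by ring]
  exact (norm_add_le _ _).trans (add_le_add
    (norm_integral_cis_le_of_convex_of_nonpos hd hd' hc hcm.1 hμ h2 hc0.le)
    (norm_integral_cis_le_of_convex_of_nonneg hd hd' hc hcm.2 hμ h2 hc0.ge))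

end

theorem cis_neg (x : ℝ) : cis (-x) = (starRingEnd ℂ) (cis x) := by
  rw [cis, cis, ← Complex.exp_conj]; simp

/-- The kernel of the group `e^{iτ a(D)}`, cut off to frequencies in `[-L, L]`. -/
theorem SecondDerivBddAway.norm_integral_cis_le {a : ℝ → ℝ} (h : SecondDerivBddAway a)
    (ha : ContDiff ℝ ∞ a) : ∃ C : ℝ, 0 ≤ C ∧ ∀ x τ L : ℝ, τ ≠ 0 → 0 ≤ L →
      ‖∫ ξ in -L..L, cis (x * ξ + τ * a ξ)‖ ≤ C * (Real.sqrt |τ|)⁻¹ := by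
  obtain ⟨κ, hκ, ε, hε, h⟩ := h.sign ha
  refine ⟨8 / Real.sqrt κ, by positivity, fun x τ L hτ hL => ?_⟩
  have hτ' : 0 < |τ| := abs_pos.2 hτ
  -- The sign `ν` makes the phase convex. Changing the sign of the phase conjugates the integral and
  -- leaves its modulus unchanged.
  set ν := ε * τ / |τ| with hν
  have hν1 : ν = 1 ∨ ν = -1 := by
    rcases hε with rfl | rfl <;> rcases abs_choice τ with h1 | h1 <;> rw [hν, h1] <;>
      [left; right; right; left] <;> field_simp
  obtain ⟨da, da'⟩ := ha.hasDerivAt_two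
  have key : ‖∫ ξ in -L..L, cis (ν * (x * ξ + τ * a ξ))‖ ≤ 8 / (Real.sqrt κ * Real.sqrt |τ|) := by
    refine norm_integral_cis_le_of_convex (ψ' := fun ξ => ν * (x + τ * deriv a ξ))
      (ψ'' := fun ξ => ν * (τ * iteratedDeriv 2 a ξ)) (fun ξ => ?_) (fun ξ => ?_) ?_ (by linarith)
      (by positivity) fun ξ => ?_
    · exact ((((hasDerivAt_id ξ).const_mul x).add ((da ξ).const_mul τ)).const_mul ν).congr_deriv
        (by simp)
    · exact (((da' ξ).const_mul τ).const_add x).const_mul ν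
    · have := (contDiff_infty.1 ha 2).continuous_iteratedDeriv 2 le_rfl
      fun_prop
    · rw [mul_pow, Real.sq_sqrt hκ.le, Real.sq_sqrt hτ'.le]
      have h1 : ν * τ = ε * |τ| := by
        rw [hν, div_mul_eq_mul_div, div_eq_iff hτ'.ne', mul_assoc, mul_assoc, ← abs_mul_abs_self τ]
      rw [← mul_assoc, h1]
      have := h ξ
      nlinarith
  have heq : ‖∫ ξ in -L..L, cis (ν * (x * ξ + τ * a ξ))‖ = ‖∫ ξ in -L..L, cis (x * ξ + τ * a ξ)‖ := by
    rcases hν1 with h1 | h1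
    · simp [h1]
    · simp only [h1, neg_one_mul, cis_neg]
      rw [intervalIntegral.integral_of_le (by linarith), intervalIntegral.integral_of_le (by linarith),
        integral_conj, RCLike.norm_conj]
  rw [← heq]
  refine key.trans (le_of_eq ?_)
  rw [div_mul_eq_div_div, div_eq_mul_inv _ (Real.sqrt |τ|)]

/-! ### Hankel forms and the dispersive estimate at `q = ∞`. -/

theorem exists_fourier_eq {F : ℝ → ℂ} (hF : MemLp F 2) :
    ∃ h : L2Line, (𝓕 h : L2Line) =ᵐ[volume] F :=
  ⟨𝓕⁻ (hF.toLp F), by rw [FourierTransform.fourier_fourierInv_eq]; exact hF.coeFn_toLp⟩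

/-- Translating `k` modulates its transform, so after writing `F` as a Fourier transform the
integral becomes an inverse transform of the product `𝓕 k · h`: the Hankel operator is diagonalised.
-/
theorem integral_comp_add_mul_eq {k : ℝ → ℂ} (hk1 : Integrable k) (hk2 : MemLp k 2) {F : ℝ → ℂ}
    {h : L2Line} (hh : (𝓕 h : L2Line) =ᵐ[volume] F) (η : ℝ) :
    ∫ z, k (z + η) * F z = 𝓕⁻ (fun x => 𝓕 k x * h x) η := by
  have hm := measurePreserving_add_right (volume : Measure ℝ) η
  have h1 : ∫ z, k (z + η) * F z = ∫ z, k (z + η) * (𝓕 h : L2Line) z := by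
    refine integral_congr_ae ?_
    filter_upwards [hh] with z hz
    rw [hz]
  rw [h1, integral_mul_fourier_Lp (k := fun z => k (z + η)) (hk1.comp_add_right η)
    (hk2.comp_measurePreserving hm), Real.fourierInv_eq']
  refine integral_congr_ae (ae_of_all _ fun x => ?_)
  have h2 : 𝓕 (fun z => k (z + η)) x = Complex.exp ((2 * Real.pi * inner ℝ x η : ℝ) * Complex.I) * 𝓕 k x := by
    rw [Real.fourier_eq', Real.fourier_eq',
      ← integral_add_right_eq_self (fun v => Complex.exp ((-2 * Real.pi * inner ℝ v x : ℝ) * Complex.I) • k v) η,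
      ← integral_const_mul]
    refine integral_congr_ae (ae_of_all _ fun z => ?_)
    simp only [smul_eq_mul]
    rw [← mul_assoc, ← Complex.exp_add]
    congr 2
    simp
    ring
  simp only [h2, smul_eq_mul]
  ring

/-- The Hankel-type form with kernel `k(z + η)` is bounded by `sup |𝓕 k|`. -/
theorem enorm_integral_hankel_le {k : ℝ → ℂ} (hk1 : Integrable k) (hk2 : MemLp k 2) {B : ℝ≥0∞}
    (hB : ∀ x, ‖𝓕 k x‖ₑ ≤ B) {F G : ℝ → ℂ} (hF : MemLp F 2) (hG1 : Integrable G) (hG2 : MemLp G 2) :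
    ‖∫ η, G η * ∫ z, k (z + η) * F z‖ₑ ≤ B * (eLpNorm F 2 volume * eLpNorm G 2 volume) := by
  obtain ⟨h, hh⟩ := exists_fourier_eq hF
  have hint : Integrable fun x => 𝓕 k x * h x :=
    (memLp_fourier hk1 hk2).integrable_mul (Lp.memLp h)
  have h1 : ∫ η, G η * ∫ z, k (z + η) * F z = ∫ x, 𝓕⁻ G x * (𝓕 k x * h x) := by
    simp_rw [integral_comp_add_mul_eq hk1 hk2 hh]
    exact (integral_fourierInv_mul_eq_flip hG1 hint).symm
  have hGm : AEStronglyMeasurable (𝓕⁻ G) volume := by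
    have : 𝓕⁻ G = fun x => 𝓕 G (-x) := by
      ext x; rw [Real.fourierInv_eq_fourier_neg]
    rw [this]
    exact ((continuous_fourier_of_integrable hG1).comp continuous_neg).aestronglyMeasurable
  rw [h1]
  calc _ ≤ ∫⁻ x, ‖𝓕⁻ G x * (𝓕 k x * h x)‖ₑ := enorm_integral_le_lintegral_enorm _
    _ ≤ ∫⁻ x, B * (‖h x‖ₑ * ‖𝓕⁻ G x‖ₑ) := by
        refine lintegral_mono fun x => ?_
        rw [enorm_mul, enorm_mul, mul_comm, mul_assoc]
        exact mul_le_mul' (hB x) le_rfl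
    _ = B * ∫⁻ x, ‖h x‖ₑ * ‖𝓕⁻ G x‖ₑ := by
        rw [lintegral_const_mul'' _ (by exact (Lp.aestronglyMeasurable h).enorm.mul hGm.enorm)]
    _ ≤ B * (l2n (fun x => ‖h x‖ₑ) * l2n (fun x => ‖𝓕⁻ G x‖ₑ)) := by
        gcongr
        exact lintegral_mul_le_l2n (Lp.aestronglyMeasurable h).enorm hGm.enorm
    _ = B * (eLpNorm F 2 volume * eLpNorm G 2 volume) := by
        rw [← eLpNorm_two_eq_l2n, ← eLpNorm_two_eq_l2n, eLpNorm_fourierInv_eq hG1 hG2, eLpNorm_Lp,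
          ← Lp.norm_fourier_eq h, ← eLpNorm_Lp, eLpNorm_congr_ae hh]

theorem integrable_bounded_mul {α : Type*} [MeasurableSpace α] {μ : Measure α} {k g : α → ℂ}
    (hk : AEStronglyMeasurable k μ) {M : ℝ} (hM : ∀ x, ‖k x‖ ≤ M) (hg : Integrable g μ) :
    Integrable (fun x => k x * g x) μ :=
  hg.bdd_mul hk (ae_of_all _ hM)

theorem enorm_integral_prod_hankel_le {k : ℝ → ℂ} (hk : Measurable k) {M : ℝ} (hM : ∀ x, ‖k x‖ ≤ M)
    (hk1 : Integrable k) (hk2 : MemLp k 2) {B : ℝ≥0∞} (hB : ∀ x, ‖𝓕 k x‖ₑ ≤ B) {F G : ℝ → ℂ}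
    (hF1 : Integrable F) (hF2 : MemLp F 2) (hG1 : Integrable G) (hG2 : MemLp G 2) :
    ‖∫ p : ℝ × ℝ, k (p.1 + p.2) * (F p.1 * G p.2)‖ₑ
      ≤ B * (eLpNorm F 2 volume * eLpNorm G 2 volume) := by
  have hint : Integrable (fun p : ℝ × ℝ => k (p.1 + p.2) * (F p.1 * G p.2)) :=
    integrable_bounded_mul (hk.comp (by fun_prop)).aestronglyMeasurable (fun p => hM _)
      (hF1.mul_prod hG1)
  have h1 : ∫ p : ℝ × ℝ, k (p.1 + p.2) * (F p.1 * G p.2) = ∫ η, G η * ∫ z, k (z + η) * F z := by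
    rw [Measure.volume_eq_prod, integral_prod_symm _ hint]
    refine integral_congr_ae (ae_of_all _ fun η => ?_)
    simp only
    rw [← integral_const_mul]
    refine integral_congr_ae (ae_of_all _ fun z => ?_)
    simp only
    ring
  rw [h1]
  exact enorm_integral_hankel_le hk1 hk2 hB hF2 hG1 hG2

/-- The derivative of a symbol in the second variable. -/
noncomputable def sndDeriv (m : FreqPlane → ℂ) (z y : ℝ) : ℂ := fderiv ℝ m !₂[z, y] !₂[0, 1]

theorem norm_snd_vector : ‖(!₂[0, 1] : FreqPlane)‖ = 1 := by
  rw [EuclideanSpace.norm_eq]; simp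

section

variable {R : ℝ} {U : Set FreqPlane} {m : FreqPlane → ℂ}

theorem IsSymbol.norm_sndDeriv_le (h : IsSymbol 1 R U m) (z y : ℝ) : ‖sndDeriv m z y‖ ≤ 1 := by
  have := (fderiv ℝ m !₂[z, y]).le_opNorm !₂[0, 1]
  rw [norm_snd_vector, mul_one] at this
  exact this.trans (h.norm_fderiv_le_one le_rfl _)

theorem IsSymbol.continuous_sndDeriv (h : IsSymbol 1 R U m) :
    Continuous fun p : ℝ × ℝ => sndDeriv m p.1 p.2 :=
  ((h.smooth.continuous_fderiv (by norm_num)).comp continuous_pt).clm_apply continuous_const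

theorem IsSymbol.hasDerivAt_snd (h : IsSymbol 1 R U m) (z y : ℝ) :
    HasDerivAt (fun y => m !₂[z, y]) (sndDeriv m z y) y := by
  have h1 : HasDerivAt (fun y : ℝ => (!₂[z, y] : FreqPlane)) !₂[0, 1] y := by
    have h2 : (fun y : ℝ => (!₂[z, y] : FreqPlane)) = fun y => !₂[z, 0] + y • !₂[0, 1] := by
      ext y i; fin_cases i <;> simp
    rw [h2]
    simpa using ((hasDerivAt_id y).smul_const (!₂[0, 1] : FreqPlane)).const_add !₂[z, 0]
  exact ((h.smooth.differentiable (by norm_num) _).hasFDerivAt).comp_hasDerivAt y h1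

theorem IsSymbol.eq_zero_of_lt (h : IsSymbol 1 R U m) {z y : ℝ} (hy : R < |z| ∨ R < |y|) :
    m !₂[z, y] = 0 := by
  by_contra hne
  obtain ⟨h1, h2⟩ := abs_le_of_mem_closedBall (h.support_ball hne)
  rcases hy with hy | hy <;> linarith

/-- The fundamental theorem of calculus in the second variable, started from the line at height
`-2R`, where the symbol vanishes. It exhibits `m` as a superposition over `y` of products of a
function of `z` and the indicator of `y ≤ η`, using a single derivative. -/
theorem IsSymbol.eq_setIntegral (h : IsSymbol 1 R U m) (hR : 0 < R) (z η : ℝ) :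
    m !₂[z, η] = ∫ y in Ioc (-(2 * R)) (2 * R), (Iic η).indicator (fun y => sndDeriv m z y) y := by
  have hbot : m !₂[z, -(2 * R)] = 0 :=
    h.eq_zero_of_lt (Or.inr (by rw [abs_neg, abs_of_pos (by positivity)]; linarith))
  rw [setIntegral_indicator measurableSet_Iic, Ioc_inter_Iic]
  rcases le_or_gt η (-(2 * R)) with h1 | h1
  · rw [Ioc_eq_empty (by
      have := min_le_right (2 * R) η
      linarith), setIntegral_empty]
    exact h.eq_zero_of_lt (Or.inr (by rw [abs_of_nonpos (by linarith)]; linarith))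
  · have hle : -(2 * R) ≤ min (2 * R) η := le_min (by linarith) h1.le
    rw [← intervalIntegral.integral_of_le hle, intervalIntegral.integral_eq_sub_of_hasDerivAt
      (fun y _ => h.hasDerivAt_snd z y) ((h.continuous_sndDeriv.comp
        (by fun_prop : Continuous fun y : ℝ => (z, y))).intervalIntegrable _ _), hbot, sub_zero]
    rcases le_total η (2 * R) with h2 | h2
    · rw [min_eq_right h2]
    · rw [min_eq_left h2, h.eq_zero_of_lt (Or.inr (by
        rw [abs_of_nonneg (by linarith)]; linarith)), h.eq_zero_of_lt (Or.inr (by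
        rw [abs_of_nonneg (by linarith)]; linarith))]

theorem integrable_indicator_of_memLp_two {F : ℝ → ℂ} (hF : MemLp F 2) (R : ℝ) :
    Integrable ((Icc (-R) R).indicator F) := by
  rw [integrable_indicator_iff measurableSet_Icc]
  exact (hF.restrict (Icc (-R) R)).integrable one_le_two

theorem eLpNorm_mul_le_of_norm_le_one {k F : ℝ → ℂ} (hk : ∀ x, ‖k x‖ ≤ 1) :
    eLpNorm (fun x => k x * F x) 2 volume ≤ eLpNorm F 2 volume :=
  eLpNorm_mono fun x => by
    rw [norm_mul]
    exact mul_le_of_le_one_left (norm_nonneg _) (hk x)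

theorem IsSymbol.form_eq (h : IsSymbol 1 R U m) (k F G : ℝ → ℂ) (p : ℝ × ℝ) :
    k (p.1 + p.2) * m !₂[p.1, p.2] * (F p.1 * G p.2) =
      (Icc (-(2 * R)) (2 * R)).indicator k (p.1 + p.2) * m !₂[p.1, p.2] *
        ((Icc (-R) R).indicator F p.1 * (Icc (-R) R).indicator G p.2) := by
  by_cases hm : m !₂[p.1, p.2] = 0
  · rw [hm]; ring
  obtain ⟨h1, h2⟩ := abs_le_of_mem_closedBall (h.support_ball hm)
  have h1' := abs_le.1 h1
  have h2' := abs_le.1 h2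
  rw [indicator_of_mem (show p.1 ∈ Icc (-R) R from h1'),
    indicator_of_mem (show p.2 ∈ Icc (-R) R from h2'),
    indicator_of_mem (show p.1 + p.2 ∈ Icc (-(2 * R)) (2 * R) from
      ⟨by linarith, by linarith⟩)]

theorem IsSymbol.integrable_form (h : IsSymbol 1 R U m) {k : ℝ × ℝ → ℂ} (hk : Measurable k)
    {M : ℝ} (hM : ∀ p, ‖k p‖ ≤ M) {F G : ℝ → ℂ} (hF : MemLp F 2) (hG : MemLp G 2) :
    Integrable fun p : ℝ × ℝ => k p * m !₂[p.1, p.2] * (F p.1 * G p.2) := by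
  have h0 := (integrable_indicator_of_memLp_two hF R).mul_prod (integrable_indicator_of_memLp_two hG R)
  have hkm : Measurable fun p : ℝ × ℝ => k p * m !₂[p.1, p.2] :=
    hk.mul (h.smooth.continuous.comp continuous_pt).measurable
  have h1 := integrable_bounded_mul (M := M * 1) hkm.aestronglyMeasurable
    (fun p => by
      rw [norm_mul]
      exact mul_le_mul (hM p) (h.norm_le_one _) (norm_nonneg _) ((norm_nonneg _).trans (hM p))) h0
  refine h1.congr (ae_of_all _ fun p => ?_)
  simp only
  by_cases hm : m !₂[p.1, p.2] = 0
  · rw [hm]; ring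
  obtain ⟨h2, h3⟩ := abs_le_of_mem_closedBall (h.support_ball hm)
  rw [indicator_of_mem (show p.1 ∈ Icc (-R) R from abs_le.1 h2),
    indicator_of_mem (show p.2 ∈ Icc (-R) R from abs_le.1 h3)]

/-- For each `y` the two factors of the symbol are bounded by `1` and are absorbed into `F` and `G`
without increasing their `L²` norms; a Hankel form with kernel `k`, cut off to `[-2R, 2R]`, remains.
The integral over `y ∈ (-2R, 2R]` gives the factor `4R`. -/
theorem IsSymbol.enorm_form_le (h : IsSymbol 1 R U m) (hR : 0 < R) {k : ℝ → ℂ} (hk : Measurable k)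
    (hk1 : ∀ x, ‖k x‖ ≤ 1) {B : ℝ≥0∞}
    (hB : ∀ x, ‖𝓕 ((Icc (-(2 * R)) (2 * R)).indicator k) x‖ₑ ≤ B) {F G : ℝ → ℂ}
    (hFm : Measurable F) (hGm : Measurable G) (hF : MemLp F 2) (hG : MemLp G 2) :
    ‖∫ p : ℝ × ℝ, k (p.1 + p.2) * m !₂[p.1, p.2] * (F p.1 * G p.2)‖ₑ
      ≤ ENNReal.ofReal (4 * R) * (B * (eLpNorm F 2 volume * eLpNorm G 2 volume)) := by
  set k' := (Icc (-(2 * R)) (2 * R)).indicator k with hk'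
  set F' := (Icc (-R) R).indicator F with hF'
  set G' := (Icc (-R) R).indicator G with hG'
  set I := Ioc (-(2 * R)) (2 * R) with hI
  have hk'm : Measurable k' := hk.indicator measurableSet_Icc
  have hF'm : Measurable F' := hFm.indicator measurableSet_Icc
  have hG'm : Measurable G' := hGm.indicator measurableSet_Icc
  have hk'1 : ∀ x, ‖k' x‖ ≤ 1 := fun x => (norm_indicator_le_norm_self _ _).trans (hk1 x)
  have hF'1 : Integrable F' := integrable_indicator_of_memLp_two hF R
  have hG'1 : Integrable G' := integrable_indicator_of_memLp_two hG R
  have hF'2 : MemLp F' 2 := hF.indicator measurableSet_Icc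
  have hG'2 : MemLp G' 2 := hG.indicator measurableSet_Icc
  have hk'2 : MemLp k' 2 :=
    (memLp_indicator_const 2 measurableSet_Icc (1 : ℂ) (Or.inr measure_Icc_lt_top.ne)).mono
      hk'm.aestronglyMeasurable (ae_of_all _ fun x => by
        by_cases hx : x ∈ Icc (-(2 * R)) (2 * R)
        · rw [indicator_of_mem hx, norm_one]; exact hk'1 x
        · rw [hk', indicator_of_notMem hx, indicator_of_notMem hx])
  have hk'i : Integrable k' := by
    rw [hk', integrable_indicator_iff measurableSet_Icc]
    exact Measure.integrableOn_of_bounded measure_Icc_lt_top.ne hk.aestronglyMeasurable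
      (ae_of_all _ hk1)
  set Φ : ℝ × ℝ → ℝ → ℂ := fun p y =>
    k' (p.1 + p.2) * ((sndDeriv m p.1 y * F' p.1) * ((Ici y).indicator (fun _ => 1) p.2 * G' p.2))
    with hΦ
  have h1 : ∀ p : ℝ × ℝ, k (p.1 + p.2) * m !₂[p.1, p.2] * (F p.1 * G p.2) = ∫ y in I, Φ p y := by
    intro p
    rw [h.form_eq k F G p, h.eq_setIntegral hR p.1 p.2, ← integral_const_mul, ← integral_mul_const]
    refine integral_congr_ae (ae_of_all _ fun y => ?_)
    simp only [hΦ]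
    by_cases hy : y ≤ p.2
    · rw [indicator_of_mem (show y ∈ Iic p.2 from hy), indicator_of_mem (show p.2 ∈ Ici y from hy)]
      ring
    · rw [indicator_of_notMem (show y ∉ Iic p.2 from hy),
        indicator_of_notMem (show p.2 ∉ Ici y from hy)]
      ring
  have hmeas : Measurable fun q : (ℝ × ℝ) × ℝ => k' (q.1.1 + q.1.2) *
      (sndDeriv m q.1.1 q.2 * (Ici q.2).indicator (fun _ => (1 : ℂ)) q.1.2) := by
    refine (hk'm.comp (by fun_prop)).mul ((h.continuous_sndDeriv.measurable.comp
      (by fun_prop : Measurable fun q : (ℝ × ℝ) × ℝ => (q.1.1, q.2))).mul ?_)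
    exact (measurable_const (a := (1 : ℂ))).indicator
      (measurableSet_le (by fun_prop : Measurable fun q : (ℝ × ℝ) × ℝ => q.2) (by fun_prop))
  have hint : Integrable (Function.uncurry Φ) (volume.prod (volume.restrict I)) := by
    have h2 : Integrable (fun q : (ℝ × ℝ) × ℝ => (F' q.1.1 * G' q.1.2) * (1 : ℂ))
        (volume.prod (volume.restrict I)) :=
      (hF'1.mul_prod hG'1).mul_prod (integrable_const (1 : ℂ))
    refine (integrable_bounded_mul (M := 1) hmeas.aestronglyMeasurable (fun q => ?_) h2).congr
      (ae_of_all _ fun q => ?_)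
    · rw [norm_mul, norm_mul]
      have h3 : ‖(Ici q.2).indicator (fun _ => (1 : ℂ)) q.1.2‖ ≤ 1 :=
        (norm_indicator_le_norm_self _ _).trans (by simp)
      exact mul_le_one₀ (hk'1 _) (by positivity)
        (mul_le_one₀ (h.norm_sndDeriv_le _ _) (norm_nonneg _) h3)
    · simp only [Function.uncurry, hΦ]; ring
  simp_rw [h1]
  rw [integral_integral_swap hint]
  refine (enorm_integral_le_lintegral_enorm _).trans ?_
  calc ∫⁻ y in I, ‖∫ p, Φ p y‖ₑ
      ≤ ∫⁻ _ in I, B * (eLpNorm F 2 volume * eLpNorm G 2 volume) := by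
        refine lintegral_mono fun y => ?_
        have hd : Measurable fun z => sndDeriv m z y :=
          h.continuous_sndDeriv.measurable.comp (by fun_prop : Measurable fun z : ℝ => (z, y))
        have hi : Measurable ((Ici y).indicator fun _ => (1 : ℂ)) :=
          measurable_const.indicator measurableSet_Ici
        have hi1 : ∀ x, ‖(Ici y).indicator (fun _ => (1 : ℂ)) x‖ ≤ 1 := fun x =>
          (norm_indicator_le_norm_self _ _).trans (by simp)
        have hFF := eLpNorm_mul_le_of_norm_le_one (F := F') fun z => h.norm_sndDeriv_le z y
        have hGG := eLpNorm_mul_le_of_norm_le_one (F := G') hi1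
        refine (enorm_integral_prod_hankel_le hk'm hk'1 hk'i hk'2 hB
          (integrable_bounded_mul hd.aestronglyMeasurable (fun z => h.norm_sndDeriv_le z y) hF'1)
          ⟨(hd.mul hF'm).aestronglyMeasurable, hFF.trans_lt hF'2.2⟩
          (integrable_bounded_mul hi.aestronglyMeasurable hi1 hG'1)
          ⟨(hi.mul hG'm).aestronglyMeasurable, hGG.trans_lt hG'2.2⟩).trans ?_
        gcongr
        · exact hFF.trans (eLpNorm_indicator_le F)
        · exact hGG.trans (eLpNorm_indicator_le G)
    _ = _ := by
        rw [setLIntegral_const, mul_comm, hI, Real.volume_Ioc]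
        congr 2; ring

end

theorem lintegral_Ioc_inv_sqrt {d : ℝ} (hd : 0 ≤ d) :
    ∫⁻ y in Ioc 0 d, ENNReal.ofReal (Real.sqrt |y|)⁻¹ = ENNReal.ofReal (2 * Real.sqrt d) := by
  have h1 : ∫⁻ y in Ioc 0 d, ENNReal.ofReal (Real.sqrt |y|)⁻¹
      = ∫⁻ y in Ioc 0 d, ENNReal.ofReal (y ^ (-1 / 2 : ℝ)) := by
    refine setLIntegral_congr_fun measurableSet_Ioc fun y hy => ?_
    rw [abs_of_pos hy.1, Real.sqrt_eq_rpow, ← Real.rpow_neg hy.1.le]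
    norm_num
  have h2 : IntervalIntegrable (fun y : ℝ => y ^ (-1 / 2 : ℝ)) volume 0 d :=
    intervalIntegral.intervalIntegrable_rpow' (by norm_num)
  rw [h1, ← ofReal_integral_eq_lintegral_ofReal ((intervalIntegrable_iff_integrableOn_Ioc_of_le hd).1 h2)
    ((ae_restrict_iff' measurableSet_Ioc).2 (ae_of_all _ fun y hy => Real.rpow_nonneg hy.1.le _)),
    ← intervalIntegral.integral_of_le hd, integral_rpow (Or.inl (by norm_num)), Real.sqrt_eq_rpow]
  congr 1
  norm_num
  ring

theorem lintegral_abs_lt_inv_sqrt_le {d : ℝ} (hd : 0 ≤ d) :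
    ∫⁻ y in {y : ℝ | |y| < d}, ENNReal.ofReal (Real.sqrt |y|)⁻¹ ≤ ENNReal.ofReal (4 * Real.sqrt d) := by
  have hsub : {y : ℝ | |y| < d} ⊆ Ioc 0 d ∪ ((fun y => -y) ⁻¹' Ioc 0 d ∪ {0}) := fun y hy => by
    have hy' : |y| < d := hy
    rcases lt_trichotomy y 0 with h | h | h
    · rw [abs_of_neg h] at hy'
      exact Or.inr (Or.inl ⟨by simpa using h, hy'.le⟩)
    · exact Or.inr (Or.inr h)
    · rw [abs_of_pos h] at hy'
      exact Or.inl ⟨h, hy'.le⟩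
  have hneg : ∫⁻ y in (fun y => -y) ⁻¹' Ioc 0 d, ENNReal.ofReal (Real.sqrt |y|)⁻¹
      = ENNReal.ofReal (2 * Real.sqrt d) := by
    have hp : MeasurePreserving (fun y : ℝ => -y) volume volume := Measure.measurePreserving_neg volume
    rw [← lintegral_Ioc_inv_sqrt hd, ← hp.setLIntegral_comp_preimage measurableSet_Ioc
      (by fun_prop : Measurable fun y : ℝ => ENNReal.ofReal (Real.sqrt |y|)⁻¹)]
    simp
  calc _ ≤ ∫⁻ y in Ioc 0 d ∪ ((fun y => -y) ⁻¹' Ioc 0 d ∪ {0}), ENNReal.ofReal (Real.sqrt |y|)⁻¹ :=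
        lintegral_mono_set hsub
    _ ≤ ENNReal.ofReal (2 * Real.sqrt d) + (ENNReal.ofReal (2 * Real.sqrt d) + 0) := by
        refine (lintegral_union_le _ _ _).trans (add_le_add (lintegral_Ioc_inv_sqrt hd).le
          ((lintegral_union_le _ _ _).trans (add_le_add hneg.le ?_)))
        simp
    _ = _ := by
        rw [add_zero, ← ENNReal.ofReal_add (by positivity) (by positivity)]
        congr 1; ring

/-- Where `|t - s| ≥ t/2` the integrand is `O(t^{-1/2})`. The remaining interval is met only if `r >
t/2`, and there the integral is `O(√t) = O(r/√t)`. Arbitrary real `r`, and not only `r = t`, is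
needed when `1/φ` is later written as an average over `r`. -/
theorem lintegral_uIoc_inv_sqrt_le {t : ℝ} (ht : 0 < t) (r : ℝ) :
    ∫⁻ s in uIoc 0 r, ENNReal.ofReal (Real.sqrt |t - s|)⁻¹
      ≤ ENNReal.ofReal (8 * |r| * (Real.sqrt t)⁻¹) := by
  set g : ℝ → ℝ≥0∞ := fun s => ENNReal.ofReal (Real.sqrt |t - s|)⁻¹ with hg
  set S : Set ℝ := {s | |t - s| < t / 2} with hS
  have hSm : MeasurableSet S := measurableSet_lt (by fun_prop) (by fun_prop)
  have hst : 0 < Real.sqrt t := Real.sqrt_pos.2 ht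
  have hs2 : Real.sqrt (t / 2) = Real.sqrt t / Real.sqrt 2 := Real.sqrt_div ht.le 2
  have h2 : Real.sqrt 2 * Real.sqrt 2 = 2 := Real.mul_self_sqrt (by norm_num)
  have h2l : 1.4 ≤ Real.sqrt 2 := Real.le_sqrt_of_sq_le (by norm_num)
  have h2u : Real.sqrt 2 ≤ 1.5 := Real.sqrt_le_iff.2 (by norm_num)
  have hfar : ∫⁻ s in uIoc 0 r \ S, g s ≤ ENNReal.ofReal (Real.sqrt 2 * |r| * (Real.sqrt t)⁻¹) := by
    calc _ ≤ ∫⁻ s in uIoc 0 r \ S, ENNReal.ofReal (Real.sqrt (t / 2))⁻¹ := by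
          refine setLIntegral_mono' (measurableSet_uIoc.diff hSm) fun s hs => ?_
          have hs' : t / 2 ≤ |t - s| := not_lt.1 hs.2
          refine ENNReal.ofReal_le_ofReal (inv_anti₀ (Real.sqrt_pos.2 (by positivity)) ?_)
          exact Real.sqrt_le_sqrt hs'
      _ ≤ ENNReal.ofReal (Real.sqrt (t / 2))⁻¹ * volume (uIoc 0 r) := by
          rw [setLIntegral_const]
          gcongr
          exact sdiff_subset
      _ = _ := by
          rw [Real.volume_uIoc, sub_zero, ← ENNReal.ofReal_mul (by positivity), hs2, inv_div]
          congr 1; ring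
  have hnear : ∫⁻ s in uIoc 0 r ∩ S, g s ≤ ENNReal.ofReal (6 * |r| * (Real.sqrt t)⁻¹) := by
    rcases le_or_gt r (t / 2) with hr | hr
    · have : uIoc 0 r ∩ S = ∅ := eq_empty_of_forall_notMem fun s hs => by
        have h3 := (abs_lt.1 (show |t - s| < t / 2 from hs.2)).2
        have h4 := hs.1.2
        have h5 : max 0 r ≤ t / 2 := max_le (by positivity) hr
        linarith
      rw [this]; simp
    · calc _ ≤ ∫⁻ s in S, g s := lintegral_mono_set inter_subset_right
        _ = ∫⁻ y in {y : ℝ | |y| < t / 2}, ENNReal.ofReal (Real.sqrt |y|)⁻¹ := by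
            have hm : MeasurableSet {y : ℝ | |y| < t / 2} :=
              measurableSet_lt (by fun_prop) (by fun_prop)
            rw [← lintegral_indicator hSm, ← lintegral_indicator hm,
              ← lintegral_sub_left_eq_self _ t]
            refine lintegral_congr fun x => ?_
            simp only [indicator, hS, hg, mem_ofPred_eq, sub_sub_cancel]
        _ ≤ ENNReal.ofReal (4 * Real.sqrt (t / 2)) := lintegral_abs_lt_inv_sqrt_le (by positivity)
        _ ≤ _ := by
            refine ENNReal.ofReal_le_ofReal ?_
            rw [abs_of_pos (by linarith : 0 < r), ← div_eq_mul_inv, le_div_iff₀ hst, hs2]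
            have h3 : Real.sqrt t * Real.sqrt t = t := Real.mul_self_sqrt ht.le
            have h4 : 4 * (Real.sqrt t / Real.sqrt 2) * Real.sqrt t = 4 * t / Real.sqrt 2 := by
              calc _ = 4 * (Real.sqrt t * Real.sqrt t) / Real.sqrt 2 := by ring
                _ = _ := by rw [h3]
            rw [h4, div_le_iff₀ (by positivity)]
            nlinarith
  calc ∫⁻ s in uIoc 0 r, g s = (∫⁻ s in uIoc 0 r ∩ S, g s) + ∫⁻ s in uIoc 0 r \ S, g s :=
        (lintegral_inter_add_sdiff g _ hSm).symm
    _ ≤ _ := add_le_add hnear hfar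
    _ ≤ _ := by
        rw [← ENNReal.ofReal_add (by positivity) (by positivity)]
        refine ENNReal.ofReal_le_ofReal ?_
        have : 0 ≤ |r| * (Real.sqrt t)⁻¹ := by positivity
        nlinarith

/-- The variable of the Fourier transform of the truncated kernel merely shifts `x`, and the van der
Corput bound is uniform in `x` and in the cutoff. -/
theorem SecondDerivBddAway.enorm_form_le {a : ℝ → ℝ} (hH : SecondDerivBddAway a)
    (ha : ContDiff ℝ ∞ a) : ∃ C : ℝ, 0 ≤ C ∧ ∀ (R : ℝ) (U : Set FreqPlane) (m : FreqPlane → ℂ),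
      0 < R → IsSymbol 1 R U m → ∀ x τ : ℝ, τ ≠ 0 → ∀ F G : ℝ → ℂ, Measurable F → Measurable G →
      MemLp F 2 → MemLp G 2 →
      ‖∫ p : ℝ × ℝ, cis (x * (p.1 + p.2) + τ * a (p.1 + p.2)) * m !₂[p.1, p.2] * (F p.1 * G p.2)‖ₑ
        ≤ ENNReal.ofReal (4 * R) * (ENNReal.ofReal (C * (Real.sqrt |τ|)⁻¹) *
          (eLpNorm F 2 volume * eLpNorm G 2 volume)) := by
  obtain ⟨C, hC, h⟩ := hH.norm_integral_cis_le ha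
  refine ⟨C, hC, fun R U m hR hm x τ hτ F G hFm hGm hF hG => ?_⟩
  have hac := ha.continuous
  refine hm.enorm_form_le hR (k := fun ξ => cis (x * ξ + τ * a ξ))
    (continuous_cis.comp (by fun_prop)).measurable (fun ξ => (norm_cis _).le) (fun y => ?_)
    hFm hGm hF hG
  have h1 : 𝓕 ((Icc (-(2 * R)) (2 * R)).indicator fun ξ => cis (x * ξ + τ * a ξ)) y
      = ∫ ξ in -(2 * R)..(2 * R), cis ((x - 2 * Real.pi * y) * ξ + τ * a ξ) := by
    rw [Real.fourier_real_eq_integral_exp_smul, intervalIntegral.integral_of_le (by linarith),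
      ← integral_Icc_eq_integral_Ioc, ← integral_indicator measurableSet_Icc]
    refine integral_congr_ae (ae_of_all _ fun ξ => ?_)
    simp only [smul_eq_mul]
    by_cases hξ : ξ ∈ Icc (-(2 * R)) (2 * R)
    · rw [indicator_of_mem hξ, indicator_of_mem hξ, mul_comm (Complex.ofReal _), ← cis, ← cis_add]
      congr 1; ring
    · rw [indicator_of_notMem hξ, indicator_of_notMem hξ, mul_zero]
  rw [h1, ← ofReal_norm]
  exact ENNReal.ofReal_le_ofReal (h _ τ (2 * R) hτ (by positivity))

theorem eLpNorm_cis_mul_hatL2_le {θ : ℝ → ℝ} (f : L2Line) :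
    eLpNorm (fun z => cis (θ z) * hatL2 f z) 2 volume ≤ ENNReal.ofReal ‖f‖ := by
  refine (eLpNorm_mul_le_of_norm_le_one fun z => (norm_cis _).le).trans (le_of_eq ?_)
  rw [eLpNorm_two_eq_l2n, ← l2n_hatE]
  rfl

/-- With `osc` unfolded, `e^{ita} e^{isφ}` equals `e^{i(t-s)a}` times free factors of `b` and `c`.
The latter are absorbed into the data, and the group of `a` at time `t - s` contributes
`|t-s|^{-1/2}`, which is integrable at `s = t`. The time `r` of the oscillatory factor is kept
independent of `t`. -/
theorem enorm_integral_duhamel_form_le {a b c : ℝ → ℝ} (ha : ContDiff ℝ ∞ a) (hb : ContDiff ℝ ∞ b)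
    (hc : ContDiff ℝ ∞ c) (hH : SecondDerivBddAway a) :
    ∃ C : ℝ, 0 ≤ C ∧ ∀ (R : ℝ) (U : Set FreqPlane) (m : FreqPlane → ℂ),
      0 < R → IsSymbol 1 R U m → ∀ x t r : ℝ, 0 < t → ∀ f g : L2Line,
      ‖∫ p : ℝ × ℝ, cis (x * (p.1 + p.2) + t * a (p.1 + p.2)) *
          (duhamelSymbol a b c m r !₂[p.1, p.2] * (hatL2 f p.1 * hatL2 g p.2))‖ₑ
        ≤ ENNReal.ofReal (C * R * (|r| * (Real.sqrt t)⁻¹) * (‖f‖ * ‖g‖)) := by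
  obtain ⟨C, hC, h⟩ := hH.enorm_form_le ha
  refine ⟨32 * C, by positivity, fun R U m hR hm x t r ht f g => ?_⟩
  have hac := ha.continuous
  have hbc := hb.continuous
  have hcc := hc.continuous
  set Φ : ℝ × ℝ → ℝ → ℂ := fun p s => cis (x * (p.1 + p.2) + (t - s) * a (p.1 + p.2)) *
    m !₂[p.1, p.2] * ((cis (s * b p.1) * hatL2 f p.1) * (cis (s * c p.2) * hatL2 g p.2)) with hΦ
  have hΦ' : ∀ p s, Φ p s = (cis (x * (p.1 + p.2) + t * a (p.1 + p.2)) *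
      cis (s * phase a b c !₂[p.1, p.2])) *
      (m !₂[p.1, p.2] * (hatL2 f p.1 * hatL2 g p.2)) := fun p s => by
    have : cis (x * (p.1 + p.2) + t * a (p.1 + p.2)) * cis (s * phase a b c !₂[p.1, p.2])
        = cis (x * (p.1 + p.2) + (t - s) * a (p.1 + p.2)) * (cis (s * b p.1) * cis (s * c p.2)) := by
      rw [phase_pt, ← cis_add, ← cis_add, ← cis_add]
      congr 1; ring
    rw [this]
    simp only [hΦ]; ring
  -- The orientation of the time integral, since `r` may be negative.
  set ε : ℝ := if 0 ≤ r then 1 else -1 with hε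
  have hε1 : ‖ε‖ₑ = 1 := by
    rw [hε]; split_ifs <;> simp
  have h1 : ∀ p : ℝ × ℝ, cis (x * (p.1 + p.2) + t * a (p.1 + p.2)) *
      (duhamelSymbol a b c m r !₂[p.1, p.2] * (hatL2 f p.1 * hatL2 g p.2))
      = ε • ∫ s in uIoc 0 r, Φ p s := fun p => by
    simp_rw [hΦ']
    rw [integral_mul_const, integral_const_mul, ← smul_mul_assoc, ← mul_smul_comm,
      ← intervalIntegral.intervalIntegral_eq_integral_uIoc, duhamelSymbol, osc]
    ring
  have hphase := continuous_phase hac hbc hcc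
  have : IsFiniteMeasure (volume.restrict (uIoc 0 r)) :=
    ⟨by rw [Measure.restrict_apply_univ, Real.volume_uIoc]; exact ENNReal.ofReal_lt_top⟩
  have hint : Integrable (Function.uncurry Φ) (volume.prod (volume.restrict (uIoc 0 r))) := by
    have h2 := (hm.integrable_form (k := fun _ => 1) measurable_const (M := 1) (fun _ => by simp)
      (memLp_hatL2 f) (memLp_hatL2 g)).mul_prod
        (integrable_const (1 : ℂ) : Integrable _ (volume.restrict (uIoc 0 r)))
    have hk : Continuous fun q : (ℝ × ℝ) × ℝ => cis (x * (q.1.1 + q.1.2) + t * a (q.1.1 + q.1.2)) *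
        cis (q.2 * phase a b c !₂[q.1.1, q.1.2]) := by
      refine (continuous_cis.comp (by fun_prop)).mul (continuous_cis.comp
        (continuous_snd.mul (hphase.comp (continuous_pt.comp continuous_fst))))
    refine (integrable_bounded_mul (M := 1) hk.aestronglyMeasurable (fun q => ?_) h2).congr
      (ae_of_all _ fun q => ?_)
    · rw [norm_mul, norm_cis, norm_cis, one_mul]
    · simp only [Function.uncurry, hΦ']; ring
  simp_rw [h1]
  rw [integral_smul, enorm_smul, hε1, one_mul, integral_integral_swap hint]
  refine (enorm_integral_le_lintegral_enorm _).trans ?_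
  have hae : ∀ᵐ s ∂(volume.restrict (uIoc 0 r)), ‖∫ p, Φ p s‖ₑ ≤ ENNReal.ofReal (4 * R) *
      (ENNReal.ofReal C * (ENNReal.ofReal ‖f‖ * ENNReal.ofReal ‖g‖)) *
        ENNReal.ofReal (Real.sqrt |t - s|)⁻¹ := by
    have hne : ∀ᵐ s ∂(volume.restrict (uIoc 0 r)), s ≠ t :=
      ae_restrict_of_ae (Measure.ae_ne volume t)
    filter_upwards [hne] with s hs
    have hmf : Measurable fun z => cis (s * b z) * hatL2 f z :=
      (continuous_cis.comp (by fun_prop)).measurable.mul (measurable_hatL2 f)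
    have hmg : Measurable fun z => cis (s * c z) * hatL2 g z :=
      (continuous_cis.comp (by fun_prop)).measurable.mul (measurable_hatL2 g)
    have hnf := eLpNorm_cis_mul_hatL2_le (θ := fun z => s * b z) f
    have hng := eLpNorm_cis_mul_hatL2_le (θ := fun z => s * c z) g
    refine (h R U m hR hm x (t - s) (sub_ne_zero.2 hs.symm) _ _ hmf hmg
      ⟨hmf.aestronglyMeasurable, hnf.trans_lt ENNReal.ofReal_lt_top⟩
      ⟨hmg.aestronglyMeasurable, hng.trans_lt ENNReal.ofReal_lt_top⟩).trans ?_
    calc _ ≤ ENNReal.ofReal (4 * R) * (ENNReal.ofReal (C * (Real.sqrt |t - s|)⁻¹) *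
          (ENNReal.ofReal ‖f‖ * ENNReal.ofReal ‖g‖)) := by gcongr
      _ = _ := by rw [ENNReal.ofReal_mul hC]; ring
  calc _ ≤ ∫⁻ s in uIoc 0 r, ENNReal.ofReal (4 * R) *
      (ENNReal.ofReal C * (ENNReal.ofReal ‖f‖ * ENNReal.ofReal ‖g‖)) *
        ENNReal.ofReal (Real.sqrt |t - s|)⁻¹ := lintegral_mono_ae hae
    _ = ENNReal.ofReal (4 * R) * (ENNReal.ofReal C * (ENNReal.ofReal ‖f‖ * ENNReal.ofReal ‖g‖)) *
        ∫⁻ s in uIoc 0 r, ENNReal.ofReal (Real.sqrt |t - s|)⁻¹ :=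
        lintegral_const_mul _ (by fun_prop)
    _ ≤ ENNReal.ofReal (4 * R) * (ENNReal.ofReal C * (ENNReal.ofReal ‖f‖ * ENNReal.ofReal ‖g‖)) *
        ENNReal.ofReal (8 * |r| * (Real.sqrt t)⁻¹) := by
        gcongr
        exact lintegral_uIoc_inv_sqrt_le ht r
    _ = _ := by
        rw [← ENNReal.ofReal_mul (by positivity), ← ENNReal.ofReal_mul hC,
          ← ENNReal.ofReal_mul (by positivity), ← ENNReal.ofReal_mul (by positivity)]
        congr 1; ring

theorem integral_mul_pseudoProductHat {σ : FreqPlane → ℂ} {χ F G : ℝ → ℂ}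
    (hint : Integrable fun p : ℝ × ℝ => χ (p.1 + p.2) * (σ !₂[p.1, p.2] * (F p.1 * G p.2))) :
    Integrable (fun ξ => χ ξ * pseudoProductHat σ F G ξ) ∧
    ∫ ξ, χ ξ * pseudoProductHat σ F G ξ
      = ∫ p : ℝ × ℝ, χ (p.1 + p.2) * (σ !₂[p.1, p.2] * (F p.1 * G p.2)) := by
  have hmp := measurePreserving_sub_prod (volume : Measure ℝ) (volume : Measure ℝ)
  have h1 := hmp.integrable_comp_of_integrable hint
  have h2 : ∀ ξ, χ ξ * pseudoProductHat σ F G ξ = ∫ η, ((fun p : ℝ × ℝ =>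
      χ (p.1 + p.2) * (σ !₂[p.1, p.2] * (F p.1 * G p.2))) ∘ fun z : ℝ × ℝ => (z.1 - z.2, z.2))
        (ξ, η) := fun ξ => by
    simp only [pseudoProductHat, Function.comp, sub_add_cancel]
    rw [← integral_const_mul]
    refine integral_congr_ae (ae_of_all _ fun η => ?_)
    simp only; ring
  simp_rw [h2]
  refine ⟨h1.integral_prod_left, ?_⟩
  rw [← integral_prod _ h1]
  have h3 := integral_map (μ := (volume : Measure ℝ).prod volume) hmp.measurable.aemeasurable
    (f := fun p : ℝ × ℝ => χ (p.1 + p.2) * (σ !₂[p.1, p.2] * (F p.1 * G p.2)))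
    (by rw [hmp.map_eq]; exact hint.aestronglyMeasurable)
  rw [hmp.map_eq] at h3
  exact h3.symm

/-- Inversion at almost every `x` followed by the shear of variables; no absolute value is taken
inside, so the oscillation remains available. -/
theorem eLpNorm_top_le_of_form {u f g : L2Line} {χ : ℝ → ℂ} {σ : FreqPlane → ℂ} (hχ : Continuous χ)
    (hχ1 : ∀ ξ, ‖χ ξ‖ ≤ 1)
    (hint : Integrable fun p : ℝ × ℝ => σ !₂[p.1, p.2] * (hatL2 f p.1 * hatL2 g p.2))
    (hu : hatL2 u =ᵐ[volume] fun ξ => χ ξ * pseudoProductHat σ (hatL2 f) (hatL2 g) ξ) {A : ℝ≥0∞}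
    (hA : ∀ x : ℝ, ‖∫ p : ℝ × ℝ, cis (x * (p.1 + p.2)) * χ (p.1 + p.2) *
      (σ !₂[p.1, p.2] * (hatL2 f p.1 * hatL2 g p.2))‖ₑ ≤ A) : eLpNorm u ⊤ volume ≤ A := by
  have hi := (integral_mul_pseudoProductHat (χ := χ) (integrable_bounded_mul
    (hχ.comp (by fun_prop : Continuous fun p : ℝ × ℝ => p.1 + p.2)).aestronglyMeasurable
    (fun p => hχ1 _) hint)).1
  rw [eLpNorm_exponent_top]
  refine essSup_le_of_ae_le _ ?_
  filter_upwards [ae_eq_integral_of_hatL2 hi hu] with x hx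
  have hc : Continuous fun ξ => cis (x * ξ) * χ ξ := (continuous_cis.comp (by fun_prop)).mul hχ
  have h2 := (integral_mul_pseudoProductHat (χ := fun ξ => cis (x * ξ) * χ ξ)
    (integrable_bounded_mul (M := 1)
    (hc.comp (by fun_prop : Continuous fun p : ℝ × ℝ => p.1 + p.2)).aestronglyMeasurable
    (fun p => by
      simp only [norm_mul, norm_cis, one_mul]
      exact hχ1 _) hint)).2
  have h1 : ‖((Real.sqrt (2 * Real.pi) : ℂ))⁻¹‖ₑ ≤ 1 := by
    rw [← ofReal_norm, ← ENNReal.ofReal_one]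
    refine ENNReal.ofReal_le_ofReal ?_
    rw [norm_inv, Complex.norm_real, Real.norm_of_nonneg (Real.sqrt_nonneg _)]
    refine inv_le_one_of_one_le₀ (Real.one_le_sqrt.2 ?_)
    linarith [Real.pi_gt_three]
  have h3 : ∫ ξ, Complex.exp (Complex.I * (x * ξ : ℝ)) *
      (χ ξ * pseudoProductHat σ (hatL2 f) (hatL2 g) ξ)
      = ∫ ξ, cis (x * ξ) * χ ξ * pseudoProductHat σ (hatL2 f) (hatL2 g) ξ := by
    refine integral_congr_ae (ae_of_all _ fun ξ => ?_)
    simp only [cis]; ring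
  rw [hx, enorm_mul, h3, h2]
  calc _ ≤ 1 * A := mul_le_mul' h1 (hA x)
    _ = A := one_mul A

/-- The dispersive estimate under condition (H), at the endpoint `q = ∞`. -/
theorem pointwiseBound_top_of_secondDeriv {a b c : ℝ → ℝ} (ha : ContDiff ℝ ∞ a)
    (hb : ContDiff ℝ ∞ b) (hc : ContDiff ℝ ∞ c) (hH : SecondDerivBddAway a) (U : Set FreqPlane) :
    PointwiseBound 1 a b c U ⊤ fun t => t ^ (1 / 2 : ℝ) := by
  obtain ⟨C, hC, h⟩ := enorm_integral_duhamel_form_le ha hb hc hH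
  refine ⟨C, fun R m hR hm f g u v w hs t ht => ?_⟩
  have hac := ha.continuous
  have hI : ‖-Complex.I‖ = 1 := by simp
  have hφ := continuous_phase hac hb.continuous hc.continuous
  refine eLpNorm_top_le_of_form (χ := fun ξ => cis (t * a ξ) * -Complex.I)
    (σ := duhamelSymbol a b c m t) (f := f) (g := g)
    ((continuous_cis.comp (by fun_prop)).mul continuous_const) (fun ξ => ?_) ?_ ?_ fun x => ?_
  · rw [norm_mul, norm_cis, hI, one_mul]
  · refine (hm.integrable_form (k := fun p => osc t (phase a b c !₂[p.1, p.2])) (M := |t|)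
      ((continuous_osc t).comp (hφ.comp continuous_pt)).measurable (fun p => norm_osc_le _ _)
      (memLp_hatL2 f) (memLp_hatL2 g)).congr (ae_of_all _ fun p => ?_)
    simp only [duhamelSymbol]; ring
  · filter_upwards [hs.hatL2_eq ha hb hc hm.smooth.continuous hm.norm_le_one ht.le] with ξ hξ
    rw [hξ, mul_assoc]
  · have h1 : ∫ p : ℝ × ℝ, cis (x * (p.1 + p.2)) * (cis (t * a (p.1 + p.2)) * -Complex.I) *
        (duhamelSymbol a b c m t !₂[p.1, p.2] * (hatL2 f p.1 * hatL2 g p.2))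
        = -Complex.I * ∫ p : ℝ × ℝ, cis (x * (p.1 + p.2) + t * a (p.1 + p.2)) *
          (duhamelSymbol a b c m t !₂[p.1, p.2] * (hatL2 f p.1 * hatL2 g p.2)) := by
      rw [← integral_const_mul]
      refine integral_congr_ae (ae_of_all _ fun p => ?_)
      simp only [cis_add]; ring
    rw [h1, enorm_mul, ← ofReal_norm (-Complex.I), hI, ENNReal.ofReal_one, one_mul]
    refine (h R U m hR hm x t t ht f g).trans (le_of_eq ?_)
    congr 1
    have h2 : |t| * (Real.sqrt t)⁻¹ = t ^ (1 / 2 : ℝ) := by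
      rw [abs_of_pos ht, ← Real.sqrt_eq_rpow, ← div_eq_mul_inv, Real.div_sqrt]
    rw [h2]; ring

/-- Interpolation of `t^{1/2}` at `q = ∞`, from dispersion, with `t^{3/4}` at `q = 2`, from the
level gain `1/4`. -/
theorem pointwiseBound_of_secondDeriv {a b c : ℝ → ℝ} (ha : ContDiff ℝ ∞ a)
    (hb : ContDiff ℝ ∞ b) (hc : ContDiff ℝ ∞ c) (hHa : SecondDerivBddAway a)
    (hHb : SecondDerivBddAway b) (hHc : SecondDerivBddAway c) (U : Set FreqPlane) {q : ℝ≥0∞}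
    (hq : 2 ≤ q) : PointwiseBound 1 a b c U q fun t => t ^ (1 / 2 + invExp q / 2) := by
  obtain ⟨C₁, h₁⟩ := pointwiseBound_top_of_secondDeriv ha hb hc hHa U
  obtain ⟨C₂, h₂⟩ := pointwiseBound_rpow (q := 2) (γ := 3 / 4) ha hb hc
    (levelBound_of_secondDeriv ha hb hc hHa hHb hHc U) le_rfl
    (by rw [interpExp, invExp_two]; norm_num) (by norm_num) (by norm_num)
  have hi0 := invExp_nonneg q
  have hi1 := invExp_le_half hq
  refine ⟨max (max C₁ C₂) 0, fun R m hR hm f g u v w hs t ht => ?_⟩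
  set C := max (max C₁ C₂) 0
  have hC0 : 0 ≤ C := le_max_right _ _
  have key : ∀ C' θ : ℝ, C' ≤ C → ENNReal.ofReal (C' * R * t ^ θ * ‖f‖ * ‖g‖)
      ≤ ENNReal.ofReal ((C * R * (‖f‖ * ‖g‖)) * t ^ θ) := fun C' θ hC' => by
    refine ENNReal.ofReal_le_ofReal ?_
    have : 0 ≤ t ^ θ := Real.rpow_nonneg ht.le θ
    calc _ ≤ C * R * t ^ θ * ‖f‖ * ‖g‖ := by gcongr
      _ = _ := by ring
  refine (eLpNorm_interpolate (Lp.aestronglyMeasurable (u t)) hq).trans ?_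
  calc _ ≤ ENNReal.ofReal ((C * R * (‖f‖ * ‖g‖)) * t ^ (3 / 4 : ℝ)) ^ (2 * invExp q) *
        ENNReal.ofReal ((C * R * (‖f‖ * ‖g‖)) * t ^ (1 / 2 : ℝ)) ^ (1 - 2 * invExp q) := by
        gcongr
        · exact (h₂ R m hR hm f g u v w hs t ht).trans
            (key C₂ (3 / 4) ((le_max_right _ _).trans (le_max_left _ _)))
        · linarith
        · exact (h₁ R m hR hm f g u v w hs t ht).trans
            (key C₁ (1 / 2) ((le_max_left _ _).trans (le_max_left _ _)))
    _ = _ := by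
        rw [rpow_interpolate (by positivity) ht (by linarith) (by linarith)]
        congr 1
        rw [show 2 * invExp q * (3 / 4) + (1 - 2 * invExp q) * (1 / 2) = 1 / 2 + invExp q / 2 by ring]
        ring

/-! ### Products of free waves: Plancherel in time on separated velocity intervals. -/

theorem lintegral_enorm_integral_cis_sq {g : ℝ → ℂ} (h1 : Integrable g) (h2 : MemLp g 2) :
    ∫⁻ t : ℝ, ‖∫ τ, cis (t * τ) * g τ‖ₑ ^ (2 : ℝ)
      = ENNReal.ofReal (2 * Real.pi) * ∫⁻ τ, ‖g τ‖ₑ ^ (2 : ℝ) := by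
  have hpi : (0 : ℝ) < 2 * Real.pi := by positivity
  have e1 : ∀ t : ℝ, ∫ τ, cis (t * τ) * g τ = 𝓕⁻ g (t / (2 * Real.pi)) := fun t => by
    rw [Real.fourierInv_eq']
    refine integral_congr_ae (ae_of_all _ fun τ => ?_)
    have : 2 * Real.pi * inner ℝ τ (t / (2 * Real.pi)) = t * τ := by
      simp only [RCLike.inner_apply, conj_trivial]; field_simp
    simp only [cis, this, smul_eq_mul]
    rw [mul_comm Complex.I]
  have hc : Continuous (𝓕⁻ g) := by
    have : 𝓕⁻ g = fun x => 𝓕 g (-x) := by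
      ext x; rw [Real.fourierInv_eq_fourier_neg]
    rw [this]
    exact (continuous_fourier_of_integrable h1).comp continuous_neg
  simp_rw [e1]
  rw [lintegral_comp_div_pos hpi (g := fun y => ‖𝓕⁻ g y‖ₑ ^ (2 : ℝ)) (hc.measurable.enorm.pow_const _),
    ← l2n_rpow_two (fun y => ‖𝓕⁻ g y‖ₑ), ← l2n_rpow_two (fun y => ‖g y‖ₑ), ← eLpNorm_two_eq_l2n,
    ← eLpNorm_two_eq_l2n, eLpNorm_fourierInv_eq h1 h2]

/-- Plancherel's theorem in time for an oscillatory integral with an injective phase `h`. -/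
theorem lintegral_enorm_integral_cis_comp_sq_le {K : Set ℝ} (hK : MeasurableSet K) {h h' : ℝ → ℝ}
    (hh : ∀ x ∈ K, HasDerivAt h (h' x) x) (hinj : InjOn h K) {δ : ℝ} (hδ : 0 < δ)
    (hδ' : ∀ x ∈ K, δ ≤ |h' x|) {A : ℝ → ℂ} (hA : IntegrableOn A K) :
    ∫⁻ t : ℝ, ‖∫ x in K, cis (t * h x) * A x‖ₑ ^ (2 : ℝ)
      ≤ ENNReal.ofReal (2 * Real.pi / δ) * ∫⁻ x in K, ‖A x‖ₑ ^ (2 : ℝ) := by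
  have hpi : (0 : ℝ) < 2 * Real.pi := by positivity
  have hd : ∀ x ∈ K, HasDerivWithinAt h (h' x) K x := fun x hx => (hh x hx).hasDerivWithinAt
  by_cases htop : ∫⁻ x in K, ‖A x‖ₑ ^ (2 : ℝ) = ⊤
  · rw [htop, ENNReal.mul_top (ENNReal.ofReal_pos.2 (by positivity)).ne']; exact le_top
  set inv := Function.invFunOn h K with hinv
  have hleft : ∀ x ∈ K, inv (h x) = x := fun x hx => hinj.leftInvOn_invFunOn hx
  -- The substitution `τ = h x` turns the integral into a Fourier integral of the density `A /
  -- |h'|`. Its squared `L²` norm is `∫ |A|² / |h'|`, since one of the two factors `1/|h'|` is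
  -- cancelled by the Jacobian; this is where `1/δ` comes from.
  set g₀ : ℝ → ℂ := fun τ => (|h' (inv τ)|)⁻¹ • A (inv τ) with hg₀
  have hg₀h : ∀ x ∈ K, |h' x| • g₀ (h x) = A x := fun x hx => by
    have : |h' x| ≠ 0 := (hδ.trans_le (hδ' x hx)).ne'
    simp only [hg₀, hleft x hx]
    rw [smul_smul, mul_inv_cancel₀ this, one_smul]
  have hKi : MeasurableSet (h '' K) :=
    hK.image_of_continuousOn_injOn (fun x hx => (hh x hx).continuousAt.continuousWithinAt) hinj
  set g := (h '' K).indicator g₀ with hg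
  have hg1 : Integrable g := by
    rw [hg, integrable_indicator_iff hKi, integrableOn_image_iff_integrableOn_abs_deriv_smul hK hd hinj]
    exact hA.congr_fun (fun x hx => (hg₀h x hx).symm) hK
  have hsq : ∫⁻ τ, ‖g τ‖ₑ ^ (2 : ℝ) ≤ ENNReal.ofReal δ⁻¹ * ∫⁻ x in K, ‖A x‖ₑ ^ (2 : ℝ) := by
    have e1 : ∀ τ, ‖g τ‖ₑ ^ (2 : ℝ) = (h '' K).indicator (fun τ => ‖g₀ τ‖ₑ ^ (2 : ℝ)) τ := fun τ => by
      by_cases hτ : τ ∈ h '' K <;> simp [hg, hτ]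
    simp_rw [e1]
    rw [lintegral_indicator hKi, lintegral_image_eq_lintegral_abs_deriv_mul hK hd hinj,
      ← lintegral_const_mul' _ _ ENNReal.ofReal_ne_top]
    refine setLIntegral_mono' hK fun x hx => ?_
    have h0 : 0 < |h' x| := hδ.trans_le (hδ' x hx)
    have e3 : g₀ (h x) = (|h' x|)⁻¹ • A x := by simp only [hg₀, hleft x hx]
    rw [e3, enorm_smul, ENNReal.mul_rpow_of_nonneg _ _ (by norm_num), ← mul_assoc,
      Real.enorm_eq_ofReal (by positivity), ENNReal.ofReal_rpow_of_nonneg (by positivity) (by norm_num),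
      ← ENNReal.ofReal_mul h0.le]
    refine mul_le_mul_left (ENNReal.ofReal_le_ofReal ?_) _
    rw [Real.rpow_two, sq, mul_inv_cancel_left₀ h0.ne']
    exact inv_anti₀ hδ (hδ' x hx)
  have hg2 : MemLp g 2 := by
    refine ⟨hg1.aestronglyMeasurable, ?_⟩
    rw [eLpNorm_two_eq_l2n, l2n]
    refine ENNReal.rpow_lt_top_of_nonneg (by norm_num) (hsq.trans_lt ?_).ne
    exact ENNReal.mul_lt_top ENNReal.ofReal_lt_top (lt_top_iff_ne_top.2 htop)
  have e2 : ∀ t, ∫ x in K, cis (t * h x) * A x = ∫ τ, cis (t * τ) * g τ := fun t => by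
    have : ∀ τ, cis (t * τ) * g τ = (h '' K).indicator (fun τ => cis (t * τ) * g₀ τ) τ := fun τ => by
      by_cases hτ : τ ∈ h '' K <;> simp [hg, hτ]
    simp_rw [this]
    rw [integral_indicator hKi, integral_image_eq_integral_abs_deriv_smul hK hd hinj]
    refine setIntegral_congr_fun hK fun x hx => ?_
    rw [← mul_smul_comm, hg₀h x hx]
  simp_rw [e2]
  rw [lintegral_enorm_integral_cis_sq hg1 hg2]
  refine (mul_le_mul_right hsq _).trans (le_of_eq ?_)
  rw [← mul_assoc, ← ENNReal.ofReal_mul hpi.le, div_eq_mul_inv]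

/-- The symbol `σ` carried along by the free flows of `b` and `c`. -/
noncomputable def evolved (b c : ℝ → ℝ) (σ : FreqPlane → ℂ) (t : ℝ) : FreqPlane → ℂ :=
  fun p => cis (t * (b (p 0) + c (p 1))) * σ p

theorem enorm_evolved (b c : ℝ → ℝ) (σ : FreqPlane → ℂ) (t : ℝ) (p : FreqPlane) :
    ‖evolved b c σ t p‖ₑ = ‖σ p‖ₑ := by
  rw [evolved, enorm_mul, enorm_cis, one_mul]

/-- The size of the evolved pseudo-product in the Fourier algebra. -/
noncomputable def evolvedMass (b c : ℝ → ℝ) (σ : FreqPlane → ℂ) (f g : L2Line) (t : ℝ) : ℝ≥0∞ :=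
  ∫⁻ ξ, ‖pseudoProductHat (evolved b c σ t) (hatL2 f) (hatL2 g) ξ‖ₑ

section
variable {b c : ℝ → ℝ} {σ : FreqPlane → ℂ} {f g : L2Line}

theorem stronglyMeasurable_evolved (hb : Continuous b) (hc : Continuous c) (hσ : Measurable σ)
    (f g : L2Line) : StronglyMeasurable fun q : ℝ × ℝ =>
      pseudoProductHat (evolved b c σ q.1) (hatL2 f) (hatL2 g) q.2 := by
  have h : Measurable fun q : (ℝ × ℝ) × ℝ =>
      evolved b c σ q.1.1 !₂[q.1.2 - q.2, q.2] * hatL2 f (q.1.2 - q.2) * hatL2 g q.2 := by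
    have h1 : Measurable fun q : (ℝ × ℝ) × ℝ => cis (q.1.1 * (b (q.1.2 - q.2) + c q.2)) :=
      (continuous_cis.comp (by fun_prop)).measurable
    have h2 : Measurable fun q : (ℝ × ℝ) × ℝ => (!₂[q.1.2 - q.2, q.2] : FreqPlane) :=
      (continuous_sheared_pt.comp (f := fun q : (ℝ × ℝ) × ℝ => (q.1.2, q.2)) (by fun_prop)).measurable
    exact ((h1.mul (hσ.comp h2)).mul ((measurable_hatL2 f).comp (by fun_prop))).mul
      ((measurable_hatL2 g).comp (by fun_prop))
  exact h.stronglyMeasurable.integral_prod_right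

theorem measurable_evolvedMass (hb : Continuous b) (hc : Continuous c) (hσ : Measurable σ)
    (f g : L2Line) : Measurable (evolvedMass b c σ f g) :=
  (stronglyMeasurable_evolved hb hc hσ f g).enorm.lintegral_prod_right'

theorem enorm_pseudoProductHat_rect_le {I J : Set ℝ} {S : ℝ≥0∞} (hS : ∀ p, ‖σ p‖ₑ ≤ S)
    (hsupp : ∀ p, σ p ≠ 0 → p 0 ∈ I ∧ p 1 ∈ J) (z η : ℝ) :
    ‖σ !₂[z, η] * hatL2 f z * hatL2 g η‖ₑ ≤ S * (I.indicator (hatE f) z * J.indicator (hatE g) η) := by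
  by_cases h : σ !₂[z, η] = 0
  · simp [h]
  · have h1 := hsupp _ h
    simp only [Matrix.cons_val_zero, Matrix.cons_val_one, Matrix.cons_val_fin_one] at h1
    rw [indicator_of_mem h1.1, indicator_of_mem h1.2, enorm_mul, enorm_mul, mul_assoc]
    exact mul_le_mul_left (hS _) _

theorem lintegral_indicator_le_l2n {I : Set ℝ} (hI : MeasurableSet I) {ℓ : ℝ}
    (hd : ∀ x ∈ I, ∀ y ∈ I, |x - y| ≤ ℓ) {F : ℝ → ℝ≥0∞} (hF : Measurable F) :
    ∫⁻ x, I.indicator F x ≤ ENNReal.ofReal ℓ ^ (1 / 2 : ℝ) * l2n (I.indicator F) := by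
  have h1 : ∀ x, I.indicator F x = I.indicator (fun _ => 1) x * I.indicator F x := fun x => by
    by_cases hx : x ∈ I <;> simp [hx]
  have h2 : ∀ x, (I.indicator (fun _ => (1 : ℝ≥0∞)) x) ^ (2 : ℝ) = I.indicator (fun _ => 1) x :=
    fun x => by by_cases hx : x ∈ I <;> simp [hx]
  rw [lintegral_congr h1]
  refine (lintegral_mul_le_l2n (aemeasurable_const.indicator hI) (hF.indicator hI).aemeasurable).trans ?_
  refine mul_le_mul_left ?_ _
  rw [l2n]
  gcongr
  simp_rw [h2]
  rw [lintegral_indicator hI, setLIntegral_one]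
  exact volume_le_of_pairwise hd

variable {I J : Set ℝ} {S : ℝ≥0∞} {ℓ : ℝ}

/-- The bound uniform in time, without oscillation: the mass of a convolution is the product of the
masses, and each mass is `O(ℓ^{1/2})` times the `L²` norm because the supports have length at most
`ℓ`. -/
theorem evolvedMass_rect_le
    (hI : MeasurableSet I) (hJ : MeasurableSet J) (hdI : ∀ x ∈ I, ∀ y ∈ I, |x - y| ≤ ℓ)
    (hdJ : ∀ x ∈ J, ∀ y ∈ J, |x - y| ≤ ℓ) (hS : ∀ p, ‖σ p‖ₑ ≤ S)
    (hsupp : ∀ p, σ p ≠ 0 → p 0 ∈ I ∧ p 1 ∈ J) (t : ℝ) :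
    evolvedMass b c σ f g t
      ≤ S * ENNReal.ofReal ℓ * (l2n (I.indicator (hatE f)) * l2n (J.indicator (hatE g))) := by
  have hF := (measurable_hatE f).indicator hI
  have hG := (measurable_hatE g).indicator hJ
  have h1 : ∀ ξ, ‖pseudoProductHat (evolved b c σ t) (hatL2 f) (hatL2 g) ξ‖ₑ
      ≤ ∫⁻ η, S * (I.indicator (hatE f) (ξ - η) * J.indicator (hatE g) η) := fun ξ => by
    refine (enorm_integral_le_lintegral_enorm _).trans (lintegral_mono fun η => ?_)
    exact enorm_pseudoProductHat_rect_le (fun p => (enorm_evolved b c σ t p).trans_le (hS p))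
      (fun p hp => hsupp p fun h => hp (by simp [evolved, h])) _ _
  have hFG : Measurable fun p : ℝ × ℝ => I.indicator (hatE f) p.1 * J.indicator (hatE g) p.2 :=
    (hF.comp measurable_fst).mul (hG.comp measurable_snd)
  have hk := hFG.const_mul S
  calc evolvedMass b c σ f g t
      ≤ ∫⁻ ξ, ∫⁻ η, S * (I.indicator (hatE f) (ξ - η) * J.indicator (hatE g) η) := lintegral_mono h1
    _ = S * ((∫⁻ z, I.indicator (hatE f) z) * ∫⁻ η, J.indicator (hatE g) η) := by
        rw [lintegral_shear hk, lintegral_const_mul _ hFG, Measure.volume_eq_prod,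
          lintegral_prod_mul hF.aemeasurable hG.aemeasurable]
    _ ≤ S * ((ENNReal.ofReal ℓ ^ (1 / 2 : ℝ) * l2n (I.indicator (hatE f))) *
        (ENNReal.ofReal ℓ ^ (1 / 2 : ℝ) * l2n (J.indicator (hatE g)))) := by
        gcongr
        · exact lintegral_indicator_le_l2n hI hdI (measurable_hatE f)
        · exact lintegral_indicator_le_l2n hJ hdJ (measurable_hatE g)
    _ = S * (ENNReal.ofReal ℓ ^ (1 / 2 : ℝ) * ENNReal.ofReal ℓ ^ (1 / 2 : ℝ)) *
        (l2n (I.indicator (hatE f)) * l2n (J.indicator (hatE g))) := by ring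
    _ = _ := by
        rw [← ENNReal.rpow_add_of_nonneg _ _ (by norm_num) (by norm_num)]; norm_num

/-- For fixed output frequency `ξ` the phase `η ↦ b(ξ-η) + c(η)` has derivative `c'(η) - b'(ξ-η)`,
the velocity difference. On the slice, which is an interval, it has constant sign and size at least
`δ`, so the phase is injective and Plancherel in time applies. -/
theorem lintegral_enorm_evolved_sq_le (hb : ∀ x, HasDerivAt b (deriv b x) x)
    (hc : ∀ x, HasDerivAt c (deriv c x) x) (hσ : Measurable σ) (hI : MeasurableSet I)
    (hJ : MeasurableSet J) (hIc : I.OrdConnected) (hJc : J.OrdConnected) {δ : ℝ} (hδ : 0 < δ)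
    (hsep : (∀ z ∈ I, ∀ η ∈ J, δ ≤ deriv c η - deriv b z) ∨
      ∀ z ∈ I, ∀ η ∈ J, δ ≤ deriv b z - deriv c η) (hSt : S ≠ ⊤) (hS : ∀ p, ‖σ p‖ₑ ≤ S)
    (hsupp : ∀ p, σ p ≠ 0 → p 0 ∈ I ∧ p 1 ∈ J) (ξ : ℝ) :
    ∫⁻ t, ‖pseudoProductHat (evolved b c σ t) (hatL2 f) (hatL2 g) ξ‖ₑ ^ (2 : ℝ)
      ≤ ENNReal.ofReal (2 * Real.pi / δ) *
        ∫⁻ η, (S * (I.indicator (hatE f) (ξ - η) * J.indicator (hatE g) η)) ^ (2 : ℝ) := by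
  set K : Set ℝ := {η | ξ - η ∈ I ∧ η ∈ J} with hK
  have hKm : MeasurableSet K := ((measurable_const.sub measurable_id) hI).inter hJ
  have hKc : Convex ℝ K := by
    refine Set.OrdConnected.convex ⟨fun x hx y hy z hz => ⟨?_, hJc.out hx.2 hy.2 hz⟩⟩
    exact hIc.out hy.1 hx.1 ⟨by linarith [hz.2], by linarith [hz.1]⟩
  set A : ℝ → ℂ := fun η => σ !₂[ξ - η, η] * hatL2 f (ξ - η) * hatL2 g η with hA
  set h : ℝ → ℝ := fun η => b (ξ - η) + c η with hh
  have hd : ∀ η, HasDerivAt h (deriv c η - deriv b (ξ - η)) η := fun η =>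
    (((hb (ξ - η)).comp η ((hasDerivAt_id η).const_sub ξ)).add (hc η)).congr_deriv (by ring)
  have hcont : ContinuousOn h K := fun η _ => (hd η).continuousAt.continuousWithinAt
  have hinj : InjOn h K := by
    rcases hsep with hs | hs
    · refine (strictMonoOn_of_deriv_pos hKc hcont fun η hη => ?_).injOn
      rw [(hd η).deriv]
      exact hδ.trans_le (hs _ (interior_subset hη).1 _ (interior_subset hη).2)
    · refine (strictAntiOn_of_deriv_neg hKc hcont fun η hη => ?_).injOn
      rw [(hd η).deriv]
      linarith [hs _ (interior_subset hη).1 _ (interior_subset hη).2]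
  have hδ' : ∀ η ∈ K, δ ≤ |deriv c η - deriv b (ξ - η)| := fun η hη => by
    rcases hsep with hs | hs
    · exact (hs _ hη.1 _ hη.2).trans (le_abs_self _)
    · exact ((hs _ hη.1 _ hη.2).trans_eq (neg_sub _ _).symm).trans (neg_le_abs _)
  have h1 := lintegral_enorm_integral_cis_comp_sq_le hKm (fun η _ => hd η) hinj hδ hδ'
    (integrable_pseudoProduct_integrand hσ hSt hS f g ξ).integrableOn (A := A)
  have h2 : ∀ t, pseudoProductHat (evolved b c σ t) (hatL2 f) (hatL2 g) ξ
      = ∫ η in K, cis (t * h η) * A η := fun t => by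
    rw [setIntegral_eq_integral_of_forall_compl_eq_zero fun η hη => ?_]
    · refine integral_congr_ae (ae_of_all _ fun η => ?_)
      simp [evolved, hA, hh, mul_assoc]
    · have : σ !₂[ξ - η, η] = 0 := by
        by_contra hne
        exact hη (show ξ - η ∈ I ∧ η ∈ J by simpa using hsupp _ hne)
      simp [hA, this]
  simp_rw [h2]
  refine h1.trans (mul_le_mul_right ((setLIntegral_le_lintegral _ _).trans (lintegral_mono fun η => ?_)) _)
  gcongr
  exact enorm_pseudoProductHat_rect_le hS hsupp _ _

/-- The output frequencies lie in a sum of two sets of diameter at most `ℓ`, so Cauchy–Schwarz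
passes from `L¹` to `L²` in `ξ` at the cost `2ℓ`; then the integrals in `t` and `ξ` are exchanged.
-/
theorem lintegral_evolvedMass_sq_le (hb : ∀ x, HasDerivAt b (deriv b x) x)
    (hc : ∀ x, HasDerivAt c (deriv c x) x) (hσ : Measurable σ) (hI : MeasurableSet I)
    (hJ : MeasurableSet J) (hIc : I.OrdConnected) (hJc : J.OrdConnected)
    (hdI : ∀ x ∈ I, ∀ y ∈ I, |x - y| ≤ ℓ) (hdJ : ∀ x ∈ J, ∀ y ∈ J, |x - y| ≤ ℓ) {δ : ℝ} (hδ : 0 < δ)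
    (hsep : (∀ z ∈ I, ∀ η ∈ J, δ ≤ deriv c η - deriv b z) ∨
      ∀ z ∈ I, ∀ η ∈ J, δ ≤ deriv b z - deriv c η) (hSt : S ≠ ⊤) (hS : ∀ p, ‖σ p‖ₑ ≤ S)
    (hsupp : ∀ p, σ p ≠ 0 → p 0 ∈ I ∧ p 1 ∈ J) :
    ∫⁻ t, evolvedMass b c σ f g t ^ (2 : ℝ) ≤ ENNReal.ofReal (2 * ℓ) * (ENNReal.ofReal (2 * Real.pi / δ) *
      (S * (l2n (I.indicator (hatE f)) * l2n (J.indicator (hatE g)))) ^ (2 : ℝ)) := by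
  have hbc : Continuous b := continuous_iff_continuousAt.2 fun x => (hb x).continuousAt
  have hcc : Continuous c := continuous_iff_continuousAt.2 fun x => (hc x).continuousAt
  have hF := (measurable_hatE f).indicator hI
  have hG := (measurable_hatE g).indicator hJ
  set V : ℝ → ℝ → ℂ := fun t ξ => pseudoProductHat (evolved b c σ t) (hatL2 f) (hatL2 g) ξ with hV
  have hVm := stronglyMeasurable_evolved hbc hcc hσ f g
  have h1 : ∀ t, evolvedMass b c σ f g t ^ (2 : ℝ)
      ≤ ENNReal.ofReal (2 * ℓ) * ∫⁻ ξ, ‖V t ξ‖ₑ ^ (2 : ℝ) := fun t => by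
    have hm : Measurable fun ξ => ‖V t ξ‖ₑ :=
      (hVm.comp_measurable (by fun_prop : Measurable fun ξ : ℝ => (t, ξ))).measurable.enorm
    set X : Set ℝ := {ξ | ‖V t ξ‖ₑ ≠ 0} with hX
    have hXm : MeasurableSet X := hm (measurableSet_singleton 0).compl
    have hex : ∀ ξ ∈ X, ∃ η, ξ - η ∈ I ∧ η ∈ J := fun ξ hξ => by
      by_contra! hne
      refine hξ ?_
      rw [enorm_eq_zero]
      refine integral_eq_zero_of_ae (ae_of_all _ fun η => ?_)
      have : σ !₂[ξ - η, η] = 0 := by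
        by_contra h0
        have := hsupp _ h0
        simp only [Matrix.cons_val_zero, Matrix.cons_val_one, Matrix.cons_val_fin_one] at this
        exact hne η this.1 this.2
      simp [evolved, this]
    have hXd : ∀ x ∈ X, ∀ y ∈ X, |x - y| ≤ 2 * ℓ := fun x hx y hy => by
      obtain ⟨η, h1, h2⟩ := hex x hx
      obtain ⟨η', h1', h2'⟩ := hex y hy
      have e1 := abs_le.1 (hdI _ h1 _ h1')
      have e2 := abs_le.1 (hdJ _ h2 _ h2')
      exact abs_le.2 ⟨by linarith [e1.1, e2.1], by linarith [e1.2, e2.2]⟩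
    have hXi : X.indicator (fun ξ => ‖V t ξ‖ₑ) = fun ξ => ‖V t ξ‖ₑ := by
      refine indicator_eq_self.2 fun ξ hξ => hξ
    have h2 := lintegral_indicator_le_l2n hXm hXd hm
    rw [hXi] at h2
    calc _ ≤ (ENNReal.ofReal (2 * ℓ) ^ (1 / 2 : ℝ) * l2n fun ξ => ‖V t ξ‖ₑ) ^ (2 : ℝ) := by
          gcongr; exact h2
      _ = _ := by
          rw [ENNReal.mul_rpow_of_nonneg _ _ (by norm_num), l2n_rpow_two, ← ENNReal.rpow_mul]
          norm_num
  have hk : Measurable fun p : ℝ × ℝ =>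
      (S * (I.indicator (hatE f) p.1 * J.indicator (hatE g) p.2)) ^ (2 : ℝ) :=
    (measurable_const.mul ((hF.comp measurable_fst).mul (hG.comp measurable_snd))).pow_const _
  refine (lintegral_mono h1).trans ?_
  rw [lintegral_const_mul' _ _ ENNReal.ofReal_ne_top]
  refine mul_le_mul_right ?_ _
  rw [lintegral_lintegral_swap (by exact (hVm.measurable.enorm.pow_const _).aemeasurable)]
  refine (lintegral_mono fun ξ => lintegral_enorm_evolved_sq_le hb hc hσ hI hJ hIc hJc hδ hsep hSt
    hS hsupp ξ).trans (le_of_eq ?_)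
  rw [lintegral_const_mul' _ _ ENNReal.ofReal_ne_top, lintegral_shear hk]
  simp_rw [ENNReal.mul_rpow_of_nonneg S _ (by norm_num : (0 : ℝ) ≤ 2)]
  rw [lintegral_const_mul' _ _ (ENNReal.rpow_ne_top_of_nonneg (by norm_num) hSt),
    lintegral_fst_mul_snd hF hG]

/-- Interpolation in time between the bound in `L²`, which gains from the separation `δ`, and the
uniform one, which gains only from the length `ℓ`. -/
theorem lintegral_evolvedMass_rpow_le (hb : ∀ x, HasDerivAt b (deriv b x) x)
    (hc : ∀ x, HasDerivAt c (deriv c x) x) (hσ : Measurable σ) (hI : MeasurableSet I)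
    (hJ : MeasurableSet J) (hIc : I.OrdConnected) (hJc : J.OrdConnected) (hℓ : 0 ≤ ℓ)
    (hdI : ∀ x ∈ I, ∀ y ∈ I, |x - y| ≤ ℓ) (hdJ : ∀ x ∈ J, ∀ y ∈ J, |x - y| ≤ ℓ) {δ : ℝ} (hδ : 0 < δ)
    (hsep : (∀ z ∈ I, ∀ η ∈ J, δ ≤ deriv c η - deriv b z) ∨
      ∀ z ∈ I, ∀ η ∈ J, δ ≤ deriv b z - deriv c η) (hSt : S ≠ ⊤) (hS : ∀ p, ‖σ p‖ₑ ≤ S)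
    (hsupp : ∀ p, σ p ≠ 0 → p 0 ∈ I ∧ p 1 ∈ J) {p : ℝ} (hp : 2 ≤ p) :
    (∫⁻ t, evolvedMass b c σ f g t ^ p) ^ (1 / p)
      ≤ ENNReal.ofReal (ℓ ^ (1 - 2 / p) * (4 * Real.pi * ℓ / δ) ^ (1 / p)) *
        (S * (l2n (I.indicator (hatE f)) * l2n (J.indicator (hatE g)))) := by
  have hp0 : 0 < p := by linarith
  set B := S * (l2n (I.indicator (hatE f)) * l2n (J.indicator (hatE g))) with hB
  have hsup : ∀ t, evolvedMass b c σ f g t ≤ ENNReal.ofReal ℓ * B := fun t =>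
    (evolvedMass_rect_le hI hJ hdI hdJ hS hsupp t).trans_eq (by rw [hB]; ring)
  have h2 := lintegral_evolvedMass_sq_le (f := f) (g := g) hb hc hσ hI hJ hIc hJc hdI hdJ hδ hsep
    hSt hS hsupp
  have hBt : B ≠ ⊤ := by
    have e : ∀ (E : Set ℝ) (f : L2Line), l2n (E.indicator (hatE f)) ≠ ⊤ := fun E f =>
      ((l2n_mono fun x => indicator_le_self' (fun _ _ => zero_le) x).trans_lt
        (l2n_hatE_ne_top f).lt_top).ne
    exact ENNReal.mul_ne_top hSt (ENNReal.mul_ne_top (e _ _) (e _ _))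
  have h3 : ∫⁻ t, evolvedMass b c σ f g t ^ p
      ≤ (ENNReal.ofReal ℓ * B) ^ (p - 2) * (ENNReal.ofReal (4 * Real.pi * ℓ / δ) * B ^ (2 : ℝ)) := by
    calc _ ≤ ∫⁻ t, (ENNReal.ofReal ℓ * B) ^ (p - 2) * evolvedMass b c σ f g t ^ (2 : ℝ) := by
          refine lintegral_mono fun t => ?_
          calc evolvedMass b c σ f g t ^ p
              = evolvedMass b c σ f g t ^ (p - 2) * evolvedMass b c σ f g t ^ (2 : ℝ) := by
                rw [← ENNReal.rpow_add_of_nonneg _ _ (by linarith) (by norm_num)]; congr 1; ring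
            _ ≤ _ := by
                gcongr
                · exact hsup t
      _ ≤ _ := by
          rw [lintegral_const_mul' _ _ (ENNReal.rpow_ne_top_of_nonneg (by linarith)
            (ENNReal.mul_ne_top ENNReal.ofReal_ne_top hBt))]
          refine mul_le_mul_right (h2.trans_eq ?_) _
          rw [← mul_assoc, ← ENNReal.ofReal_mul (by positivity)]
          congr 2
          ring
  calc _ ≤ ((ENNReal.ofReal ℓ * B) ^ (p - 2) *
        (ENNReal.ofReal (4 * Real.pi * ℓ / δ) * B ^ (2 : ℝ))) ^ (1 / p) := by gcongr
    _ = ENNReal.ofReal ℓ ^ ((p - 2) * (1 / p)) * ENNReal.ofReal (4 * Real.pi * ℓ / δ) ^ (1 / p) *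
        (B ^ ((p - 2) * (1 / p)) * B ^ (2 * (1 / p))) := by
        rw [ENNReal.mul_rpow_of_nonneg _ _ (by positivity : 0 ≤ 1 / p),
          ENNReal.mul_rpow_of_nonneg _ _ (by linarith : 0 ≤ p - 2),
          ENNReal.mul_rpow_of_nonneg _ _ (by positivity : 0 ≤ 1 / p),
          ENNReal.mul_rpow_of_nonneg _ _ (by positivity : 0 ≤ 1 / p), ← ENNReal.rpow_mul,
          ← ENNReal.rpow_mul, ← ENNReal.rpow_mul]
        ring
    _ = _ := by
        rw [← ENNReal.rpow_add_of_nonneg _ _ (mul_nonneg (by linarith) (by positivity)) (by positivity),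
          show (p - 2) * (1 / p) + 2 * (1 / p) = 1 by field_simp; ring, ENNReal.rpow_one,
          show (p - 2) * (1 / p) = 1 - 2 / p by field_simp,
          ENNReal.ofReal_rpow_of_nonneg hℓ (by rw [sub_nonneg, div_le_one hp0]; exact hp),
          ENNReal.ofReal_rpow_of_nonneg (by positivity) (by positivity),
          ← ENNReal.ofReal_mul (Real.rpow_nonneg hℓ _)]

end

/-! ### Whitney decomposition in the velocities. -/

/-- Minkowski's inequality for countable sums. -/
theorem lintegral_tsum_rpow_le {α ι : Type*} [MeasurableSpace α] {μ : Measure α} [Countable ι]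
    {g : ι → α → ℝ≥0∞} (hg : ∀ i, Measurable (g i)) {p : ℝ} (hp : 1 ≤ p) :
    (∫⁻ x, (∑' i, g i x) ^ p ∂μ) ^ (1 / p) ≤ ∑' i, (∫⁻ x, g i x ^ p ∂μ) ^ (1 / p) := by
  have hp0 : 0 < p := by linarith
  have h1 : ∀ s : Finset ι, (∫⁻ x, (∑ i ∈ s, g i x) ^ p ∂μ) ^ (1 / p)
      ≤ ∑ i ∈ s, (∫⁻ x, g i x ^ p ∂μ) ^ (1 / p) := fun s => by
    have := eLpNorm'_sum_le (μ := μ) (f := g) (s := s) (q := p)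
      (fun i _ => (hg i).aestronglyMeasurable) hp
    simpa [eLpNorm'] using this
  have h2 : ∀ x, (∑' i, g i x) ^ p = ⨆ s : Finset ι, (∑ i ∈ s, g i x) ^ p := fun x => by
    rw [ENNReal.tsum_eq_iSup_sum]
    exact (ENNReal.orderIsoRpow p hp0).map_iSup _
  simp_rw [h2]
  rw [lintegral_iSup_directed, one_div, ENNReal.rpow_inv_le_iff hp0]
  · refine iSup_le fun s => ?_
    rw [← ENNReal.rpow_inv_le_iff hp0, ← one_div]
    exact (h1 s).trans (ENNReal.sum_le_tsum s)
  · exact fun s => ((Finset.measurable_fun_sum s fun i _ => hg i).pow_const p).aemeasurable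
  · refine Monotone.directed_le fun s s' hs x => ?_
    simp only
    gcongr

theorem tsum_mul_le_sqrt {ι : Type*} (u v : ι → ℝ≥0∞) :
    ∑' i, u i * v i ≤ (∑' i, u i ^ (2 : ℝ)) ^ (1 / 2 : ℝ) * (∑' i, v i ^ (2 : ℝ)) ^ (1 / 2 : ℝ) := by
  let _ : MeasurableSpace ι := ⊤
  have := ENNReal.lintegral_mul_le_Lp_mul_Lq (Measure.count : Measure ι) Real.HolderConjugate.two_two
    (f := u) (g := v) measurable_from_top.aemeasurable measurable_from_top.aemeasurable
  simpa only [lintegral_count, Pi.mul_apply] using this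

/-- Sums over pairs of integers at distance at most `3`. -/
theorem tsum_near_diagonal_le {u v : ℤ → ℝ≥0∞} {W : ℤ → ℤ → Prop} [∀ k l, Decidable (W k l)]
    (hW : ∀ k l, W k l → |k - l| ≤ 3) {P Q : ℝ≥0∞} (hu : ∑' k, u k ^ (2 : ℝ) ≤ P ^ (2 : ℝ))
    (hv : ∑' k, v k ^ (2 : ℝ) ≤ Q ^ (2 : ℝ)) :
    ∑' k, ∑' l, (if W k l then u k * v l else 0) ≤ 7 * (P * Q) := by
  have h1 : ∀ k, ∑' l, (if W k l then u k * v l else 0)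
      ≤ ∑ e ∈ Finset.Icc (-3 : ℤ) 3, u k * v (k + e) := fun k => by
    rw [← (Equiv.addLeft k).tsum_eq, tsum_eq_sum (s := Finset.Icc (-3 : ℤ) 3)]
    · refine Finset.sum_le_sum fun e _ => ?_
      show (if W k (k + e) then u k * v (k + e) else 0) ≤ u k * v (k + e)
      split_ifs
      exacts [le_rfl, zero_le]
    · intro e he
      rw [if_neg]
      intro hw
      have := abs_le.1 (hW k (k + e) hw)
      exact he (Finset.mem_Icc.2 ⟨by linarith [this.2], by linarith [this.1]⟩)
  have h2 : ∀ e : ℤ, ∑' k, u k * v (k + e) ≤ P * Q := fun e => by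
    refine (tsum_mul_le_sqrt _ _).trans ?_
    have h3 : ∑' k, v (k + e) ^ (2 : ℝ) = ∑' k, v k ^ (2 : ℝ) :=
      (Equiv.addRight e).tsum_eq (fun k => v k ^ (2 : ℝ))
    rw [h3]
    calc _ ≤ (P ^ (2 : ℝ)) ^ (1 / 2 : ℝ) * (Q ^ (2 : ℝ)) ^ (1 / 2 : ℝ) := by gcongr
      _ = P * Q := by rw [sq_rpow_half, sq_rpow_half]
  calc _ ≤ ∑' k, ∑ e ∈ Finset.Icc (-3 : ℤ) 3, u k * v (k + e) := ENNReal.tsum_le_tsum h1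
    _ = ∑ e ∈ Finset.Icc (-3 : ℤ) 3, ∑' k, u k * v (k + e) :=
        Summable.tsum_finsetSum fun _ _ => ENNReal.summable
    _ ≤ ∑ e ∈ Finset.Icc (-3 : ℤ) 3, P * Q := Finset.sum_le_sum fun e _ => h2 e
    _ = 7 * (P * Q) := by simp

/-- The index of the dyadic interval of length `2^(-j)` containing `x`. -/
noncomputable def dyadicIndex (j : ℤ) (x : ℝ) : ℤ := ⌊(2 : ℝ) ^ j * x⌋

theorem dyadicIndex_pred (j : ℤ) (x : ℝ) : dyadicIndex (j - 1) x = dyadicIndex j x / 2 := by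
  have := Int.floor_div_natCast ((2 : ℝ) ^ j * x) 2
  simp only [dyadicIndex]
  rw [zpow_sub_one₀ two_ne_zero]
  push_cast at this
  rw [← this]
  congr 1
  ring

theorem measurable_dyadicIndex (j : ℤ) : Measurable (dyadicIndex j) :=
  Int.measurable_floor.comp (by fun_prop)

/-- Dyadic intervals that are not neighbours, though their parents are. -/
def WhitneyPair (k l : ℤ) : Prop := 2 ≤ |k - l| ∧ |k / 2 - l / 2| ≤ 1

instance (k l : ℤ) : Decidable (WhitneyPair k l) := inferInstanceAs (Decidable (_ ∧ _))

theorem WhitneyPair.abs_sub_le {k l : ℤ} (h : WhitneyPair k l) : |k - l| ≤ 3 := by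
  have := abs_le.1 h.2
  exact abs_le.2 ⟨by omega, by omega⟩

/-- At coarse scales both indices are `-1` or `0`, and at fine scales they are far apart. The
coarsest scale at which they differ by at least `2` works, since one step earlier they were
neighbours. -/
theorem exists_whitneyPair {x y : ℝ} (h : x ≠ y) :
    ∃ j, WhitneyPair (dyadicIndex j x) (dyadicIndex j y) := by
  have hsmall : ∃ b : ℤ, ∀ j : ℤ, 2 ≤ |dyadicIndex j x - dyadicIndex j y| → b ≤ j := by
    obtain ⟨n, hn⟩ := pow_unbounded_of_one_lt (|x| + |y| + 1) (one_lt_two : (1 : ℝ) < 2)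
    refine ⟨-n, fun j hj => ?_⟩
    by_contra! hlt
    have h2 : (2 : ℝ) ^ j ≤ ((2 : ℝ) ^ n)⁻¹ := by
      rw [← zpow_natCast, ← zpow_neg]
      exact zpow_le_zpow_right₀ one_le_two hlt.le
    have hpos : (0 : ℝ) < 2 ^ j := by positivity
    have h3 : ∀ z : ℝ, |z| ≤ |x| + |y| → -1 ≤ dyadicIndex j z ∧ dyadicIndex j z ≤ 0 := fun z hz => by
      have h4 : |(2 : ℝ) ^ j * z| < 1 := by
        rw [abs_mul, abs_of_pos hpos]
        calc _ ≤ ((2 : ℝ) ^ n)⁻¹ * |z| := by gcongr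
          _ < 1 := by
            rw [inv_mul_lt_iff₀ (by positivity)]; linarith
      have h5 := abs_lt.1 h4
      refine ⟨Int.le_floor.2 (by push_cast; linarith), ?_⟩
      exact Int.lt_add_one_iff.1 (Int.floor_lt.2 (by push_cast; linarith))
    have hx := h3 x (by linarith [abs_nonneg y])
    have hy := h3 y (by linarith [abs_nonneg x])
    rcases le_abs.1 hj with h | h <;> omega
  have hlarge : ∃ j : ℤ, 2 ≤ |dyadicIndex j x - dyadicIndex j y| := by
    have hxy : 0 < |x - y| := abs_pos.2 (sub_ne_zero.2 h)
    obtain ⟨n, hn⟩ := pow_unbounded_of_one_lt (3 / |x - y|) (one_lt_two : (1 : ℝ) < 2)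
    refine ⟨n, ?_⟩
    rw [div_lt_iff₀ hxy] at hn
    by_contra! hlt
    have h1 : |(2 : ℝ) ^ n * x - 2 ^ n * y| = 2 ^ n * |x - y| := by
      rw [← mul_sub, abs_mul, abs_of_pos (by positivity)]
    have h2 := Int.floor_le ((2 : ℝ) ^ n * x)
    have h3 := Int.lt_floor_add_one ((2 : ℝ) ^ n * x)
    have h4 := Int.floor_le ((2 : ℝ) ^ n * y)
    have h5 := Int.lt_floor_add_one ((2 : ℝ) ^ n * y)
    simp only [dyadicIndex, zpow_natCast] at hlt
    have h6 := abs_lt.1 hlt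
    have h7 : (⌊(2 : ℝ) ^ n * x⌋ : ℝ) - ⌊(2 : ℝ) ^ n * y⌋ ≤ 1 := by
      have : ⌊(2 : ℝ) ^ n * x⌋ - ⌊(2 : ℝ) ^ n * y⌋ ≤ 1 := by omega
      exact_mod_cast this
    have h8 : -1 ≤ (⌊(2 : ℝ) ^ n * x⌋ : ℝ) - ⌊(2 : ℝ) ^ n * y⌋ := by
      have : -1 ≤ ⌊(2 : ℝ) ^ n * x⌋ - ⌊(2 : ℝ) ^ n * y⌋ := by omega
      exact_mod_cast this
    have h9 : |(2 : ℝ) ^ n * x - 2 ^ n * y| ≤ 2 := abs_le.2 ⟨by linarith, by linarith⟩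
    rw [h1] at h9
    linarith
  obtain ⟨j, hj, hmin⟩ := Int.exists_least_of_bdd hsmall hlarge
  refine ⟨j, hj, ?_⟩
  rw [← dyadicIndex_pred, ← dyadicIndex_pred]
  by_contra! hlt
  have := hmin (j - 1) (by omega)
  omega

/-- Intervals separated at one scale stay separated at all finer ones, whereas the parents of a
Whitney pair are not separated. Applied in both directions, this makes the scale of a pair unique,
hence the cells disjoint. -/
theorem WhitneyPair.level_le {x y : ℝ} {j j' : ℤ} (h : WhitneyPair (dyadicIndex j x) (dyadicIndex j y))
    (h' : WhitneyPair (dyadicIndex j' x) (dyadicIndex j' y)) : j' ≤ j := by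
  by_contra! hlt
  have h1 : ∀ i, j ≤ i → 2 ≤ |dyadicIndex i x - dyadicIndex i y| := fun i hi => by
    induction i, hi using Int.leInduction with
    | base => exact h.1
    | succ i _ ih =>
      have e1 := dyadicIndex_pred (i + 1) x
      have e2 := dyadicIndex_pred (i + 1) y
      rw [add_sub_cancel_right] at e1 e2
      rw [e1, e2] at ih
      rcases le_abs.1 ih with h | h
      · exact le_abs.2 (Or.inl (by omega))
      · exact le_abs.2 (Or.inr (by omega))
  have h2 := h1 (j' - 1) (by omega)
  rw [dyadicIndex_pred, dyadicIndex_pred] at h2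
  have := h'.2
  omega

theorem SecondDerivBddAway.deriv_expanding {a : ℝ → ℝ} (h : SecondDerivBddAway a)
    (ha : ContDiff ℝ ∞ a) : ∃ κ : ℝ, 0 < κ ∧ (Monotone (deriv a) ∨ Antitone (deriv a)) ∧
      ∀ x y, κ * |x - y| ≤ |deriv a x - deriv a y| := by
  obtain ⟨κ, hκ, ε, hε, hs⟩ := h.sign ha
  have hd := ha.hasDerivAt_two.2
  have h1 : ∀ x y, x ≤ y → κ * (y - x) ≤ ε * deriv a y - ε * deriv a x := fun x y hxy => by
    have hd' : ∀ z, HasDerivAt (fun z => ε * deriv a z) (ε * iteratedDeriv 2 a z) z := fun z =>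
      (hd z).const_mul ε
    refine mul_sub_le_image_sub_of_le_deriv (f := fun z => ε * deriv a z)
      (fun z => (hd' z).differentiableAt) (fun z => ?_) hxy
    rw [(hd' z).deriv]; exact hs z
  refine ⟨κ, hκ, ?_, fun x y => ?_⟩
  · rcases hε with rfl | rfl
    · exact Or.inl fun x y hxy => by
        nlinarith [h1 x y hxy, mul_nonneg hκ.le (sub_nonneg.2 hxy)]
    · exact Or.inr fun x y hxy => by
        nlinarith [h1 x y hxy, mul_nonneg hκ.le (sub_nonneg.2 hxy)]
  · have hε1 : |ε| = 1 := by rcases hε with rfl | rfl <;> simp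
    have h2 : |deriv a x - deriv a y| = |ε * deriv a x - ε * deriv a y| := by
      rw [← mul_sub, abs_mul, hε1, one_mul]
    rw [h2]
    rcases le_total x y with hxy | hxy
    · rw [abs_sub_comm, abs_of_nonneg (sub_nonneg.2 hxy), abs_sub_comm]
      exact (h1 x y hxy).trans (le_abs_self _)
    · rw [abs_of_nonneg (sub_nonneg.2 hxy)]
      exact (h1 y x hxy).trans (le_abs_self _)

/-- The frequencies in `[-R, R]` whose velocity lies in a given dyadic interval. -/
def velocitySlab (β : ℝ → ℝ) (R : ℝ) (j k : ℤ) : Set ℝ := {z | |z| ≤ R ∧ dyadicIndex j (β z) = k}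

theorem measurableSet_velocitySlab {β : ℝ → ℝ} (hβ : Measurable β) (R : ℝ) (j k : ℤ) :
    MeasurableSet (velocitySlab β R j k) := by
  have h : MeasurableSet {z : ℝ | |z| ≤ R} := measurableSet_le (by fun_prop) measurable_const
  exact h.inter (((measurable_dyadicIndex j).comp hβ) (measurableSet_singleton k))

theorem ordConnected_velocitySlab {β : ℝ → ℝ} (hβ : Monotone β ∨ Antitone β) (R : ℝ) (j k : ℤ) :
    (velocitySlab β R j k).OrdConnected := by
  have hm : Monotone (dyadicIndex j) := fun x y hxy => Int.floor_mono (by gcongr)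
  have h1 : ((fun z => dyadicIndex j (β z)) ⁻¹' {k}).OrdConnected := by
    rcases hβ with hβ | hβ
    · exact ordConnected_singleton.preimage_mono (hm.comp hβ)
    · exact ordConnected_singleton.preimage_anti (hm.comp_antitone hβ)
  have h2 : velocitySlab β R j k = Icc (-R) R ∩ (fun z => dyadicIndex j (β z)) ⁻¹' {k} := by
    ext z; simp [velocitySlab, abs_le]
  rw [h2]
  exact ordConnected_Icc.inter h1

theorem abs_sub_le_of_mem_velocitySlab {β : ℝ → ℝ} {R κ : ℝ} (hκ : 0 < κ)
    (hβ : ∀ x y, κ * |x - y| ≤ |β x - β y|) {j k : ℤ} {x y : ℝ} (hx : x ∈ velocitySlab β R j k)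
    (hy : y ∈ velocitySlab β R j k) :
    |x - y| ≤ 2 * R ∧ |x - y| ≤ ((2 : ℝ) ^ j)⁻¹ / κ := by
  have hpos : (0 : ℝ) < 2 ^ j := by positivity
  constructor
  · exact (abs_sub _ _).trans (by linarith [hx.1, hy.1])
  · have h1 := Int.abs_sub_lt_one_of_floor_eq_floor (hx.2.trans hy.2.symm)
    rw [← mul_sub, abs_mul, abs_of_pos hpos, ← lt_inv_mul_iff₀ hpos, mul_one] at h1
    rw [le_div_iff₀ hκ, mul_comm]
    exact (hβ x y).trans h1.le

theorem separation_of_whitneyPair {β γ : ℝ → ℝ} {R : ℝ} {j k l : ℤ} (h : WhitneyPair k l) :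
    (∀ z ∈ velocitySlab β R j k, ∀ η ∈ velocitySlab γ R j l, ((2 : ℝ) ^ j)⁻¹ ≤ γ η - β z) ∨
      ∀ z ∈ velocitySlab β R j k, ∀ η ∈ velocitySlab γ R j l, ((2 : ℝ) ^ j)⁻¹ ≤ β z - γ η := by
  have hpos : (0 : ℝ) < 2 ^ j := by positivity
  have key : ∀ x y : ℝ, dyadicIndex j x + 2 ≤ dyadicIndex j y → ((2 : ℝ) ^ j)⁻¹ ≤ y - x := fun x y hxy => by
    rw [inv_le_iff_one_le_mul₀ hpos]
    have h1 := Int.lt_floor_add_one ((2 : ℝ) ^ j * x)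
    have h2 := Int.floor_le ((2 : ℝ) ^ j * y)
    have h3 : (⌊(2 : ℝ) ^ j * x⌋ : ℝ) + 2 ≤ ⌊(2 : ℝ) ^ j * y⌋ := by exact_mod_cast hxy
    linarith
  rcases le_abs.1 h.1 with h | h
  · refine Or.inr fun z hz η hη => key _ _ ?_
    rw [hz.2, hη.2]; omega
  · refine Or.inl fun z hz η hη => key _ _ ?_
    rw [hz.2, hη.2]; omega

theorem tsum_l2n_velocitySlab_le {β : ℝ → ℝ} (hβ : Measurable β) (R : ℝ) (j : ℤ) {F : ℝ → ℝ≥0∞}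
    (hF : Measurable F) :
    ∑' k, l2n ((velocitySlab β R j k).indicator F) ^ (2 : ℝ) ≤ l2n F ^ (2 : ℝ) := by
  have hm := (measurable_dyadicIndex j).comp hβ
  rw [ENNReal.tsum_eq_iSup_sum]
  refine iSup_le fun s => (Finset.sum_le_sum fun k _ => ?_).trans (sum_l2n_fiberPart_sq_le hm hF s)
  gcongr
  exact l2n_mono fun x => indicator_le_indicator_of_subset (fun z hz => hz.2) (fun _ => zero_le) x

/-- The Whitney pieces of the complement of the set of equal velocities. -/
def whitneyCell (β γ : ℝ → ℝ) (R : ℝ) (i : ℤ × ℤ × ℤ) : Set FreqPlane :=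
  {p | p 0 ∈ velocitySlab β R i.1 i.2.1 ∧ p 1 ∈ velocitySlab γ R i.1 i.2.2 ∧
    WhitneyPair i.2.1 i.2.2}

theorem measurableSet_whitneyCell {β γ : ℝ → ℝ} (hβ : Measurable β) (hγ : Measurable γ) (R : ℝ)
    (i : ℤ × ℤ × ℤ) : MeasurableSet (whitneyCell β γ R i) :=
  ((by fun_prop : Measurable fun p : FreqPlane => p 0) (measurableSet_velocitySlab hβ R _ _)).inter
    (((by fun_prop : Measurable fun p : FreqPlane => p 1) (measurableSet_velocitySlab hγ R _ _)).inter
      (MeasurableSet.const _))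

theorem pairwise_disjoint_whitneyCell (β γ : ℝ → ℝ) (R : ℝ) :
    Pairwise fun i i' => Disjoint (whitneyCell β γ R i) (whitneyCell β γ R i') := by
  rintro ⟨j, k, l⟩ ⟨j', k', l'⟩ hne
  refine disjoint_left.2 fun p hp hp' => hne ?_
  obtain ⟨⟨-, h1⟩, ⟨-, h2⟩, h3⟩ := hp
  obtain ⟨⟨-, h1'⟩, ⟨-, h2'⟩, h3'⟩ := hp'
  simp only at h1 h2 h3 h1' h2' h3'
  subst h1 h2 h1' h2'
  have hj : j = j' := le_antisymm (h3'.level_le h3) (h3.level_le h3')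
  rw [hj]

theorem mem_iUnion_whitneyCell {β γ : ℝ → ℝ} {R : ℝ} {p : FreqPlane} (h0 : |p 0| ≤ R)
    (h1 : |p 1| ≤ R) (h : β (p 0) ≠ γ (p 1)) : ∃ i, p ∈ whitneyCell β γ R i := by
  obtain ⟨j, hj⟩ := exists_whitneyPair h
  exact ⟨(j, _, _), ⟨h0, rfl⟩, ⟨h1, rfl⟩, hj⟩

/-- The Whitney cells miss the set of equal velocities. Injectivity of `γ` lets each line with fixed
first coordinate meet that set at most once, so it is null, and the shear carries this over to
almost every output frequency. -/
theorem ae_ae_velocity_ne {β γ : ℝ → ℝ} (hβ : Measurable β) (hγ : Measurable γ)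
    (hinj : Function.Injective γ) : ∀ᵐ ξ : ℝ, ∀ᵐ η : ℝ, β (ξ - η) ≠ γ η := by
  have hs : MeasurableSet {p : ℝ × ℝ | β p.1 = γ p.2} :=
    measurableSet_eq_fun (hβ.comp measurable_fst) (hγ.comp measurable_snd)
  have hz : ∫⁻ p : ℝ × ℝ, {p : ℝ × ℝ | β p.1 = γ p.2}.indicator 1 p = 0 := by
    rw [lintegral_indicator_one hs, Measure.volume_eq_prod, Measure.measure_prod_null hs]
    refine ae_of_all _ fun z => ?_
    exact Set.Subsingleton.measure_zero (fun x hx y hy => hinj (hx.symm.trans hy)) _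
  rw [← lintegral_shear (measurable_one.indicator hs)] at hz
  have hm : Measurable fun p : ℝ × ℝ => {p : ℝ × ℝ | β p.1 = γ p.2}.indicator (1 : ℝ × ℝ → ℝ≥0∞)
      (p.1 - p.2, p.2) := (measurable_one.indicator hs).comp (by fun_prop)
  rw [lintegral_eq_zero_iff hm.lintegral_prod_right'] at hz
  filter_upwards [hz] with ξ hξ
  have hm' : Measurable fun η : ℝ => {p : ℝ × ℝ | β p.1 = γ p.2}.indicator (1 : ℝ × ℝ → ℝ≥0∞)
      (ξ - η, η) := hm.comp (by fun_prop : Measurable fun η : ℝ => (ξ, η))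
  simp only [Pi.zero_apply] at hξ
  rw [lintegral_eq_zero_iff hm'] at hξ
  filter_upwards [hξ] with η hη heq
  simp [heq] at hη

section
variable {b c : ℝ → ℝ} {σ : FreqPlane → ℂ}

/-- For almost every output frequency the cells partition the support up to a null set, so the
integral is the sum of its restrictions; the absolute values are summed only afterwards. -/
theorem evolvedMass_le_tsum_whitneyCell (hb : Continuous b) (hc : Continuous c) {β γ : ℝ → ℝ}
    (hβ : Measurable β) (hγ : Measurable γ) (hinj : Function.Injective γ) (hσ : Measurable σ)
    {S : ℝ≥0∞} (hSt : S ≠ ⊤) (hS : ∀ p, ‖σ p‖ₑ ≤ S) {R : ℝ}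
    (hsupp : ∀ p, σ p ≠ 0 → |p 0| ≤ R ∧ |p 1| ≤ R) (f g : L2Line) (t : ℝ) :
    evolvedMass b c σ f g t
      ≤ ∑' i, evolvedMass b c ((whitneyCell β γ R i).indicator σ) f g t := by
  have hm := fun i => measurableSet_whitneyCell hβ hγ R i
  have hmeas : ∀ σ' : FreqPlane → ℂ, Measurable σ' →
      Measurable fun ξ => ‖pseudoProductHat (evolved b c σ' t) (hatL2 f) (hatL2 g) ξ‖ₑ :=
    fun σ' hσ' => ((stronglyMeasurable_evolved hb hc hσ' f g).comp_measurable
      (by fun_prop : Measurable fun ξ : ℝ => (t, ξ))).measurable.enorm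
  simp only [evolvedMass]
  rw [← lintegral_tsum fun i => (hmeas _ (hσ.indicator (hm i))).aemeasurable]
  refine lintegral_mono_ae ?_
  filter_upwards [ae_ae_velocity_ne hβ hγ hinj] with ξ hξ
  have hev : Measurable (evolved b c σ t) :=
    (continuous_cis.comp (by fun_prop : Continuous fun p : FreqPlane =>
      t * (b (p 0) + c (p 1)))).measurable.mul hσ
  have hint := integrable_pseudoProduct_integrand hev hSt
    (fun p => (enorm_evolved b c σ t p).trans_le (hS p)) f g ξ
  set A : ℝ → ℂ := fun η => evolved b c σ t !₂[ξ - η, η] * hatL2 f (ξ - η) * hatL2 g η with hA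
  set s : ℤ × ℤ × ℤ → Set ℝ := fun i => {η | (!₂[ξ - η, η] : FreqPlane) ∈ whitneyCell β γ R i} with hs
  have hpt : Measurable fun η : ℝ => (!₂[ξ - η, η] : FreqPlane) :=
    (continuous_sheared_pt.comp (f := fun η : ℝ => (ξ, η)) (by fun_prop)).measurable
  have hsm : ∀ i, MeasurableSet (s i) := fun i => hpt (hm i)
  have hsd : Pairwise (Function.onFun Disjoint s) := fun i i' hne =>
    (pairwise_disjoint_whitneyCell β γ R hne).preimage _
  have h1 := hasSum_integral_iUnion hsm hsd hint.integrableOn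
  have h2 : ∫ η in ⋃ i, s i, A η = pseudoProductHat (evolved b c σ t) (hatL2 f) (hatL2 g) ξ := by
    refine setIntegral_eq_integral_of_ae_compl_eq_zero ?_
    filter_upwards [hξ] with η hη hn
    have : σ !₂[ξ - η, η] = 0 := by
      by_contra h0
      have h3 := hsupp _ h0
      exact hn (mem_iUnion.2 (mem_iUnion_whitneyCell h3.1 h3.2 (by simpa using hη)))
    simp [hA, evolved, this]
  have h3 : ∀ i, ∫ η in s i, A η = pseudoProductHat
      (evolved b c ((whitneyCell β γ R i).indicator σ) t) (hatL2 f) (hatL2 g) ξ := fun i => by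
    rw [← integral_indicator (hsm i)]
    refine integral_congr_ae (ae_of_all _ fun η => ?_)
    by_cases hη : (!₂[ξ - η, η] : FreqPlane) ∈ whitneyCell β γ R i
    · have h4 : η ∈ s i := hη
      simp [h4, hA, evolved, hη]
    · have h4 : η ∉ s i := hη
      simp [h4, evolved, hη]
  simp only [h3] at h1
  rw [← h2, ← h1.tsum_eq]
  exact enorm_tsum_le_tsum_enorm

end

theorem tsum_natAbs_pow_ne_top {r : ℝ≥0∞} (hr : r < 1) : ∑' j : ℤ, r ^ j.natAbs ≠ ⊤ := by
  have hg : ∑' n : ℕ, r ^ n ≠ ⊤ := by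
    rw [ENNReal.tsum_geometric]
    exact ENNReal.inv_ne_top.2 (tsub_pos_of_lt hr).ne'
  rw [tsum_of_nat_of_neg_add_one ENNReal.summable ENNReal.summable]
  refine ENNReal.add_ne_top.2 ⟨by simpa using hg, ne_top_of_le_ne_top hg (ENNReal.tsum_le_tsum fun n => ?_)⟩
  have : (-((n : ℤ) + 1)).natAbs = n + 1 := by omega
  rw [this]
  exact pow_le_pow_right_of_le_one' hr.le (Nat.le_succ n)

/-- Gain from bilinear dispersion at the dyadic scale `j`. -/
theorem exists_whitney_gain {κ p : ℝ} (hκ : 0 < κ) (hp : 2 < p) :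
    ∃ D r : ℝ, 0 ≤ D ∧ 0 ≤ r ∧ r < 1 ∧ ∀ R : ℝ, 0 < R → ∀ j : ℤ, ∃ ℓ : ℝ, 0 ≤ ℓ ∧
      (ℓ = 2 * R ∨ ℓ = ((2 : ℝ) ^ j)⁻¹ / κ) ∧
      ℓ ^ (1 - 2 / p) * (4 * Real.pi * ℓ / ((2 : ℝ) ^ j)⁻¹) ^ (1 / p) ≤ D * (1 + R) * r ^ j.natAbs := by
  have hp0 : 0 < p := by linarith
  have hθ : 0 < 1 - 2 / p := by rw [sub_pos, div_lt_one hp0]; exact hp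
  have hq : 0 < 1 / p := by positivity
  have hpi := Real.pi_gt_three
  set r₁ : ℝ := (2 : ℝ)⁻¹ ^ (1 - 2 / p) with hr₁
  set r₂ : ℝ := (2 : ℝ)⁻¹ ^ (1 / p) with hr₂
  have hr₁1 : r₁ < 1 := Real.rpow_lt_one (by norm_num) (by norm_num) hθ
  have hr₂1 : r₂ < 1 := Real.rpow_lt_one (by norm_num) (by norm_num) hq
  have hr₁0 : 0 ≤ r₁ := by positivity
  have hr₂0 : 0 ≤ r₂ := by positivity
  have hpow : ∀ (n : ℕ) (θ : ℝ), (((2 : ℝ) ^ n)⁻¹) ^ θ = ((2 : ℝ)⁻¹ ^ θ) ^ n := fun n θ => by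
    rw [← inv_pow, ← Real.rpow_natCast, ← Real.rpow_natCast, ← Real.rpow_mul (by norm_num),
      ← Real.rpow_mul (by norm_num), mul_comm]
  set D₁ : ℝ := (1 / κ) ^ (1 - 2 / p) * (4 * Real.pi / κ) ^ (1 / p) with hD₁
  have hD₁0 : 0 ≤ D₁ := by positivity
  refine ⟨max D₁ (8 * Real.pi), max r₁ r₂, le_max_of_le_left hD₁0, le_max_of_le_left hr₁0,
    max_lt hr₁1 hr₂1, fun R hR j => ?_⟩
  -- At fine scales the slabs have length `2^{-j}/κ`; the ratio of length to separation is then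
  -- constant, and the decay is that of `ℓ^{1-2/p}`, which needs `p > 2`. At coarse scales the
  -- length is `2R` and the decay comes from the large separation `2^n`.
  rcases le_or_gt 0 j with hj | hj
  · obtain ⟨n, rfl⟩ := Int.eq_ofNat_of_zero_le hj
    refine ⟨((2 : ℝ) ^ (n : ℤ))⁻¹ / κ, by positivity, Or.inr rfl, ?_⟩
    rw [zpow_natCast, Int.natAbs_natCast]
    have hpos : (0 : ℝ) < 2 ^ n := by positivity
    have e1 : 4 * Real.pi * (((2 : ℝ) ^ n)⁻¹ / κ) / ((2 : ℝ) ^ n)⁻¹ = 4 * Real.pi / κ := by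
      field_simp
    rw [e1, div_eq_mul_one_div (((2 : ℝ) ^ n)⁻¹), Real.mul_rpow (by positivity) (by positivity), hpow]
    calc r₁ ^ n * (1 / κ) ^ (1 - 2 / p) * (4 * Real.pi / κ) ^ (1 / p) = D₁ * 1 * r₁ ^ n := by
          rw [hD₁]; ring
      _ ≤ _ := by
          gcongr
          · exact le_max_left _ _
          · linarith
          · exact le_max_left _ _
  · obtain ⟨n, rfl⟩ := Int.exists_eq_neg_ofNat hj.le
    refine ⟨2 * R, by positivity, Or.inl rfl, ?_⟩
    rw [zpow_neg, zpow_natCast, inv_inv, Int.natAbs_neg, Int.natAbs_natCast]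
    have e1 : 4 * Real.pi * (2 * R) / (2 : ℝ) ^ n = 8 * Real.pi * R * ((2 : ℝ) ^ n)⁻¹ := by
      field_simp; ring
    rw [e1, Real.mul_rpow (x := 8 * Real.pi * R) (by positivity) (by positivity), hpow]
    set X : ℝ := 8 * Real.pi * (1 + R) with hX
    have hX1 : 1 ≤ X := by rw [hX]; nlinarith
    have h2 : (2 * R) ^ (1 - 2 / p) * (8 * Real.pi * R) ^ (1 / p) ≤ X := by
      calc _ ≤ X ^ (1 - 2 / p) * X ^ (1 / p) := by
            gcongr
            · rw [hX]; nlinarith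
            · rw [hX]; nlinarith
        _ = X ^ (1 - 1 / p) := by
            rw [← Real.rpow_add (by linarith)]; congr 1; ring
        _ ≤ X ^ (1 : ℝ) := Real.rpow_le_rpow_of_exponent_le hX1 (by linarith)
        _ = X := Real.rpow_one X
    calc (2 * R) ^ (1 - 2 / p) * ((8 * Real.pi * R) ^ (1 / p) * r₂ ^ n)
        = ((2 * R) ^ (1 - 2 / p) * (8 * Real.pi * R) ^ (1 / p)) * r₂ ^ n := by ring
      _ ≤ X * r₂ ^ n := by gcongr
      _ ≤ _ := by
          rw [hX]
          gcongr
          · exact le_max_right _ _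
          · exact le_max_right _ _

/-- Bilinear Strichartz estimate: the evolved pseudo-product lies in `L^p` in time, with values in
the Fourier algebra, for each `p > 2`. -/
theorem exists_evolvedMass_bound {b c : ℝ → ℝ} (hb : ContDiff ℝ ∞ b) (hc : ContDiff ℝ ∞ c)
    (hHb : SecondDerivBddAway b) (hHc : SecondDerivBddAway c) {p : ℝ} (hp : 2 < p) :
    ∃ D : ℝ, 0 ≤ D ∧ ∀ (R : ℝ) (S : ℝ) (σ : FreqPlane → ℂ), 0 < R → 0 ≤ S → Measurable σ →
      (∀ p, ‖σ p‖ ≤ S) → (∀ p, σ p ≠ 0 → |p 0| ≤ R ∧ |p 1| ≤ R) → ∀ f g : L2Line,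
        (∫⁻ t, evolvedMass b c σ f g t ^ p) ^ (1 / p)
          ≤ ENNReal.ofReal (D * (S * (1 + R)) * (‖f‖ * ‖g‖)) := by
  obtain ⟨κ₁, hκ₁, hmb, heb⟩ := hHb.deriv_expanding hb
  obtain ⟨κ₂, hκ₂, hmc, hec⟩ := hHc.deriv_expanding hc
  set κ := min κ₁ κ₂ with hκdef
  have hκ : 0 < κ := lt_min hκ₁ hκ₂
  have heb' : ∀ x y, κ * |x - y| ≤ |deriv b x - deriv b y| := fun x y =>
    (mul_le_mul_of_nonneg_right (min_le_left _ _) (abs_nonneg _)).trans (heb x y)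
  have hec' : ∀ x y, κ * |x - y| ≤ |deriv c x - deriv c y| := fun x y =>
    (mul_le_mul_of_nonneg_right (min_le_right _ _) (abs_nonneg _)).trans (hec x y)
  have hinj : Function.Injective (deriv c) := fun x y hxy => by
    have := hec' x y
    rw [hxy, sub_self, abs_zero] at this
    exact sub_eq_zero.1 (abs_eq_zero.1 (le_antisymm (by
      by_contra! h; linarith [mul_pos hκ h]) (abs_nonneg _)))
  have hβ : Measurable (deriv b) := measurable_deriv b
  have hγ : Measurable (deriv c) := measurable_deriv c
  obtain ⟨D, r, hD, hr0, hr1, hgain⟩ := exists_whitney_gain hκ hp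
  have hT : ∑' j : ℤ, ENNReal.ofReal r ^ j.natAbs ≠ ⊤ :=
    tsum_natAbs_pow_ne_top (by rw [← ENNReal.ofReal_one]; exact (ENNReal.ofReal_lt_ofReal_iff one_pos).2 hr1)
  set T := ∑' j : ℤ, ENNReal.ofReal r ^ j.natAbs with hTdef
  set τ : ℝ := T.toReal
  have hTτ : T = ENNReal.ofReal τ := (ENNReal.ofReal_toReal hT).symm
  have hτ0 : 0 ≤ τ := ENNReal.toReal_nonneg
  refine ⟨7 * D * τ, by positivity, fun R S σ hR hS hσ hσS hsupp f g => ?_⟩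
  have hSe : ∀ p, ‖σ p‖ₑ ≤ ENNReal.ofReal S := fun p => by
    rw [← ofReal_norm]; exact ENNReal.ofReal_le_ofReal (hσS p)
  have hbd := hb.hasDerivAt_two.1
  have hcd := hc.hasDerivAt_two.1
  set u : ℤ → ℤ → ℝ≥0∞ := fun j k => l2n ((velocitySlab (deriv b) R j k).indicator (hatE f)) with hu
  set v : ℤ → ℤ → ℝ≥0∞ := fun j k => l2n ((velocitySlab (deriv c) R j k).indicator (hatE g)) with hv
  set Q : ℤ → ℝ≥0∞ := fun j => ENNReal.ofReal (D * (1 + R)) * ENNReal.ofReal r ^ j.natAbs *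
    ENNReal.ofReal S with hQ
  have hQs : ∑' j, Q j = ENNReal.ofReal (D * (1 + R)) * T * ENNReal.ofReal S := by
    simp only [hQ]
    rw [ENNReal.tsum_mul_right, ENNReal.tsum_mul_left]
  have hpiece : ∀ i : ℤ × ℤ × ℤ,
      (∫⁻ t, evolvedMass b c ((whitneyCell (deriv b) (deriv c) R i).indicator σ) f g t ^ p) ^ (1 / p)
        ≤ Q i.1 * (if WhitneyPair i.2.1 i.2.2 then u i.1 i.2.1 * v i.1 i.2.2 else 0) := fun i => by
    obtain ⟨j, k, l⟩ := i
    by_cases hW : WhitneyPair k l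
    · obtain ⟨ℓ, hℓ0, hℓ, hle⟩ := hgain R hR j
      have hdI : ∀ x ∈ velocitySlab (deriv b) R j k, ∀ y ∈ velocitySlab (deriv b) R j k,
          |x - y| ≤ ℓ := fun x hx y hy => by
        have := abs_sub_le_of_mem_velocitySlab hκ heb' hx hy
        rcases hℓ with h | h <;> rw [h]
        exacts [this.1, this.2]
      have hdJ : ∀ x ∈ velocitySlab (deriv c) R j l, ∀ y ∈ velocitySlab (deriv c) R j l,
          |x - y| ≤ ℓ := fun x hx y hy => by
        have := abs_sub_le_of_mem_velocitySlab hκ hec' hx hy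
        rcases hℓ with h | h <;> rw [h]
        exacts [this.1, this.2]
      refine (lintegral_evolvedMass_rpow_le hbd hcd
        (hσ.indicator (measurableSet_whitneyCell hβ hγ R (j, k, l)))
        (measurableSet_velocitySlab hβ R j k) (measurableSet_velocitySlab hγ R j l)
        (ordConnected_velocitySlab hmb R j k) (ordConnected_velocitySlab hmc R j l) hℓ0 hdI hdJ
        (by positivity : (0 : ℝ) < ((2 : ℝ) ^ j)⁻¹) (separation_of_whitneyPair hW)
        (S := ENNReal.ofReal S) ENNReal.ofReal_ne_top (fun p => ?_) (fun p h0 => ?_) hp.le).trans ?_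
      · exact (enorm_indicator_le_enorm_self _ _).trans (hSe p)
      · have := mem_of_indicator_ne_zero h0
        exact ⟨this.1, this.2.1⟩
      · simp only [if_pos hW, hQ]
        rw [← mul_assoc]
        refine mul_le_mul_left (mul_le_mul_left ?_ _) _
        rw [← ENNReal.ofReal_pow hr0, ← ENNReal.ofReal_mul (by positivity)]
        exact ENNReal.ofReal_le_ofReal hle
    · have h0 : (whitneyCell (deriv b) (deriv c) R (j, k, l)).indicator σ = 0 := by
        ext p
        exact indicator_of_notMem (fun h => hW h.2.2) _
      have h1 : ∀ t, evolvedMass b c ((whitneyCell (deriv b) (deriv c) R (j, k, l)).indicator σ) f g t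
          = 0 := fun t => by
        simp [evolvedMass, h0, evolved, pseudoProductHat]
      simp_rw [h1, ENNReal.zero_rpow_of_pos (by linarith : 0 < p), lintegral_zero]
      rw [ENNReal.zero_rpow_of_pos (by positivity)]
      exact zero_le
  have hmm := fun i : ℤ × ℤ × ℤ => measurable_evolvedMass hb.continuous hc.continuous
    (hσ.indicator (measurableSet_whitneyCell hβ hγ R i)) f g
  -- At each scale only indices within distance `3` interact, so Cauchy–Schwarz and the disjointness
  -- of the slabs sum the pairs with no loss but a constant; the scales are then summed by the
  -- geometric gain.
  calc (∫⁻ t, evolvedMass b c σ f g t ^ p) ^ (1 / p)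
      ≤ (∫⁻ t, (∑' i, evolvedMass b c ((whitneyCell (deriv b) (deriv c) R i).indicator σ) f g t) ^ p) ^
          (1 / p) := by
        gcongr with t
        exact evolvedMass_le_tsum_whitneyCell hb.continuous hc.continuous hβ hγ hinj hσ
          ENNReal.ofReal_ne_top hSe hsupp f g t
    _ ≤ ∑' i, (∫⁻ t, evolvedMass b c ((whitneyCell (deriv b) (deriv c) R i).indicator σ) f g t ^ p) ^
          (1 / p) := lintegral_tsum_rpow_le hmm (by linarith)
    _ ≤ ∑' i : ℤ × ℤ × ℤ, Q i.1 *
          (if WhitneyPair i.2.1 i.2.2 then u i.1 i.2.1 * v i.1 i.2.2 else 0) :=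
        ENNReal.tsum_le_tsum hpiece
    _ = ∑' j, Q j * ∑' k, ∑' l, (if WhitneyPair k l then u j k * v j l else 0) := by
        rw [ENNReal.tsum_prod']
        refine tsum_congr fun j => ?_
        change ∑' q : ℤ × ℤ, Q j * (if WhitneyPair q.1 q.2 then u j q.1 * v j q.2 else 0) = _
        rw [ENNReal.tsum_mul_left, ENNReal.tsum_prod']
    _ ≤ ∑' j, Q j * (7 * (ENNReal.ofReal ‖f‖ * ENNReal.ofReal ‖g‖)) := by
        refine ENNReal.tsum_le_tsum fun j => mul_le_mul_right ?_ _
        refine tsum_near_diagonal_le (fun k l h => h.abs_sub_le) ?_ ?_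
        · rw [← l2n_hatE]; exact tsum_l2n_velocitySlab_le hβ R j (measurable_hatE f)
        · rw [← l2n_hatE]; exact tsum_l2n_velocitySlab_le hγ R j (measurable_hatE g)
    _ = ENNReal.ofReal (D * (1 + R)) * T * ENNReal.ofReal S *
          (7 * (ENNReal.ofReal ‖f‖ * ENNReal.ofReal ‖g‖)) := by
        rw [ENNReal.tsum_mul_right, hQs]
    _ = _ := by
        rw [hTτ, show (7 : ℝ≥0∞) = ENNReal.ofReal 7 by simp,
          ← ENNReal.ofReal_mul (by positivity), ← ENNReal.ofReal_mul (by positivity),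
          ← ENNReal.ofReal_mul (by positivity), ← ENNReal.ofReal_mul (by positivity),
          ← ENNReal.ofReal_mul (by positivity)]
        congr 1
        ring

/-! ### Integration in time without time resonances. -/

theorem continuous_osc_uncurry : Continuous fun q : ℝ × ℝ => osc q.1 q.2 := by
  unfold osc
  exact intervalIntegral.continuous_parametric_intervalIntegral_of_continuous
    (f := fun (q : ℝ × ℝ) (s : ℝ) => cis (s * q.2)) (continuous_cis.comp (by fun_prop)) continuous_fst

/-- Away from the origin, `i / x` is an average of the oscillatory integrals `osc r x`. -/
theorem exists_osc_average {κ : ℝ} (hκ : 0 < κ) : ∃ ρ : ℝ → ℂ, Continuous ρ ∧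
    Integrable (fun r => |r| * ‖ρ r‖) ∧
    ∀ x : ℝ, κ ≤ |x| → ∫ r, ρ r * osc r x = Complex.I / x := by
  have hpi := Real.pi_pos
  -- With `ρ` the Fourier transform of `B`, the average of `osc r x` equals `(B(x/2π) - B(0)) /
  -- (ix)`. The outer radius `κ/(4π)` makes `B(x/2π)` vanish for `|x| ≥ κ`, and `B(0) = 1` leaves
  -- `-1/(ix) = i/x`.
  let B : ContDiffBump (0 : ℝ) := ⟨κ / (8 * Real.pi), κ / (4 * Real.pi), by positivity, by gcongr; norm_num⟩
  have hB1 : ContDiff ℝ ∞ fun x => (B x : ℂ) := Complex.ofRealCLM.contDiff.comp B.contDiff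
  have hB2 : HasCompactSupport fun x => (B x : ℂ) :=
    B.hasCompactSupport.comp_left (g := fun y : ℝ => (y : ℂ)) (by simp)
  set χ : SchwartzMap ℝ ℂ := hB2.toSchwartzMap hB1 with hχ
  have hχx : ∀ x, χ x = (B x : ℂ) := fun x => rfl
  set ρ : SchwartzMap ℝ ℂ := 𝓕 χ with hρ
  have hint : ∀ x : ℝ, Integrable fun r => ρ r * cis (r * x) := fun x => by
    refine ρ.integrable.mul_bdd (c := 1) (continuous_cis.comp (by fun_prop)).aestronglyMeasurable
      (ae_of_all _ fun r => (norm_cis _).le)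
  have hFx : ∀ x : ℝ, ∫ r, ρ r * cis (r * x) = B (x / (2 * Real.pi)) := fun x => by
    have h1 : 𝓕⁻ (ρ : ℝ → ℂ) = χ := by
      rw [← SchwartzMap.fourierInv_coe, hρ, FourierTransform.fourierInv_fourier_eq]
    rw [← hχx, ← h1, Real.fourierInv_eq']
    refine integral_congr_ae (ae_of_all _ fun r => ?_)
    have : 2 * Real.pi * inner ℝ r (x / (2 * Real.pi)) = r * x := by
      simp only [RCLike.inner_apply, conj_trivial]; field_simp
    simp only [cis, this, smul_eq_mul]
    rw [mul_comm Complex.I, mul_comm]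
  refine ⟨ρ, ρ.continuous, ?_, fun x hx => ?_⟩
  · simpa using ρ.integrable_pow_mul volume 1
  have hx0 : x ≠ 0 := by rintro rfl; simp at hx; linarith
  have hx0' : (x : ℂ) ≠ 0 := by exact_mod_cast hx0
  have h1 : ∀ r, ρ r * osc r x = (ρ r * cis (r * x) - ρ r * cis (r * 0)) * (Complex.I * x)⁻¹ :=
    fun r => by
      rw [osc_eq hx0, mul_zero, cis_zero]; ring
  simp_rw [h1]
  rw [integral_mul_const, integral_sub (hint x) (hint 0), hFx, hFx]
  have h2 : B (x / (2 * Real.pi)) = 0 := by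
    refine B.zero_of_le_dist ?_
    rw [Real.dist_eq, sub_zero, abs_div, abs_of_pos (by positivity : 0 < 2 * Real.pi)]
    change κ / (4 * Real.pi) ≤ _
    rw [div_le_div_iff₀ (by positivity) (by positivity)]
    nlinarith
  have h3 : B (0 / (2 * Real.pi)) = 1 := by
    rw [zero_div]
    exact B.one_of_mem_closedBall (Metric.mem_closedBall_self B.rIn_pos.le)
  rw [h2, h3, mul_inv, Complex.inv_I]
  push_cast
  field_simp
  ring

/-- The symbol `m / φ` obtained by integrating in time. -/
noncomputable def quotientSymbol (a b c : ℝ → ℝ) (m : FreqPlane → ℂ) : FreqPlane → ℂ :=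
  fun p => m p / (phase a b c p : ℂ)

section
variable {a b c : ℝ → ℝ} {m : FreqPlane → ℂ} {R : ℝ} {U : Set FreqPlane} {κ : ℝ}

theorem measurable_quotientSymbol (ha : Continuous a) (hb : Continuous b) (hc : Continuous c)
    (hm : Continuous m) : Measurable (quotientSymbol a b c m) :=
  hm.measurable.div (Complex.continuous_ofReal.comp (continuous_phase ha hb hc)).measurable

theorem IsSymbol.mem_of_ne_zero {N : ℕ} (hm : IsSymbol N R U m) {p : FreqPlane} (hp : m p ≠ 0) :
    p ∈ U := hm.support_region hp

theorem norm_quotientSymbol_le (hR : 0 < R) (hm : IsSymbol 1 R U m) (hκ : 0 < κ)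
    (hU : ∀ p ∈ U, κ ≤ |phase a b c p|) (p : FreqPlane) :
    ‖quotientSymbol a b c m p‖ ≤ symbolSize R / κ := by
  by_cases h : m p = 0
  · rw [quotientSymbol, h, zero_div, norm_zero]
    exact div_nonneg (symbolSize_nonneg hR) hκ.le
  · rw [quotientSymbol, norm_div, Complex.norm_real, Real.norm_eq_abs]
    exact div_le_div₀ (symbolSize_nonneg hR) (hm.norm_le_symbolSize le_rfl hR p) hκ
      (hU p (hm.mem_of_ne_zero h))

theorem duhamelSymbol_eq_quotient (hm : IsSymbol 1 R U m) (hκ : 0 < κ)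
    (hU : ∀ p ∈ U, κ ≤ |phase a b c p|) (t : ℝ) (p : FreqPlane) :
    duhamelSymbol a b c m t p
      = -Complex.I * (quotientSymbol a b c m p * (cis (t * phase a b c p) - 1)) := by
  by_cases h : m p = 0
  · simp [duhamelSymbol, quotientSymbol, h]
  · have hφ : phase a b c p ≠ 0 := fun h0 => by
      have := hU p (hm.mem_of_ne_zero h)
      rw [h0, abs_zero] at this; linarith
    rw [duhamelSymbol, quotientSymbol, osc_eq hφ, ← Complex.inv_I]
    field_simp

end

/-- The profile left over by the integration in time disperses. -/
theorem enorm_integral_quotient_form_le {a b c : ℝ → ℝ} (ha : ContDiff ℝ ∞ a) (hb : ContDiff ℝ ∞ b)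
    (hc : ContDiff ℝ ∞ c) (hH : SecondDerivBddAway a) {κ : ℝ} (hκ : 0 < κ) :
    ∃ C : ℝ, 0 ≤ C ∧ ∀ (R : ℝ) (U : Set FreqPlane) (m : FreqPlane → ℂ),
      0 < R → IsSymbol 1 R U m → (∀ p ∈ U, κ ≤ |phase a b c p|) → ∀ x t : ℝ, 0 < t → ∀ f g : L2Line,
      ‖∫ p : ℝ × ℝ, cis (x * (p.1 + p.2) + t * a (p.1 + p.2)) *
          (quotientSymbol a b c m !₂[p.1, p.2] * (hatL2 f p.1 * hatL2 g p.2))‖ₑ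
        ≤ ENNReal.ofReal (C * R * (Real.sqrt t)⁻¹ * (‖f‖ * ‖g‖)) := by
  obtain ⟨C, hC, h⟩ := enorm_integral_duhamel_form_le ha hb hc hH
  obtain ⟨ρ, hρc, hρ1, hρ⟩ := exists_osc_average hκ
  have hL0 : 0 ≤ ∫ r, |r| * ‖ρ r‖ := integral_nonneg fun r => by positivity
  refine ⟨C * ∫ r, |r| * ‖ρ r‖, by positivity, fun R U m hR hm hU x t ht f g => ?_⟩
  have hφ := continuous_phase ha.continuous hb.continuous hc.continuous
  set E : ℝ × ℝ → ℂ := fun p => cis (x * (p.1 + p.2) + t * a (p.1 + p.2)) with hE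
  have hEc : Continuous E := continuous_cis.comp (by have := ha.continuous; fun_prop)
  set Φ : ℝ × ℝ → ℝ → ℂ := fun p r => ρ r * (E p *
    (duhamelSymbol a b c m r !₂[p.1, p.2] * (hatL2 f p.1 * hatL2 g p.2))) with hΦ
  -- The gradient of `m/φ` need not be bounded, so the tensor-product representation is not applied
  -- to it. Writing `1/φ` as an average of `osc r φ` reduces to the forms with symbol `m · osc r φ`,
  -- whose bound grows only like `|r|`, a weight against which `ρ` is integrable.
  have h1 : ∀ p : ℝ × ℝ, E p * (quotientSymbol a b c m !₂[p.1, p.2] * (hatL2 f p.1 * hatL2 g p.2))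
      = -Complex.I * ∫ r, Φ p r := fun p => by
    by_cases h0 : m !₂[p.1, p.2] = 0
    · simp [hΦ, duhamelSymbol, quotientSymbol, h0]
    · have h2 : ∀ r, Φ p r = (ρ r * osc r (phase a b c !₂[p.1, p.2])) *
          (E p * (m !₂[p.1, p.2] * (hatL2 f p.1 * hatL2 g p.2))) := fun r => by
        simp only [hΦ, duhamelSymbol]; ring
      simp_rw [h2]
      rw [integral_mul_const, hρ _ (hU _ (hm.mem_of_ne_zero h0)), quotientSymbol]
      linear_combination (E p * (m !₂[p.1, p.2] / (phase a b c !₂[p.1, p.2] : ℂ) *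
        (hatL2 f p.1 * hatL2 g p.2))) * Complex.I_mul_I
  have hint : Integrable (Function.uncurry Φ) (volume.prod volume) := by
    have h2 := (hm.integrable_form (k := fun _ => 1) measurable_const (M := 1) (fun _ => by simp)
      (memLp_hatL2 f) (memLp_hatL2 g))
    have h3 := h2.norm.mul_prod hρ1
    refine h3.mono' ?_ (ae_of_all _ fun q => ?_)
    · have hF : Measurable fun q : (ℝ × ℝ) × ℝ => hatL2 f q.1.1 :=
        (measurable_hatL2 f).comp (by fun_prop)
      have hG : Measurable fun q : (ℝ × ℝ) × ℝ => hatL2 g q.1.2 :=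
        (measurable_hatL2 g).comp (by fun_prop)
      have hm' := (hm.smooth.continuous.comp (continuous_pt.comp (continuous_fst (Y := ℝ)))).measurable
      have ho : Measurable fun q : (ℝ × ℝ) × ℝ => osc q.2 (phase a b c !₂[q.1.1, q.1.2]) :=
        (continuous_osc_uncurry.comp (f := fun q : (ℝ × ℝ) × ℝ =>
          (q.2, phase a b c !₂[q.1.1, q.1.2])) (continuous_snd.prodMk
            (hφ.comp (continuous_pt.comp continuous_fst)))).measurable
      exact ((hρc.comp continuous_snd).measurable.mul ((hEc.comp continuous_fst).measurable.mul
        ((hm'.mul ho).mul (hF.mul hG)))).aestronglyMeasurable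
    · have h4 := norm_osc_le q.2 (phase a b c !₂[q.1.1, q.1.2])
      simp only [Function.uncurry, hΦ, hE, duhamelSymbol, norm_mul, norm_cis, one_mul]
      calc _ ≤ ‖ρ q.2‖ * (‖m !₂[q.1.1, q.1.2]‖ * |q.2| * (‖hatL2 f q.1.1‖ * ‖hatL2 g q.1.2‖)) := by
            gcongr
        _ = _ := by ring
  refine (congrArg (fun z : ℂ => ‖z‖ₑ) (integral_congr_ae (ae_of_all _ h1))).trans_le ?_
  rw [integral_const_mul, enorm_mul, integral_integral_swap hint]
  have hI : ‖-Complex.I‖ₑ = 1 := by rw [← ofReal_norm]; simp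
  rw [hI, one_mul]
  refine (enorm_integral_le_lintegral_enorm _).trans ?_
  have h5 : ∀ r, ‖∫ p, Φ p r‖ₑ
      ≤ ENNReal.ofReal (C * R * (Real.sqrt t)⁻¹ * (‖f‖ * ‖g‖)) * ENNReal.ofReal (|r| * ‖ρ r‖) := fun r => by
    simp only [hΦ]
    rw [integral_const_mul, enorm_mul, ← ofReal_norm, ← ENNReal.ofReal_mul (by positivity)]
    refine (mul_le_mul_right (h R U m hR hm x t r ht f g) _).trans (le_of_eq ?_)
    rw [← ENNReal.ofReal_mul (norm_nonneg _)]
    congr 1; ring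
  refine (lintegral_mono h5).trans (le_of_eq ?_)
  rw [lintegral_const_mul' _ _ ENNReal.ofReal_ne_top, ← ofReal_integral_eq_lintegral_ofReal hρ1
    (ae_of_all _ fun r => by positivity), ← ENNReal.ofReal_mul (by positivity)]
  congr 1; ring

/-- The symbol is `-i (m/φ)(e^{itφ} - 1)`. Multiplied by `e^{ita}`, its first part oscillates as
`e^{it(b+c)}`, a product of free waves measured by its mass on the Fourier side; its second part is
a fixed profile under the group of `a` and decays like `t^{-1/2}`. -/
theorem exists_evolvedMass_bound_top {a b c : ℝ → ℝ} (ha : ContDiff ℝ ∞ a) (hb : ContDiff ℝ ∞ b)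
    (hc : ContDiff ℝ ∞ c) (hH : SecondDerivBddAway a) {U : Set FreqPlane}
    {κ : ℝ} (hκ : 0 < κ) (hU : ∀ p ∈ U, κ ≤ |phase a b c p|) :
    ∃ C : ℝ, 0 ≤ C ∧ ∀ (R : ℝ) (m : FreqPlane → ℂ), 0 < R → IsSymbol 1 R U m →
      ∀ (f g : L2Line) (u v w : ℝ → L2Line), SolvesSystem a b c m f g u v w → ∀ t : ℝ, 0 < t →
        eLpNorm (u t) ⊤ volume ≤ evolvedMass b c (quotientSymbol a b c m) f g t +
          ENNReal.ofReal (C * R * (Real.sqrt t)⁻¹ * (‖f‖ * ‖g‖)) := by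
  obtain ⟨C, hC, h⟩ := enorm_integral_quotient_form_le ha hb hc hH hκ
  refine ⟨C, hC, fun R m hR hm f g u v w hs t ht => ?_⟩
  have hac := ha.continuous
  have hbc := hb.continuous
  have hcc := hc.continuous
  have hI : ‖-Complex.I‖ = 1 := by simp
  have hφ := continuous_phase hac hbc hcc
  have hσ := measurable_quotientSymbol hac hbc hcc hm.smooth.continuous
  have hint : ∀ k : ℝ × ℝ → ℂ, Measurable k → (∀ p, ‖k p‖ ≤ 1) → Integrable fun p : ℝ × ℝ =>
      k p * (quotientSymbol a b c m !₂[p.1, p.2] * (hatL2 f p.1 * hatL2 g p.2)) := fun k hk hk1 => by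
    have h0 := hm.integrable_form (k := fun _ => 1) measurable_const (M := 1) (fun _ => by simp)
      (memLp_hatL2 f) (memLp_hatL2 g)
    refine (h0.norm.mul_const κ⁻¹).mono' ?_ (ae_of_all _ fun p => ?_)
    · exact (hk.mul ((hσ.comp continuous_pt.measurable).mul (((measurable_hatL2 f).comp
        measurable_fst).mul ((measurable_hatL2 g).comp measurable_snd)))).aestronglyMeasurable
    · have h1 : ‖quotientSymbol a b c m !₂[p.1, p.2]‖ ≤ ‖m !₂[p.1, p.2]‖ * κ⁻¹ := by
        by_cases h2 : m !₂[p.1, p.2] = 0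
        · simp [quotientSymbol, h2]
        · rw [quotientSymbol, norm_div, Complex.norm_real, Real.norm_eq_abs, div_eq_mul_inv]
          gcongr
          exact hU _ (hm.mem_of_ne_zero h2)
      rw [norm_mul, norm_mul, one_mul, norm_mul _ (hatL2 f p.1 * hatL2 g p.2)]
      calc _ ≤ 1 * (‖m !₂[p.1, p.2]‖ * κ⁻¹ * ‖hatL2 f p.1 * hatL2 g p.2‖) := by
            gcongr; exact hk1 p
        _ = _ := by ring
  refine eLpNorm_top_le_of_form (χ := fun ξ => cis (t * a ξ) * -Complex.I)
    (σ := duhamelSymbol a b c m t) (f := f) (g := g)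
    ((continuous_cis.comp (by fun_prop)).mul continuous_const) (fun ξ => ?_) ?_ ?_ fun x => ?_
  · rw [norm_mul, norm_cis, hI, one_mul]
  · refine (hm.integrable_form (k := fun p => osc t (phase a b c !₂[p.1, p.2])) (M := |t|)
      ((continuous_osc t).comp (hφ.comp continuous_pt)).measurable (fun p => norm_osc_le _ _)
      (memLp_hatL2 f) (memLp_hatL2 g)).congr (ae_of_all _ fun p => ?_)
    simp only [duhamelSymbol]; ring
  · filter_upwards [hs.hatL2_eq ha hb hc hm.smooth.continuous hm.norm_le_one ht.le] with ξ hξ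
    rw [hξ, mul_assoc]
  · have hx : Continuous fun p : ℝ × ℝ => cis (x * (p.1 + p.2)) := continuous_cis.comp (by fun_prop)
    have hxa : Continuous fun p : ℝ × ℝ => cis (x * (p.1 + p.2) + t * a (p.1 + p.2)) :=
      continuous_cis.comp (by fun_prop)
    have hbcx : Continuous fun p : ℝ × ℝ => cis (x * (p.1 + p.2)) * cis (t * (b p.1 + c p.2)) :=
      hx.mul (continuous_cis.comp (by fun_prop))
    have i1 : Integrable fun p : ℝ × ℝ => cis (x * (p.1 + p.2)) * (evolved b c (quotientSymbol a b c m) t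
        !₂[p.1, p.2] * (hatL2 f p.1 * hatL2 g p.2)) := by
      refine (hint _ hbcx.measurable fun p => by rw [norm_mul, norm_cis, norm_cis, one_mul]).congr
        (ae_of_all _ fun p => ?_)
      simp [evolved]; ring
    have i2 := hint _ hxa.measurable fun p => (norm_cis _).le
    have h1 : ∀ p : ℝ × ℝ, cis (x * (p.1 + p.2)) * (cis (t * a (p.1 + p.2)) * -Complex.I) *
        (duhamelSymbol a b c m t !₂[p.1, p.2] * (hatL2 f p.1 * hatL2 g p.2))
        = cis (x * (p.1 + p.2) + t * a (p.1 + p.2)) *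
            (quotientSymbol a b c m !₂[p.1, p.2] * (hatL2 f p.1 * hatL2 g p.2))
          - cis (x * (p.1 + p.2)) * (evolved b c (quotientSymbol a b c m) t
            !₂[p.1, p.2] * (hatL2 f p.1 * hatL2 g p.2)) := fun p => by
      have e1 : cis (t * (b p.1 + c p.2)) = cis (t * a (p.1 + p.2)) *
          cis (t * phase a b c !₂[p.1, p.2]) := by
        rw [← cis_add, phase_pt]; congr 1; ring
      rw [duhamelSymbol_eq_quotient hm hκ hU, evolved]
      simp only [Matrix.cons_val_zero, Matrix.cons_val_one, Matrix.cons_val_fin_one]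
      rw [e1, cis_add]
      linear_combination (cis (x * (p.1 + p.2)) * cis (t * a (p.1 + p.2)) *
        quotientSymbol a b c m !₂[p.1, p.2] * (cis (t * phase a b c !₂[p.1, p.2]) - 1) *
        (hatL2 f p.1 * hatL2 g p.2)) * Complex.I_mul_I
    simp_rw [h1]
    rw [integral_sub i2 i1, add_comm, ← (integral_mul_pseudoProductHat
      (σ := evolved b c (quotientSymbol a b c m) t) (χ := fun ξ => cis (x * ξ)) i1).2]
    refine enorm_sub_le.trans (add_le_add (h R U m hR hm hU x t ht f g) ?_)
    refine (enorm_integral_le_lintegral_enorm _).trans (le_of_eq (lintegral_congr fun ξ => ?_))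
    rw [enorm_mul, enorm_cis, one_mul]

/-! ### The mixed-norm estimate and the final statement. -/

theorem lintegral_Ioi_one_rpow_ne_top {s : ℝ} (hs : s < -1) :
    ∫⁻ t in Ioi (1 : ℝ), ENNReal.ofReal (t ^ s) ≠ ⊤ := by
  have h := integrableOn_Ioi_rpow_of_lt hs one_pos
  rw [← ofReal_integral_eq_lintegral_ofReal h ((ae_restrict_mem measurableSet_Ioi).mono fun t ht =>
    Real.rpow_nonneg (zero_le_one.trans (le_of_lt ht)) _)]
  exact ENNReal.ofReal_ne_top

/-- For `t > 1` the `L^q` norm is interpolated between the uniform `L²` bound and the `L^∞` bound,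
the latter being a sum of a function in `L^s` and of `O(t^{-1/2})`. For `t ≤ 1` the uniform `L^q`
bound is enough. -/
theorem mixedNormBound_of_nonResonant {a b c : ℝ → ℝ} (ha : ContDiff ℝ ∞ a)
    (hb : ContDiff ℝ ∞ b) (hc : ContDiff ℝ ∞ c) (hHa : SecondDerivBddAway a)
    (hHb : SecondDerivBddAway b) (hHc : SecondDerivBddAway c) {U : Set FreqPlane}
    (h : NonResonant (phase a b c) U) {p q : ℝ} (hp : 2 ≤ p) (hq : 2 ≤ q)
    (hpq : 1 / p + 1 / q < 1 / 2) : MixedNormBound 1 a b c U p q := by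
  have hq' : 2 ≤ ENNReal.ofReal q := by
    rw [show (2 : ℝ≥0∞) = ENNReal.ofReal 2 by simp]; exact ENNReal.ofReal_le_ofReal hq
  have hp0 : 0 < p := by linarith
  have hq0 : 0 < q := by linarith
  have hie : invExp (ENNReal.ofReal q) = 1 / q := by
    rw [invExp, ← ENNReal.ofReal_inv_of_pos hq0, ENNReal.toReal_ofReal (by positivity), one_div]
  obtain ⟨Cq, hCq⟩ := h.pointwiseBound ha hb hc hq'
  obtain ⟨C2, hC2⟩ := h.pointwiseBound ha hb hc le_rfl
  obtain ⟨κ, hκ, hU⟩ := h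
  obtain ⟨Ct, hCt0, hCt⟩ := exists_evolvedMass_bound_top ha hb hc hHa hκ hU
  -- The power to which the `L^∞` norm is raised after interpolation. It exceeds `2` exactly when
  -- `1/p + 1/q < 1/2`, which is what both the bilinear estimate and the integrability of `t^{-s/2}`
  -- at infinity require.
  set s : ℝ := p * (1 - 2 * (1 / q)) with hs
  have hs2 : 2 < s := by
    have : 1 / p < 1 / 2 - 1 / q := by linarith
    rw [div_lt_iff₀ hp0] at this
    rw [hs]; nlinarith
  have hs0 : 0 < s := by linarith
  obtain ⟨D, hD, hDb⟩ := exists_evolvedMass_bound hb hc hHb hHc hs2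
  have hZ := lintegral_Ioi_one_rpow_ne_top (s := -(s / 2)) (by linarith)
  set Z := ∫⁻ t in Ioi (1 : ℝ), ENNReal.ofReal (t ^ (-(s / 2))) with hZdef
  set ζ : ℝ := (Z ^ (1 / s)).toReal
  have hZζ : Z ^ (1 / s) = ENNReal.ofReal ζ :=
    (ENNReal.ofReal_toReal (ENNReal.rpow_ne_top_of_nonneg (by positivity) hZ)).symm
  have hζ0 : 0 ≤ ζ := ENNReal.toReal_nonneg
  set C3 : ℝ := D * 6 / κ + Ct * ζ with hC3
  have hC30 : 0 ≤ C3 := by positivity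
  set C : ℝ := max (max Cq C2) C3 with hC
  have hC0 : 0 ≤ C := hC30.trans (le_max_right _ _)
  refine ⟨2 * C, fun R m hR hm f g u v w hsol => ?_⟩
  set Λ : ℝ := ‖f‖ * ‖g‖ with hΛ
  have hΛ0 : 0 ≤ Λ := by positivity
  set X : ℝ≥0∞ := ENNReal.ofReal (C * R * Λ) with hX
  have hq_le : ∀ t, 0 < t → eLpNorm (u t) (ENNReal.ofReal q) volume ≤ X := fun t ht => by
    refine (hCq R m hR hm f g u v w hsol t ht).trans (ENNReal.ofReal_le_ofReal ?_)
    rw [mul_one, mul_assoc]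
    gcongr
    exact (le_max_left _ _).trans (le_max_left _ _)
  have h2_le : ∀ t, 0 < t → eLpNorm (u t) 2 volume ≤ X := fun t ht => by
    refine (hC2 R m hR hm f g u v w hsol t ht).trans (ENNReal.ofReal_le_ofReal ?_)
    rw [mul_one, mul_assoc]
    gcongr
    exact (le_max_right _ _).trans (le_max_left _ _)
  set σ := quotientSymbol a b c m with hσdef
  have hσ : Measurable σ := measurable_quotientSymbol ha.continuous hb.continuous hc.continuous
    hm.smooth.continuous
  set Y : ℝ → ℝ≥0∞ := fun t => ENNReal.ofReal (Ct * R * (Real.sqrt t)⁻¹ * Λ) with hY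
  have hN := measurable_evolvedMass hb.continuous hc.continuous hσ f g
  have hYm : Measurable Y := by fun_prop
  have hNs : (∫⁻ t in Ioi 1, evolvedMass b c σ f g t ^ s) ^ (1 / s)
      ≤ ENNReal.ofReal (D * 6 / κ * R * Λ) := by
    calc _ ≤ (∫⁻ t, evolvedMass b c σ f g t ^ s) ^ (1 / s) := by
          exact ENNReal.rpow_le_rpow (setLIntegral_le_lintegral _ _) (by positivity)
      _ ≤ ENNReal.ofReal (D * (symbolSize R / κ * (1 + R)) * Λ) := by
          refine hDb R (symbolSize R / κ) σ hR (div_nonneg (symbolSize_nonneg hR) hκ.le) hσ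
            (norm_quotientSymbol_le hR hm hκ hU) (fun p h0 => ?_) f g
          have h1 : m p ≠ 0 := fun h1 => h0 (by simp [hσdef, quotientSymbol, h1])
          have h2 := hm.support_ball h1
          refine abs_le_of_mem_closedBall (x := p 0) (y := p 1) ?_
          convert h2 using 1
          ext i; fin_cases i <;> rfl
      _ ≤ _ := by
          refine ENNReal.ofReal_le_ofReal ?_
          have := symbolSize_mul_le hR
          calc D * (symbolSize R / κ * (1 + R)) * Λ = D / κ * Λ * (symbolSize R * (1 + R)) := by ring
            _ ≤ D / κ * Λ * (6 * R) := by gcongr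
            _ = _ := by ring
  have hYs : (∫⁻ t in Ioi 1, Y t ^ s) ^ (1 / s) = ENNReal.ofReal (Ct * ζ * R * Λ) := by
    have h1 : ∀ t ∈ Ioi (1 : ℝ), Y t ^ s
        = ENNReal.ofReal (Ct * R * Λ) ^ s * ENNReal.ofReal (t ^ (-(s / 2))) := fun t ht => by
      have ht0 : 0 < t := zero_lt_one.trans ht
      have e1 : Y t = ENNReal.ofReal (Ct * R * Λ) * ENNReal.ofReal (t ^ (-(1 / 2) : ℝ)) := by
        rw [← ENNReal.ofReal_mul (by positivity)]
        simp only [hY]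
        rw [Real.rpow_neg ht0.le, ← Real.sqrt_eq_rpow]
        congr 1; ring
      rw [e1, ENNReal.mul_rpow_of_nonneg _ _ hs0.le, ENNReal.ofReal_rpow_of_nonneg
        (by positivity : 0 ≤ t ^ (-(1 / 2) : ℝ)) hs0.le, ← Real.rpow_mul ht0.le]
      congr 3; ring
    rw [setLIntegral_congr_fun measurableSet_Ioi h1, lintegral_const_mul' _ _
      (ENNReal.rpow_ne_top_of_nonneg hs0.le ENNReal.ofReal_ne_top), ENNReal.mul_rpow_of_nonneg _ _
      (by positivity), hZζ, ← ENNReal.rpow_mul, mul_one_div_cancel hs0.ne', ENNReal.rpow_one,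
      ← ENNReal.ofReal_mul (by positivity)]
    congr 1; ring
  have hsum : ∫⁻ t in Ioi 1, (evolvedMass b c σ f g t + Y t) ^ s ≤ X ^ s := by
    have h1 := ENNReal.lintegral_Lp_add_le (μ := volume.restrict (Ioi (1 : ℝ))) hN.aemeasurable
      hYm.aemeasurable (by linarith : 1 ≤ s)
    rw [hYs] at h1
    have h2 := h1.trans (add_le_add_left hNs _)
    rw [← ENNReal.ofReal_add (by positivity) (by positivity), one_div,
      ENNReal.rpow_inv_le_iff hs0] at h2
    refine h2.trans ?_
    rw [hX]
    gcongr
    calc D * 6 / κ * R * Λ + Ct * ζ * R * Λ = C3 * R * Λ := by rw [hC3]; ring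
      _ ≤ C * R * Λ := by gcongr; exact le_max_right _ _
  have hlarge : ∫⁻ t in Ioi 1, eLpNorm (u t) (ENNReal.ofReal q) volume ^ p ≤ X ^ p := by
    have hq1 : 0 ≤ 1 - 2 * (1 / q) := by
      have : 1 / q ≤ 1 / 2 := one_div_le_one_div_of_le two_pos hq
      linarith
    calc _ ≤ ∫⁻ t in Ioi 1, X ^ (2 * (1 / q) * p) * (evolvedMass b c σ f g t + Y t) ^ s := by
          refine setLIntegral_mono' measurableSet_Ioi fun t ht => ?_
          have ht0 : 0 < t := zero_lt_one.trans ht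
          have h1 := eLpNorm_interpolate (Lp.aestronglyMeasurable (u t)) hq'
          rw [hie] at h1
          calc _ ≤ (X ^ (2 * (1 / q)) * (evolvedMass b c σ f g t + Y t) ^ (1 - 2 * (1 / q))) ^ p := by
                gcongr
                refine h1.trans ?_
                gcongr
                · exact h2_le t ht0
                · exact hCt R m hR hm f g u v w hsol t ht0
            _ = _ := by
                rw [ENNReal.mul_rpow_of_nonneg _ _ hp0.le, ← ENNReal.rpow_mul, ← ENNReal.rpow_mul, hs,
                  mul_comm p]
      _ ≤ X ^ (2 * (1 / q) * p) * X ^ s := by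
          rw [lintegral_const_mul' _ _ (ENNReal.rpow_ne_top_of_nonneg (by positivity)
            ENNReal.ofReal_ne_top)]
          gcongr
      _ = X ^ p := by
          rw [← ENNReal.rpow_add_of_nonneg _ _ (by positivity) hs0.le, hs]
          congr 1; ring
  have hsmall : ∫⁻ t in Ioc 0 1, eLpNorm (u t) (ENNReal.ofReal q) volume ^ p ≤ X ^ p := by
    calc _ ≤ ∫⁻ t in Ioc (0 : ℝ) 1, X ^ p := by
          refine setLIntegral_mono' measurableSet_Ioc fun t ht => ?_
          gcongr
          exact hq_le t ht.1
      _ = X ^ p := by simp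
  have htot : ∫⁻ t in Ioi (0 : ℝ), eLpNorm (u t) (ENNReal.ofReal q) volume ^ p ≤ (2 * X) ^ p := by
    rw [← Ioc_union_Ioi_eq_Ioi zero_le_one]
    calc _ ≤ X ^ p + X ^ p := (lintegral_union_le _ _ _).trans (add_le_add hsmall hlarge)
      _ = 2 ^ (1 : ℝ) * X ^ p := by rw [ENNReal.rpow_one, two_mul]
      _ ≤ 2 ^ p * X ^ p := by
          gcongr
          · norm_num
          · linarith
      _ = (2 * X) ^ p := by rw [ENNReal.mul_rpow_of_nonneg _ _ hp0.le]
  rw [one_div, ENNReal.rpow_inv_le_iff hp0]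
  refine htot.trans (le_of_eq ?_)
  have h2X : 2 * X = ENNReal.ofReal (2 * (C * R * Λ)) := by
    rw [ENNReal.ofReal_mul zero_le_two, ENNReal.ofReal_ofNat]
  rw [h2X]
  congr 2
  rw [hΛ]; ring

theorem corollary3p3 :
    ∃ N : ℕ, ∀ (a b c : ℝ → ℝ), ContDiff ℝ ∞ a → ContDiff ℝ ∞ b → ContDiff ℝ ∞ c →
      ∀ U : Set FreqPlane,
        (∀ q : ℝ≥0∞, 2 ≤ q →
          PointwiseBound N a b c U q (fun t => t) ∧
          (NonResonant (phase a b c) U →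
            PointwiseBound N a b c U q (fun _ => 1)) ∧
          (ResonantPoint (phase a b c) U →
            PointwiseBound N a b c U q (fun t => t ^ (1 / 2 + invExp q / 2))) ∧
          (VanishesAtOrderOne (phase a b c) U →
            (NonCharacteristicCurve (resonantSet a b c) U →
              (q ≠ ⊤ → PointwiseBound N a b c U q (fun t => t ^ invExp q)) ∧
              (q = ⊤ → PointwiseBound N a b c U q
                (fun t => Real.sqrt (1 + Real.log t ^ 2)))) ∧
            (CurvedCurve (resonantSet a b c) U →
              PointwiseBound N a b c U q (fun t => t ^ (1 / 4 + invExp q / 2))) ∧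
            (GeneralCurve (resonantSet a b c) U →
              PointwiseBound N a b c U q (fun t => t ^ (1 / 2 : ℝ))))) ∧
        (SecondDerivBddAway a → SecondDerivBddAway b → SecondDerivBddAway c →
          (∀ q : ℝ≥0∞, 2 ≤ q →
            PointwiseBound N a b c U q (fun t => t ^ (1 / 2 + invExp q / 2))) ∧
          (NonResonant (phase a b c) U →
            ∀ p q : ℝ, 2 ≤ p → 2 ≤ q → 1 / p + 1 / q < 1 / 2 →
              MixedNormBound N a b c U p q)) := by
  -- One derivative suffices: it bounds `m` by its radius, and it enters the tensor-product
  -- representation behind the dispersive estimate.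
  refine ⟨1, fun a b c ha hb hc U => ⟨fun q hq => ⟨pointwiseBound_linear ha hb hc U hq,
    fun h => h.pointwiseBound ha hb hc hq, fun h => h.pointwiseBound ha hb hc hq,
    fun h => ⟨fun hΓ => h.pointwiseBound_of_nonCharacteristic ha hb hc hΓ hq,
      fun hΓ => h.pointwiseBound_of_curved ha hb hc hΓ hq,
      fun hΓ => h.pointwiseBound_of_generalCurve ha hb hc hΓ hq⟩⟩,
    fun hHa hHb hHc => ⟨fun q hq => pointwiseBound_of_secondDeriv ha hb hc hHa hHb hHc U hq,
      fun h p q hp hq hpq => mixedNormBound_of_nonResonant ha hb hc hHa hHb hHc h hp hq hpq⟩⟩⟩
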